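/- Let $M$ be either the round sphere $\mathbb{S}^4$ of radius $\sqrt2$, or $\mathbb{CP}^2$ with its complex orientation and the Fubini–Study metric of holomorphic sectional curvature $1$ (in both cases the metric $g_M$ has scalar curvature $6$). Let $\pi:\Lambda^2_-(M)\to M$ be the bundle of anti-self-dual $2$-forms. For a local oriented orthonormal coframe $e^0,\dots,e^3$ of $M$ put $\Omega_i=e^0\wedge e^i-e^j\wedge e^k$ for $(i,j,k)$ a cyclic permutation of $(1,2,3)$. Let $a_1,a_2,a_3$ be the fibre coordinates of $\sum_i a_i\Omega_i$, let $s^2=\sum_i a_i^2$ and $f=(1+s^2)^{-1/4}$, and let $\alpha_1,\alpha_2,\alpha_3$ be the coordinates, in the basis $\Omega_i$, of the vertical part of a tangent vector with respect to the Levi-Civita connection. The Bryant–Salamon $G_2$-structure on $\Lambda^2_-(M)$ has the metric $g=f^2\sum_i\alpha_i^2+f^{-2}\pi^*g_M$ and the $3$-form $\varphi=f^3\alpha_1\wedge\alpha_2\wedge\alpha_3+f^{-1}\sum_i\alpha_i\wedge\Omega_i$. Let $\psi=*\varphi$, and let $r$ be the geodesic distance to the zero section $M\subset\Lambda^2_-(M)$.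 Let $G=SU(2)$ if $M=\mathbb{S}^4$ and $G=SO(3)$ if $M=\mathbb{CP}^2$. Norms on the Lie algebra of $G$ are taken in the $\mathrm{Ad}$-invariant inner product $-2\,\mathrm{tr}(XY)$ on $\mathfrak{su}(2)$, respectively $-\tfrac12\mathrm{tr}(XY)$ on $\mathfrak{so}(3)$ (which correspond to each other under $\mathfrak{su}(2)\cong\mathfrak{so}(3)$), and $|F_A|^2=\sum_{i<j}|F_A(e_i,e_j)|^2$ in a $g$-orthonormal frame. Theorem. There are a principal $G$-bundle $P\to\Lambda^2_-(M)$ and a real two-parameter family $(A_c,\Phi_c)$, $c\in(0,\infty)\times(0,1)$, of pairs of a smooth connection $A_c$ on $P|_{\Lambda^2_-(M)\setminus M}$ and a smooth section $\Phi_c$ of its adjoint bundle, such that $(A_c,\Phi_c)$ depends smoothly on $c$, pairs with different parameters are not gauge equivalent, and for every $c$: 1. $(A_c,\Phi_c)$ is a $G_2$-monopole on $\Lambda^2_-(M)\setminus M$, that is, $*(F_{A_c}\wedge\psi)=d_{A_c}\Phi_c$; 2. $A_c$ is irreducible, that is, its holonomy group is all of $G$; 3. $\displaystyle\lim_{r\to0}r\,|\Phi_c|=\lim_{r\to0}r^2\,|F_{A_c}|=1$,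 so that the singularities along the zero section are of Dirac type, with charge $1$. -/

import Mathlib

open Set Filter Topology
open scoped ContDiff Nat

namespace G2Monopole

/-- The maximum norm on matrices. It only serves to speak of smooth maps. -/
noncomputable abbrev matrixNorm {𝕜 : Type*} [RCLike 𝕜] {m : Type*} [Fintype m] :
    NormedAddCommGroup (Matrix m m 𝕜) :=
  inferInstanceAs (NormedAddCommGroup (m → m → 𝕜))

attribute [local instance] matrixNorm

/-- The maximum norm on matrices is a norm on a real vector space. -/
noncomputable abbrev matrixNormedSpace {𝕜 : Type*} [RCLike 𝕜] {m : Type*} [Fintype m] :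
    NormedSpace ℝ (Matrix m m 𝕜) :=
  inferInstanceAs (NormedSpace ℝ (m → m → 𝕜))

attribute [local instance] matrixNormedSpace

noncomputable section

/-! ### Submanifolds of vector spaces

All manifolds are realised as submanifolds of finite dimensional normed spaces. -/

/-- `γ` is a smooth curve that stays in the set `S`. -/
def SmoothCurveIn {V : Type*} [NormedAddCommGroup V] [NormedSpace ℝ V]
    (S : Set V) (γ : ℝ → V) : Prop :=
  ContDiff ℝ ∞ γ ∧ ∀ t, γ t ∈ S

/-- The velocity vectors at `p` of the smooth curves in `S`. If `S` is a submanifold, this is the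
tangent space of `S` at `p`. -/
def tangentVectors {V : Type*} [NormedAddCommGroup V] [NormedSpace ℝ V]
    (S : Set V) (p : V) : Set V :=
  {v | ∃ γ : ℝ → V, SmoothCurveIn S γ ∧ γ 0 = p ∧ deriv γ 0 = v}

/-! ### Exterior algebra in an orthonormal frame

A `k`-form on an oriented Euclidean space of dimension `n`, with values in `W`, is represented by
its values `η I = η (e_{I 0}, …, e_{I (k - 1)})` on the vectors of an oriented orthonormal
basis `e`. -/

/-- The Levi-Civita symbol: the sign of `I` if `I` is a permutation, and `0` otherwise. -/
def leviCivita {n : ℕ} (I : Fin n → Fin n) : ℝ :=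
  ∏ a : Fin n, ∏ b ∈ Finset.Ioi a, ((Int.sign ((I b : ℤ) - (I a : ℤ)) : ℤ) : ℝ)

/-- The Hodge star `(⋆η)_J = (1 / k!) ∑_I η_I ε_{IJ}` of a `k`-form in dimension `k + l`, so that
`α ∧ ⋆β = ⟨α, β⟩ vol`. -/
def hodge {W : Type*} [AddCommGroup W] [Module ℝ W] {k l : ℕ}
    (η : (Fin k → Fin (k + l)) → W) : (Fin l → Fin (k + l)) → W :=
  fun J => ((k ! : ℝ)⁻¹) • ∑ I : Fin k → Fin (k + l), leviCivita (Fin.append I J) • η I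

/-- The wedge product of a `W`-valued `k`-form and a real `l`-form. -/
def wedge {W : Type*} [AddCommGroup W] [Module ℝ W] {ι : Type*} {k l : ℕ}
    (α : (Fin k → ι) → W) (β : (Fin l → ι) → ℝ) : (Fin (k + l) → ι) → W :=
  fun K => (((k ! : ℝ) * (l ! : ℝ))⁻¹) • ∑ σ : Equiv.Perm (Fin (k + l)),
    (((Equiv.Perm.sign σ : ℤ) : ℝ) * β (fun j => K (σ (Fin.natAdd k j)))) •
      α (fun i => K (σ (Fin.castAdd l i)))

/-! ### The two four-manifolds -/

/-- A four dimensional submanifold of a Euclidean space with an orientation. The submanifold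
carries the induced Riemannian metric. -/
structure OrientedSubmanifold (E : Type*) where
  /-- the points -/
  carrier : Set E
  /-- `positive x e`: the basis `e` of the tangent space at `x` is positively oriented -/
  positive : E → (Fin 4 → E) → Prop

/-- The round four-sphere of radius `√2` (scalar curvature `6`), oriented by the outward normal. -/
def sphere4 : OrientedSubmanifold (EuclideanSpace ℝ (Fin 5)) where
  carrier := Metric.sphere 0 (Real.sqrt 2)
  positive x e :=
    0 < Matrix.det (Matrix.of fun i j : Fin 5 =>
      (Fin.cons x e : Fin 5 → EuclideanSpace ℝ (Fin 5)) i j)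

/-- The space of complex `3 × 3` matrices with the inner product `Re tr (A* B)`. -/
abbrev MatrixSpace : Type := EuclideanSpace ℂ (Fin 3 × Fin 3)

/-- The complex structure of the projective plane at `x = √2 p`, where `p` is a projection onto a
complex line: `ξ ↦ i (ξ p - p ξ)`. -/
def complexStructure (x ξ : MatrixSpace) : MatrixSpace :=
  WithLp.toLp 2 fun ij : Fin 3 × Fin 3 => Complex.I * (((Real.sqrt 2)⁻¹ : ℝ) : ℂ) *
    ∑ k, (ξ (ij.1, k) * x (k, ij.2) - x (ij.1, k) * ξ (k, ij.2))

/-- The Kähler form of the projective plane. -/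
def kaehlerForm (x ξ η : MatrixSpace) : ℝ := inner ℝ (complexStructure x ξ) η

/-- The complex projective plane: the line spanned by a unit vector `z` of `ℂ³` is identified with
`√2` times the orthogonal projection `z z*` onto it. The metric induced from the space of matrices
is the Fubini-Study metric of holomorphic sectional curvature `1` (scalar curvature `6`). The
orientation is the complex one, in which the square of the Kähler form is positive. -/
def projectivePlane : OrientedSubmanifold MatrixSpace where
  carrier := {x | ∃ z : Fin 3 → ℂ, ∑ i, ‖z i‖ ^ 2 = 1 ∧
    ∀ i j, x (i, j) = (Real.sqrt 2 : ℂ) * z i * starRingEnd ℂ (z j)}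
  positive x e :=
    0 < kaehlerForm x (e 0) (e 1) * kaehlerForm x (e 2) (e 3)
      - kaehlerForm x (e 0) (e 2) * kaehlerForm x (e 1) (e 3)
      + kaehlerForm x (e 0) (e 3) * kaehlerForm x (e 1) (e 2)

/-! ### The bundle of anti-self-dual two-forms and its Bryant-Salamon structure -/

section BryantSalamon

variable {E : Type*} [NormedAddCommGroup E] [InnerProductSpace ℝ E]

/-- `e` is an oriented orthonormal basis of the tangent space of `M` at `x`. -/
def IsOrientedFrame (M : OrientedSubmanifold E) (x : E) (e : Fin 4 → E) : Prop :=
  (∀ i, e i ∈ tangentVectors M.carrier x) ∧ Orthonormal ℝ e ∧ M.positive x e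

/-- The total space `Λ²₋(M)` of the bundle of anti-self-dual two-forms of `M`. A two-form on the
tangent space of `M` at `x` is identified with the two-form on the ambient space that extends it
and vanishes on normal vectors. -/
def asdBundle (M : OrientedSubmanifold E) : Set (E × (E [⋀^Fin 2]→L[ℝ] ℝ)) :=
  {z | z.1 ∈ M.carrier ∧
    (∀ n : E, (∀ v ∈ tangentVectors M.carrier z.1, inner ℝ n v = 0) →
      ∀ u : E, z.2 ![n, u] = 0) ∧
    ∀ e, IsOrientedFrame M z.1 e → z.2 ![e 0, e 1] + z.2 ![e 2, e 3] = 0}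

/-- The complement of the zero section in `Λ²₋(M)`. -/
def puncturedAsdBundle (M : OrientedSubmanifold E) : Set (E × (E [⋀^Fin 2]→L[ℝ] ℝ)) :=
  {z | z ∈ asdBundle M ∧ z.2 ≠ 0}

/-- An oriented orthonormal basis of the tangent space of `M` at `x`. The tensors below do not
depend on the choice. -/
def chosenFrame (M : OrientedSubmanifold E) (x : E) : Fin 4 → E :=
  Classical.epsilon (IsOrientedFrame M x)

/-- The coordinates of (the anti-self-dual restriction to the tangent space at `x` of) `η` in the
basis `Ω_i = e^0 ∧ e^i - e^j ∧ e^k`, with `(i, j, k)` a cyclic permutation of `(1, 2, 3)`. -/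
def fibreCoord (M : OrientedSubmanifold E) (x : E) (η : E [⋀^Fin 2]→L[ℝ] ℝ) : Fin 3 → ℝ :=
  fun i => η ![chosenFrame M x 0, chosenFrame M x i.succ]

/-- The square of the Euclidean distance `s` to the zero section along the fibre. -/
def fibreNormSq (M : OrientedSubmanifold E) (z : E × (E [⋀^Fin 2]→L[ℝ] ℝ)) : ℝ :=
  ∑ i, fibreCoord M z.1 z.2 i ^ 2

/-- The function `f = (1 + s²)^(-1/4)`. -/
def conformalFactor (M : OrientedSubmanifold E) (z : E × (E [⋀^Fin 2]→L[ℝ] ℝ)) : ℝ :=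
  (1 + fibreNormSq M z) ^ (-(1 / 4) : ℝ)

/-- The Bryant-Salamon metric `f² g_{ℝ³} + f⁻² π^* g_M` on `Λ²₋(M)`. The covariant derivative of a
curve of two-forms `(x, η)` for the Levi-Civita connection of `M` is the restriction of the
ambient derivative of `η` to the tangent space of `M`, so that the vertical part of the tangent
vector `u` has the coordinates `fibreCoord M z.1 u.2`, and its horizontal part is `u.1`. -/
def metric (M : OrientedSubmanifold E) (z u v : E × (E [⋀^Fin 2]→L[ℝ] ℝ)) : ℝ :=
  conformalFactor M z ^ 2 * ∑ i, fibreCoord M z.1 u.2 i * fibreCoord M z.1 v.2 i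
    + (conformalFactor M z ^ 2)⁻¹ * inner ℝ u.1 v.1

/-- The Bryant-Salamon three-form `φ = f³ α_1 ∧ α_2 ∧ α_3 + f⁻¹ ∑ α_i ∧ Ω_i`, where `α_i` are the
coordinates of the vertical part. The second sum is evaluated on tangent vectors through
`∑ α_i(u) Ω_i = u.2` on the tangent space of `M`. -/
def phi (M : OrientedSubmanifold E) (z u v w : E × (E [⋀^Fin 2]→L[ℝ] ℝ)) : ℝ :=
  conformalFactor M z ^ 3 *
      Matrix.det (Matrix.of ![fibreCoord M z.1 u.2, fibreCoord M z.1 v.2, fibreCoord M z.1 w.2])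
    + (conformalFactor M z)⁻¹ *
      (u.2 ![v.1, w.1] + v.2 ![w.1, u.1] + w.2 ![u.1, v.1])

/-- `u` is a basis of the tangent space of `Λ²₋(M)` at `z`, orthonormal for the Bryant-Salamon
metric. -/
def IsOrthonormalFrame (M : OrientedSubmanifold E) (z : E × (E [⋀^Fin 2]→L[ℝ] ℝ))
    (u : Fin 7 → E × (E [⋀^Fin 2]→L[ℝ] ℝ)) : Prop :=
  (∀ i, u i ∈ tangentVectors (asdBundle M) z) ∧
    ∀ i j, metric M z (u i) (u j) = if i = j then 1 else 0

/-- The geodesic distance `r` to the zero section: the infimum of the lengths, in the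
Bryant-Salamon metric, of the smooth curves in `Λ²₋(M)` from the zero section to `z`. -/
def zeroSectionDist (M : OrientedSubmanifold E) (z : E × (E [⋀^Fin 2]→L[ℝ] ℝ)) : ℝ :=
  sInf {L | ∃ γ : ℝ → E × (E [⋀^Fin 2]→L[ℝ] ℝ), ContDiff ℝ ∞ γ ∧
    (∀ t ∈ Icc (0 : ℝ) 1, γ t ∈ asdBundle M) ∧ (γ 0).2 = 0 ∧ γ 1 = z ∧
    L = ∫ t in (0 : ℝ)..1, Real.sqrt (metric M (γ t) (deriv γ t) (deriv γ t))}

end BryantSalamon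

/-! ### Principal bundles, connections and Higgs fields -/

section Gauge

variable {𝕜 : Type*} [RCLike 𝕜] {m : Type*} [Fintype m] [DecidableEq m]

/-- A smooth principal bundle over the submanifold `X` of `F` for the matrix group `G`, with total
space a submanifold of `V`. Here `ContDiffOn` on a submanifold means that the map extends locally to
a smooth map on an open set. -/
structure PrincipalBundle (G : Submonoid (Matrix m m 𝕜)) {F : Type*} [NormedAddCommGroup F]
    [NormedSpace ℝ F] (X : Set F) (V : Type*) [NormedAddCommGroup V] [NormedSpace ℝ V] where
  /-- the total space -/
  total : Set V
  /-- the projection to the base -/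
  proj : V → F
  /-- the right action of the group -/
  act : V → Matrix m m 𝕜 → V
  proj_mem : ∀ p ∈ total, proj p ∈ X
  proj_smooth : ∃ U : Set V, IsOpen U ∧ total ⊆ U ∧ ContDiffOn ℝ ∞ proj U
  act_mem : ∀ p ∈ total, ∀ g ∈ G, act p g ∈ total
  proj_act : ∀ p ∈ total, ∀ g ∈ G, proj (act p g) = proj p
  act_one : ∀ p ∈ total, act p 1 = p
  act_mul : ∀ p ∈ total, ∀ g ∈ G, ∀ h ∈ G, act p (g * h) = act (act p g) h
  act_smooth : ContDiffOn ℝ ∞ (fun q : V × Matrix m m 𝕜 => act q.1 q.2)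
    (total ×ˢ (G : Set (Matrix m m 𝕜)))
  /-- Near every point of the base there are a smooth section `σ` and a smooth map `τ` to the group
  such that `p ↦ (proj p, τ p)` and `(y, g) ↦ σ y · g` are inverse to each other. -/
  locally_trivial : ∀ x ∈ X, ∃ (W : Set F) (σ : F → V) (τ : V → Matrix m m 𝕜),
    IsOpen W ∧ x ∈ W ∧ ContDiffOn ℝ ∞ σ (X ∩ W) ∧ ContDiffOn ℝ ∞ τ (total ∩ proj ⁻¹' W) ∧
    (∀ y ∈ X ∩ W, σ y ∈ total ∧ proj (σ y) = y ∧ ∀ g ∈ G, τ (act (σ y) g) = g) ∧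
    ∀ p ∈ total ∩ proj ⁻¹' W, τ p ∈ G ∧ act (σ (proj p)) (τ p) = p

variable {E : Type*} [NormedAddCommGroup E] [InnerProductSpace ℝ E]
  {M : OrientedSubmanifold E} {G : Submonoid (Matrix m m 𝕜)}
  {V : Type*} [NormedAddCommGroup V] [NormedSpace ℝ V]

/-- The part of the total space over the complement of the zero section. -/
def PrincipalBundle.punctured (P : PrincipalBundle G (asdBundle M) V) : Set V :=
  {p | p ∈ P.total ∧ P.proj p ∈ puncturedAsdBundle M}

/-- The tangent vectors `v i` at the point `p` of the total space project to an orthonormal basis of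
the tangent space of `Λ²₋(M)`. -/
def PrincipalBundle.IsFrameLift (P : PrincipalBundle G (asdBundle M) V) (p : V)
    (v : Fin 7 → V) : Prop :=
  (∀ i, v i ∈ tangentVectors P.punctured p) ∧
    IsOrthonormalFrame M (P.proj p) fun i => fderiv ℝ P.proj p (v i)

/-- Such a lift. -/
def PrincipalBundle.chosenLift (P : PrincipalBundle G (asdBundle M) V) (p : V) : Fin 7 → V :=
  Classical.epsilon (P.IsFrameLift p)

/-- A connection `A` and a Higgs field `Φ` on the restriction of `P` to the complement of the zero
section. The connection is given by its connection form on the total space, the section `Φ` of the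
adjoint bundle by the corresponding equivariant map from the total space to the Lie algebra
`tangentVectors G 1`. -/
structure GaugePair (P : PrincipalBundle G (asdBundle M) V) where
  /-- the connection form -/
  form : V → V →L[ℝ] Matrix m m 𝕜
  /-- the Higgs field -/
  higgs : V → Matrix m m 𝕜
  smooth : ∃ U : Set V, IsOpen U ∧ P.punctured ⊆ U ∧
    ContDiffOn ℝ ∞ form U ∧ ContDiffOn ℝ ∞ higgs U
  form_mem : ∀ p ∈ P.punctured, ∀ v ∈ tangentVectors P.punctured p,
    form p v ∈ tangentVectors (G : Set (Matrix m m 𝕜)) 1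
  /-- The connection form reproduces the generators of the action. -/
  form_vertical : ∀ p ∈ P.punctured, ∀ g : ℝ → Matrix m m 𝕜,
    SmoothCurveIn (G : Set (Matrix m m 𝕜)) g → g 0 = 1 →
      form p (deriv (fun t => P.act p (g t)) 0) = deriv g 0
  /-- The connection form is equivariant. -/
  form_equivariant : ∀ γ : ℝ → V, SmoothCurveIn P.punctured γ → ∀ g ∈ G,
    form (P.act (γ 0) g) (deriv (fun t => P.act (γ t) g) 0) = g⁻¹ * form (γ 0) (deriv γ 0) * g
  higgs_mem : ∀ p ∈ P.punctured, higgs p ∈ tangentVectors (G : Set (Matrix m m 𝕜)) 1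
  higgs_equivariant : ∀ p ∈ P.punctured, ∀ g ∈ G, higgs (P.act p g) = g⁻¹ * higgs p * g

namespace GaugePair

variable {P : PrincipalBundle G (asdBundle M) V}

/-- The curvature `F_A = dA + ½ [A ∧ A]` on a pair of tangent vectors of the total space. -/
def curvature (C : GaugePair P) (p u v : V) : Matrix m m 𝕜 :=
  fderiv ℝ C.form p u v - fderiv ℝ C.form p v u
    + (C.form p u * C.form p v - C.form p v * C.form p u)

/-- The covariant derivative `d_A Φ` in the direction of a tangent vector of the total space. -/
def covDeriv (C : GaugePair P) (p v : V) : Matrix m m 𝕜 :=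
  fderiv ℝ C.higgs p v + (C.form p v * C.higgs p - C.higgs p * C.form p v)

/-- The monopole equation `⋆(F_A ∧ ψ) = d_A Φ` with `ψ = ⋆φ`, in every orthonormal frame. Since the
Hodge star occurs twice, the equation does not depend on the orientation. -/
def IsMonopole (C : GaugePair P) : Prop :=
  ∀ p ∈ P.punctured, ∀ v : Fin 7 → V, P.IsFrameLift p v →
    let phi3 : (Fin 3 → Fin 7) → ℝ := fun I => phi M (P.proj p) (fderiv ℝ P.proj p (v (I 0)))
      (fderiv ℝ P.proj p (v (I 1))) (fderiv ℝ P.proj p (v (I 2)))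
    let psi : (Fin 4 → Fin 7) → ℝ := hodge (k := 3) (l := 4) phi3
    let F : (Fin 2 → Fin 7) → Matrix m m 𝕜 := fun I => C.curvature p (v (I 0)) (v (I 1))
    ∀ i : Fin 7, hodge (k := 6) (l := 1) (wedge (k := 2) (l := 4) F psi) ![i] = C.covDeriv p (v i)

/-- `q` is the end point of a smooth horizontal curve from `p`. -/
def HorizontalStep (C : GaugePair P) (p q : V) : Prop :=
  ∃ γ : ℝ → V, ContDiff ℝ ∞ γ ∧ γ 0 = p ∧ γ 1 = q ∧
    ∀ t ∈ Icc (0 : ℝ) 1, γ t ∈ P.punctured ∧ C.form (γ t) (deriv γ t) = 0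

/-- The connection is irreducible: its holonomy group at every point is the whole structure group,
that is, `p` and `p · g` can always be joined by a piecewise smooth horizontal curve. -/
def IsIrreducible (C : GaugePair P) : Prop :=
  ∀ p ∈ P.punctured, ∀ g ∈ G, Relation.ReflTransGen C.HorizontalStep p (P.act p g)

/-- The two pairs are related by a gauge transformation, that is, by an automorphism of the
restriction of `P` to the complement of the zero section that covers the identity. -/
def GaugeEquivalent (C C' : GaugePair P) : Prop :=
  ∃ a : V → V, ContDiffOn ℝ ∞ a P.punctured ∧
    (∀ p ∈ P.punctured, a p ∈ P.punctured ∧ P.proj (a p) = P.proj p ∧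
      ∀ g ∈ G, a (P.act p g) = P.act (a p) g) ∧
    (∀ p ∈ P.punctured, C'.higgs (a p) = C.higgs p) ∧
    ∀ γ : ℝ → V, SmoothCurveIn P.punctured γ →
      C'.form (a (γ 0)) (deriv (fun t => a (γ t)) 0) = C.form (γ 0) (deriv γ 0)

/-- The pairs `C c` depend smoothly on the parameter `c` in `D`. -/
def IsSmoothFamily (C : ℝ × ℝ → GaugePair P) (D : Set (ℝ × ℝ)) : Prop :=
  ∃ U : Set V, IsOpen U ∧ P.punctured ⊆ U ∧
    ContDiffOn ℝ ∞ (fun q : (ℝ × ℝ) × V => (C q.1).form q.2) (D ×ˢ U) ∧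
    ContDiffOn ℝ ∞ (fun q : (ℝ × ℝ) × V => (C q.1).higgs q.2) (D ×ˢ U)

end GaugePair

/-- The norm of the inner product `-κ tr (X Y)` on skew-Hermitian matrices. -/
def lieNorm (κ : ℝ) (X : Matrix m m 𝕜) : ℝ :=
  Real.sqrt (κ * ∑ i, ∑ j, ‖X i j‖ ^ 2)

namespace GaugePair

variable {P : PrincipalBundle G (asdBundle M) V}

/-- The pointwise norm `|F_A|`, with `|F_A|² = ∑_{i < j} |F_A(e_i, e_j)|²` in an orthonormal
frame. -/
def curvatureNorm (κ : ℝ) (C : GaugePair P) (p : V) : ℝ :=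
  Real.sqrt (∑ i : Fin 7, ∑ j ∈ Finset.Ioi i,
    lieNorm κ (C.curvature p (P.chosenLift p i) (P.chosenLift p j)) ^ 2)

/-- `lim_{r → 0} r |Φ| = lim_{r → 0} r² |F_A| = 1`, where `r` is the distance to the zero section. -/
def HasUnitCharge (κ : ℝ) (C : GaugePair P) : Prop :=
  Tendsto (fun p => zeroSectionDist M (P.proj p) * lieNorm κ (C.higgs p))
      (comap (fun p => zeroSectionDist M (P.proj p)) (𝓝 0) ⊓ 𝓟 P.punctured) (𝓝 1) ∧
    Tendsto (fun p => zeroSectionDist M (P.proj p) ^ 2 * C.curvatureNorm κ p)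
      (comap (fun p => zeroSectionDist M (P.proj p)) (𝓝 0) ⊓ 𝓟 P.punctured) (𝓝 1)

end GaugePair

end Gauge

end

end G2Monopole

namespace G2Monopole

noncomputable section

/-! ### The reduced system of ordinary differential equations -/

/-- The profile equations of an invariant monopole, in logarithmic time. -/
def profileField (x : ℝ × ℝ × ℝ) : ℝ × ℝ × ℝ :=
  (x.2.2 * x.2.1 * x.1, x.2.1 + (x.1 ^ 2 - 1) * x.2.2 ^ 3, -(1 / 2) * (x.2.2 * (1 - x.2.2 ^ 4)))

theorem contDiff_profileField {n : WithTop ℕ∞} : ContDiff ℝ n profileField := by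
  unfold profileField; fun_prop

/-- The primitive of a path. -/
def pathIntegral : C(unitInterval, ℝ) →L[ℝ] C(unitInterval, ℝ) :=
  LinearMap.mkContinuous
    { toFun := fun y => ⟨fun t => ∫ s in (0 : ℝ)..t, Set.IccExtend zero_le_one y s, by
        have := intervalIntegral.continuous_primitive (μ := MeasureTheory.volume)
          (f := Set.IccExtend zero_le_one y)
          (fun a b => (y.continuous.Icc_extend' (h := zero_le_one)).intervalIntegrable a b) 0
        exact this.comp continuous_subtype_val⟩
      map_add' := by
        intro y z
        ext t
        simp only [ContinuousMap.coe_mk, ContinuousMap.coe_add, ContinuousMap.add_apply]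
        rw [← intervalIntegral.integral_add]
        · rfl
        · exact (y.continuous.Icc_extend' (h := zero_le_one)).intervalIntegrable _ _
        · exact (z.continuous.Icc_extend' (h := zero_le_one)).intervalIntegrable _ _
      map_smul' := by
        intro c y
        ext t
        simp only [ContinuousMap.coe_mk, ContinuousMap.coe_smul, ContinuousMap.smul_apply,
          RingHom.id_apply]
        rw [← intervalIntegral.integral_smul]
        rfl } 1 (by
    intro y
    rw [ContinuousMap.norm_le _ (by positivity)]
    intro t
    simp only [LinearMap.coe_mk, AddHom.coe_mk, ContinuousMap.coe_mk]
    refine (intervalIntegral.norm_integral_le_of_norm_le_const (C := ‖y‖) fun s _ => ?_).trans ?_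
    · exact y.norm_coe_le_norm _
    · have h0 := t.2.1
      have h1 := t.2.2
      rw [sub_zero, abs_of_nonneg h0, one_mul]
      exact mul_le_of_le_one_right (norm_nonneg _) h1)

theorem pathIntegral_apply (y : C(unitInterval, ℝ)) (t : unitInterval) :
    pathIntegral y t = ∫ s in (0 : ℝ)..t, Set.IccExtend zero_le_one y s := rfl

/-- Paths in the phase space of the profile equations. -/
abbrev ProfilePath : Type := C(unitInterval, ℝ) × C(unitInterval, ℝ) × C(unitInterval, ℝ)

/-- The zeros of this map are the solutions of the profile equations on a time interval of
length `T` with a given initial value. -/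
def profileDefect (q : ((ℝ × ℝ × ℝ) × ℝ) × ProfilePath) : ProfilePath :=
  (q.2.1 - q.1.1.1 • (1 : C(unitInterval, ℝ)) - q.1.2 • pathIntegral (q.2.2.2 * q.2.2.1 * q.2.1),
    q.2.2.1 - q.1.1.2.1 • (1 : C(unitInterval, ℝ))
      - q.1.2 • pathIntegral (q.2.2.1 + (q.2.1 ^ 2 - 1) * q.2.2.2 ^ 3),
    q.2.2.2 - q.1.1.2.2 • (1 : C(unitInterval, ℝ))
      - q.1.2 • pathIntegral ((-(1 / 2) : ℝ) • (q.2.2.2 * (1 - q.2.2.2 ^ 4))))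

theorem contDiff_profileDefect {n : WithTop ℕ∞} : ContDiff ℝ n profileDefect := by
  unfold profileDefect; fun_prop

theorem hasDerivAt_primitive (a T : ℝ) (y : C(unitInterval, ℝ)) (s : ℝ) :
    HasDerivAt (fun t => a + T * ∫ r in (0 : ℝ)..t, Set.IccExtend zero_le_one y r)
      (T * Set.IccExtend zero_le_one y s) s := by
  have hc := y.continuous.Icc_extend' (h := zero_le_one)
  exact ((intervalIntegral.integral_hasDerivAt_right (hc.intervalIntegrable _ _)
    (hc.stronglyMeasurableAtFilter _ _) hc.continuousAt).const_mul T).const_add a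

/-- A zero of the defect is a solution. -/
theorem exists_solution_of_profileDefect_eq_zero {x : ℝ × ℝ × ℝ} {T : ℝ} {y : ProfilePath}
    (h : profileDefect ((x, T), y) = 0) :
    ∃ z : ℝ → ℝ × ℝ × ℝ, z 0 = x ∧ z 1 = (y.1 1, y.2.1 1, y.2.2 1) ∧
      ∀ t ∈ Icc (0 : ℝ) 1, HasDerivAt z (T • profileField (z t)) t := by
  obtain ⟨w, η, p⟩ := y
  obtain ⟨x₁, x₂, x₃⟩ := x
  simp only [profileDefect, Prod.mk_eq_zero] at h
  obtain ⟨h1, h2, h3⟩ := h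
  set k₁ := p * η * w
  set k₂ := η + (w ^ 2 - 1) * p ^ 3
  set k₃ := (-(1 / 2) : ℝ) • (p * (1 - p ^ 4))
  have e1 : ∀ t : unitInterval, w t = x₁ + T * ∫ s in (0 : ℝ)..t, Set.IccExtend zero_le_one k₁ s := by
    intro t
    have := DFunLike.congr_fun h1 t
    simp [pathIntegral_apply] at this
    linarith
  have e2 : ∀ t : unitInterval, η t = x₂ + T * ∫ s in (0 : ℝ)..t, Set.IccExtend zero_le_one k₂ s := by
    intro t
    have := DFunLike.congr_fun h2 t
    simp [pathIntegral_apply] at this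
    linarith
  have e3 : ∀ t : unitInterval, p t = x₃ + T * ∫ s in (0 : ℝ)..t, Set.IccExtend zero_le_one k₃ s := by
    intro t
    have := DFunLike.congr_fun h3 t
    simp [pathIntegral_apply] at this
    linarith
  refine ⟨fun t => (x₁ + T * ∫ s in (0 : ℝ)..t, Set.IccExtend zero_le_one k₁ s,
    x₂ + T * ∫ s in (0 : ℝ)..t, Set.IccExtend zero_le_one k₂ s,
    x₃ + T * ∫ s in (0 : ℝ)..t, Set.IccExtend zero_le_one k₃ s), ?_, ?_, ?_⟩
  · simp
  · have := e1 1; have := e2 1; have := e3 1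
    simp_all
  · intro t ht
    have a1 := e1 ⟨t, ht⟩
    have a2 := e2 ⟨t, ht⟩
    have a3 := e3 ⟨t, ht⟩
    simp only at a1 a2 a3
    have d := (hasDerivAt_primitive x₁ T k₁ t).prodMk
      ((hasDerivAt_primitive x₂ T k₂ t).prodMk (hasDerivAt_primitive x₃ T k₃ t))
    convert d using 1
    simp only [profileField, ← a1, ← a2, ← a3, Set.IccExtend_of_mem _ _ ht, Prod.smul_mk,
      smul_eq_mul]
    rfl

/-- Two solutions of the same autonomous equation on the unit interval with the same initial value
are equal. -/
theorem profile_unique {T : ℝ} {z z' : ℝ → ℝ × ℝ × ℝ}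
    (hz : ∀ t ∈ Icc (0 : ℝ) 1, HasDerivAt z (T • profileField (z t)) t)
    (hz' : ∀ t ∈ Icc (0 : ℝ) 1, HasDerivAt z' (T • profileField (z' t)) t)
    (h0 : z 0 = z' 0) : z 1 = z' 1 := by
  have hc : ContinuousOn z (Icc 0 1) := fun t ht => (hz t ht).continuousAt.continuousWithinAt
  have hc' : ContinuousOn z' (Icc 0 1) := fun t ht => (hz' t ht).continuousAt.continuousWithinAt
  obtain ⟨R, hR⟩ := (((isCompact_Icc.image_of_continuousOn hc).union
    (isCompact_Icc.image_of_continuousOn hc')).isBounded).subset_closedBall 0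
  have hL : ∃ K, LipschitzOnWith K (fun x => T • profileField x) (Metric.closedBall 0 R) := by
    have hd : ContDiff ℝ 1 (fun x => T • profileField x) := contDiff_profileField.const_smul T
    exact hd.contDiffOn.exists_lipschitzOnWith one_ne_zero (convex_closedBall _ _)
      (isCompact_closedBall _ _)
  obtain ⟨K, hK⟩ := hL
  have := ODE_solution_unique_of_mem_Icc_right (v := fun _ x => T • profileField x)
    (s := fun _ => Metric.closedBall 0 R) (K := K) (fun _ _ => hK) hc
    (fun t ht => (hz t ⟨ht.1, ht.2.le⟩).hasDerivWithinAt)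
    (fun t ht => hR (Or.inl ⟨t, ⟨ht.1, ht.2.le⟩, rfl⟩)) hc'
    (fun t ht => (hz' t ⟨ht.1, ht.2.le⟩).hasDerivWithinAt)
    (fun t ht => hR (Or.inr ⟨t, ⟨ht.1, ht.2.le⟩, rfl⟩)) h0
  exact this ⟨zero_le_one, le_rfl⟩

/-- The translates of a solution on the whole line, run at a different speed. -/
theorem hasDerivAt_rescale {X : ℝ → ℝ × ℝ × ℝ} (hX : ∀ t, HasDerivAt X (profileField (X t)) t)
    (t T s : ℝ) : HasDerivAt (fun s => X (t + T * s)) (T • profileField (X (t + T * s))) s := by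
  have h : HasDerivAt (fun s => t + T * s) T s := by
    simpa using ((hasDerivAt_id s).const_mul T).const_add t
  exact (hX (t + T * s)).scomp s h

/-- `(x, τ)` is in the open domain of the smooth flow. -/
def IsFlowPoint (q : (ℝ × ℝ × ℝ) × ℝ) : Prop :=
  ∃ ψ : (ℝ × ℝ × ℝ) × ℝ → ℝ × ℝ × ℝ, ∀ᶠ q' in 𝓝 q, ContDiffAt ℝ ∞ ψ q' ∧
    ∀ X : ℝ → ℝ × ℝ × ℝ, (∀ t, HasDerivAt X (profileField (X t)) t) →
      ∀ t, X t = q'.1 → X (t + q'.2) = ψ q'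

theorem isOpen_isFlowPoint : IsOpen {q | IsFlowPoint q} := by
  rw [isOpen_iff_mem_nhds]
  rintro q ⟨ψ, h⟩
  filter_upwards [h.eventually_nhds] with q' hq'
  exact ⟨ψ, hq'⟩

theorem isFlowPoint_zero (x : ℝ × ℝ × ℝ) : IsFlowPoint (x, 0) := by
  set y₀ : ProfilePath := (x.1 • (1 : C(unitInterval, ℝ)), x.2.1 • (1 : C(unitInterval, ℝ)), x.2.2 • (1 : C(unitInterval, ℝ))) with hy₀
  set u : ((ℝ × ℝ × ℝ) × ℝ) × ProfilePath := ((x, 0), y₀) with hu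
  have hF : ContDiffAt ℝ ω profileDefect u := contDiff_profileDefect.contDiffAt
  have hd : fderiv ℝ profileDefect u ∘L .inr ℝ ((ℝ × ℝ × ℝ) × ℝ) ProfilePath
      = ContinuousLinearMap.id ℝ ProfilePath := by
    have h1 : HasFDerivAt profileDefect (fderiv ℝ profileDefect u) u :=
      (hF.differentiableAt (by simp)).hasFDerivAt
    have h2 : HasFDerivAt (fun y : ProfilePath => (((x, 0) : (ℝ × ℝ × ℝ) × ℝ), y))
        (.inr ℝ ((ℝ × ℝ × ℝ) × ℝ) ProfilePath) y₀ := hasFDerivAt_prodMk_right _ _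
    have h3 := h1.comp y₀ h2
    have h4 : HasFDerivAt (fun y : ProfilePath => y - y₀) (ContinuousLinearMap.id ℝ ProfilePath)
        y₀ := (hasFDerivAt_id y₀).sub_const y₀
    refine h3.unique (h4.congr_of_eventuallyEq (Eventually.of_forall fun y => ?_))
    simp [profileDefect, hy₀]
    rfl
  have hi : (fderiv ℝ profileDefect u ∘L .inr ℝ ((ℝ × ℝ × ℝ) × ℝ) ProfilePath).IsInvertible := by
    rw [hd]; exact ⟨ContinuousLinearEquiv.refl ℝ _, rfl⟩
  have hn : (ω : WithTop ℕ∞) ≠ 0 := by simp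
  have hu0 : profileDefect u = 0 := by simp [profileDefect, hu, hy₀]
  set ψ := hF.implicitFunction hn hi
  have hψ := hF.contDiffAt_implicitFunction hn hi
  have hev := hF.eventually_apply_implicitFunction hn hi
  have hsm : ∀ᶠ q' in 𝓝 u.1, ContDiffAt ℝ ∞ ψ q' := by
    filter_upwards [hψ.eventually (by simp)] with q hq using hq.of_le le_top
  refine ⟨fun q => ((ψ q).1 1, (ψ q).2.1 1, (ψ q).2.2 1), ?_⟩
  filter_upwards [hsm, hev] with q' hq' he
  constructor
  · have ev : ContDiff ℝ ∞ (fun y : ProfilePath => ((y.1 1, y.2.1 1, y.2.2 1) : ℝ × ℝ × ℝ)) := by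
      have e : ContDiff ℝ ∞ (fun y : C(unitInterval, ℝ) => y 1) :=
        (ContinuousMap.evalCLM (M := ℝ) ℝ (1 : unitInterval)).contDiff
      exact (e.comp contDiff_fst).prodMk
        ((e.comp (contDiff_fst.comp contDiff_snd)).prodMk (e.comp (contDiff_snd.comp contDiff_snd)))
    exact ev.contDiffAt.comp q' hq'
  · intro X hX t ht
    obtain ⟨z, hz0, hz1, hz⟩ := exists_solution_of_profileDefect_eq_zero (x := q'.1) (T := q'.2)
      (y := ψ q') (by rw [← hu0, ← he])
    rw [← hz1]
    have := profile_unique (T := q'.2) (fun s _ => hasDerivAt_rescale hX t q'.2 s) hz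
      (by simpa [hz0] using ht)
    simpa using this

theorem IsFlowPoint.comp {X : ℝ → ℝ × ℝ × ℝ} (hX : ∀ t, HasDerivAt X (profileField (X t)) t)
    {τ τ' : ℝ} (h : IsFlowPoint (X 0, τ)) (h' : IsFlowPoint (X τ, τ')) :
    IsFlowPoint (X 0, τ + τ') := by
  obtain ⟨ψ, hψ⟩ := h
  obtain ⟨ψ', hψ'⟩ := h'
  have hX' : ψ (X 0, τ) = X τ := by
    have := hψ.self_of_nhds.2 X hX 0 rfl
    simpa using this.symm
  set s : (ℝ × ℝ × ℝ) × ℝ → (ℝ × ℝ × ℝ) × ℝ := fun q => (q.1, q.2 - τ')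
  set k : (ℝ × ℝ × ℝ) × ℝ → (ℝ × ℝ × ℝ) × ℝ := fun q => (ψ (s q), τ')
  have hs : ContDiff ℝ ∞ s := by fun_prop
  have hs0 : s (X 0, τ + τ') = (X 0, τ) := by simp [s]
  have hst : Tendsto s (𝓝 (X 0, τ + τ')) (𝓝 (X 0, τ)) := by
    rw [← hs0]; exact hs.continuous.continuousAt
  have hk0 : k (X 0, τ + τ') = (X τ, τ') := by simp only [k, hs0, hX']
  have e1 := hst.eventually hψ
  have hkc : ∀ q', ContDiffAt ℝ ∞ ψ (s q') → ContDiffAt ℝ ∞ k q' := fun q' hq =>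
    (hq.comp q' hs.contDiffAt).prodMk contDiffAt_const
  have hkt : Tendsto k (𝓝 (X 0, τ + τ')) (𝓝 (X τ, τ')) := by
    rw [← hk0]; exact (hkc _ e1.self_of_nhds.1).continuousAt
  refine ⟨fun q => ψ' (k q), ?_⟩
  filter_upwards [e1, hkt.eventually hψ'] with q' h1 h2
  refine ⟨h2.1.comp q' (hkc q' h1.1), fun Y hY t ht => ?_⟩
  have := h1.2 Y hY t ht
  have h3 := h2.2 Y hY (t + (s q').2) this
  rw [← h3]
  congr 1
  simp only [s, k]
  ring

/-- All times are in the domain of the smooth flow along a solution on the whole line. -/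
theorem isFlowPoint_of_solution {X : ℝ → ℝ × ℝ × ℝ}
    (hX : ∀ t, HasDerivAt X (profileField (X t)) t) (τ : ℝ) : IsFlowPoint (X 0, τ) := by
  have hc : Continuous X := continuous_iff_continuousAt.2 fun t => (hX t).continuousAt
  have key : IsClopen {τ | IsFlowPoint (X 0, τ)} := by
    constructor
    · rw [← isOpen_compl_iff, isOpen_iff_mem_nhds]
      intro τ hτ
      have h1 : Tendsto (fun σ => (X σ, τ - σ)) (𝓝 τ) (𝓝 (X τ, 0)) := by
        have : Continuous (fun σ => (X σ, τ - σ)) := by fun_prop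
        simpa using this.tendsto τ
      filter_upwards [h1.eventually (isOpen_isFlowPoint.mem_nhds (isFlowPoint_zero (X τ)))]
        with σ hσ hσ'
      apply hτ
      have := IsFlowPoint.comp hX hσ' hσ
      simpa using this
    · exact isOpen_isFlowPoint.preimage (f := fun τ => (X 0, τ)) (by fun_prop)
  have := key.eq_univ ⟨0, isFlowPoint_zero _⟩
  exact (Set.ext_iff.1 this τ).2 (mem_univ τ)

/-- Smooth dependence of solutions on the whole line on their initial values. -/
theorem contDiffOn_solution {A : Type*} [NormedAddCommGroup A] [NormedSpace ℝ A] {D : Set A}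
    {X : A → ℝ → ℝ × ℝ × ℝ} (hX : ∀ c ∈ D, ∀ t, HasDerivAt (X c) (profileField (X c t)) t)
    (h0 : ContDiffOn ℝ ∞ (fun c => X c 0) D) :
    ContDiffOn ℝ ∞ (fun q : A × ℝ => X q.1 q.2) (D ×ˢ univ) := by
  rintro ⟨c, τ⟩ ⟨hc, -⟩
  obtain ⟨ψ, hψ⟩ := isFlowPoint_of_solution (hX c hc) τ
  have hin : ContDiffWithinAt ℝ ∞ (fun q : A × ℝ => (X q.1 0, q.2)) (D ×ˢ univ) (c, τ) :=
    ((h0 c hc).comp (c, τ) contDiffWithinAt_fst (fun q hq => hq.1)).prodMk contDiffWithinAt_snd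
  have hev := hin.continuousWithinAt.tendsto.eventually hψ
  have hcomp : ContDiffWithinAt ℝ ∞ (fun q : A × ℝ => ψ (X q.1 0, q.2)) (D ×ˢ univ) (c, τ) :=
    (hψ.self_of_nhds.1).comp_contDiffWithinAt (c, τ) hin
  refine hcomp.congr_of_eventuallyEq ?_ ?_
  · filter_upwards [hev, self_mem_nhdsWithin] with q hq hq'
    have := hq.2 (X q.1) (hX _ hq'.1) 0 rfl
    simpa using this
  · have := hψ.self_of_nhds.2 (X c) (hX c hc) 0 rfl
    simpa using this

/-- The conformal factor `(1 + s²)^(-1/4)` as a function of the distance `s` along the fibre. -/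
def scaleFactor (s : ℝ) : ℝ := (1 + s ^ 2) ^ (-(1 / 4) : ℝ)

theorem scaleFactor_pos (s : ℝ) : 0 < scaleFactor s := Real.rpow_pos_of_pos (by positivity) _

theorem scaleFactor_le_one (s : ℝ) : scaleFactor s ≤ 1 :=
  Real.rpow_le_one_of_one_le_of_nonpos (by nlinarith [sq_nonneg s]) (by norm_num)

theorem scaleFactor_pow_four (s : ℝ) : scaleFactor s ^ 4 * (1 + s ^ 2) = 1 := by
  have h : (0 : ℝ) < 1 + s ^ 2 := by positivity
  rw [scaleFactor, ← Real.rpow_natCast, ← Real.rpow_mul h.le]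
  norm_num
  rw [Real.rpow_neg_one, inv_mul_cancel₀ h.ne']

theorem hasDerivAt_scaleFactor (s : ℝ) :
    HasDerivAt scaleFactor (-(1 / 2) * s * scaleFactor s ^ 5) s := by
  have h : (0 : ℝ) < 1 + s ^ 2 := by positivity
  have h1 : HasDerivAt (fun s : ℝ => 1 + s ^ 2) (2 * s) s := by
    simpa using (hasDerivAt_pow 2 s).const_add 1
  have h2 := h1.rpow_const (p := -(1 / 4)) (Or.inl h.ne')
  refine h2.congr_deriv ?_
  have e1 : ((1 + s ^ 2) ^ (-(1 / 4) - 1 : ℝ)) = scaleFactor s * (1 + s ^ 2)⁻¹ := by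
    rw [Real.rpow_sub h, Real.rpow_one]; rfl
  have e2 : scaleFactor s ^ 5 = scaleFactor s * (1 + s ^ 2)⁻¹ := by
    have := scaleFactor_pow_four s
    field_simp
    linear_combination scaleFactor s * this
  rw [e1, e2]; ring

theorem contDiff_scaleFactor : ContDiff ℝ ∞ scaleFactor := by
  unfold scaleFactor
  refine ContDiff.rpow_const_of_ne (by fun_prop) fun s => ?_
  positivity

theorem scaleFactor_anti {s t : ℝ} (hs : 0 ≤ s) (hst : s ≤ t) : scaleFactor t ≤ scaleFactor s := by
  refine Real.rpow_le_rpow_of_nonpos (by positivity) ?_ (by norm_num)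
  gcongr

theorem hasDerivAt_scaleFactor_exp (a t : ℝ) :
    HasDerivAt (fun t => scaleFactor (a * Real.exp t))
      (-(1 / 2) * (scaleFactor (a * Real.exp t) * (1 - scaleFactor (a * Real.exp t) ^ 4))) t := by
  have h := (hasDerivAt_scaleFactor (a * Real.exp t)).comp t ((Real.hasDerivAt_exp t).const_mul a)
  refine h.congr_deriv ?_
  have := scaleFactor_pow_four (a * Real.exp t)
  linear_combination -(1 / 2) * scaleFactor (a * Real.exp t) * this

/-! ### Global existence -/

theorem abs_max_min_sub_le (R x y : ℝ) :
    |max (-R) (min x R) - max (-R) (min y R)| ≤ |x - y| := by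
  refine (abs_max_sub_max_le_max _ _ _ _).trans ?_
  simp only [sub_self, abs_zero]
  refine max_le (abs_nonneg _) ((abs_min_sub_min_le_max _ _ _ _).trans ?_)
  simp

theorem abs_exp_min_sub_le (x y : ℝ) :
    |Real.exp (2 * min x 0) - Real.exp (2 * min y 0)| ≤ 2 * |x - y| := by
  have key : ∀ a b : ℝ, a ≤ b → b ≤ 0 → Real.exp (2 * b) - Real.exp (2 * a) ≤ 2 * (b - a) := by
    intro a b hab hb
    have h1 : 2 * (a - b) + 1 ≤ Real.exp (2 * (a - b)) := Real.add_one_le_exp _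
    have h2 : Real.exp (2 * a) = Real.exp (2 * b) * Real.exp (2 * (a - b)) := by
      rw [← Real.exp_add]; ring_nf
    have h3 : Real.exp (2 * b) ≤ 1 := Real.exp_le_one_iff.2 (by linarith)
    have h4 := Real.exp_pos (2 * b)
    rw [h2]
    nlinarith
  have h5 : |min x 0 - min y 0| ≤ |x - y| := by
    refine (abs_min_sub_min_le_max _ _ _ _).trans ?_
    simp
  refine le_trans ?_ (mul_le_mul_of_nonneg_left h5 zero_le_two)
  rcases le_total (min x 0) (min y 0) with h | h
  · rw [abs_sub_comm, abs_of_nonneg (sub_nonneg.2 (Real.exp_le_exp.2 (by linarith))),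
      abs_sub_comm, abs_of_nonneg (sub_nonneg.2 h)]
    exact key _ _ h (min_le_right _ _)
  · rw [abs_of_nonneg (sub_nonneg.2 (Real.exp_le_exp.2 (by linarith))),
      abs_of_nonneg (sub_nonneg.2 h)]
    exact key _ _ h (min_le_right _ _)

/-- A solution of the profile equations on an interval around the time at which the Higgs field
vanishes. -/
theorem exists_profile_on_Ioo {a b N : ℝ} (ha : 0 < a) (hb : 0 < b) (hb1 : b < 1) (hN : 0 < N) :
    ∃ X : ℝ → ℝ × ℝ × ℝ, X 0 = (b, 0, scaleFactor a) ∧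
      ∀ t ∈ Ioo (-N) N, HasDerivAt X (profileField (X t)) t ∧ 0 < (X t).1 ∧ (X t).1 ≤ b ∧
        (X t).2.2 = scaleFactor (a * Real.exp t) := by
  set s : ℝ → ℝ := fun t => a * Real.exp t with hs
  have hs0 : ∀ t, 0 < s t := fun t => mul_pos ha (Real.exp_pos t)
  set p : ℝ → ℝ := fun t => scaleFactor (s t) with hp
  set S := a * Real.exp N
  set S' := a⁻¹ * Real.exp N
  have hS : 0 < S := by positivity
  have hS' : 0 < S' := by positivity
  set R := S' * N
  have hR : 0 < R := by positivity
  set v : ℝ → ℝ × ℝ → ℝ × ℝ := fun t x => (s t * p t * max (-R) (min x.2 R),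
    -((1 - Real.exp (2 * min x.1 0)) * p t ^ 3 * (s t)⁻¹)) with hv
  have hsc : Continuous s := by fun_prop
  have hpc : Continuous p := contDiff_scaleFactor.continuous.comp hsc
  have hsp : ∀ t ∈ Icc (-N) N, 0 ≤ s t * p t ∧ s t * p t ≤ S := by
    intro t ht
    refine ⟨(mul_pos (hs0 t) (scaleFactor_pos _)).le, ?_⟩
    calc s t * p t ≤ s t * 1 := mul_le_mul_of_nonneg_left (scaleFactor_le_one _) (hs0 t).le
      _ = s t := mul_one _
      _ ≤ S := mul_le_mul_of_nonneg_left (Real.exp_le_exp.2 ht.2) ha.le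
  have hps : ∀ t ∈ Icc (-N) N, 0 ≤ p t ^ 3 * (s t)⁻¹ ∧ p t ^ 3 * (s t)⁻¹ ≤ S' := by
    intro t ht
    have h1 : 0 ≤ p t := (scaleFactor_pos _).le
    have h2 : (s t)⁻¹ ≤ S' := by
      simp only [hs, mul_inv, ← Real.exp_neg, S']
      exact mul_le_mul_of_nonneg_left (Real.exp_le_exp.2 (by linarith [ht.1])) (by positivity)
    have h3 : 0 ≤ (s t)⁻¹ := (inv_pos.2 (hs0 t)).le
    refine ⟨by positivity, ?_⟩
    calc p t ^ 3 * (s t)⁻¹ ≤ 1 * (s t)⁻¹ :=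
          mul_le_mul_of_nonneg_right (pow_le_one₀ h1 (scaleFactor_le_one _)) h3
      _ ≤ S' := by rwa [one_mul]
  have hk : ∀ x : ℝ, 0 ≤ 1 - Real.exp (2 * min x 0) ∧ 1 - Real.exp (2 * min x 0) ≤ 1 := by
    intro x
    have h1 : Real.exp (2 * min x 0) ≤ 1 :=
      Real.exp_le_one_iff.2 (by linarith [min_le_right x 0])
    exact ⟨by linarith, by linarith [Real.exp_pos (2 * min x 0)]⟩
  have hclip : ∀ x : ℝ, |max (-R) (min x R)| ≤ R := by
    intro x
    rw [abs_le]
    exact ⟨le_max_left _ _, max_le (by linarith) (min_le_right _ _)⟩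
  have hv2 : ∀ t ∈ Icc (-N) N, ∀ x, |(v t x).2| ≤ S' := by
    intro t ht x
    simp only [hv]
    rw [abs_neg, mul_assoc, abs_mul, abs_of_nonneg (hk _).1, abs_of_nonneg (hps t ht).1]
    calc _ ≤ 1 * (p t ^ 3 * (s t)⁻¹) := mul_le_mul_of_nonneg_right (hk _).2 (hps t ht).1
      _ ≤ S' := by rw [one_mul]; exact (hps t ht).2
  set L : NNReal := ⟨max (S * R) S', le_max_of_le_right hS'.le⟩ with hL
  set K : NNReal := ⟨max S (2 * S'), le_max_of_le_left hS.le⟩ with hK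
  set A : NNReal := L * ⟨N, hN.le⟩ with hA
  have hpl : IsPicardLindelof v (⟨0, ⟨by linarith, hN.le⟩⟩ : Icc (-N) N) (Real.log b, 0) A 0 L K := by
    constructor
    · intro t ht
      refine LipschitzOnWith.of_dist_le_mul fun x _ y _ => ?_
      rw [Prod.dist_eq, Real.dist_eq, Real.dist_eq]
      have hxy1 : |x.1 - y.1| ≤ dist x y := by rw [← Real.dist_eq]; exact le_max_left _ _
      have hxy2 : |x.2 - y.2| ≤ dist x y := by rw [← Real.dist_eq]; exact le_max_right _ _
      have hd : 0 ≤ dist x y := dist_nonneg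
      refine max_le ?_ ?_
      · simp only [hv, ← mul_sub]
        rw [abs_mul, abs_of_nonneg (hsp t ht).1]
        calc _ ≤ S * dist x y := mul_le_mul (hsp t ht).2
              ((abs_max_min_sub_le _ _ _).trans hxy2) (abs_nonneg _) hS.le
          _ ≤ K * dist x y := mul_le_mul_of_nonneg_right (le_max_left _ _) hd
      · have e : (v t x).2 - (v t y).2 = (Real.exp (2 * min x.1 0) - Real.exp (2 * min y.1 0))
            * (p t ^ 3 * (s t)⁻¹) := by simp only [hv]; ring
        rw [e, abs_mul, abs_of_nonneg (hps t ht).1]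
        calc _ ≤ (2 * dist x y) * S' := mul_le_mul ((abs_exp_min_sub_le _ _).trans (by linarith))
              (hps t ht).2 (hps t ht).1 (by positivity)
          _ = (2 * S') * dist x y := by ring
          _ ≤ K * dist x y := mul_le_mul_of_nonneg_right (le_max_right _ _) hd
    · intro x _
      apply Continuous.continuousOn
      have : Continuous fun t => (s t)⁻¹ := hsc.inv₀ fun t => (hs0 t).ne'
      simp only [hv]
      fun_prop
    · intro t ht x _
      rw [Prod.norm_def, Real.norm_eq_abs, Real.norm_eq_abs]
      refine max_le ?_ ((hv2 t ht x).trans (le_max_right _ _))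
      simp only [hv]
      rw [abs_mul, abs_of_nonneg (hsp t ht).1]
      exact (mul_le_mul (hsp t ht).2 (hclip _) (abs_nonneg _) hS.le).trans (le_max_left _ _)
    · simp only [hA, sub_zero, zero_sub, neg_neg, max_self, NNReal.coe_zero]
      exact le_of_eq rfl
  obtain ⟨α, hα0, hα⟩ := hpl.exists_eq_forall_mem_Icc_hasDerivWithinAt₀
  simp only at hα0
  have hd1 : ∀ t ∈ Icc (-N) N, HasDerivWithinAt (fun t => (α t).1) (v t (α t)).1 (Icc (-N) N) t :=
    fun t ht => (hα t ht).fst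
  have hd2 : ∀ t ∈ Icc (-N) N, HasDerivWithinAt (fun t => (α t).2) (v t (α t)).2 (Icc (-N) N) t :=
    fun t ht => (hα t ht).snd
  have h0mem : (0 : ℝ) ∈ Icc (-N) N := ⟨by linarith, hN.le⟩
  have hbound : ∀ t ∈ Icc (-N) N, |(α t).2| ≤ R := by
    intro t ht
    have := (convex_Icc (-N) N).norm_image_sub_le_of_norm_hasDerivWithin_le (f := fun t => (α t).2)
      (C := S') hd2 (fun t ht => hv2 t ht _) h0mem ht
    rw [hα0, Real.norm_eq_abs, Real.norm_eq_abs, sub_zero, sub_zero] at this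
    exact this.trans (mul_le_mul_of_nonneg_left (abs_le.2 ht) hS'.le)
  have hunclip : ∀ t ∈ Icc (-N) N, max (-R) (min (α t).2 R) = (α t).2 := by
    intro t ht
    have := abs_le.1 (hbound t ht)
    rw [min_eq_left this.2, max_eq_right this.1]
  have hmem : ∀ t ∈ interior (Icc (-N) N), Icc (-N) N ∈ 𝓝 t := fun t ht =>
    mem_interior_iff_mem_nhds.1 ht
  have hanti : AntitoneOn (fun t => (α t).2) (Icc (-N) N) := by
    refine antitoneOn_of_deriv_nonpos (convex_Icc _ _) (fun t ht => (hd2 t ht).continuousWithinAt)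
      (fun t ht => ((hd2 t (interior_subset ht)).hasDerivAt (hmem t ht)).differentiableAt.differentiableWithinAt) fun t ht => ?_
    rw [((hd2 t (interior_subset ht)).hasDerivAt (hmem t ht)).deriv]
    simp only [hv]
    rw [mul_assoc]
    exact neg_nonpos.2 (mul_nonneg (hk _).1 (hps t (interior_subset ht)).1)
  have hg : ∀ t ∈ Icc (-N) N, (α t).1 ≤ Real.log b := by
    have hg0 : (α 0).1 = Real.log b := by rw [hα0]
    intro t ht
    rw [← hg0]
    rcases le_total t 0 with h | h
    · have hsub : Icc t 0 ⊆ Icc (-N) N := Icc_subset_Icc ht.1 hN.le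
      refine (monotoneOn_of_deriv_nonneg (convex_Icc t 0) (f := fun t => (α t).1)
        (fun r hr => ((hd1 r (hsub hr)).continuousWithinAt).mono hsub) (fun r hr =>
          ((hd1 r (hsub (interior_subset hr))).hasDerivAt (hmem r (interior_mono hsub hr))).differentiableAt.differentiableWithinAt)
        fun r hr => ?_) ⟨le_rfl, h⟩ ⟨h, le_rfl⟩ h
      have hr' := hsub (interior_subset hr)
      rw [((hd1 r hr').hasDerivAt (hmem r (interior_mono hsub hr))).deriv]
      simp only [hv, hunclip r hr']
      refine mul_nonneg (hsp r hr').1 ?_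
      have := hanti hr' h0mem (interior_subset hr).2
      simpa [hα0] using this
    · have hsub : Icc 0 t ⊆ Icc (-N) N := Icc_subset_Icc (by linarith) ht.2
      refine (antitoneOn_of_deriv_nonpos (convex_Icc 0 t) (f := fun t => (α t).1)
        (fun r hr => ((hd1 r (hsub hr)).continuousWithinAt).mono hsub) (fun r hr =>
          ((hd1 r (hsub (interior_subset hr))).hasDerivAt (hmem r (interior_mono hsub hr))).differentiableAt.differentiableWithinAt)
        fun r hr => ?_) ⟨le_rfl, h⟩ ⟨h, le_rfl⟩ h
      have hr' := hsub (interior_subset hr)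
      rw [((hd1 r hr').hasDerivAt (hmem r (interior_mono hsub hr))).deriv]
      simp only [hv, hunclip r hr']
      refine mul_nonpos_of_nonneg_of_nonpos (hsp r hr').1 ?_
      have := hanti h0mem hr' (interior_subset hr).1
      simpa [hα0] using this
  have hlog : Real.log b < 0 := Real.log_neg hb hb1
  refine ⟨fun t => (Real.exp (α t).1, s t * (α t).2, p t), ?_, ?_⟩
  · simp [hα0, Real.exp_log hb, hp, hs]
  · intro t ht
    have ht' := Ioo_subset_Icc_self ht
    have hn : Icc (-N) N ∈ 𝓝 t := Icc_mem_nhds ht.1 ht.2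
    refine ⟨?_, Real.exp_pos _, ?_, rfl⟩
    · have e1 := ((hd1 t ht').hasDerivAt hn).exp
      have e2 : HasDerivAt s (s t) t := (Real.hasDerivAt_exp t).const_mul a
      have e3 := e2.mul ((hd2 t ht').hasDerivAt hn)
      have e4 := hasDerivAt_scaleFactor_exp a t
      refine (e1.prodMk (e3.prodMk e4)).congr_deriv ?_
      have hmin : min (α t).1 0 = (α t).1 := min_eq_left ((hg t ht').trans hlog.le)
      have hexp : Real.exp (2 * (α t).1) = Real.exp (α t).1 ^ 2 := by
        rw [← Real.exp_nat_mul]; norm_num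
      have hst := (hs0 t).ne'
      simp only [profileField, hv, hunclip t ht', hmin, hexp]
      refine Prod.ext ?_ (Prod.ext ?_ rfl)
      · simp only; ring
      · simp only; field_simp; ring
    · calc Real.exp (α t).1 ≤ Real.exp (Real.log b) := Real.exp_le_exp.2 (hg t ht')
        _ = b := Real.exp_log hb

theorem profile_unique_of_abs_lt {X Y : ℝ → ℝ × ℝ × ℝ} {N : ℝ}
    (hX : ∀ t ∈ Ioo (-N) N, HasDerivAt X (profileField (X t)) t)
    (hY : ∀ t ∈ Ioo (-N) N, HasDerivAt Y (profileField (Y t)) t) (h0 : X 0 = Y 0) {t : ℝ}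
    (ht : t ∈ Ioo (-N) N) : X t = Y t := by
  have hmem : ∀ r ∈ Icc (0 : ℝ) 1, t * r ∈ Ioo (-N) N := by
    intro r hr
    have h : |t * r| < N := by
      rw [abs_mul, abs_of_nonneg hr.1]
      exact (mul_le_of_le_one_right (abs_nonneg t) hr.2).trans_lt (abs_lt.2 ht)
    exact abs_lt.1 h
  have hd : ∀ r, HasDerivAt (fun r => t * r) t r := fun r => by
    simpa using (hasDerivAt_id r).const_mul t
  have := profile_unique (T := t) (z := fun r => X (t * r)) (z' := fun r => Y (t * r))
    (fun r hr => (hX _ (hmem r hr)).scomp r (hd r))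
    (fun r hr => (hY _ (hmem r hr)).scomp r (hd r)) (by simpa using h0)
  simpa using this

theorem exists_profile_global {a b : ℝ} (ha : 0 < a) (hb : 0 < b) (hb1 : b < 1) :
    ∃ X : ℝ → ℝ × ℝ × ℝ, X 0 = (b, 0, scaleFactor a) ∧
      ∀ t, HasDerivAt X (profileField (X t)) t ∧ 0 < (X t).1 ∧ (X t).1 ≤ b ∧
        (X t).2.2 = scaleFactor (a * Real.exp t) := by
  have := fun n : ℕ => exists_profile_on_Ioo ha hb hb1 (N := (n : ℝ) + 1) (by positivity)
  choose Y hY0 hY using this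
  have hagree : ∀ m n : ℕ, ∀ t ∈ Ioo (-((m : ℝ) + 1)) (m + 1), t ∈ Ioo (-((n : ℝ) + 1)) (n + 1) →
      Y m t = Y n t := by
    intro m n t hm hn
    rcases le_total m n with h | h
    · have h' : (m : ℝ) ≤ n := by exact_mod_cast h
      exact profile_unique_of_abs_lt (fun t ht => (hY m t ht).1)
        (fun t ht => (hY n t ⟨by linarith [ht.1], by linarith [ht.2]⟩).1) (by rw [hY0, hY0]) hm
    · have h' : (n : ℝ) ≤ m := by exact_mod_cast h
      exact profile_unique_of_abs_lt
        (fun t ht => (hY m t ⟨by linarith [ht.1], by linarith [ht.2]⟩).1)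
        (fun t ht => (hY n t ht).1) (by rw [hY0, hY0]) hn
  have hceil : ∀ t : ℝ, t ∈ Ioo (-((⌈|t|⌉₊ : ℝ) + 1)) (⌈|t|⌉₊ + 1) := fun t =>
    abs_lt.1 ((Nat.le_ceil |t|).trans_lt (lt_add_one _))
  refine ⟨fun t => Y ⌈|t|⌉₊ t, by simp [hY0], fun t => ⟨?_, (hY _ t (hceil t)).2⟩⟩
  refine ((hY _ t (hceil t)).1).congr_of_eventuallyEq ?_
  filter_upwards [isOpen_Ioo.mem_nhds (hceil t)] with r hr
  exact hagree _ _ r (hceil r) hr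

/-! ### The profile functions -/

/-- The parameters of the family. -/
def profileDomain : Set (ℝ × ℝ) := Set.Ioi 0 ×ˢ Set.Ioo 0 1

theorem tendsto_mul_of_hasDerivAt {h k : ℝ → ℝ} {δ : ℝ} (hδ : 0 < δ)
    (hd : ∀ s ∈ Ioc 0 δ, HasDerivAt h (-(k s) / s ^ 2) s)
    (hk : Tendsto k (𝓝[>] 0) (𝓝 1)) : Tendsto (fun s => s * h s) (𝓝[>] 0) (𝓝 1) := by
  have mono : ∀ ε r, 0 < r → r ≤ δ → (∀ s ∈ Ioc 0 r, 1 - ε ≤ k s ∧ k s ≤ 1 + ε) →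
      ∀ s ∈ Ioc 0 r, (1 - ε) + s * (h r - (1 - ε) / r) ≤ s * h s ∧
        s * h s ≤ (1 + ε) + s * (h r - (1 + ε) / r) := by
    intro ε r hr hrδ hkr s hs
    have hsub : ∀ x ∈ Icc s r, x ∈ Ioc 0 r := fun x hx => ⟨hs.1.trans_le hx.1, hx.2⟩
    have hder : ∀ c : ℝ, ∀ x ∈ Icc s r,
        HasDerivAt (fun x => h x - c / x) ((c - k x) / x ^ 2) x := by
      intro c x hx
      have hx0 := (hsub x hx).1.ne'
      have h1 := (hd x ⟨(hsub x hx).1, (hsub x hx).2.trans hrδ⟩).sub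
        ((hasDerivAt_inv hx0).const_mul c)
      simp only [← div_eq_mul_inv] at h1
      refine h1.congr_deriv ?_
      field_simp
      ring
    have hlow : h r - (1 - ε) / r ≤ h s - (1 - ε) / s := by
      refine antitoneOn_of_deriv_nonpos (convex_Icc s r) (f := fun x => h x - (1 - ε) / x)
        (fun x hx => (hder _ x hx).continuousAt.continuousWithinAt)
        (fun x hx => (hder _ x (interior_subset hx)).differentiableAt.differentiableWithinAt)
        (fun x hx => ?_) ⟨le_rfl, hs.2⟩ ⟨hs.2, le_rfl⟩ hs.2
      rw [(hder _ x (interior_subset hx)).deriv]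
      have := (hkr x (hsub x (interior_subset hx))).1
      exact div_nonpos_of_nonpos_of_nonneg (by linarith) (sq_nonneg x)
    have hup : h s - (1 + ε) / s ≤ h r - (1 + ε) / r := by
      refine monotoneOn_of_deriv_nonneg (convex_Icc s r) (f := fun x => h x - (1 + ε) / x)
        (fun x hx => (hder _ x hx).continuousAt.continuousWithinAt)
        (fun x hx => (hder _ x (interior_subset hx)).differentiableAt.differentiableWithinAt)
        (fun x hx => ?_) ⟨le_rfl, hs.2⟩ ⟨hs.2, le_rfl⟩ hs.2
      rw [(hder _ x (interior_subset hx)).deriv]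
      have := (hkr x (hsub x (interior_subset hx))).2
      exact div_nonneg (by linarith) (sq_nonneg x)
    have hs0 := hs.1
    constructor
    · have := mul_le_mul_of_nonneg_left hlow hs0.le
      have e : s * (h s - (1 - ε) / s) = s * h s - (1 - ε) := by field_simp
      linarith
    · have := mul_le_mul_of_nonneg_left hup hs0.le
      have e : s * (h s - (1 + ε) / s) = s * h s - (1 + ε) := by field_simp
      linarith
  rw [Metric.tendsto_nhds]
  intro ε hε
  have hk' := (Metric.tendsto_nhds.1 hk) (ε / 2) (by positivity)
  rw [eventually_nhdsWithin_iff, Metric.eventually_nhds_iff] at hk'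
  obtain ⟨η, hη, hkη⟩ := hk'
  set r := min δ (η / 2)
  have hr : 0 < r := lt_min hδ (by positivity)
  have hkr : ∀ s ∈ Ioc 0 r, 1 - ε / 2 ≤ k s ∧ k s ≤ 1 + ε / 2 := by
    intro s hs
    have h1 : dist s 0 < η := by
      rw [Real.dist_eq, sub_zero, abs_of_pos hs.1]
      linarith [hs.2.trans (min_le_right δ (η / 2))]
    have h2 := hkη h1 hs.1
    rw [Real.dist_eq, abs_lt] at h2
    constructor <;> linarith [h2.1, h2.2]
  have hm := mono (ε / 2) r hr (min_le_left _ _) hkr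
  have hlim : ∀ C : ℝ, Tendsto (fun s => s * C) (𝓝[>] 0) (𝓝 0) := by
    intro C
    have : Continuous fun s : ℝ => s * C := by fun_prop
    simpa using (this.tendsto 0).mono_left nhdsWithin_le_nhds
  have e1 := (hlim (h r - (1 - ε / 2) / r)).eventually (lt_mem_nhds (show -(ε / 2) < 0 by linarith))
  have e2 := (hlim (h r - (1 + ε / 2) / r)).eventually (gt_mem_nhds (show (0 : ℝ) < ε / 2 by linarith))
  filter_upwards [e1, e2, Ioc_mem_nhdsGT hr] with s h1 h2 hs
  have := hm s hs
  rw [Real.dist_eq, abs_lt]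
  constructor <;> linarith [this.1, this.2]

/-- The two-parameter family of solutions of the profile equations. The Higgs field `h` vanishes at
`s = c.1`, where the connection profile `W` takes the value `c.2`. -/
theorem exists_profile : ∃ W h : ℝ × ℝ → ℝ → ℝ,
    ContDiffOn ℝ ∞ (fun q : (ℝ × ℝ) × ℝ => W q.1 q.2) (profileDomain ×ˢ Ioi 0) ∧
    ContDiffOn ℝ ∞ (fun q : (ℝ × ℝ) × ℝ => h q.1 q.2) (profileDomain ×ˢ Ioi 0) ∧
    ∀ c ∈ profileDomain, W c c.1 = c.2 ∧ h c c.1 = 0 ∧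
      (∀ s, 0 < s → 0 < W c s ∧ W c s < 1 ∧
        HasDerivAt (W c) (scaleFactor s * h c s * W c s) s ∧
        HasDerivAt (h c) ((W c s ^ 2 - 1) * scaleFactor s ^ 3 / s ^ 2) s) ∧
      Tendsto (W c) (𝓝[>] 0) (𝓝 0) ∧ Tendsto (fun s => s * h c s) (𝓝[>] 0) (𝓝 1) := by
  have hex : ∀ c : ℝ × ℝ, ∃ X : ℝ → ℝ × ℝ × ℝ, c ∈ profileDomain →
      X 0 = (c.2, 0, scaleFactor c.1) ∧
      ∀ t, HasDerivAt X (profileField (X t)) t ∧ 0 < (X t).1 ∧ (X t).1 ≤ c.2 ∧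
        (X t).2.2 = scaleFactor (c.1 * Real.exp t) := by
    intro c
    by_cases hc : c ∈ profileDomain
    · obtain ⟨X, hX⟩ := exists_profile_global hc.1 hc.2.1 hc.2.2
      exact ⟨X, fun _ => hX⟩
    · exact ⟨fun _ => 0, fun h => absurd h hc⟩
  choose X hX using hex
  have hsm : ContDiffOn ℝ ∞ (fun q : (ℝ × ℝ) × ℝ => X q.1 q.2) (profileDomain ×ˢ univ) := by
    refine contDiffOn_solution (fun c hc t => ((hX c hc).2 t).1) ?_
    refine ContDiffOn.congr (f := fun c : ℝ × ℝ => (c.2, 0, scaleFactor c.1)) ?_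
      fun c hc => (hX c hc).1
    have := contDiff_scaleFactor.comp (contDiff_fst (𝕜 := ℝ) (E := ℝ) (F := ℝ) (n := ∞))
    exact (contDiff_snd.prodMk (contDiff_const.prodMk this)).contDiffOn
  have hsm' : ContDiffOn ℝ ∞ (fun q : (ℝ × ℝ) × ℝ => X q.1 (Real.log q.2 - Real.log q.1.1))
      (profileDomain ×ˢ Ioi 0) := by
    refine hsm.comp (f := fun q : (ℝ × ℝ) × ℝ => (q.1, Real.log q.2 - Real.log q.1.1)) ?_
      fun q hq => ⟨hq.1, mem_univ _⟩
    refine contDiffOn_fst.prodMk (ContDiffOn.sub ?_ ?_)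
    · exact contDiffOn_snd.log fun q hq => (ne_of_gt hq.2)
    · exact (contDiff_fst.fst.contDiffOn).log fun q hq => (ne_of_gt hq.1.1)
  refine ⟨fun c s => (X c (Real.log s - Real.log c.1)).1,
    fun c s => (X c (Real.log s - Real.log c.1)).2.1 / s, hsm'.fst,
    hsm'.snd.fst.div contDiffOn_snd fun q hq => (ne_of_gt hq.2), ?_⟩
  intro c hc
  obtain ⟨h0, hX⟩ := hX c hc
  have hc1 : 0 < c.1 := hc.1
  have hc2 : 0 < c.2 := hc.2.1
  have hc3 : c.2 < 1 := hc.2.2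
  set W : ℝ → ℝ := fun s => (X c (Real.log s - Real.log c.1)).1 with hW
  set h : ℝ → ℝ := fun s => (X c (Real.log s - Real.log c.1)).2.1 / s with hh
  have hWc : W c.1 = c.2 := by simp [hW, h0]
  have hhc : h c.1 = 0 := by simp [hh, h0]
  have hWle : ∀ s, W s ≤ c.2 := fun s => (hX _).2.2.1
  have hWpos : ∀ s, 0 < W s := fun s => (hX _).2.1
  have hp : ∀ s, 0 < s → (X c (Real.log s - Real.log c.1)).2.2 = scaleFactor s := by
    intro s hs
    rw [(hX _).2.2.2, Real.exp_sub, Real.exp_log hs, Real.exp_log hc1, mul_div_cancel₀ _ hc1.ne']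
  have hXd : ∀ s, 0 < s → HasDerivAt (fun s => X c (Real.log s - Real.log c.1))
      (s⁻¹ • profileField (X c (Real.log s - Real.log c.1))) s := fun s hs =>
    (hX (Real.log s - Real.log c.1)).1.scomp s ((Real.hasDerivAt_log hs.ne').sub_const _)
  have hWd : ∀ s, 0 < s → HasDerivAt W (scaleFactor s * h s * W s) s := by
    intro s hs
    have h1 : HasDerivAt W (s⁻¹ • profileField (X c (Real.log s - Real.log c.1))).1 s :=
      (hXd s hs).fst
    refine h1.congr_deriv ?_
    simp only [profileField, hp s hs, Prod.smul_mk, smul_eq_mul, hW, hh]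
    field_simp
  have hhd : ∀ s, 0 < s → HasDerivAt h ((W s ^ 2 - 1) * scaleFactor s ^ 3 / s ^ 2) s := by
    intro s hs
    have h1 : HasDerivAt (fun s => (X c (Real.log s - Real.log c.1)).2.1)
      (s⁻¹ • profileField (X c (Real.log s - Real.log c.1))).2.1 s := (hXd s hs).snd.fst
    refine (h1.div (hasDerivAt_id s) hs.ne').congr_deriv ?_
    simp only [profileField, hp s hs, Prod.smul_mk, smul_eq_mul, hW, id]
    field_simp
    ring
  have hW0 : Tendsto W (𝓝[>] 0) (𝓝 0) := by
    set p := scaleFactor c.1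
    have hp0 : 0 < p := scaleFactor_pos _
    set k := (1 - c.2 ^ 2) * p ^ 3
    have hk0 : 0 < k := mul_pos (by nlinarith) (by positivity)
    have hlow : ∀ s ∈ Ioc 0 c.1, k * (1 / s - 1 / c.1) ≤ h s := by
      intro s hs
      have hder : ∀ x ∈ Icc s c.1, HasDerivAt (fun x => h x - k / x)
          ((W x ^ 2 - 1) * scaleFactor x ^ 3 / x ^ 2 + k / x ^ 2) x := by
        intro x hx
        have hx0 : 0 < x := hs.1.trans_le hx.1
        have h1 := (hhd x hx0).sub ((hasDerivAt_inv hx0.ne').const_mul k)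
        simp only [← div_eq_mul_inv] at h1
        refine h1.congr_deriv ?_
        field_simp
        ring
      have := antitoneOn_of_deriv_nonpos (convex_Icc s c.1) (f := fun x => h x - k / x)
        (fun x hx => (hder x hx).continuousAt.continuousWithinAt)
        (fun x hx => (hder x (interior_subset hx)).differentiableAt.differentiableWithinAt)
        (fun x hx => ?_) ⟨le_rfl, hs.2⟩ ⟨hs.2, le_rfl⟩ hs.2
      · simp only [hhc] at this
        have e : k * (1 / s - 1 / c.1) = k / s - k / c.1 := by ring
        linarith
      · rw [(hder x (interior_subset hx)).deriv]
        have hx' := interior_subset hx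
        have hx0 : 0 < x := hs.1.trans_le hx'.1
        have h1 : p ≤ scaleFactor x := scaleFactor_anti hx0.le hx'.2
        have h2 : p ^ 3 ≤ scaleFactor x ^ 3 := pow_le_pow_left₀ hp0.le h1 3
        have h3 : W x ^ 2 ≤ c.2 ^ 2 := pow_le_pow_left₀ (hWpos x).le (hWle x) 2
        have h4 : k ≤ (1 - W x ^ 2) * scaleFactor x ^ 3 :=
          mul_le_mul (by linarith) h2 (by positivity) (by nlinarith)
        rw [← add_div]
        exact div_nonpos_of_nonpos_of_nonneg (by linarith) (sq_nonneg x)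
    have hlogW : ∀ s ∈ Ioc 0 c.1, Real.log (W s)
        ≤ Real.log c.2 + p * k * (Real.log s - Real.log c.1 + 1) := by
      intro s hs
      have hder : ∀ x ∈ Icc s c.1,
          HasDerivAt (fun x => Real.log (W x) - p * k * (Real.log x - x / c.1))
            (scaleFactor x * h x - p * k * (1 / x - 1 / c.1)) x := by
        intro x hx
        have hx0 : 0 < x := hs.1.trans_le hx.1
        have h1 := ((hWd x hx0).log (hWpos x).ne').sub
          (((Real.hasDerivAt_log hx0.ne').sub ((hasDerivAt_id x).div_const c.1)).const_mul (p * k))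
        refine h1.congr_deriv ?_
        have := (hWpos x).ne'
        field_simp
      have := monotoneOn_of_deriv_nonneg (convex_Icc s c.1)
        (f := fun x => Real.log (W x) - p * k * (Real.log x - x / c.1))
        (fun x hx => (hder x hx).continuousAt.continuousWithinAt)
        (fun x hx => (hder x (interior_subset hx)).differentiableAt.differentiableWithinAt)
        (fun x hx => ?_) ⟨le_rfl, hs.2⟩ ⟨hs.2, le_rfl⟩ hs.2
      · simp only [hWc, div_self hc1.ne'] at this
        have h5 : 0 < s / c.1 := div_pos hs.1 hc1
        have h6 : 0 < p * k := mul_pos hp0 hk0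
        nlinarith
      · rw [(hder x (interior_subset hx)).deriv]
        have hx' := interior_subset hx
        have hx0 : 0 < x := hs.1.trans_le hx'.1
        have h1 : p ≤ scaleFactor x := scaleFactor_anti hx0.le hx'.2
        have h2 := hlow x ⟨hx0, hx'.2⟩
        have h3 : 0 ≤ k * (1 / x - 1 / c.1) :=
          mul_nonneg hk0.le (sub_nonneg.2 (one_div_le_one_div_of_le hx0 hx'.2))
        have h4 := mul_le_mul h1 h2 h3 (scaleFactor_pos x).le
        linarith
    have hexp : ∀ s ∈ Ioc 0 c.1,
        W s ≤ Real.exp (Real.log c.2 + p * k * (Real.log s - Real.log c.1 + 1)) := fun s hs =>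
      (Real.le_exp_log (W s)).trans (Real.exp_le_exp.2 (hlogW s hs))
    refine squeeze_zero' (Eventually.of_forall fun s => (hWpos s).le)
      (eventually_of_mem (Ioc_mem_nhdsGT hc1) hexp) ?_
    refine Real.tendsto_exp_atBot.comp (tendsto_atBot_add_const_left _ _ ?_)
    refine Tendsto.const_mul_atBot (mul_pos hp0 hk0) ?_
    refine tendsto_atBot_add_const_right _ _ (tendsto_atBot_add_const_right _ _ ?_)
    exact Real.tendsto_log_nhdsGT_zero
  refine ⟨hWc, hhc, fun s hs => ⟨hWpos s, (hWle s).trans_lt hc3, hWd s hs, hhd s hs⟩, hW0, ?_⟩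
  refine tendsto_mul_of_hasDerivAt (k := fun s => (1 - W s ^ 2) * scaleFactor s ^ 3) one_pos
    (fun s hs => (hhd s hs.1).congr_deriv (by ring)) ?_
  have hp : Tendsto scaleFactor (𝓝[>] 0) (𝓝 1) := by
    have := (contDiff_scaleFactor.continuous.tendsto 0).mono_left (nhdsWithin_le_nhds (s := Ioi 0))
    simpa [scaleFactor] using this
  simpa using ((hW0.pow 2).const_sub 1).mul (hp.pow 3)

end

/-! ### The Levi-Civita symbol -/

theorem leviCivita_comp_perm {n : ℕ} (I : Fin n → Fin n) (σ : Equiv.Perm (Fin n)) :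
    leviCivita (I ∘ σ) = ((Equiv.Perm.sign σ : ℤ) : ℝ) * leviCivita I := by
  have := Equiv.Perm.prod_Ioi_comp_eq_sign_mul_prod (R := ℝ) σ
    (f := fun i j => ((Int.sign ((I j : ℤ) - (I i : ℤ)) : ℤ) : ℝ)) (by
      intro i j
      rw [← neg_sub, Int.sign_neg]
      push_cast
      ring)
  simpa [leviCivita] using this

theorem leviCivita_of_not_injective {n : ℕ} {I : Fin n → Fin n} (h : ¬ Function.Injective I) :
    leviCivita I = 0 := by
  simp only [Function.Injective, not_forall] at h
  obtain ⟨a, b, hab, hne⟩ := h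
  rcases lt_or_gt_of_ne hne with h | h
  · exact Finset.prod_eq_zero (Finset.mem_univ a)
      (Finset.prod_eq_zero (Finset.mem_Ioi.2 h) (by simp [hab]))
  · exact Finset.prod_eq_zero (Finset.mem_univ b)
      (Finset.prod_eq_zero (Finset.mem_Ioi.2 h) (by simp [hab]))

theorem leviCivita_id {n : ℕ} : leviCivita (id : Fin n → Fin n) = 1 := by
  refine Finset.prod_eq_one fun a _ => Finset.prod_eq_one fun b hb => ?_
  have : (a : ℕ) < b := Fin.lt_def.1 (Finset.mem_Ioi.1 hb)
  rw [Int.sign_eq_one_of_pos (by simpa using this)]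
  simp

theorem leviCivita_perm {n : ℕ} (σ : Equiv.Perm (Fin n)) :
    leviCivita σ = ((Equiv.Perm.sign σ : ℤ) : ℝ) := by
  have := leviCivita_comp_perm id σ
  simpa [leviCivita_id] using this

theorem leviCivita_perm_comp {n : ℕ} (τ : Equiv.Perm (Fin n)) (I : Fin n → Fin n) :
    leviCivita (τ ∘ I) = ((Equiv.Perm.sign τ : ℤ) : ℝ) * leviCivita I := by
  by_cases h : Function.Injective I
  · obtain ⟨σ, rfl⟩ : ∃ σ : Equiv.Perm (Fin n), I = σ :=
      ⟨Equiv.ofBijective I (Finite.injective_iff_bijective.1 h), rfl⟩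
    rw [leviCivita_comp_perm, leviCivita_perm, leviCivita_perm]
    ring
  · rw [leviCivita_of_not_injective h, leviCivita_of_not_injective
      (fun h' => h (Function.Injective.of_comp h')), mul_zero]

theorem sign_mul_sign {n : ℕ} (σ : Equiv.Perm (Fin n)) :
    ((Equiv.Perm.sign σ : ℤ) : ℝ) * ((Equiv.Perm.sign σ : ℤ) : ℝ) = 1 := by
  rcases Int.units_eq_one_or (Equiv.Perm.sign σ) with h | h <;> simp [h]

/-- The permutation of `Fin (p + q)` that acts by `σ` on the first `p` and by `π` on the last `q`
elements. -/
def blockPerm {p q : ℕ} (σ : Equiv.Perm (Fin p)) (π : Equiv.Perm (Fin q)) :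
    Equiv.Perm (Fin (p + q)) :=
  finSumFinEquiv.permCongr (Equiv.Perm.sumCongr σ π)

theorem sign_blockPerm {p q : ℕ} (σ : Equiv.Perm (Fin p)) (π : Equiv.Perm (Fin q)) :
    Equiv.Perm.sign (blockPerm σ π) = Equiv.Perm.sign σ * Equiv.Perm.sign π := by
  rw [blockPerm, Equiv.Perm.sign_permCongr, Equiv.Perm.sign_sumCongr]

theorem append_comp_blockPerm {p q : ℕ} {α : Type*} (I : Fin p → α) (J : Fin q → α)
    (σ : Equiv.Perm (Fin p)) (π : Equiv.Perm (Fin q)) :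
    Fin.append I J ∘ blockPerm σ π = Fin.append (I ∘ σ) (J ∘ π) := by
  funext a
  refine Fin.addCases (fun i => ?_) (fun j => ?_) a <;>
    simp [blockPerm, Equiv.permCongr_apply]

theorem leviCivita_append_comp {p q : ℕ} (I : Fin p → Fin (p + q)) (J : Fin q → Fin (p + q))
    (σ : Equiv.Perm (Fin p)) (π : Equiv.Perm (Fin q)) :
    leviCivita (Fin.append (I ∘ σ) (J ∘ π)) =
      ((Equiv.Perm.sign σ : ℤ) : ℝ) * ((Equiv.Perm.sign π : ℤ) : ℝ) *
        leviCivita (Fin.append I J) := by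
  rw [← append_comp_blockPerm, leviCivita_comp_perm, sign_blockPerm]
  push_cast
  ring

theorem append_castAdd_natAdd {p q : ℕ} :
    Fin.append (Fin.castAdd q : Fin p → Fin (p + q)) (Fin.natAdd p) = id := by
  funext a
  refine Fin.addCases (fun i => ?_) (fun j => ?_) a <;> simp

theorem exists_perm_of_leviCivita_castAdd_ne_zero {p q : ℕ} {J : Fin q → Fin (p + q)}
    (h : leviCivita (Fin.append (Fin.castAdd q : Fin p → Fin (p + q)) J) ≠ 0) :
    ∃ π : Equiv.Perm (Fin q), J = Fin.natAdd p ∘ π := by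
  have hinj : Function.Injective (Fin.append (Fin.castAdd q : Fin p → Fin (p + q)) J) := by
    by_contra h'
    exact h (leviCivita_of_not_injective h')
  have hJ : ∀ j, ∃ k, J j = Fin.natAdd p k := by
    intro j
    rcases hb : J j with ⟨v, hv⟩
    by_cases hlt : v < p
    · exfalso
      have e : Fin.append (Fin.castAdd q : Fin p → Fin (p + q)) J (Fin.castAdd q ⟨v, hlt⟩)
          = Fin.append (Fin.castAdd q : Fin p → Fin (p + q)) J (Fin.natAdd p j) := by
        rw [Fin.append_left, Fin.append_right, hb]; rfl
      have := congrArg Fin.val (hinj e)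
      simp at this
      omega
    · exact ⟨⟨v - p, by omega⟩, by ext; simp; omega⟩
  choose k hk using hJ
  have kinj : Function.Injective k := by
    intro a b hab
    have e : Fin.append (Fin.castAdd q : Fin p → Fin (p + q)) J (Fin.natAdd p a)
        = Fin.append (Fin.castAdd q : Fin p → Fin (p + q)) J (Fin.natAdd p b) := by
      rw [Fin.append_right, Fin.append_right, hk, hk, hab]
    simpa using hinj e
  exact ⟨Equiv.ofBijective k (Finite.injective_iff_bijective.1 kinj), funext hk⟩

theorem exists_perm_of_leviCivita_natAdd_ne_zero {p q : ℕ} {L : Fin p → Fin (p + q)}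
    (h : leviCivita (Fin.append L (Fin.natAdd p : Fin q → Fin (p + q))) ≠ 0) :
    ∃ ρ : Equiv.Perm (Fin p), L = Fin.castAdd q ∘ ρ := by
  have hinj : Function.Injective (Fin.append L (Fin.natAdd p : Fin q → Fin (p + q))) := by
    by_contra h'
    exact h (leviCivita_of_not_injective h')
  have hL : ∀ j, ∃ k, L j = Fin.castAdd q k := by
    intro j
    rcases hb : L j with ⟨v, hv⟩
    by_cases hlt : v < p
    · exact ⟨⟨v, hlt⟩, rfl⟩
    · exfalso
      have e : Fin.append L (Fin.natAdd p : Fin q → Fin (p + q)) (Fin.castAdd q j)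
          = Fin.append L (Fin.natAdd p : Fin q → Fin (p + q)) (Fin.natAdd p ⟨v - p, by omega⟩) := by
        rw [Fin.append_left, Fin.append_right, hb]; ext; simp; omega
      have := congrArg Fin.val (hinj e)
      simp at this
      omega
  choose k hk using hL
  have kinj : Function.Injective k := by
    intro a b hab
    have e : Fin.append L (Fin.natAdd p : Fin q → Fin (p + q)) (Fin.castAdd q a)
        = Fin.append L (Fin.natAdd p : Fin q → Fin (p + q)) (Fin.castAdd q b) := by
      rw [Fin.append_left, Fin.append_left, hk, hk, hab]
    simpa using hinj e
  exact ⟨Equiv.ofBijective k (Finite.injective_iff_bijective.1 kinj), funext hk⟩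

theorem sum_leviCivita_castAdd {p q : ℕ} (g : (Fin q → Fin (p + q)) → ℝ) :
    ∑ J, leviCivita (Fin.append (Fin.castAdd q : Fin p → Fin (p + q)) J) * g J =
      ∑ π : Equiv.Perm (Fin q), ((Equiv.Perm.sign π : ℤ) : ℝ) * g (Fin.natAdd p ∘ π) := by
  symm
  refine Fintype.sum_of_injective (fun π : Equiv.Perm (Fin q) => Fin.natAdd p ∘ π) ?_ _ _ ?_ ?_
  · intro π π' h
    ext a
    have := congrFun h a
    simpa [Fin.ext_iff] using this
  · intro J hJ
    by_contra h
    obtain ⟨π, hπ⟩ := exists_perm_of_leviCivita_castAdd_ne_zero (left_ne_zero_of_mul h)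
    exact hJ ⟨π, hπ.symm⟩
  · intro π
    have := leviCivita_append_comp (p := p) (q := q) (Fin.castAdd q) (Fin.natAdd p) 1 π
    simp only [Equiv.Perm.coe_one, Function.comp_id, Equiv.Perm.sign_one, append_castAdd_natAdd,
      leviCivita_id] at this
    rw [this]; simp

theorem sum_leviCivita_natAdd {p q : ℕ} (g : (Fin p → Fin (p + q)) → ℝ) :
    ∑ L, leviCivita (Fin.append L (Fin.natAdd p : Fin q → Fin (p + q))) * g L =
      ∑ ρ : Equiv.Perm (Fin p), ((Equiv.Perm.sign ρ : ℤ) : ℝ) * g (Fin.castAdd q ∘ ρ) := by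
  symm
  refine Fintype.sum_of_injective (fun ρ : Equiv.Perm (Fin p) => Fin.castAdd q ∘ ρ) ?_ _ _ ?_ ?_
  · intro π π' h
    ext a
    have := congrFun h a
    simpa [Fin.ext_iff] using this
  · intro L hL
    by_contra h
    obtain ⟨π, hπ⟩ := exists_perm_of_leviCivita_natAdd_ne_zero (left_ne_zero_of_mul h)
    exact hL ⟨π, hπ.symm⟩
  · intro π
    have := leviCivita_append_comp (p := p) (q := q) (Fin.castAdd q) (Fin.natAdd p) π 1
    simp only [Equiv.Perm.coe_one, Function.comp_id, Equiv.Perm.sign_one, append_castAdd_natAdd,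
      leviCivita_id] at this
    rw [this]; simp

theorem exists_perm_extending {p q : ℕ} {X : Fin p → Fin (p + q)} (hX : Function.Injective X) :
    ∃ τ : Equiv.Perm (Fin (p + q)), ∀ i, τ (Fin.castAdd q i) = X i := by
  classical
  let e : {x // x ∈ range (Fin.castAdd q : Fin p → Fin (p + q))} ≃ {x // x ∈ range X} :=
    (Equiv.ofInjective _ (Fin.castAdd_injective p q)).symm.trans (Equiv.ofInjective X hX)
  refine ⟨e.extendSubtype, fun i => ?_⟩
  rw [Equiv.extendSubtype_apply_of_mem e _ ⟨i, rfl⟩]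
  simp only [e, Equiv.trans_apply]
  rw [show (⟨Fin.castAdd q i, ⟨i, rfl⟩⟩ : {x // x ∈ range (Fin.castAdd q : Fin p → Fin (p + q))})
    = Equiv.ofInjective _ (Fin.castAdd_injective p q) i from rfl, Equiv.symm_apply_apply]
  rfl

/-- Contracting two Levi-Civita symbols over the last `q` indices antisymmetrises over the
remaining ones. -/
theorem sum_leviCivita_mul_leviCivita {p q : ℕ} (η : (Fin p → Fin (p + q)) → ℝ)
    (hη : ∀ (I : Fin p → Fin (p + q)) (σ : Equiv.Perm (Fin p)),
      η (I ∘ σ) = ((Equiv.Perm.sign σ : ℤ) : ℝ) * η I) (X : Fin p → Fin (p + q)) :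
    ∑ J : Fin q → Fin (p + q), leviCivita (Fin.append X J) *
      ∑ L : Fin p → Fin (p + q), leviCivita (Fin.append L J) * η L = (q ! * p ! : ℝ) * η X := by
  by_cases hX : Function.Injective X
  · obtain ⟨τ, hτ⟩ := exists_perm_extending hX
    have hXτ : X = τ ∘ Fin.castAdd q := funext fun i => (hτ i).symm
    have happ : ∀ {r : ℕ} (I : Fin p → Fin (p + q)) (J : Fin r → Fin (p + q)),
        Fin.append (τ ∘ I) (τ ∘ J) = τ ∘ Fin.append I J := by
      intro r I J
      funext a
      refine Fin.addCases (fun i => ?_) (fun j => ?_) a <;> simp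
    rw [← Equiv.sum_comp (Equiv.arrowCongr (Equiv.refl (Fin q)) τ)]
    have h1 : ∀ J : Fin q → Fin (p + q),
        leviCivita (Fin.append X (Equiv.arrowCongr (Equiv.refl (Fin q)) τ J)) *
          ∑ L, leviCivita (Fin.append L (Equiv.arrowCongr (Equiv.refl (Fin q)) τ J)) * η L =
        leviCivita (Fin.append (Fin.castAdd q : Fin p → Fin (p + q)) J) *
          ∑ L, leviCivita (Fin.append L J) * η (τ ∘ L) := by
      intro J
      have e : (Equiv.arrowCongr (Equiv.refl (Fin q)) τ J) = τ ∘ J := rfl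
      rw [e, hXτ, happ, leviCivita_perm_comp, ← Equiv.sum_comp (Equiv.arrowCongr (Equiv.refl (Fin p)) τ)]
      have h2 : ∀ L : Fin p → Fin (p + q),
          leviCivita (Fin.append (Equiv.arrowCongr (Equiv.refl (Fin p)) τ L) (τ ∘ J)) *
            η (Equiv.arrowCongr (Equiv.refl (Fin p)) τ L) =
          ((Equiv.Perm.sign τ : ℤ) : ℝ) * (leviCivita (Fin.append L J) * η (τ ∘ L)) := by
        intro L
        have e : (Equiv.arrowCongr (Equiv.refl (Fin p)) τ L) = τ ∘ L := rfl
        rw [e, happ, leviCivita_perm_comp, mul_assoc]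
      simp only [h2, ← Finset.mul_sum]
      have := sign_mul_sign τ
      linear_combination (leviCivita (Fin.append (Fin.castAdd q : Fin p → Fin (p + q)) J) *
          ∑ L, leviCivita (Fin.append L J) * η (τ ∘ L)) * this
    simp only [h1]
    rw [sum_leviCivita_castAdd]
    have h3 : ∀ π : Equiv.Perm (Fin q), ((Equiv.Perm.sign π : ℤ) : ℝ) *
        ∑ L, leviCivita (Fin.append L (Fin.natAdd p ∘ π : Fin q → Fin (p + q))) * η (τ ∘ L) =
        (p ! : ℝ) * η X := by
      intro π
      have h4 : ∀ L : Fin p → Fin (p + q),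
          leviCivita (Fin.append L (Fin.natAdd p ∘ π : Fin q → Fin (p + q))) =
          ((Equiv.Perm.sign π : ℤ) : ℝ) * leviCivita (Fin.append L (Fin.natAdd p)) := by
        intro L
        have := leviCivita_append_comp L (Fin.natAdd p) 1 π
        simpa using this
      simp only [h4, mul_assoc, ← Finset.mul_sum]
      rw [← mul_assoc, sign_mul_sign, one_mul, sum_leviCivita_natAdd (fun L => η (τ ∘ L))]
      have h5 : ∀ ρ : Equiv.Perm (Fin p), ((Equiv.Perm.sign ρ : ℤ) : ℝ) *
          η (τ ∘ Fin.castAdd q ∘ ρ) = η X := by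
        intro ρ
        rw [← Function.comp_assoc, ← hXτ, hη, ← mul_assoc, sign_mul_sign, one_mul]
      simp only [h5]
      simp [Fintype.card_perm]
    simp only [h3]
    simp [Fintype.card_perm, mul_assoc]
  · have h1 : ∀ J : Fin q → Fin (p + q), leviCivita (Fin.append X J) = 0 := by
      intro J
      refine leviCivita_of_not_injective fun h => hX fun a b hab => ?_
      have : Fin.append X J (Fin.castAdd q a) = Fin.append X J (Fin.castAdd q b) := by simp [hab]
      simpa using h this
    have h2 : η X = 0 := by
      simp only [Function.Injective, not_forall] at hX
      obtain ⟨a, b, hab, hne⟩ := hX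
      have e : X ∘ Equiv.swap a b = X := by
        funext c
        by_cases hca : c = a
        · simp [hca, hab]
        · by_cases hcb : c = b
          · simp [hcb, hab]
          · simp [Equiv.swap_apply_of_ne_of_ne hca hcb]
      have := hη X (Equiv.swap a b)
      rw [e, Equiv.Perm.sign_swap hne] at this
      norm_num at this
      linarith
    simp [h1, h2]

/-! ### The operator `⋆(F ∧ ⋆η)` in dimension seven -/

theorem hodge_wedge {W : Type*} [AddCommGroup W] [Module ℝ W] {k l m : ℕ}
    (α : (Fin k → Fin (k + l + m)) → W) (β : (Fin l → Fin (k + l + m)) → ℝ)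
    (J : Fin m → Fin (k + l + m)) :
    hodge (k := k + l) (l := m) (wedge α β) J = (((k ! : ℝ) * (l ! : ℝ))⁻¹) •
      ∑ A : Fin k → Fin (k + l + m), ∑ B : Fin l → Fin (k + l + m),
        (leviCivita (Fin.append (Fin.append A B) J) * β B) • α A := by
  unfold hodge wedge
  set c : ℝ := ((k ! : ℝ) * (l ! : ℝ))⁻¹
  have h1 : ∀ σ : Equiv.Perm (Fin (k + l)), ∑ I : Fin (k + l) → Fin (k + l + m),
      leviCivita (Fin.append I J) • (((Equiv.Perm.sign σ : ℤ) : ℝ) *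
        β (fun j => I (σ (Fin.natAdd k j)))) • α (fun i => I (σ (Fin.castAdd l i))) =
      ∑ I : Fin (k + l) → Fin (k + l + m), (leviCivita (Fin.append I J) *
        β (fun j => I (Fin.natAdd k j))) • α (fun i => I (Fin.castAdd l i)) := by
    intro σ
    rw [← Equiv.sum_comp (Equiv.arrowCongr σ (Equiv.refl (Fin (k + l + m))))]
    refine Finset.sum_congr rfl fun I _ => ?_
    have e : (Equiv.arrowCongr σ (Equiv.refl (Fin (k + l + m)))) I = I ∘ σ.symm := rfl
    have h2 := leviCivita_append_comp I J σ.symm 1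
    simp only [Equiv.Perm.coe_one, Function.comp_id, Equiv.Perm.sign_one, Units.val_one,
      Int.cast_one, mul_one, Equiv.Perm.sign_symm] at h2
    rw [e, h2, smul_smul]
    simp only [Function.comp_apply, Equiv.symm_apply_apply]
    congr 1
    linear_combination (leviCivita (Fin.append I J) * β fun j => I (Fin.natAdd k j)) *
      sign_mul_sign σ
  have h3 : ∀ I : Fin (k + l) → Fin (k + l + m), leviCivita (Fin.append I J) • (c •
      ∑ σ : Equiv.Perm (Fin (k + l)), (((Equiv.Perm.sign σ : ℤ) : ℝ) *
        β (fun j => I (σ (Fin.natAdd k j)))) • α (fun i => I (σ (Fin.castAdd l i)))) =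
      c • ∑ σ : Equiv.Perm (Fin (k + l)), leviCivita (Fin.append I J) •
        (((Equiv.Perm.sign σ : ℤ) : ℝ) * β (fun j => I (σ (Fin.natAdd k j)))) •
          α (fun i => I (σ (Fin.castAdd l i))) := by
    intro I
    rw [smul_comm, Finset.smul_sum]
  rw [Finset.sum_congr rfl fun I _ => h3 I, ← Finset.smul_sum, Finset.sum_comm,
    Finset.sum_congr rfl fun σ _ => h1 σ, Finset.sum_const, Finset.card_univ, Fintype.card_perm,
    Fintype.card_fin, smul_comm, ← Nat.cast_smul_eq_nsmul ℝ, smul_smul _ (((k + l) ! : ℕ) : ℝ),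
    inv_mul_cancel₀ (by positivity), one_smul, ← Equiv.sum_comp (Fin.appendEquiv k l),
    Fintype.sum_prod_type]
  simp [Fin.appendEquiv]

theorem hodge_wedge_hodge {W : Type*} [AddCommGroup W] [Module ℝ W]
    (η : (Fin 3 → Fin 7) → ℝ) (F : (Fin 2 → Fin 7) → W)
    (hη : ∀ (I : Fin 3 → Fin 7) (σ : Equiv.Perm (Fin 3)),
      η (I ∘ σ) = ((Equiv.Perm.sign σ : ℤ) : ℝ) * η I) (i : Fin 7) :
    hodge (k := 6) (l := 1) (wedge (k := 2) (l := 4) F (hodge (k := 3) (l := 4) η)) ![i] =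
      (1 / 2 : ℝ) • ∑ a, ∑ b, η ![i, a, b] • F ![a, b] := by
  have h := hodge_wedge (k := 2) (l := 4) (m := 1) F (hodge (k := 3) (l := 4) η) ![i]
  refine h.trans ?_
  have key : ∀ A : Fin 2 → Fin 7, ∑ B : Fin 4 → Fin 7,
      (leviCivita (Fin.append (Fin.append A B) ![i] : Fin (2 + 4 + 1) → Fin (2 + 4 + 1)) *
        hodge (k := 3) (l := 4) η B) • F A = ((24 : ℝ) * η ![i, A 0, A 1]) • F A := by
    intro A
    rw [← Finset.sum_smul]
    congr 1
    have h1 := sum_leviCivita_mul_leviCivita (p := 3) (q := 4) η hη ![i, A 0, A 1]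
    have h2 : ∀ B : Fin 4 → Fin 7,
        leviCivita (Fin.append (Fin.append A B) ![i] : Fin (2 + 4 + 1) → Fin (2 + 4 + 1)) =
        leviCivita (Fin.append ![i, A 0, A 1] B : Fin (3 + 4) → Fin (3 + 4)) := by
      intro B
      have e : (Fin.append (Fin.append A B) ![i] : Fin 7 → Fin 7) =
          (Fin.append ![i, A 0, A 1] B : Fin 7 → Fin 7) ∘ finRotate 7 := by
        funext a
        fin_cases a <;> rfl
      have h3 := leviCivita_comp_perm (n := 7) (Fin.append ![i, A 0, A 1] B) (finRotate 7)
      rw [← e, sign_finRotate] at h3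
      refine h3.trans ?_
      norm_num
    have h4 : ∀ B : Fin 4 → Fin 7, hodge (k := 3) (l := 4) η B =
        (6 : ℝ)⁻¹ * ∑ L : Fin 3 → Fin (3 + 4), leviCivita (Fin.append L B) * η L := by
      intro B
      simp [hodge, Nat.factorial]
    simp only [h2, h4]
    norm_num [Nat.factorial] at h1
    have h5 : ∀ B : Fin 4 → Fin (3 + 4),
      leviCivita (Fin.append ![i, A 0, A 1] B : Fin (3 + 4) → Fin (3 + 4)) *
        ((6 : ℝ)⁻¹ * ∑ L : Fin 3 → Fin (3 + 4), leviCivita (Fin.append L B) * η L) =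
      (6 : ℝ)⁻¹ * (leviCivita (Fin.append ![i, A 0, A 1] B : Fin (3 + 4) → Fin (3 + 4)) *
        ∑ L : Fin 3 → Fin (3 + 4), leviCivita (Fin.append L B) * η L) := fun B => by ring
    refine (Finset.sum_congr rfl fun B _ => h5 B).trans ?_
    rw [← Finset.mul_sum]
    refine (congrArg _ h1).trans ?_
    ring
  refine (congrArg _ (Finset.sum_congr rfl fun A _ => key A)).trans ?_
  rw [← Equiv.sum_comp (finTwoArrowEquiv (Fin 7)).symm, Fintype.sum_prod_type]
  simp only [Finset.smul_sum, smul_smul]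
  refine Finset.sum_congr rfl fun a _ => Finset.sum_congr rfl fun b _ => ?_
  simp [finTwoArrowEquiv, Nat.factorial]
  congr 1
  ring

attribute [local instance] matrixNorm
attribute [local instance] matrixNormedSpace

noncomputable section

open Matrix

/-! ### Anti-self-dual two-forms on `ℝ⁴` -/

/-- The values of the standard basis of the anti-self-dual two-forms of `ℝ⁴`. -/
def asd (a b : Fin 4 → ℝ) : Fin 3 → ℝ :=
  ![a 0 * b 1 - a 1 * b 0 - (a 2 * b 3 - a 3 * b 2),
    a 0 * b 2 - a 2 * b 0 - (a 3 * b 1 - a 1 * b 3),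
    a 0 * b 3 - a 3 * b 0 - (a 1 * b 2 - a 2 * b 1)]

theorem asd_dot_asd (a b c : Fin 4 → ℝ) :
    asd a b ⬝ᵥ asd a c = (a ⬝ᵥ a) * (b ⬝ᵥ c) - (a ⬝ᵥ b) * (a ⬝ᵥ c) := by
  simp [asd, dotProduct, Fin.sum_univ_succ]
  ring

theorem det_of_fin_four (a b c d : Fin 4 → ℝ) :
    (Matrix.of ![a, b, c, d]).det =
      a 0 * (Matrix.of ![![b 1, b 2, b 3], ![c 1, c 2, c 3], ![d 1, d 2, d 3]]).det
      - a 1 * (Matrix.of ![![b 0, b 2, b 3], ![c 0, c 2, c 3], ![d 0, d 2, d 3]]).det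
      + a 2 * (Matrix.of ![![b 0, b 1, b 3], ![c 0, c 1, c 3], ![d 0, d 1, d 3]]).det
      - a 3 * (Matrix.of ![![b 0, b 1, b 2], ![c 0, c 1, c 2], ![d 0, d 1, d 2]]).det := by
  rw [Matrix.det_succ_row_zero]
  simp only [Fin.sum_univ_four, Matrix.det_fin_three]
  simp [Fin.succAbove, Matrix.submatrix, Fin.lt_def]
  ring

theorem det_asd (a b c d : Fin 4 → ℝ) :
    (Matrix.of ![asd a b, asd a c, asd a d]).det =
      (a ⬝ᵥ a) * (Matrix.of ![a, b, c, d]).det := by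
  rw [det_of_fin_four]
  simp only [Matrix.det_fin_three]
  simp [asd, dotProduct, Fin.sum_univ_succ]
  ring

theorem cross_asd_asd (a c d : Fin 4 → ℝ) :
    crossProduct (asd a c) (asd a d) =
      (-(a ⬝ᵥ a)) • asd c d + (a ⬝ᵥ c) • asd a d - (a ⬝ᵥ d) • asd a c := by
  funext i
  fin_cases i <;> (simp [cross_apply, asd, dotProduct, Fin.sum_univ_succ]; ring)

theorem row_eq_cross_of_rotation {R : Matrix (Fin 3) (Fin 3) ℝ} (h : R * Rᵀ = 1)
    (hd : R.det = 1) : R 0 = crossProduct (R 1) (R 2) := by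
  have h1 : R.adjugate = Rᵀ := by
    have h2 : R * R.adjugate = 1 := by rw [Matrix.mul_adjugate, hd, one_smul]
    have h3 : Rᵀ * R = 1 := mul_eq_one_comm.1 h
    calc R.adjugate = (Rᵀ * R) * R.adjugate := by rw [h3, one_mul]
      _ = Rᵀ := by rw [mul_assoc, h2, mul_one]
  have h4 : ∀ i j, R j i = R.adjugate i j := fun i j => by rw [h1]; rfl
  funext i
  rw [h4 i 0]
  fin_cases i <;> simp [Matrix.adjugate_fin_three, cross_apply]
  ring

/-- An oriented orthonormal basis of `ℝ⁴` acts on anti-self-dual forms by a rotation. -/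
theorem rotation_of_frame {ε : Fin 4 → Fin 4 → ℝ}
    (hε : ∀ i j, ε i ⬝ᵥ ε j = if i = j then 1 else 0) (hd : 0 < (Matrix.of ε).det) :
    (Matrix.of fun j : Fin 3 => asd (ε 0) (ε j.succ)) *
        (Matrix.of fun j : Fin 3 => asd (ε 0) (ε j.succ))ᵀ = 1 ∧
      (Matrix.of fun j : Fin 3 => asd (ε 0) (ε j.succ)).det = 1 ∧
      asd (ε 0) (ε 1) + asd (ε 2) (ε 3) = 0 := by
  set R := Matrix.of fun j : Fin 3 => asd (ε 0) (ε j.succ) with hR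
  have h1 : R * Rᵀ = 1 := by
    ext i j
    have : (R * Rᵀ) i j = asd (ε 0) (ε i.succ) ⬝ᵥ asd (ε 0) (ε j.succ) := by
      simp [Matrix.mul_apply, hR, dotProduct]
    rw [this, asd_dot_asd, hε, hε, hε, hε, Matrix.one_apply]
    simp [Fin.succ_inj, (Fin.succ_ne_zero _).symm]
  have hE : (Matrix.of ε) = Matrix.of ![ε 0, ε 1, ε 2, ε 3] := by
    ext i j; fin_cases i <;> rfl
  have h2 : R.det = (Matrix.of ε).det := by
    have e : R = Matrix.of ![asd (ε 0) (ε 1), asd (ε 0) (ε 2), asd (ε 0) (ε 3)] := by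
      ext i j; fin_cases i <;> rfl
    rw [e, det_asd, hε, hE]
    simp
  have h3 : R.det = 1 := by
    have h4 : R.det * R.det = 1 := by
      have := congrArg Matrix.det h1
      rwa [Matrix.det_mul, Matrix.det_transpose, Matrix.det_one] at this
    rw [h2] at h4 ⊢
    nlinarith
  refine ⟨h1, h3, ?_⟩
  have h5 : asd (ε 0) (ε 1) = crossProduct (asd (ε 0) (ε 2)) (asd (ε 0) (ε 3)) :=
    row_eq_cross_of_rotation h1 h3
  rw [h5, cross_asd_asd, hε, hε, hε]
  simp

theorem bilin_eq_asd (B : (Fin 4 → ℝ) →ₗ[ℝ] (Fin 4 → ℝ) →ₗ[ℝ] ℝ) (hB : ∀ a, B a a = 0)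
    (h1 : B (Pi.single 0 1) (Pi.single 1 1) + B (Pi.single 2 1) (Pi.single 3 1) = 0)
    (h2 : B (Pi.single 0 1) (Pi.single 2 1) + B (Pi.single 3 1) (Pi.single 1 1) = 0)
    (h3 : B (Pi.single 0 1) (Pi.single 3 1) + B (Pi.single 1 1) (Pi.single 2 1) = 0)
    (a b : Fin 4 → ℝ) :
    B a b = (fun i : Fin 3 => B (Pi.single 0 1) (Pi.single i.succ 1)) ⬝ᵥ asd a b := by
  have hs : ∀ a b, B a b = - B b a := by
    intro a b
    have := hB (a + b)
    simp only [map_add, LinearMap.add_apply, hB] at this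
    linarith
  have hx : ∀ a : Fin 4 → ℝ, a = a 0 • Pi.single 0 1 + a 1 • Pi.single 1 1 +
      a 2 • Pi.single 2 1 + a 3 • Pi.single 3 1 := by
    intro a
    funext i
    fin_cases i <;> simp
  have e : B a b = B (a 0 • Pi.single 0 1 + a 1 • Pi.single 1 1 +
      a 2 • Pi.single 2 1 + a 3 • Pi.single 3 1) (b 0 • Pi.single 0 1 + b 1 • Pi.single 1 1 +
      b 2 • Pi.single 2 1 + b 3 • Pi.single 3 1) := by rw [← hx a, ← hx b]
  have s10 := hs (Pi.single 1 1) (Pi.single 0 1)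
  have s20 := hs (Pi.single 2 1) (Pi.single 0 1)
  have s30 := hs (Pi.single 3 1) (Pi.single 0 1)
  have s21 := hs (Pi.single 2 1) (Pi.single 1 1)
  have s32 := hs (Pi.single 3 1) (Pi.single 2 1)
  have s13 := hs (Pi.single 1 1) (Pi.single 3 1)
  rw [e]
  simp only [map_add, map_smul, LinearMap.add_apply, LinearMap.smul_apply, smul_eq_mul, hB,
    s10, s20, s30, s21, s32, s13]
  simp [asd, dotProduct, Fin.sum_univ_succ]
  have t1 : B (Pi.single 2 1) (Pi.single 3 1) = - B (Pi.single 0 1) (Pi.single 1 1) := by linarith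
  have t2 : B (Pi.single 3 1) (Pi.single 1 1) = - B (Pi.single 0 1) (Pi.single 2 1) := by linarith
  have t3 : B (Pi.single 1 1) (Pi.single 2 1) = - B (Pi.single 0 1) (Pi.single 3 1) := by linarith
  rw [t1, t2, t3]
  ring

/-! ### Two-forms as bilinear maps -/

section Alternating

variable {E : Type*} [NormedAddCommGroup E] [NormedSpace ℝ E]

theorem alternating_add_left (η : E [⋀^Fin 2]→L[ℝ] ℝ) (u v w : E) :
    η ![u + v, w] = η ![u, w] + η ![v, w] :=
  η.toContinuousMultilinearMap.cons_add ![w] u v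

theorem alternating_smul_left (η : E [⋀^Fin 2]→L[ℝ] ℝ) (c : ℝ) (u w : E) :
    η ![c • u, w] = c * η ![u, w] :=
  η.toContinuousMultilinearMap.cons_smul ![w] c u

theorem alternating_swap (η : E [⋀^Fin 2]→L[ℝ] ℝ) (u v : E) : η ![u, v] = -η ![v, u] := by
  have := η.toAlternatingMap.map_swap ![v, u] (show (0 : Fin 2) ≠ 1 by decide)
  rw [show ![v, u] ∘ Equiv.swap (0 : Fin 2) 1 = ![u, v] from by
    funext i; fin_cases i <;> simp] at this
  exact this

theorem alternating_self (η : E [⋀^Fin 2]→L[ℝ] ℝ) (u : E) : η ![u, u] = 0 := by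
  linarith [alternating_swap η u u]

/-- A two-form as a bilinear map. -/
def twoForm (η : E [⋀^Fin 2]→L[ℝ] ℝ) : E →ₗ[ℝ] E →ₗ[ℝ] ℝ :=
  LinearMap.mk₂ ℝ (fun u v => η ![u, v]) (alternating_add_left η)
    (fun c u w => by simpa using alternating_smul_left η c u w)
    (fun u v w => by
      rw [alternating_swap, alternating_add_left, alternating_swap η v, alternating_swap η w]; ring)
    (fun c u w => by
      rw [alternating_swap, alternating_smul_left, alternating_swap η w]; simp)

@[simp] theorem twoForm_apply (η : E [⋀^Fin 2]→L[ℝ] ℝ) (u v : E) : twoForm η u v = η ![u, v] := rfl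

/-- Evaluation of two-forms as a continuous linear map. -/
def evalTwoForm (u v : E) : (E [⋀^Fin 2]→L[ℝ] ℝ) →L[ℝ] ℝ :=
  LinearMap.mkContinuous
    { toFun := fun η => η ![u, v]
      map_add' := fun _ _ => rfl
      map_smul' := fun _ _ => rfl } (∏ i, ‖![u, v] i‖) (fun η => by
    rw [mul_comm]; exact η.le_opNorm _)

@[simp] theorem evalTwoForm_apply (u v : E) (η : E [⋀^Fin 2]→L[ℝ] ℝ) :
    evalTwoForm u v η = η ![u, v] := rfl

end Alternating

/-! ### The structure group -/

section Models

variable {𝕜 : Type*} [RCLike 𝕜] {m : Type*} [Fintype m] [DecidableEq m]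

/-- A matrix group that is locally isomorphic to the rotation group of `ℝ³`. -/
structure LieModel (G : Submonoid (Matrix m m 𝕜)) (κ : ℝ) where
  /-- the isomorphism of `ℝ³` with the Lie algebra -/
  gen : (Fin 3 → ℝ) →ₗ[ℝ] Matrix m m 𝕜
  /-- the adjoint action `a ↦ g⁻¹ a g` -/
  ad : Matrix m m 𝕜 → (Fin 3 → ℝ) →ₗ[ℝ] (Fin 3 → ℝ)
  /-- the one-parameter groups -/
  rot : ℝ → (Fin 3 → ℝ) → Matrix m m 𝕜
  tangent_eq : tangentVectors (G : Set (Matrix m m 𝕜)) 1 = Set.range gen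
  bracket : ∀ a b, gen a * gen b - gen b * gen a = gen (crossProduct a b)
  lieNorm_gen : ∀ a, lieNorm κ (gen a) = Real.sqrt (a ⬝ᵥ a)
  ad_smooth : ContDiff ℝ ∞ fun q : Matrix m m 𝕜 × (Fin 3 → ℝ) => ad q.1 q.2
  conj_gen : ∀ g ∈ G, ∀ a, g⁻¹ * gen a * g = gen (ad g a)
  inv_mem : ∀ g ∈ G, g⁻¹ ∈ G
  inv_mul : ∀ g ∈ G, g⁻¹ * g = 1
  ad_dot : ∀ g ∈ G, ∀ a b, ad g a ⬝ᵥ ad g b = a ⬝ᵥ b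
  rot_mem : ∀ t n, n ⬝ᵥ n = 1 → rot t n ∈ G
  rot_smooth : ∀ n, ContDiff ℝ ∞ fun t => rot t n
  rot_zero : ∀ n, rot 0 n = 1
  rot_deriv : ∀ t n, n ⬝ᵥ n = 1 → HasDerivAt (fun t => rot t n) (rot t n * gen n) t
  rot_add : ∀ s t n, n ⬝ᵥ n = 1 → rot (s + t) n = rot s n * rot t n
  rot_neg : ∀ t n, rot t (-n) = rot (-t) n
  rot_period : ∀ n, rot (4 * Real.pi) n = 1
  ad_rot : ∀ t n y, n ⬝ᵥ n = 1 → n ⬝ᵥ y = 0 →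
    ad (rot t n) y = Real.cos t • y - Real.sin t • crossProduct n y
  ad_rot_self : ∀ t n, n ⬝ᵥ n = 1 → ad (rot t n) n = n
  conj_rot : ∀ g ∈ G, ∀ t n, g⁻¹ * rot t n * g = rot t (ad g n)
  ker_ad : ∀ g ∈ G, (∀ a, ad g a = a) → g = 1 ∨ ∀ n, n ⬝ᵥ n = 1 → g = rot (2 * Real.pi) n

variable {E : Type*} [NormedAddCommGroup E] [InnerProductSpace ℝ E]

/-- A linear isometry of `ℝ⁴` onto the tangent space at `x` that identifies the two-forms `θ i`
with the standard basis of the anti-self-dual two-forms. -/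
structure IsAdaptedFrame (M : OrientedSubmanifold E) (x : E) (θ : Fin 3 → E [⋀^Fin 2]→L[ℝ] ℝ)
    (e : (Fin 4 → ℝ) →ₗ[ℝ] E) : Prop where
  inner_eq : ∀ a b, inner ℝ (e a) (e b) = a ⬝ᵥ b
  range_eq : tangentVectors M.carrier x = Set.range e
  positive_iff : ∀ ε : Fin 4 → Fin 4 → ℝ, (∀ i j, ε i ⬝ᵥ ε j = if i = j then 1 else 0) →
    (M.positive x (fun i => e (ε i)) ↔ 0 < (Matrix.of ε).det)
  forms_apply : ∀ i a b, θ i ![e a, e b] = asd a b i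
  forms_normal : ∀ i n, (∀ a, inner ℝ n (e a) = 0) → ∀ u, θ i ![n, u] = 0

/-- A principal bundle of frames of the bundle of anti-self-dual two-forms, possibly lifted to a
covering of the rotation group, with the connection of the Levi-Civita connection. The manifold is
assumed to be self-dual and Einstein, of scalar curvature `6`, through the field `curvature`. -/
structure AsdFrames (M : OrientedSubmanifold E) {G : Submonoid (Matrix m m 𝕜)} {κ : ℝ}
    (L : LieModel G κ) (Q : Type*) [NormedAddCommGroup Q] [NormedSpace ℝ Q] where
  /-- the total space -/
  total : Set Q
  /-- the projection -/
  base : Q → E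
  /-- the tautological frame -/
  forms : Q → Fin 3 → E [⋀^Fin 2]→L[ℝ] ℝ
  /-- the connection form -/
  conn : Q →L[ℝ] Q →L[ℝ] (Fin 3 → ℝ)
  /-- the action of the structure group -/
  act : Q → Matrix m m 𝕜 → Q
  base_smooth : ContDiff ℝ ∞ base
  forms_smooth : ∀ i, ContDiff ℝ ∞ fun q => forms q i
  act_smooth : ContDiff ℝ ∞ fun q : Q × Matrix m m 𝕜 => act q.1 q.2
  base_mem : ∀ q ∈ total, base q ∈ M.carrier
  act_mem : ∀ q ∈ total, ∀ g ∈ G, act q g ∈ total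
  act_one : ∀ q ∈ total, act q 1 = q
  act_mul : ∀ q ∈ total, ∀ g ∈ G, ∀ h ∈ G, act q (g * h) = act (act q g) h
  base_act : ∀ q ∈ total, ∀ g ∈ G, base (act q g) = base q
  forms_act : ∀ q ∈ total, ∀ g ∈ G, ∀ y : Fin 3 → ℝ,
    ∑ i, L.ad g y i • forms (act q g) i = ∑ i, y i • forms q i
  exists_frame : ∀ q ∈ total, ∃ e, IsAdaptedFrame M (base q) (forms q) e
  parallel : ∀ q ∈ total, ∀ u ∈ tangentVectors total q, ∀ y : Fin 3 → ℝ,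
    ∀ v ∈ tangentVectors M.carrier (base q), ∀ w ∈ tangentVectors M.carrier (base q),
      ∑ i, y i * (fderiv ℝ (fun q => forms q i) q u) ![v, w] =
        ∑ i, crossProduct (conn q u) y i * forms q i ![v, w]
  curvature : ∀ q ∈ total, ∀ u ∈ tangentVectors total q, ∀ v ∈ tangentVectors total q, ∀ i,
    (conn u v - conn v u + crossProduct (conn q u) (conn q v)) i =
      1 / 2 * forms q i ![fderiv ℝ base q u, fderiv ℝ base q v]
  horizontal : ∀ q ∈ total, ∀ v ∈ tangentVectors M.carrier (base q),
    ∃ u ∈ tangentVectors total q, conn q u = 0 ∧ fderiv ℝ base q u = v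
  conn_vertical : ∀ q ∈ total, ∀ g : ℝ → Matrix m m 𝕜, SmoothCurveIn (G : Set (Matrix m m 𝕜)) g →
    g 0 = 1 → L.gen (conn q (deriv (fun t => act q (g t)) 0)) = deriv g 0
  conn_equivariant : ∀ γ : ℝ → Q, SmoothCurveIn total γ → ∀ g ∈ G,
    conn (act (γ 0) g) (deriv (fun t => act (γ t) g) 0) = L.ad g (conn (γ 0) (deriv γ 0))
  locally_trivial : ∀ x ∈ M.carrier, ∃ (W : Set E) (σ : E → Q) (τ : Q → Matrix m m 𝕜),
    IsOpen W ∧ x ∈ W ∧ ContDiffOn ℝ ∞ σ W ∧ ContDiffOn ℝ ∞ τ (total ∩ base ⁻¹' W) ∧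
    (∀ y ∈ M.carrier ∩ W, σ y ∈ total ∧ base (σ y) = y ∧ ∀ g ∈ G, τ (act (σ y) g) = g) ∧
    ∀ q ∈ total ∩ base ⁻¹' W, τ q ∈ G ∧ act (σ (base q)) (τ q) = q

end Models

/-! ### The tautological identification of the bundle of anti-self-dual two-forms -/

section Frame

variable {E : Type*} [NormedAddCommGroup E] [InnerProductSpace ℝ E] {M : OrientedSubmanifold E}
  {x : E} {θ : Fin 3 → E [⋀^Fin 2]→L[ℝ] ℝ} {e : (Fin 4 → ℝ) →ₗ[ℝ] E}

theorem eq_of_eq_on_tangent (he : ∀ a b, inner ℝ (e a) (e b) = a ⬝ᵥ b)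
    {η ζ : E [⋀^Fin 2]→L[ℝ] ℝ}
    (hη : ∀ n, (∀ a, inner ℝ n (e a) = 0) → ∀ u, η ![n, u] = 0)
    (hζ : ∀ n, (∀ a, inner ℝ n (e a) = 0) → ∀ u, ζ ![n, u] = 0)
    (h : ∀ a b, η ![e a, e b] = ζ ![e a, e b]) : η = ζ := by
  have hdec : ∀ u : E, ∃ a n, u = e a + n ∧ ∀ b, inner ℝ n (e b) = 0 := by
    intro u
    let a : Fin 4 → ℝ := fun k => inner ℝ u (e (Pi.single k 1))
    refine ⟨a, u - e a, by abel, fun b => ?_⟩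
    have hb : e b = ∑ k, b k • e (Pi.single k 1) := by
      conv_lhs => rw [pi_eq_sum_univ' b]
      simp [map_sum]
    rw [inner_sub_left, he, hb, inner_sum]
    simp [inner_smul_right, dotProduct, a, mul_comm]
  ext v
  have hv : v = ![v 0, v 1] := by funext i; fin_cases i <;> rfl
  rw [hv]
  obtain ⟨a, n, h0, hn⟩ := hdec (v 0)
  obtain ⟨b, n', h1, hn'⟩ := hdec (v 1)
  rw [h0, h1, alternating_add_left, alternating_add_left, hη n hn, hζ n hn,
    alternating_swap, alternating_add_left, hη n' hn', alternating_swap ζ, alternating_add_left,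
    hζ n' hn', h]

end Frame

section

theorem contDiffOn_inv_mulVec {X : Type*} [NormedAddCommGroup X] [NormedSpace ℝ X] {S : Set X}
    {A : X → Matrix (Fin 3) (Fin 3) ℝ} {b : X → Fin 3 → ℝ}
    (hA : ∀ i j, ContDiffOn ℝ ∞ (fun x => A x i j) S)
    (hb : ∀ i, ContDiffOn ℝ ∞ (fun x => b x i) S) (hd : ∀ x ∈ S, (A x).det ≠ 0) :
    ContDiffOn ℝ ∞ (fun x => (A x)⁻¹ *ᵥ b x) S := by
  rw [contDiffOn_pi]
  intro i
  have hdet : ContDiffOn ℝ ∞ (fun x => (A x).det) S := by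
    simp only [Matrix.det_fin_three]
    fun_prop
  have hadj : ∀ i j, ContDiffOn ℝ ∞ (fun x => (A x).adjugate i j) S := by
    intro i j
    simp only [Matrix.adjugate_fin_three]
    fin_cases i <;> fin_cases j <;> simp <;> fun_prop
  simp only [Matrix.inv_def, Ring.inverse_eq_inv', Matrix.mulVec, dotProduct, Matrix.smul_apply,
    smul_eq_mul]
  exact ContDiffOn.sum fun j _ => ((hdet.inv hd).mul (hadj i j)).mul (hb j)

variable {𝕜 : Type*} [RCLike 𝕜] {m : Type*} [Fintype m] [DecidableEq m]
  {E : Type*} [NormedAddCommGroup E] [InnerProductSpace ℝ E] {M : OrientedSubmanifold E}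

section Frame

variable {x : E} {θ : Fin 3 → E [⋀^Fin 2]→L[ℝ] ℝ} {e : (Fin 4 → ℝ) →ₗ[ℝ] E}

theorem IsAdaptedFrame.sum_forms_apply (h : IsAdaptedFrame M x θ e) (y : Fin 3 → ℝ)
    (a b : Fin 4 → ℝ) : (∑ i, y i • θ i) ![e a, e b] = y ⬝ᵥ asd a b := by
  simp [ContinuousAlternatingMap.sum_apply, h.forms_apply, dotProduct]

theorem IsAdaptedFrame.sum_forms_normal (h : IsAdaptedFrame M x θ e) (y : Fin 3 → ℝ) (n : E)
    (hn : ∀ a, inner ℝ n (e a) = 0) (u : E) : (∑ i, y i • θ i) ![n, u] = 0 := by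
  simp [ContinuousAlternatingMap.sum_apply, h.forms_normal _ n hn]

theorem IsAdaptedFrame.injective (h : IsAdaptedFrame M x θ e) : Function.Injective e := by
  rw [injective_iff_map_eq_zero]
  intro a ha
  have := h.inner_eq a a
  rw [ha, inner_zero_left] at this
  exact dotProduct_self_eq_zero.1 this.symm

theorem IsAdaptedFrame.isOrientedFrame (h : IsAdaptedFrame M x θ e) {ε : Fin 4 → Fin 4 → ℝ}
    (hε : ∀ i j, ε i ⬝ᵥ ε j = if i = j then 1 else 0) (hd : 0 < (Matrix.of ε).det) :
    IsOrientedFrame M x fun i => e (ε i) := by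
  refine ⟨fun i => by rw [h.range_eq]; exact ⟨_, rfl⟩, ?_, (h.positive_iff ε hε).2 hd⟩
  rw [orthonormal_iff_ite]
  intro i j
  rw [h.inner_eq, hε]

theorem IsAdaptedFrame.exists_eq_of_isOrientedFrame (h : IsAdaptedFrame M x θ e) {f : Fin 4 → E}
    (hf : IsOrientedFrame M x f) : ∃ ε : Fin 4 → Fin 4 → ℝ, (f = fun i => e (ε i)) ∧
      (∀ i j, ε i ⬝ᵥ ε j = if i = j then 1 else 0) ∧ 0 < (Matrix.of ε).det := by
  obtain ⟨ht, ho, hp⟩ := hf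
  have h1 : ∀ i, ∃ a, e a = f i := fun i => by
    have := ht i
    rwa [h.range_eq] at this
  choose ε hε using h1
  have hfe : f = fun i => e (ε i) := funext fun i => (hε i).symm
  have hort : ∀ i j, ε i ⬝ᵥ ε j = if i = j then 1 else 0 := by
    intro i j
    rw [← h.inner_eq, hε, hε]
    exact orthonormal_iff_ite.1 ho i j
  exact ⟨ε, hfe, hort, (h.positive_iff ε hort).1 (hfe ▸ hp)⟩

theorem single_orthonormal (σ : Equiv.Perm (Fin 4)) (i j : Fin 4) :
    (Pi.single (σ i) 1 : Fin 4 → ℝ) ⬝ᵥ Pi.single (σ j) 1 = if i = j then 1 else 0 := by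
  simp [Pi.single_apply, eq_comm]

theorem det_single (σ : Equiv.Perm (Fin 4)) :
    (Matrix.of fun i => (Pi.single (σ i) 1 : Fin 4 → ℝ)).det = ((Equiv.Perm.sign σ : ℤ) : ℝ) := by
  have := Matrix.det_permutation (R := ℝ) σ
  rw [← this]
  congr 1
  ext i j
  simp [Equiv.Perm.permMatrix, PEquiv.toMatrix_apply, Pi.single_apply, eq_comm]

theorem IsAdaptedFrame.isOrientedFrame_single (h : IsAdaptedFrame M x θ e)
    {σ : Equiv.Perm (Fin 4)} (hσ : Equiv.Perm.sign σ = 1) :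
    IsOrientedFrame M x fun i => e (Pi.single (σ i) 1) :=
  h.isOrientedFrame (single_orthonormal σ) (by rw [det_single, hσ]; simp)

theorem IsAdaptedFrame.mem_asdBundle (h : IsAdaptedFrame M x θ e) (hx : x ∈ M.carrier)
    (y : Fin 3 → ℝ) : (x, ∑ i, y i • θ i) ∈ asdBundle M := by
  refine ⟨hx, fun n hn u => ?_, fun f hf => ?_⟩
  · refine h.sum_forms_normal y n (fun a => hn _ ?_) u
    rw [h.range_eq]; exact ⟨a, rfl⟩
  · obtain ⟨ε, rfl, h1, h2⟩ := h.exists_eq_of_isOrientedFrame hf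
    simp only [h.sum_forms_apply]
    rw [← dotProduct_add, (rotation_of_frame h1 h2).2.2, dotProduct_zero]

theorem IsAdaptedFrame.eq_sum_of_mem_asdBundle (h : IsAdaptedFrame M x θ e)
    {η : E [⋀^Fin 2]→L[ℝ] ℝ} (hη : (x, η) ∈ asdBundle M) :
    η = ∑ i, η ![e (Pi.single 0 1), e (Pi.single i.succ 1)] • θ i := by
  obtain ⟨-, hn, ha⟩ := hη
  set y : Fin 3 → ℝ := fun i => η ![e (Pi.single 0 1), e (Pi.single i.succ 1)] with hy
  refine eq_of_eq_on_tangent h.inner_eq (fun n h1 u => hn n ?_ u) (h.sum_forms_normal y) ?_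
  · intro v hv
    rw [h.range_eq] at hv
    obtain ⟨a, rfl⟩ := hv
    exact h1 a
  · intro a b
    rw [h.sum_forms_apply]
    have := bilin_eq_asd ((twoForm η).compl₁₂ e e) (fun a => alternating_self η _)
      (by simpa using ha _ (h.isOrientedFrame_single (σ := 1) (by simp)))
      (by
        have := ha _ (h.isOrientedFrame_single
          (σ := Equiv.swap 1 2 * Equiv.swap 2 3) (by decide))
        simpa [Equiv.swap_apply_of_ne_of_ne] using this)
      (by
        have := ha _ (h.isOrientedFrame_single
          (σ := Equiv.swap 1 3 * Equiv.swap 2 3) (by decide))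
        simpa [Equiv.swap_apply_of_ne_of_ne] using this) a b
    exact this

theorem IsAdaptedFrame.sum_forms_injective (h : IsAdaptedFrame M x θ e) {y y' : Fin 3 → ℝ}
    (hy : ∑ i, y i • θ i = ∑ i, y' i • θ i) : y = y' := by
  funext i
  have h1 := h.sum_forms_apply y (Pi.single 0 1) (Pi.single i.succ 1)
  rw [hy, h.sum_forms_apply] at h1
  fin_cases i <;> simpa [asd, dotProduct, Fin.sum_univ_succ] using h1.symm

theorem IsAdaptedFrame.exists_fibreCoord_eq (h : IsAdaptedFrame M x θ e) :
    ∃ R : Matrix (Fin 3) (Fin 3) ℝ, R * Rᵀ = 1 ∧ R.det = 1 ∧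
      ∀ (η : E [⋀^Fin 2]→L[ℝ] ℝ) (d : Fin 3 → ℝ),
        (∀ v ∈ tangentVectors M.carrier x, ∀ w ∈ tangentVectors M.carrier x,
          η ![v, w] = ∑ i, d i * θ i ![v, w]) → fibreCoord M x η = R *ᵥ d := by
  have hc : IsOrientedFrame M x (chosenFrame M x) :=
    Classical.epsilon_spec (p := IsOrientedFrame M x) ⟨_, h.isOrientedFrame_single (σ := 1) (by simp)⟩
  obtain ⟨ε, he, h1, h2⟩ := h.exists_eq_of_isOrientedFrame hc
  obtain ⟨r1, r2, -⟩ := rotation_of_frame h1 h2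
  refine ⟨_, r1, r2, fun η d hη => ?_⟩
  funext j
  have hm : ∀ i, e (ε i) ∈ tangentVectors M.carrier x := fun i => by
    rw [h.range_eq]; exact ⟨_, rfl⟩
  simp only [fibreCoord, he]
  rw [hη _ (hm _) _ (hm _)]
  simp [h.forms_apply, Matrix.mulVec, dotProduct, mul_comm]

end Frame

namespace AsdFrames

variable {G : Submonoid (Matrix m m 𝕜)} {κ : ℝ} {L : LieModel G κ}
  {Q : Type*} [NormedAddCommGroup Q] [NormedSpace ℝ Q] (F : AsdFrames M L Q)

/-- The two-form with the coordinates `y` in the frame `q`. -/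
def form (q : Q) (y : Fin 3 → ℝ) : E [⋀^Fin 2]→L[ℝ] ℝ := ∑ i, y i • F.forms q i

theorem form_smooth : ContDiff ℝ ∞ fun p : Q × (Fin 3 → ℝ) => F.form p.1 p.2 := by
  unfold form
  refine ContDiff.sum fun i _ => ?_
  have h1 : ContDiff ℝ ∞ fun p : Q × (Fin 3 → ℝ) => p.2 i := by fun_prop
  exact h1.smul ((F.forms_smooth i).comp contDiff_fst)

/-- The identification of the associated bundle with the bundle of anti-self-dual two-forms. -/
def proj (p : Q × (Fin 3 → ℝ)) : E × (E [⋀^Fin 2]→L[ℝ] ℝ) := (F.base p.1, F.form p.1 p.2)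

theorem proj_smooth : ContDiff ℝ ∞ F.proj :=
  (F.base_smooth.comp contDiff_fst).prodMk F.form_smooth

theorem proj_mem {q : Q} (hq : q ∈ F.total) (y : Fin 3 → ℝ) : F.proj (q, y) ∈ asdBundle M := by
  obtain ⟨e, he⟩ := F.exists_frame q hq
  exact he.mem_asdBundle (F.base_mem q hq) y

theorem form_injective {q : Q} (hq : q ∈ F.total) {y y' : Fin 3 → ℝ}
    (h : F.form q y = F.form q y') : y = y' := by
  obtain ⟨e, he⟩ := F.exists_frame q hq
  exact he.sum_forms_injective h

theorem exists_form_eq {q : Q} (hq : q ∈ F.total) {η : E [⋀^Fin 2]→L[ℝ] ℝ}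
    (h : (F.base q, η) ∈ asdBundle M) : ∃ y, η = F.form q y := by
  obtain ⟨e, he⟩ := F.exists_frame q hq
  exact ⟨_, he.eq_sum_of_mem_asdBundle h⟩

theorem form_act {q : Q} (hq : q ∈ F.total) {g : Matrix m m 𝕜} (hg : g ∈ G) (y : Fin 3 → ℝ) :
    F.form (F.act q g) (L.ad g y) = F.form q y := F.forms_act q hq g hg y

end AsdFrames

theorem LieModel.mul_inv {G : Submonoid (Matrix m m 𝕜)} {κ : ℝ} (L : LieModel G κ)
    {g : Matrix m m 𝕜} (hg : g ∈ G) : g * g⁻¹ = 1 := mul_eq_one_comm.1 (L.inv_mul g hg)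

theorem LieModel.gen_injective {G : Submonoid (Matrix m m 𝕜)} {κ : ℝ} (L : LieModel G κ) :
    Function.Injective L.gen := by
  rw [injective_iff_map_eq_zero]
  intro a ha
  have h1 := L.lieNorm_gen a
  rw [ha] at h1
  have h2 : lieNorm κ (0 : Matrix m m 𝕜) = 0 := by simp [lieNorm]
  rw [h2] at h1
  have h3 : 0 ≤ a ⬝ᵥ a := by
    simp only [dotProduct]
    exact Finset.sum_nonneg fun i _ => mul_self_nonneg _
  exact dotProduct_self_eq_zero.1 ((Real.sqrt_eq_zero h3).1 h1.symm)

theorem LieModel.ad_one {G : Submonoid (Matrix m m 𝕜)} {κ : ℝ} (L : LieModel G κ)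
    (a : Fin 3 → ℝ) : L.ad 1 a = a := by
  apply L.gen_injective
  rw [← L.conj_gen 1 G.one_mem]
  simp

theorem LieModel.ad_mul {G : Submonoid (Matrix m m 𝕜)} {κ : ℝ} (L : LieModel G κ)
    {g h : Matrix m m 𝕜} (hg : g ∈ G) (hh : h ∈ G) (a : Fin 3 → ℝ) :
    L.ad (g * h) a = L.ad h (L.ad g a) := by
  apply L.gen_injective
  rw [← L.conj_gen _ (G.mul_mem hg hh), ← L.conj_gen h hh, ← L.conj_gen g hg, Matrix.mul_inv_rev]
  simp only [mul_assoc]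

theorem LieModel.ad_cross {G : Submonoid (Matrix m m 𝕜)} {κ : ℝ} (L : LieModel G κ)
    {g : Matrix m m 𝕜} (hg : g ∈ G) (a b : Fin 3 → ℝ) :
    L.ad g (crossProduct a b) = crossProduct (L.ad g a) (L.ad g b) := by
  apply L.gen_injective
  rw [← L.conj_gen g hg, ← L.bracket, ← L.bracket, ← L.conj_gen g hg, ← L.conj_gen g hg]
  have h := L.mul_inv hg
  have e : ∀ X Y : Matrix m m 𝕜, g⁻¹ * X * g * (g⁻¹ * Y * g) = g⁻¹ * (X * Y) * g := by
    intro X Y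
    calc _ = g⁻¹ * X * (g * g⁻¹) * Y * g := by simp only [mul_assoc]
      _ = _ := by rw [h]; simp only [mul_one, mul_assoc]
  rw [e, e, mul_sub, sub_mul]

namespace AsdFrames

variable {G : Submonoid (Matrix m m 𝕜)} {κ : ℝ} {L : LieModel G κ}
  {Q : Type*} [NormedAddCommGroup Q] [NormedSpace ℝ Q] (F : AsdFrames M L Q)

/-- A local section of the pull-back of the frame bundle to the bundle of anti-self-dual forms,
together with the smooth coordinates of a form. -/
theorem exists_section (x : E) (hx : x ∈ M.carrier) :
    ∃ (W : Set (E × (E [⋀^Fin 2]→L[ℝ] ℝ))) (σ : E × (E [⋀^Fin 2]→L[ℝ] ℝ) → Q × (Fin 3 → ℝ))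
      (τ : Q → Matrix m m 𝕜), IsOpen W ∧ (∀ η, (x, η) ∈ W) ∧ ContDiffOn ℝ ∞ σ W ∧
      ContDiffOn ℝ ∞ τ {q | q ∈ F.total ∧ ∃ η, (F.base q, η) ∈ W} ∧
      (∀ z ∈ asdBundle M ∩ W, (σ z).1 ∈ F.total ∧ F.proj (σ z) = z ∧
        ∀ g ∈ G, τ (F.act (σ z).1 g) = g) ∧
      ∀ p : Q × (Fin 3 → ℝ), p.1 ∈ F.total → F.proj p ∈ W → τ p.1 ∈ G ∧
        F.act (σ (F.proj p)).1 (τ p.1) = p.1 ∧ L.ad (τ p.1) (σ (F.proj p)).2 = p.2 := by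
  obtain ⟨W₀, σ₀, τ₀, hW₀, hxW, hσ, hτ, h1, h2⟩ := F.locally_trivial x hx
  obtain ⟨hq0, hb0, -⟩ := h1 x ⟨hx, hxW⟩
  obtain ⟨e, he⟩ := F.exists_frame _ hq0
  set v : Fin 4 → E := fun k => e (Pi.single k 1)
  set A : E → Matrix (Fin 3) (Fin 3) ℝ := fun x => Matrix.of fun i j =>
    F.forms (σ₀ x) j ![v 0, v i.succ] with hA
  have hAx : A x = 1 := by
    ext i j
    simp only [hA, Matrix.of_apply, v, he.forms_apply]
    fin_cases i <;> fin_cases j <;> simp [asd]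
  have hAs : ∀ i j, ContDiffOn ℝ ∞ (fun x => A x i j) W₀ := fun i j =>
    (evalTwoForm (v 0) (v i.succ)).contDiff.comp_contDiffOn ((F.forms_smooth j).comp_contDiffOn hσ)
  have hdet : ContinuousOn (fun x => (A x).det) W₀ := by
    have : ContDiffOn ℝ ∞ (fun x => (A x).det) W₀ := by
      simp only [Matrix.det_fin_three]
      fun_prop
    exact this.continuousOn
  set W₁ : Set E := W₀ ∩ (fun x => (A x).det) ⁻¹' {0}ᶜ
  have hW₁ : IsOpen W₁ := hdet.isOpen_inter_preimage hW₀ isOpen_compl_singleton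
  have hxW₁ : x ∈ W₁ := ⟨hxW, by simp [hAx]⟩
  set b : E × (E [⋀^Fin 2]→L[ℝ] ℝ) → Fin 3 → ℝ := fun z i => z.2 ![v 0, v i.succ] with hb
  have hbs : ∀ i, ContDiff ℝ ∞ fun z : E × (E [⋀^Fin 2]→L[ℝ] ℝ) => b z i := fun i =>
    (evalTwoForm (v 0) (v i.succ)).contDiff.comp contDiff_snd
  have key : ∀ x y, (A x).det ≠ 0 → (A x)⁻¹ *ᵥ b (x, F.form (σ₀ x) y) = y := by
    intro x y hd
    have : b (x, F.form (σ₀ x) y) = A x *ᵥ y := by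
      funext i
      simp [hb, hA, form, ContinuousAlternatingMap.sum_apply, Matrix.mulVec, dotProduct, mul_comm]
    rw [this, Matrix.mulVec_mulVec, Matrix.nonsing_inv_mul _ (isUnit_iff_ne_zero.2 hd),
      Matrix.one_mulVec]
  refine ⟨Prod.fst ⁻¹' W₁, fun z => (σ₀ z.1, (A z.1)⁻¹ *ᵥ b z), τ₀, hW₁.preimage continuous_fst,
    fun η => hxW₁, ?_, ?_, ?_, ?_⟩
  · have hfst : MapsTo Prod.fst (Prod.fst ⁻¹' W₁ : Set (E × (E [⋀^Fin 2]→L[ℝ] ℝ))) W₀ :=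
      fun z hz => hz.1
    refine (hσ.comp contDiffOn_fst hfst).prodMk (contDiffOn_inv_mulVec
      (fun i j => (hAs i j).comp contDiffOn_fst hfst) (fun i => (hbs i).contDiffOn)
      fun z hz => hz.2)
  · refine hτ.mono ?_
    rintro q ⟨hq, η, hη⟩
    exact ⟨hq, hη.1⟩
  · rintro ⟨x', η⟩ ⟨hz, hzW⟩
    obtain ⟨h3, h4, h5⟩ := h1 x' ⟨hz.1, hzW.1⟩
    refine ⟨h3, ?_, h5⟩
    obtain ⟨y, rfl⟩ := F.exists_form_eq h3 (η := η) (by rw [h4]; exact hz)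
    refine Prod.ext h4 ?_
    simp only [proj]
    rw [key x' y hzW.2]
  · rintro ⟨q, y⟩ hq hW
    have hbq : F.base q ∈ W₁ := hW
    obtain ⟨h3, h4⟩ := h2 q ⟨hq, hbq.1⟩
    obtain ⟨h5, h6, -⟩ := h1 (F.base q) ⟨F.base_mem q hq, hbq.1⟩
    refine ⟨h3, h4, ?_⟩
    obtain ⟨y', hy'⟩ := F.exists_form_eq h5 (η := F.form q y) (by
      rw [h6]; exact F.proj_mem hq y)
    simp only [proj]
    rw [hy', key _ y' hbq.2]
    apply F.form_injective hq
    have := F.form_act h5 h3 y'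
    rw [h4] at this
    rw [this, ← hy']

/-- The principal bundle over the bundle of anti-self-dual two-forms. -/
def bundle : PrincipalBundle G (asdBundle M) (Q × (Fin 3 → ℝ)) where
  total := {p | p.1 ∈ F.total}
  proj := F.proj
  act p g := (F.act p.1 g, L.ad g p.2)
  proj_mem p hp := F.proj_mem hp p.2
  proj_smooth := ⟨univ, isOpen_univ, subset_univ _, F.proj_smooth.contDiffOn⟩
  act_mem p hp g hg := F.act_mem p.1 hp g hg
  proj_act p hp g hg := Prod.ext (F.base_act p.1 hp g hg) (F.form_act hp hg p.2)
  act_one p hp := Prod.ext (F.act_one p.1 hp) (L.ad_one p.2)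
  act_mul p hp g hg h hh := Prod.ext (F.act_mul p.1 hp g hg h hh) (L.ad_mul hg hh p.2)
  act_smooth := by
    have h1 : ContDiff ℝ ∞ fun q : (Q × (Fin 3 → ℝ)) × Matrix m m 𝕜 => F.act q.1.1 q.2 :=
      F.act_smooth.comp (contDiff_fst.fst.prodMk contDiff_snd)
    have h2 : ContDiff ℝ ∞ fun q : (Q × (Fin 3 → ℝ)) × Matrix m m 𝕜 => L.ad q.2 q.1.2 :=
      L.ad_smooth.comp (contDiff_snd.prodMk contDiff_fst.snd)
    exact (h1.prodMk h2).contDiffOn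
  locally_trivial := by
    rintro ⟨x, η⟩ hz
    obtain ⟨W, σ, τ, hW, hx, hσ, hτ, h1, h2⟩ := F.exists_section x hz.1
    refine ⟨W, σ, fun p => τ p.1, hW, hx η, hσ.mono inter_subset_right, ?_, ?_, ?_⟩
    · exact hτ.comp contDiffOn_fst fun p hp => ⟨hp.1, _, hp.2⟩
    · exact fun z hz => h1 z hz
    · rintro p ⟨hp, hpW⟩
      obtain ⟨h3, h4, h5⟩ := h2 p hp hpW
      exact ⟨h3, Prod.ext h4 h5⟩

end AsdFrames

end

section

variable {𝕜 : Type*} [RCLike 𝕜] {m : Type*} [Fintype m]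
  {E : Type*} [NormedAddCommGroup E] [InnerProductSpace ℝ E] {M : OrientedSubmanifold E}

/-- Multiplication of matrices as a continuous bilinear map. -/
def mulCLM (𝕜 m : Type*) [RCLike 𝕜] [Fintype m] :
    Matrix m m 𝕜 →L[ℝ] Matrix m m 𝕜 →L[ℝ] Matrix m m 𝕜 :=
  haveI : FiniteDimensional ℝ (Matrix m m 𝕜) := inferInstanceAs (FiniteDimensional ℝ (m → m → 𝕜))
  (LinearMap.mul ℝ (Matrix m m 𝕜)).toContinuousBilinearMap

@[simp] theorem mulCLM_apply (A B : Matrix m m 𝕜) : mulCLM 𝕜 m A B = A * B := rfl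

theorem hasDerivAt_matrix_mul {A B : ℝ → Matrix m m 𝕜} {A' B' : Matrix m m 𝕜} {t : ℝ}
    (hA : HasDerivAt A A' t) (hB : HasDerivAt B B' t) :
    HasDerivAt (fun t => A t * B t) (A t * B' + A' * B t) t :=
  (mulCLM 𝕜 m).hasDerivAt_of_bilinear (fun _ => hA) (fun _ => hB)

/-- The cross product as a continuous bilinear map. -/
def crossCLM : (Fin 3 → ℝ) →L[ℝ] (Fin 3 → ℝ) →L[ℝ] (Fin 3 → ℝ) :=
  (crossProduct (R := ℝ)).toContinuousBilinearMap

@[simp] theorem crossCLM_apply (a b : Fin 3 → ℝ) : crossCLM a b = crossProduct a b := rfl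

/-- The Euclidean length of a vector of `ℝ³`. -/
def len (y : Fin 3 → ℝ) : ℝ := Real.sqrt (y ⬝ᵥ y)

theorem dot_self_pos {y : Fin 3 → ℝ} (hy : y ≠ 0) : 0 < y ⬝ᵥ y := by
  refine lt_of_le_of_ne ?_ fun h => hy (dotProduct_self_eq_zero.1 h.symm)
  simp only [dotProduct]
  exact Finset.sum_nonneg fun i _ => mul_self_nonneg _

theorem len_pos {y : Fin 3 → ℝ} (hy : y ≠ 0) : 0 < len y := Real.sqrt_pos.2 (dot_self_pos hy)

theorem len_sq (y : Fin 3 → ℝ) : len y ^ 2 = y ⬝ᵥ y :=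
  Real.sq_sqrt (by simp only [dotProduct]; exact Finset.sum_nonneg fun i _ => mul_self_nonneg _)

theorem contDiff_dot_self : ContDiff ℝ ∞ fun y : Fin 3 → ℝ => y ⬝ᵥ y := by
  simp only [dotProduct]
  fun_prop

theorem contDiffOn_len : ContDiffOn ℝ ∞ len {y | y ≠ 0} :=
  contDiff_dot_self.contDiffOn.sqrt fun _ hy => (dot_self_pos hy).ne'

theorem hasDerivAt_dot {a b : ℝ → Fin 3 → ℝ} {a' b' : Fin 3 → ℝ} {t : ℝ}
    (ha : HasDerivAt a a' t) (hb : HasDerivAt b b' t) :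
    HasDerivAt (fun t => a t ⬝ᵥ b t) (a' ⬝ᵥ b t + a t ⬝ᵥ b') t := by
  simp only [dotProduct, ← Finset.sum_add_distrib]
  exact HasDerivAt.fun_sum fun i _ => (hasDerivAt_pi.1 ha i).mul (hasDerivAt_pi.1 hb i)

theorem hasDerivAt_len {a : ℝ → Fin 3 → ℝ} {a' : Fin 3 → ℝ} {t : ℝ} (ha : HasDerivAt a a' t)
    (h0 : a t ≠ 0) : HasDerivAt (fun t => len (a t)) ((a t ⬝ᵥ a') / len (a t)) t := by
  have h := (hasDerivAt_dot ha ha).sqrt (dot_self_pos h0).ne'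
  refine h.congr_deriv ?_
  rw [dotProduct_comm a', ← two_mul, mul_div_mul_left _ _ two_ne_zero]
  rfl

theorem hasDerivAt_cross {a b : ℝ → Fin 3 → ℝ} {a' b' : Fin 3 → ℝ} {t : ℝ}
    (ha : HasDerivAt a a' t) (hb : HasDerivAt b b' t) :
    HasDerivAt (fun t => crossProduct (a t) (b t))
      (crossProduct (a t) b' + crossProduct a' (b t)) t :=
  crossCLM.hasDerivAt_of_bilinear (fun _ => ha) (fun _ => hb)

theorem isOpen_snd_ne_zero {Q : Type*} [TopologicalSpace Q] :
    IsOpen {p : Q × (Fin 3 → ℝ) | p.2 ≠ 0} :=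
  isOpen_compl_singleton.preimage continuous_snd

variable [DecidableEq m]

namespace AsdFrames

variable {G : Submonoid (Matrix m m 𝕜)} {κ : ℝ} {L : LieModel G κ}
  {Q : Type*} [NormedAddCommGroup Q] [NormedSpace ℝ Q] (F : AsdFrames M L Q)

theorem mem_punctured_iff {p : Q × (Fin 3 → ℝ)} :
    p ∈ F.bundle.punctured ↔ p.1 ∈ F.total ∧ p.2 ≠ 0 := by
  have h0 : F.form p.1 0 = 0 := by simp [form]
  constructor
  · rintro ⟨h1, -, h2⟩
    refine ⟨h1, fun h => h2 ?_⟩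
    change F.form p.1 p.2 = 0
    rw [h, h0]
  · rintro ⟨h1, h2⟩
    refine ⟨h1, F.proj_mem h1 p.2, fun h => h2 (F.form_injective h1 ?_)⟩
    rw [h0]; exact h

/-- The coordinates of the vertical part of a tangent vector. -/
def vert : (Q × (Fin 3 → ℝ)) → (Q × (Fin 3 → ℝ)) →L[ℝ] (Fin 3 → ℝ) := fun p =>
  ContinuousLinearMap.snd ℝ Q (Fin 3 → ℝ) +
    (crossCLM.flip p.2) ∘L (F.conn p.1) ∘L ContinuousLinearMap.fst ℝ Q (Fin 3 → ℝ)

@[simp] theorem vert_apply (p v : Q × (Fin 3 → ℝ)) :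
    F.vert p v = v.2 + crossProduct (F.conn p.1 v.1) p.2 := rfl

/-- The linear map `gen` as a continuous map. -/
def _root_.G2Monopole.LieModel.genCLM {G : Submonoid (Matrix m m 𝕜)} {κ : ℝ} (L : LieModel G κ) :
    (Fin 3 → ℝ) →L[ℝ] Matrix m m 𝕜 := LinearMap.toContinuousLinearMap L.gen

@[simp] theorem _root_.G2Monopole.LieModel.genCLM_apply {G : Submonoid (Matrix m m 𝕜)} {κ : ℝ}
    (L : LieModel G κ) (a : Fin 3 → ℝ) : L.genCLM a = L.gen a := rfl

/-- The coordinates of the connection form `ω + μ(|y|) y × Dy`. -/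
def potential (μ : ℝ → ℝ) (p : Q × (Fin 3 → ℝ)) : (Q × (Fin 3 → ℝ)) →L[ℝ] (Fin 3 → ℝ) :=
  F.conn p.1 ∘L ContinuousLinearMap.fst ℝ Q (Fin 3 → ℝ) +
    μ (len p.2) • (crossCLM p.2 ∘L F.vert p)

@[simp] theorem potential_apply (μ : ℝ → ℝ) (p v : Q × (Fin 3 → ℝ)) :
    F.potential μ p v = F.conn p.1 v.1 + μ (len p.2) • crossProduct p.2 (F.vert p v) := rfl

theorem vert_smooth : ContDiff ℝ ∞ F.vert := by
  have h1 : ContDiff ℝ ∞ fun p : Q × (Fin 3 → ℝ) => crossCLM.flip p.2 :=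
    crossCLM.flip.contDiff.comp contDiff_snd
  have h2 : ContDiff ℝ ∞ fun p : Q × (Fin 3 → ℝ) =>
      (F.conn p.1) ∘L ContinuousLinearMap.fst ℝ Q (Fin 3 → ℝ) :=
    (F.conn.contDiff.comp contDiff_fst).clm_comp contDiff_const
  exact contDiff_const.add (h1.clm_comp h2)

theorem potential_smooth {X : Type*} [NormedAddCommGroup X] [NormedSpace ℝ X] {D : Set X}
    {μ : X → ℝ → ℝ} (hμ : ContDiffOn ℝ ∞ (fun q : X × ℝ => μ q.1 q.2) (D ×ˢ Ioi 0)) :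
    ContDiffOn ℝ ∞ (fun q : X × (Q × (Fin 3 → ℝ)) => F.potential (μ q.1) q.2)
      (D ×ˢ {p | p.2 ≠ 0}) := by
  have h1 : ContDiff ℝ ∞ fun q : X × (Q × (Fin 3 → ℝ)) =>
      F.conn q.2.1 ∘L ContinuousLinearMap.fst ℝ Q (Fin 3 → ℝ) :=
    (F.conn.contDiff.comp contDiff_snd.fst).clm_comp contDiff_const
  have h2 : ContDiff ℝ ∞ fun q : X × (Q × (Fin 3 → ℝ)) => crossCLM q.2.2 ∘L F.vert q.2 :=
    (crossCLM.contDiff.comp contDiff_snd.snd).clm_comp (F.vert_smooth.comp contDiff_snd)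
  have h3 : ContDiffOn ℝ ∞ (fun q : X × (Q × (Fin 3 → ℝ)) => μ q.1 (len q.2.2))
      (D ×ˢ {p | p.2 ≠ 0}) :=
    hμ.comp (contDiffOn_fst.prodMk
      (contDiffOn_len.comp contDiff_snd.snd.contDiffOn fun q hq => hq.2))
      fun q hq => ⟨hq.1, len_pos hq.2⟩
  exact h1.contDiffOn.add (h3.smul h2.contDiffOn)

theorem higgs_smooth {X : Type*} [NormedAddCommGroup X] [NormedSpace ℝ X] {D : Set X}
    {χ : X → ℝ → ℝ} (hχ : ContDiffOn ℝ ∞ (fun q : X × ℝ => χ q.1 q.2) (D ×ˢ Ioi 0)) :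
    ContDiffOn ℝ ∞ (fun q : X × (Q × (Fin 3 → ℝ)) => χ q.1 (len q.2.2) • L.gen q.2.2)
      (D ×ˢ {p | p.2 ≠ 0}) := by
  have h3 : ContDiffOn ℝ ∞ (fun q : X × (Q × (Fin 3 → ℝ)) => χ q.1 (len q.2.2))
      (D ×ˢ {p | p.2 ≠ 0}) :=
    hχ.comp (contDiffOn_fst.prodMk
      (contDiffOn_len.comp contDiff_snd.snd.contDiffOn fun q hq => hq.2))
      fun q hq => ⟨hq.1, len_pos hq.2⟩
  have h4 : ContDiff ℝ ∞ fun q : X × (Q × (Fin 3 → ℝ)) => L.gen q.2.2 :=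
    L.genCLM.contDiff.comp contDiff_snd.snd
  exact h3.smul h4.contDiffOn

theorem contDiffOn_const_prod {X : Type*} [NormedAddCommGroup X] [NormedSpace ℝ X] {μ : ℝ → ℝ}
    (hμ : ContDiffOn ℝ ∞ μ (Ioi 0)) :
    ContDiffOn ℝ ∞ (fun q : X × ℝ => μ q.2) (univ ×ˢ Ioi 0) :=
  hμ.comp contDiffOn_snd fun _ hq => hq.2

theorem vert_act {γ : ℝ → Q × (Fin 3 → ℝ)} (hγ : SmoothCurveIn F.bundle.punctured γ)
    {g : Matrix m m 𝕜} (hg : g ∈ G) :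
    ∃ u, HasDerivAt (fun t => F.bundle.act (γ t) g) u 0 ∧
      F.conn (F.act (γ 0).1 g) u.1 = L.ad g (F.conn (γ 0).1 (deriv γ 0).1) ∧
      F.vert (F.bundle.act (γ 0) g) u = L.ad g (F.vert (γ 0) (deriv γ 0)) := by
  have hd : HasDerivAt γ (deriv γ 0) 0 :=
    (hγ.1.differentiable (by simp)).differentiableAt.hasDerivAt
  have hc : SmoothCurveIn F.total fun t => (γ t).1 :=
    ⟨contDiff_fst.comp hγ.1, fun t => (F.mem_punctured_iff.1 (hγ.2 t)).1⟩
  have h1 : HasDerivAt (fun t => F.act (γ t).1 g) (deriv (fun t => F.act (γ t).1 g) 0) 0 := by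
    have : ContDiff ℝ ∞ fun t => F.act (γ t).1 g := F.act_smooth.comp (hc.1.prodMk contDiff_const)
    exact (this.differentiable (by simp)).differentiableAt.hasDerivAt
  have h2 : HasDerivAt (fun t => L.ad g (γ t).2) (L.ad g (deriv γ 0).2) 0 :=
    (LinearMap.toContinuousLinearMap (L.ad g)).hasFDerivAt.comp_hasDerivAt (0 : ℝ) hd.snd
  have h3 := F.conn_equivariant _ hc g hg
  have h4 : deriv (fun t => (γ t).1) 0 = (deriv γ 0).1 :=
    HasDerivAt.deriv (f := fun t => (γ t).1) ((ContinuousLinearMap.fst ℝ Q (Fin 3 → ℝ)).hasFDerivAt.comp_hasDerivAt (0 : ℝ) hd)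
  rw [h4] at h3
  refine ⟨_, h1.prodMk h2, h3, ?_⟩
  simp only [vert_apply, map_add, L.ad_cross hg]
  rw [← h3]
  rfl

theorem vert_vertical {p : Q × (Fin 3 → ℝ)} (hp : p.1 ∈ F.total) {g : ℝ → Matrix m m 𝕜}
    (hg : SmoothCurveIn (G : Set (Matrix m m 𝕜)) g) (h0 : g 0 = 1) :
    ∃ u, HasDerivAt (fun t => F.bundle.act p (g t)) u 0 ∧
      L.gen (F.conn p.1 u.1) = deriv g 0 ∧ F.vert p u = 0 := by
  have hd : HasDerivAt g (deriv g 0) 0 :=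
    (hg.1.differentiable (by simp)).differentiableAt.hasDerivAt
  have h1 : HasDerivAt (fun t => F.act p.1 (g t)) (deriv (fun t => F.act p.1 (g t)) 0) 0 := by
    have : ContDiff ℝ ∞ fun t => F.act p.1 (g t) := F.act_smooth.comp (contDiff_const.prodMk hg.1)
    exact (this.differentiable (by simp)).differentiableAt.hasDerivAt
  have h2 : HasDerivAt (fun t => L.ad (g t) p.2) (deriv (fun t => L.ad (g t) p.2) 0) 0 := by
    have : ContDiff ℝ ∞ fun t => L.ad (g t) p.2 := L.ad_smooth.comp (hg.1.prodMk contDiff_const)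
    exact (this.differentiable (by simp)).differentiableAt.hasDerivAt
  have h3 := F.conn_vertical _ hp g hg h0
  refine ⟨_, h1.prodMk h2, h3, ?_⟩
  apply L.gen_injective
  set y' := deriv (fun t => L.ad (g t) p.2) 0
  have h4 : HasDerivAt (fun t => g t * L.gen (L.ad (g t) p.2)) (g 0 * L.gen y' +
      deriv g 0 * L.gen (L.ad (g 0) p.2)) 0 :=
    hasDerivAt_matrix_mul hd (L.genCLM.hasFDerivAt.comp_hasDerivAt (0 : ℝ) h2)
  have h5 : HasDerivAt (fun t => L.gen p.2 * g t) (L.gen p.2 * deriv g 0 + 0 * g 0) 0 :=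
    hasDerivAt_matrix_mul (hasDerivAt_const _ _) hd
  have h6 : (fun t => g t * L.gen (L.ad (g t) p.2)) = fun t => L.gen p.2 * g t := by
    funext t
    rw [← L.conj_gen _ (hg.2 t), ← mul_assoc, ← mul_assoc, L.mul_inv (hg.2 t), one_mul]
  rw [h6] at h4
  have h7 := h4.unique h5
  rw [h0, L.ad_one] at h7
  simp only [vert_apply, map_add, ← L.bracket, h3, map_zero]
  simp only [one_mul, zero_mul, add_zero] at h7
  rw [← h7]
  abel

/-- The connection `ω + μ(|y|) y × Dy` and the Higgs field `χ(|y|) y`. -/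
def gaugePair (μ χ : ℝ → ℝ) (hμ : ContDiffOn ℝ ∞ μ (Ioi 0)) (hχ : ContDiffOn ℝ ∞ χ (Ioi 0)) :
    GaugePair F.bundle where
  form p := L.genCLM ∘L F.potential μ p
  higgs p := χ (len p.2) • L.gen p.2
  smooth := by
    refine ⟨{p | p.2 ≠ 0}, isOpen_snd_ne_zero, fun p hp => (F.mem_punctured_iff.1 hp).2, ?_, ?_⟩
    · have h := (F.potential_smooth (X := ℝ) (μ := fun _ => μ) (contDiffOn_const_prod hμ)).comp
        (s := {p : Q × (Fin 3 → ℝ) | p.2 ≠ 0}) (contDiff_const (c := (0 : ℝ)).prodMk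
          contDiff_id).contDiffOn fun p hp => ⟨mem_univ _, hp⟩
      exact contDiffOn_const.clm_comp h
    · exact (higgs_smooth (L := L) (Q := Q) (X := ℝ) (χ := fun _ => χ) (contDiffOn_const_prod hχ)).comp
        (s := {p : Q × (Fin 3 → ℝ) | p.2 ≠ 0}) (contDiff_const (c := (0 : ℝ)).prodMk
          contDiff_id).contDiffOn fun p hp => ⟨mem_univ _, hp⟩
  form_mem p _ v _ := by
    rw [L.tangent_eq]
    exact ⟨_, rfl⟩
  form_vertical p hp g hg h0 := by
    obtain ⟨u, h1, h2, h3⟩ := F.vert_vertical (F.mem_punctured_iff.1 hp).1 hg h0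
    rw [h1.deriv]
    simp only [ContinuousLinearMap.comp_apply, potential_apply, h3, map_zero, smul_zero, add_zero,
      LieModel.genCLM_apply, h2]
  form_equivariant γ hγ g hg := by
    obtain ⟨u, h1, h2, h3⟩ := F.vert_act hγ hg
    have h4 : len (L.ad g (γ 0).2) = len (γ 0).2 := by simp only [len, L.ad_dot g hg]
    rw [h1.deriv]
    simp only [ContinuousLinearMap.comp_apply, potential_apply, h3, LieModel.genCLM_apply]
    rw [L.conj_gen g hg]
    change L.gen (F.conn (F.act (γ 0).1 g) u.1 + μ (len (L.ad g (γ 0).2)) •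
      crossProduct (L.ad g (γ 0).2) _) = _
    rw [h2, h4, ← L.ad_cross hg, map_add (L.ad g), map_smul]
  higgs_mem p _ := by
    rw [L.tangent_eq]
    exact ⟨χ (len p.2) • p.2, map_smul _ _ _⟩
  higgs_equivariant p _ g hg := by
    have h4 : len (L.ad g p.2) = len p.2 := by simp only [len, L.ad_dot g hg]
    change χ (len (L.ad g p.2)) • L.gen (L.ad g p.2) = _
    rw [h4, ← L.conj_gen g hg, mul_smul_comm, smul_mul_assoc]

theorem isSmoothFamily {D : Set (ℝ × ℝ)} {μ χ : ℝ × ℝ → ℝ → ℝ} {C : ℝ × ℝ → GaugePair F.bundle}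
    (hμ : ContDiffOn ℝ ∞ (fun q : (ℝ × ℝ) × ℝ => μ q.1 q.2) (D ×ˢ Ioi 0))
    (hχ : ContDiffOn ℝ ∞ (fun q : (ℝ × ℝ) × ℝ => χ q.1 q.2) (D ×ˢ Ioi 0))
    (h1 : ∀ c ∈ D, (C c).form = fun p => L.genCLM ∘L F.potential (μ c) p)
    (h2 : ∀ c ∈ D, (C c).higgs = fun p => χ c (len p.2) • L.gen p.2) :
    GaugePair.IsSmoothFamily C D := by
  refine ⟨{p | p.2 ≠ 0}, isOpen_snd_ne_zero, fun p hp => (F.mem_punctured_iff.1 hp).2, ?_, ?_⟩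
  · refine (contDiffOn_const (c := L.genCLM)).clm_comp (F.potential_smooth hμ) |>.congr fun q hq => ?_
    rw [h1 _ hq.1]
  · refine (higgs_smooth (L := L) (Q := Q) hχ).congr fun q hq => ?_
    rw [h2 _ hq.1]

end AsdFrames

end

section

/-! ### Tangent vectors -/

theorem hasDerivAt_of_smoothCurveIn {V : Type*} [NormedAddCommGroup V] [NormedSpace ℝ V]
    {S : Set V} {γ : ℝ → V} (h : SmoothCurveIn S γ) (t : ℝ) : HasDerivAt γ (deriv γ t) t :=
  (h.1.differentiable (by simp)).differentiableAt.hasDerivAt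

theorem fderiv_mem_tangentVectors {V W : Type*} [NormedAddCommGroup V] [NormedSpace ℝ V]
    [NormedAddCommGroup W] [NormedSpace ℝ W] {S : Set V} {T : Set W} {f : V → W}
    (hf : ContDiff ℝ ∞ f) (hST : MapsTo f S T) {p v : V} (hv : v ∈ tangentVectors S p) :
    fderiv ℝ f p v ∈ tangentVectors T (f p) := by
  obtain ⟨γ, hγ, rfl, rfl⟩ := hv
  refine ⟨fun t => f (γ t), ⟨hf.comp hγ.1, fun t => hST (hγ.2 t)⟩, rfl, ?_⟩
  exact ((hf.differentiable (by simp)).differentiableAt.hasFDerivAt.comp_hasDerivAt (0 : ℝ)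
    (hasDerivAt_of_smoothCurveIn hγ 0)).deriv

/-- A reparametrisation of a line that stays in the ball of radius `ε`. -/
theorem exists_small_curve {ε : ℝ} (hε : 0 < ε) :
    ∃ β : ℝ → ℝ, ContDiff ℝ ∞ β ∧ β 0 = 0 ∧ HasDerivAt β 1 0 ∧ ∀ t, |β t| ≤ ε := by
  refine ⟨fun t => ε * Real.sin (t / ε), by fun_prop, by simp, ?_, fun t => ?_⟩
  · have h : HasDerivAt (fun t : ℝ => t / ε) (1 / ε) 0 := (hasDerivAt_id (0 : ℝ)).div_const ε
    refine (h.sin.const_mul ε).congr_deriv ?_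
    simp [hε.ne']
  · rw [abs_mul, abs_of_pos hε]
    exact mul_le_of_le_one_right hε.le (Real.abs_sin_le_one _)

variable {𝕜 : Type*} [RCLike 𝕜] {m : Type*} [Fintype m] [DecidableEq m]
  {E : Type*} [NormedAddCommGroup E] [InnerProductSpace ℝ E] {M : OrientedSubmanifold E}

/-! ### The Bryant-Salamon structure in an orthonormal frame -/

/-- The three-form of the standard `G₂`-structure on `ℝ³ ⊕ ℝ⁴`. -/
def stdPhi (x y z : Fin 3 ⊕ Fin 4 → ℝ) : ℝ :=
  (x ∘ Sum.inl) ⬝ᵥ crossProduct (y ∘ Sum.inl) (z ∘ Sum.inl) +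
    ((x ∘ Sum.inl) ⬝ᵥ asd (y ∘ Sum.inr) (z ∘ Sum.inr) +
      (y ∘ Sum.inl) ⬝ᵥ asd (z ∘ Sum.inr) (x ∘ Sum.inr) +
      (z ∘ Sum.inl) ⬝ᵥ asd (x ∘ Sum.inr) (y ∘ Sum.inr))

/-- The curvature of the connection `ω + μ y × Dy` in an orthonormal frame; `ν` is the derivative
of `μ` divided by `|y|`. -/
def stdCurv (f μ ν : ℝ) (y : Fin 3 → ℝ) (u v : Fin 3 ⊕ Fin 4 → ℝ) : Fin 3 → ℝ :=
  (f⁻¹ ^ 2) • (ν • ((y ⬝ᵥ (u ∘ Sum.inl)) • crossProduct y (v ∘ Sum.inl) -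
      (y ⬝ᵥ (v ∘ Sum.inl)) • crossProduct y (u ∘ Sum.inl)) +
      (2 * μ) • crossProduct (u ∘ Sum.inl) (v ∘ Sum.inl) +
      (μ ^ 2) • crossProduct (crossProduct y (u ∘ Sum.inl)) (crossProduct y (v ∘ Sum.inl))) +
    (f ^ 2 / 2) • (asd (u ∘ Sum.inr) (v ∘ Sum.inr) +
      μ • crossProduct y (crossProduct (asd (u ∘ Sum.inr) (v ∘ Sum.inr)) y))

/-- The covariant derivative of the Higgs field `χ y` in an orthonormal frame; `ρ` is the derivative
of `χ` divided by `|y|`. -/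
def stdCov (f μ χ ρ : ℝ) (y : Fin 3 → ℝ) (u : Fin 3 ⊕ Fin 4 → ℝ) : Fin 3 → ℝ :=
  f⁻¹ • ((ρ * (y ⬝ᵥ (u ∘ Sum.inl))) • y + χ • (u ∘ Sum.inl) +
    (χ * μ) • crossProduct (crossProduct y (u ∘ Sum.inl)) y)

theorem cross_zero (a b : Fin 3 → ℝ) : crossProduct a b 0 = a 1 * b 2 - a 2 * b 1 := rfl

theorem cross_one (a b : Fin 3 → ℝ) : crossProduct a b 1 = a 2 * b 0 - a 0 * b 2 := rfl

theorem cross_two (a b : Fin 3 → ℝ) : crossProduct a b 2 = a 0 * b 1 - a 1 * b 0 := rfl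

theorem dot_eq (a b : Fin 3 → ℝ) : a ⬝ᵥ b = a 0 * b 0 + a 1 * b 1 + a 2 * b 2 :=
  Fin.sum_univ_three _

theorem vec_ext {a b : Fin 3 → ℝ} (h0 : a 0 = b 0) (h1 : a 1 = b 1) (h2 : a 2 = b 2) : a = b := by
  funext i
  fin_cases i
  exacts [h0, h1, h2]

theorem det_of_mulVec (R : Matrix (Fin 3) (Fin 3) ℝ) (a b c : Fin 3 → ℝ) :
    (Matrix.of ![R *ᵥ a, R *ᵥ b, R *ᵥ c]).det = R.det * (a ⬝ᵥ crossProduct b c) := by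
  have h : Matrix.of ![R *ᵥ a, R *ᵥ b, R *ᵥ c] = Matrix.of ![a, b, c] * Rᵀ := by
    ext i j
    fin_cases i <;> simp [Matrix.mul_apply, Matrix.mulVec, dotProduct, mul_comm]
  rw [h, Matrix.det_mul, Matrix.det_transpose, triple_product_eq_det, mul_comm]
  rfl

theorem mulVec_dot_mulVec {R : Matrix (Fin 3) (Fin 3) ℝ} (h : R * Rᵀ = 1) (a b : Fin 3 → ℝ) :
    (R *ᵥ a) ⬝ᵥ (R *ᵥ b) = a ⬝ᵥ b := by
  rw [Matrix.dotProduct_mulVec, ← Matrix.mulVec_transpose, Matrix.mulVec_mulVec,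
    mul_eq_one_comm.1 h, Matrix.one_mulVec]

namespace AsdFrames

variable {G : Submonoid (Matrix m m 𝕜)} {κ : ℝ} {L : LieModel G κ}
  {Q : Type*} [NormedAddCommGroup Q] [NormedSpace ℝ Q] (F : AsdFrames M L Q)

theorem fst_mem_tangentVectors {p v : Q × (Fin 3 → ℝ)}
    (hv : v ∈ tangentVectors F.bundle.punctured p) : v.1 ∈ tangentVectors F.total p.1 := by
  have := fderiv_mem_tangentVectors (f := Prod.fst) (T := F.total) contDiff_fst
    (fun x hx => (F.mem_punctured_iff.1 hx).1) hv
  simpa [fderiv_fst] using this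

theorem mem_tangentVectors_punctured {q u : Q} {y d : Fin 3 → ℝ} (hy : y ≠ 0)
    (hu : u ∈ tangentVectors F.total q) : (u, d) ∈ tangentVectors F.bundle.punctured (q, y) := by
  obtain ⟨γ, hγ, rfl, rfl⟩ := hu
  have hε : 0 < ‖y‖ / (‖d‖ + 1) := div_pos (norm_pos_iff.2 hy) (by positivity)
  obtain ⟨β, h1, h2, h3, h4⟩ := exists_small_curve hε
  refine ⟨fun t => (γ t, y + β t • d), ⟨hγ.1.prodMk (contDiff_const.add (h1.smul contDiff_const)),
    fun t => F.mem_punctured_iff.2 ⟨hγ.2 t, fun h => ?_⟩⟩, by simp [h2], ?_⟩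
  · have h5 : ‖y‖ = |β t| * ‖d‖ := by
      have : y = -(β t • d) := eq_neg_of_add_eq_zero_left h
      rw [this, norm_neg, norm_smul, Real.norm_eq_abs]
    have h6 : |β t| * ‖d‖ ≤ ‖y‖ / (‖d‖ + 1) * ‖d‖ :=
      mul_le_mul_of_nonneg_right (h4 t) (norm_nonneg _)
    have h7 : ‖y‖ / (‖d‖ + 1) * ‖d‖ < ‖y‖ := by
      rw [div_mul_eq_mul_div, div_lt_iff₀ (by positivity)]
      nlinarith [norm_pos_iff.2 hy]
    linarith
  · refine HasDerivAt.deriv ?_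
    have := (hasDerivAt_of_smoothCurveIn hγ 0).prodMk
      ((h3.smul_const d).const_add y)
    simpa using this

theorem hasDerivAt_form {γ : ℝ → Q × (Fin 3 → ℝ)} {v : Q × (Fin 3 → ℝ)} {t : ℝ}
    (h : HasDerivAt γ v t) : HasDerivAt (fun t => F.form (γ t).1 (γ t).2)
      (F.form (γ t).1 v.2 + ∑ i, (γ t).2 i • fderiv ℝ (fun q => F.forms q i) (γ t).1 v.1) t := by
  have h1 : HasDerivAt (fun t => (γ t).1) v.1 t :=
    (ContinuousLinearMap.fst ℝ Q (Fin 3 → ℝ)).hasFDerivAt.comp_hasDerivAt t h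
  have h2 : HasDerivAt (fun t => (γ t).2) v.2 t :=
    (ContinuousLinearMap.snd ℝ Q (Fin 3 → ℝ)).hasFDerivAt.comp_hasDerivAt t h
  have h3 : ∀ i, HasDerivAt (fun t => F.forms (γ t).1 i)
      (fderiv ℝ (fun q => F.forms q i) (γ t).1 v.1) t := fun i =>
    ((F.forms_smooth i).differentiable (by simp)).differentiableAt.hasFDerivAt.comp_hasDerivAt t h1
  simp only [form, ← Finset.sum_add_distrib]
  refine HasDerivAt.fun_sum fun i _ => ?_
  rw [add_comm]
  exact (hasDerivAt_pi.1 h2 i).smul (h3 i)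

theorem hasDerivAt_proj {γ : ℝ → Q × (Fin 3 → ℝ)} {v : Q × (Fin 3 → ℝ)} {t : ℝ}
    (h : HasDerivAt γ v t) : HasDerivAt (fun t => F.proj (γ t)) (fderiv ℝ F.base (γ t).1 v.1,
      F.form (γ t).1 v.2 + ∑ i, (γ t).2 i • fderiv ℝ (fun q => F.forms q i) (γ t).1 v.1) t := by
  refine HasDerivAt.prodMk ?_ (F.hasDerivAt_form h)
  have h1 : HasDerivAt (fun t => (γ t).1) v.1 t :=
    (ContinuousLinearMap.fst ℝ Q (Fin 3 → ℝ)).hasFDerivAt.comp_hasDerivAt t h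
  exact (F.base_smooth.differentiable (by simp)).differentiableAt.hasFDerivAt.comp_hasDerivAt t h1

theorem fderiv_proj (p v : Q × (Fin 3 → ℝ)) : fderiv ℝ F.proj p v = (fderiv ℝ F.base p.1 v.1,
      F.form p.1 v.2 + ∑ i, p.2 i • fderiv ℝ (fun q => F.forms q i) p.1 v.1) := by
  have h1 := (F.proj_smooth.differentiable (by simp) p).hasFDerivAt.hasLineDerivAt v
  have h2 := F.hasDerivAt_proj (γ := fun t : ℝ => p + t • v) (v := v) (t := 0) (by
    simpa using ((hasDerivAt_id (0 : ℝ)).smul_const v).const_add p)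
  have := HasDerivAt.unique h1 h2
  simpa using this

theorem fderiv_proj_apply {p v : Q × (Fin 3 → ℝ)} (hp : p.1 ∈ F.total)
    (hv : v.1 ∈ tangentVectors F.total p.1) {a b : E}
    (ha : a ∈ tangentVectors M.carrier (F.base p.1))
    (hb : b ∈ tangentVectors M.carrier (F.base p.1)) :
    (fderiv ℝ F.proj p v).2 ![a, b] = ∑ i, F.vert p v i * F.forms p.1 i ![a, b] := by
  have := F.parallel _ hp _ hv p.2 a ha b hb
  rw [fderiv_proj]
  simp only [ContinuousAlternatingMap.add_apply, ContinuousAlternatingMap.sum_apply, form,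
    ContinuousAlternatingMap.smul_apply, smul_eq_mul, vert_apply, Pi.add_apply, add_mul,
    Finset.sum_add_distrib]
  rw [this]

theorem fibreNormSq_proj {p : Q × (Fin 3 → ℝ)} (hp : p.1 ∈ F.total) :
    fibreNormSq M (F.proj p) = p.2 ⬝ᵥ p.2 := by
  obtain ⟨e, he⟩ := F.exists_frame _ hp
  obtain ⟨R, h1, -, h2⟩ := he.exists_fibreCoord_eq
  have h3 : fibreCoord M (F.base p.1) (F.form p.1 p.2) = R *ᵥ p.2 :=
    h2 _ _ fun v _ w _ => by simp [form, ContinuousAlternatingMap.sum_apply]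
  have : fibreNormSq M (F.proj p) = (R *ᵥ p.2) ⬝ᵥ (R *ᵥ p.2) := by
    rw [← h3]; simp [fibreNormSq, proj, dotProduct, sq]
  rw [this, mulVec_dot_mulVec h1]

theorem conformalFactor_proj {p : Q × (Fin 3 → ℝ)} (hp : p.1 ∈ F.total) :
    conformalFactor M (F.proj p) = scaleFactor (len p.2) := by
  rw [conformalFactor, F.fibreNormSq_proj hp, scaleFactor, len_sq]

theorem metric_proj {p u v : Q × (Fin 3 → ℝ)} (hp : p.1 ∈ F.total)
    (hu : u.1 ∈ tangentVectors F.total p.1) (hv : v.1 ∈ tangentVectors F.total p.1) :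
    metric M (F.proj p) (fderiv ℝ F.proj p u) (fderiv ℝ F.proj p v) =
      scaleFactor (len p.2) ^ 2 * (F.vert p u ⬝ᵥ F.vert p v) + (scaleFactor (len p.2) ^ 2)⁻¹ *
        inner ℝ (fderiv ℝ F.base p.1 u.1) (fderiv ℝ F.base p.1 v.1) := by
  obtain ⟨e, he⟩ := F.exists_frame _ hp
  obtain ⟨R, h1, -, h2⟩ := he.exists_fibreCoord_eq
  rw [metric, F.conformalFactor_proj hp]
  change _ * ∑ i, fibreCoord M (F.base p.1) _ i * fibreCoord M (F.base p.1) _ i + _ = _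
  rw [h2 _ _ fun a ha b hb => F.fderiv_proj_apply hp hu ha hb,
    h2 _ _ fun a ha b hb => F.fderiv_proj_apply hp hv ha hb, ← mulVec_dot_mulVec h1, fderiv_proj,
    fderiv_proj]
  rfl

/-- An orthonormal coframe on the horizontal space that brings the Bryant-Salamon structure into
standard form. -/
theorem exists_coframe {p : Q × (Fin 3 → ℝ)} (hp : p ∈ F.bundle.punctured) :
    ∃ θ : (Q × (Fin 3 → ℝ)) → (Fin 3 ⊕ Fin 4 → ℝ),
      (∀ v, θ v ∘ Sum.inl = scaleFactor (len p.2) • F.vert p v) ∧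
      (∀ u ∈ tangentVectors F.bundle.punctured p, ∀ v ∈ tangentVectors F.bundle.punctured p,
        metric M (F.proj p) (fderiv ℝ F.proj p u) (fderiv ℝ F.proj p v) = θ u ⬝ᵥ θ v ∧
        (∀ i, F.forms p.1 i ![fderiv ℝ F.base p.1 u.1, fderiv ℝ F.base p.1 v.1] =
          scaleFactor (len p.2) ^ 2 * asd (θ u ∘ Sum.inr) (θ v ∘ Sum.inr) i) ∧
        ∀ w ∈ tangentVectors F.bundle.punctured p, phi M (F.proj p) (fderiv ℝ F.proj p u)
          (fderiv ℝ F.proj p v) (fderiv ℝ F.proj p w) = stdPhi (θ u) (θ v) (θ w)) ∧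
      ∀ x, ∃ v ∈ tangentVectors F.bundle.punctured p, θ v = x := by
  obtain ⟨hq, hy⟩ := F.mem_punctured_iff.1 hp
  obtain ⟨e, he⟩ := F.exists_frame _ hq
  obtain ⟨R, h1, h2, h3⟩ := he.exists_fibreCoord_eq
  set f := scaleFactor (len p.2) with hf
  have hf0 : 0 < f := scaleFactor_pos _
  let a : Q × (Fin 3 → ℝ) → Fin 4 → ℝ := fun v k =>
    inner ℝ (fderiv ℝ F.base p.1 v.1) (e (Pi.single k 1))
  have ha : ∀ b v, fderiv ℝ F.base p.1 v.1 = e b → a v = b := by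
    intro b v h
    funext k
    simp only [a, h, he.inner_eq]
    simp
  have hmem : ∀ c, e c ∈ tangentVectors M.carrier (F.base p.1) := fun c => by
    rw [he.range_eq]; exact ⟨c, rfl⟩
  have hea : ∀ v ∈ tangentVectors F.bundle.punctured p, fderiv ℝ F.base p.1 v.1 = e (a v) := by
    intro v hv
    have := fderiv_mem_tangentVectors F.base_smooth F.base_mem (F.fst_mem_tangentVectors hv)
    rw [he.range_eq] at this
    obtain ⟨b, hb⟩ := this
    rw [ha b v hb.symm, hb]
  refine ⟨fun v => Sum.elim (f • F.vert p v) (f⁻¹ • a v), fun v => by simp, ?_, ?_⟩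
  · intro u hu v hv
    refine ⟨?_, ?_, ?_⟩
    · rw [F.metric_proj hq (F.fst_mem_tangentVectors hu) (F.fst_mem_tangentVectors hv), ← hf,
        hea u hu, hea v hv, he.inner_eq, sumElim_dotProduct_sumElim]
      simp only [smul_dotProduct, dotProduct_smul, smul_eq_mul]
      ring
    · intro i
      rw [hea u hu, hea v hv, he.forms_apply]
      simp only [Sum.elim_comp_inr]
      have : asd (f⁻¹ • a u) (f⁻¹ • a v) i = f⁻¹ ^ 2 * asd (a u) (a v) i := by
        fin_cases i <;> simp [asd] <;> ring
      rw [this]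
      field_simp
    · intro w hw
      have hφ : ∀ v ∈ tangentVectors F.bundle.punctured p, fibreCoord M (F.base p.1)
          (fderiv ℝ F.proj p v).2 = R *ᵥ F.vert p v := fun v hv =>
        h3 _ _ fun a ha b hb => F.fderiv_proj_apply hq (F.fst_mem_tangentVectors hv) ha hb
      have hη : ∀ v ∈ tangentVectors F.bundle.punctured p, ∀ b c,
          (fderiv ℝ F.proj p v).2 ![e b, e c] = F.vert p v ⬝ᵥ asd b c := by
        intro v hv b c
        rw [F.fderiv_proj_apply hq (F.fst_mem_tangentVectors hv) (hmem b) (hmem c)]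
        simp [he.forms_apply, dotProduct]
      have h1' : ∀ v ∈ tangentVectors F.bundle.punctured p, (fderiv ℝ F.proj p v).1 = e (a v) := by
        intro v hv
        rw [fderiv_proj]
        exact hea v hv
      rw [phi, F.conformalFactor_proj hq]
      change _ * (Matrix.of ![fibreCoord M (F.base p.1) _, fibreCoord M (F.base p.1) _,
        fibreCoord M (F.base p.1) _]).det + _ = _
      rw [hφ u hu, hφ v hv, hφ w hw, h1' u hu, h1' v hv, h1' w hw, hη u hu, hη v hv, hη w hw,
        det_of_mulVec, h2]
      have hasd : ∀ b c, asd (f⁻¹ • b) (f⁻¹ • c) = (f⁻¹ * f⁻¹) • asd b c := by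
        intro b c
        funext i
        fin_cases i <;> simp [asd] <;> ring
      simp only [stdPhi, Sum.elim_comp_inl, Sum.elim_comp_inr, hasd, map_smul, LinearMap.smul_apply,
        smul_dotProduct, dotProduct_smul, smul_eq_mul, ← hf]
      field_simp
  · intro x
    obtain ⟨u, hu, h4, h5⟩ := F.horizontal _ hq (e (f • (x ∘ Sum.inr))) (hmem _)
    refine ⟨(u, f⁻¹ • (x ∘ Sum.inl)), F.mem_tangentVectors_punctured hy hu, ?_⟩
    simp only [ha _ (u, f⁻¹ • (x ∘ Sum.inl)) h5, vert_apply, h4, map_zero, LinearMap.zero_apply, add_zero, smul_smul,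
      mul_inv_cancel₀ hf0.ne', inv_mul_cancel₀ hf0.ne', one_smul]
    exact Sum.elim_comp_inl_inr x

theorem hasDerivAt_potential {μ : ℝ → ℝ} {μ' : ℝ} {p : Q × (Fin 3 → ℝ)} (hp : p.2 ≠ 0)
    (hμ : HasDerivAt μ μ' (len p.2)) (u v : Q × (Fin 3 → ℝ)) :
    HasDerivAt (fun t : ℝ => F.potential μ (p + t • u) v)
      (F.conn u.1 v.1 + ((μ' * ((p.2 ⬝ᵥ u.2) / len p.2)) • crossProduct p.2 (F.vert p v) +
        μ (len p.2) • (crossProduct u.2 (F.vert p v) + crossProduct p.2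
          (crossProduct (F.conn u.1 v.1) p.2 + crossProduct (F.conn p.1 v.1) u.2)))) 0 := by
  have h0 : HasDerivAt (fun t : ℝ => p + t • u) u 0 := by
    simpa using ((hasDerivAt_id (0 : ℝ)).smul_const u).const_add p
  have h1 : HasDerivAt (fun t : ℝ => p.1 + t • u.1) u.1 0 := by
    simpa using ((hasDerivAt_id (0 : ℝ)).smul_const u.1).const_add p.1
  have h2 : HasDerivAt (fun t : ℝ => p.2 + t • u.2) u.2 0 := by
    simpa using ((hasDerivAt_id (0 : ℝ)).smul_const u.2).const_add p.2
  have hc : HasDerivAt (fun t : ℝ => F.conn (p.1 + t • u.1) v.1) (F.conn u.1 v.1) 0 :=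
    ((ContinuousLinearMap.apply ℝ (Fin 3 → ℝ) v.1) ∘L F.conn).hasFDerivAt.comp_hasDerivAt (0 : ℝ) h1
  have hv : HasDerivAt (fun t : ℝ => v.2 + crossProduct (F.conn (p.1 + t • u.1) v.1)
      (p.2 + t • u.2)) (crossProduct (F.conn p.1 v.1) u.2 + crossProduct (F.conn u.1 v.1) p.2) 0 := by
    simpa using (hasDerivAt_cross hc h2).const_add v.2
  have hl : HasDerivAt (fun t : ℝ => len (p.2 + t • u.2)) ((p.2 ⬝ᵥ u.2) / len p.2) 0 := by
    simpa using hasDerivAt_len h2 (by simpa using hp)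
  have hm : HasDerivAt (fun t : ℝ => μ (len (p.2 + t • u.2)))
      (μ' * ((p.2 ⬝ᵥ u.2) / len p.2)) 0 :=
    HasDerivAt.comp (0 : ℝ) (h₂ := μ) (by simpa using hμ) hl
  have := hc.add (hm.smul (hasDerivAt_cross h2 hv))
  refine this.congr_deriv ?_
  simp only [zero_smul, add_zero, vert_apply]
  rw [add_comm (μ (len p.2) • _), add_comm (crossProduct p.2 _) (crossProduct u.2 _),
    add_comm (crossProduct (F.conn p.1 v.1) u.2)]

variable {μ χ : ℝ → ℝ} (hμ : ContDiffOn ℝ ∞ μ (Ioi 0)) (hχ : ContDiffOn ℝ ∞ χ (Ioi 0))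

theorem gaugePair_fderiv_form {p : Q × (Fin 3 → ℝ)} (hp : p.2 ≠ 0)
    {μ' : ℝ} (hμ' : HasDerivAt μ μ' (len p.2)) (u v : Q × (Fin 3 → ℝ)) :
    fderiv ℝ (F.gaugePair μ χ hμ hχ).form p u v =
      L.gen (F.conn u.1 v.1 + ((μ' * ((p.2 ⬝ᵥ u.2) / len p.2)) • crossProduct p.2 (F.vert p v) +
        μ (len p.2) • (crossProduct u.2 (F.vert p v) + crossProduct p.2
          (crossProduct (F.conn u.1 v.1) p.2 + crossProduct (F.conn p.1 v.1) u.2)))) := by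
  have hd : DifferentiableAt ℝ (F.gaugePair μ χ hμ hχ).form p := by
    have h := (F.potential_smooth (X := ℝ) (μ := fun _ => μ) (contDiffOn_const_prod hμ)).comp
        (s := {p : Q × (Fin 3 → ℝ) | p.2 ≠ 0}) (contDiff_const (c := (0 : ℝ)).prodMk
          contDiff_id).contDiffOn fun p hp => ⟨mem_univ _, hp⟩
    have h2 := (contDiffOn_const (c := L.genCLM)).clm_comp h
    exact ((h2.contDiffAt (isOpen_snd_ne_zero.mem_nhds hp)).differentiableAt (by simp))
  have h1 := hd.hasFDerivAt.hasLineDerivAt u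
  have h2 : HasDerivAt (fun t : ℝ => (F.gaugePair μ χ hμ hχ).form (p + t • u) v)
      (fderiv ℝ (F.gaugePair μ χ hμ hχ).form p u v) 0 :=
    (ContinuousLinearMap.apply ℝ (Matrix m m 𝕜) v).hasFDerivAt.comp_hasDerivAt (0 : ℝ) h1
  exact h2.unique (L.genCLM.hasFDerivAt.comp_hasDerivAt (0 : ℝ)
    (F.hasDerivAt_potential hp hμ' u v))

theorem curvature_identity (μ ν s : ℝ) (y d d' a a' r : Fin 3 → ℝ) (c c' : Fin 3 → ℝ)
    (u u' : Fin 3 → ℝ) (hu : u = d - crossProduct a y) (hu' : u' = d' - crossProduct a' y)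
    (hc : c = r - crossProduct a a' + c') (hs : s ≠ 0) :
    (c + ((ν * s * ((y ⬝ᵥ u) / s)) • crossProduct y d' + μ • (crossProduct u d' + crossProduct y
        (crossProduct c y + crossProduct a' u)))) -
      (c' + ((ν * s * ((y ⬝ᵥ u') / s)) • crossProduct y d + μ • (crossProduct u' d + crossProduct y
        (crossProduct c' y + crossProduct a u')))) +
      crossProduct (a + μ • crossProduct y d) (a' + μ • crossProduct y d') =
    (ν • ((y ⬝ᵥ d) • crossProduct y d' - (y ⬝ᵥ d') • crossProduct y d) +
      (2 * μ) • crossProduct d d' +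
      (μ ^ 2) • crossProduct (crossProduct y d) (crossProduct y d')) +
      (r + μ • crossProduct y (crossProduct r y)) := by
  subst hu hu' hc
  have h1 : ∀ z, ν * s * (z / s) = ν * z := fun z => by field_simp
  rw [h1, h1]
  apply vec_ext <;>
    simp only [cross_zero, cross_one, cross_two, dot_eq, Pi.add_apply, Pi.sub_apply, Pi.smul_apply,
      smul_eq_mul] <;> ring

theorem gaugePair_curvature {p u v : Q × (Fin 3 → ℝ)} (hp : p.1 ∈ F.total) (hy : p.2 ≠ 0)
    (hu : u.1 ∈ tangentVectors F.total p.1) (hv : v.1 ∈ tangentVectors F.total p.1)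
    {ν : ℝ} (hμ' : HasDerivAt μ (ν * len p.2) (len p.2)) {r : Fin 3 → ℝ}
    (hr : ∀ i, F.forms p.1 i ![fderiv ℝ F.base p.1 u.1, fderiv ℝ F.base p.1 v.1] = 2 * r i) :
    (F.gaugePair μ χ hμ hχ).curvature p u v = L.gen
      ((ν • ((p.2 ⬝ᵥ F.vert p u) • crossProduct p.2 (F.vert p v) -
          (p.2 ⬝ᵥ F.vert p v) • crossProduct p.2 (F.vert p u)) +
        (2 * μ (len p.2)) • crossProduct (F.vert p u) (F.vert p v) +
        (μ (len p.2) ^ 2) • crossProduct (crossProduct p.2 (F.vert p u))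
          (crossProduct p.2 (F.vert p v))) +
        (r + μ (len p.2) • crossProduct p.2 (crossProduct r p.2))) := by
  have hc : F.conn u.1 v.1 = r - crossProduct (F.conn p.1 u.1) (F.conn p.1 v.1) +
      F.conn v.1 u.1 := by
    funext i
    have := F.curvature _ hp _ hu _ hv i
    rw [hr] at this
    simp only [Pi.add_apply, Pi.sub_apply] at this ⊢
    linarith
  rw [← curvature_identity (μ (len p.2)) ν (len p.2) p.2 (F.vert p u) (F.vert p v)
    (F.conn p.1 u.1) (F.conn p.1 v.1) r _ _ u.2 v.2 (by simp) (by simp) hc (len_pos hy).ne']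
  rw [GaugePair.curvature, F.gaugePair_fderiv_form hμ hχ hy hμ',
    F.gaugePair_fderiv_form hμ hχ hy hμ', ← map_sub]
  change _ + (L.gen (F.potential μ p u) * L.gen (F.potential μ p v) -
    L.gen (F.potential μ p v) * L.gen (F.potential μ p u)) = _
  rw [L.bracket, ← map_add]
  rfl

theorem gaugePair_covDeriv {p v : Q × (Fin 3 → ℝ)} (hy : p.2 ≠ 0)
    {ρ : ℝ} (hχ' : HasDerivAt χ (ρ * len p.2) (len p.2)) :
    (F.gaugePair μ χ hμ hχ).covDeriv p v = L.gen
      ((ρ * (p.2 ⬝ᵥ F.vert p v)) • p.2 + χ (len p.2) • F.vert p v +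
        (χ (len p.2) * μ (len p.2)) • crossProduct (crossProduct p.2 (F.vert p v)) p.2) := by
  have hd : DifferentiableAt ℝ (F.gaugePair μ χ hμ hχ).higgs p := by
    have h := (higgs_smooth (L := L) (Q := Q) (X := ℝ) (χ := fun _ => χ)
      (contDiffOn_const_prod hχ)).comp
        (s := {p : Q × (Fin 3 → ℝ) | p.2 ≠ 0}) (contDiff_const (c := (0 : ℝ)).prodMk
          contDiff_id).contDiffOn fun p hp => ⟨mem_univ _, hp⟩
    exact ((h.contDiffAt (isOpen_snd_ne_zero.mem_nhds hy)).differentiableAt (by simp))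
  have h1 := hd.hasFDerivAt.hasLineDerivAt v
  have h2 : HasDerivAt (fun t : ℝ => p.2 + t • v.2) v.2 0 := by
    simpa using ((hasDerivAt_id (0 : ℝ)).smul_const v.2).const_add p.2
  have hl : HasDerivAt (fun t : ℝ => len (p.2 + t • v.2)) ((p.2 ⬝ᵥ v.2) / len p.2) 0 := by
    simpa using hasDerivAt_len h2 (by simpa using hy)
  have hm : HasDerivAt (fun t : ℝ => χ (len (p.2 + t • v.2)))
      (ρ * len p.2 * ((p.2 ⬝ᵥ v.2) / len p.2)) 0 :=
    HasDerivAt.comp (0 : ℝ) (h₂ := χ) (by simpa using hχ') hl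
  have h3 := L.genCLM.hasFDerivAt.comp_hasDerivAt (0 : ℝ) (hm.smul h2)
  have h4 : fderiv ℝ (F.gaugePair μ χ hμ hχ).higgs p v = L.gen (χ (len p.2) • v.2 +
      (ρ * len p.2 * ((p.2 ⬝ᵥ v.2) / len p.2)) • p.2) := by
    refine HasDerivAt.unique h1 ?_
    convert h3 using 1
    · funext t
      simp [gaugePair]
    · simp
  have h5 : ρ * len p.2 * ((p.2 ⬝ᵥ v.2) / len p.2) = ρ * (p.2 ⬝ᵥ v.2) := by
    have := (len_pos hy).ne'
    field_simp
  have h6 : (F.gaugePair μ χ hμ hχ).higgs p = L.gen (χ (len p.2) • p.2) := (map_smul _ _ _).symm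
  rw [GaugePair.covDeriv, h4, h5, h6]
  change _ + (L.gen (F.potential μ p v) * _ - _ * L.gen (F.potential μ p v)) = _
  rw [L.bracket, ← map_add]
  congr 1
  apply vec_ext <;>
    simp only [potential_apply, vert_apply, cross_zero, cross_one, cross_two, dot_eq, Pi.add_apply, Pi.smul_apply, smul_eq_mul] <;> ring

end AsdFrames

end

section

/-! ### Sums over orthonormal frames -/

section Frames

variable {ι κ W A B : Type*} [Fintype ι] [Fintype κ] [DecidableEq ι] [DecidableEq κ]
  [AddCommGroup W] [Module ℝ W] [AddCommGroup A] [Module ℝ A] [AddCommGroup B] [Module ℝ B]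

theorem sum_frame {x : κ → ι → ℝ} (hc : Fintype.card κ = Fintype.card ι)
    (hx : ∀ i j, x i ⬝ᵥ x j = if i = j then 1 else 0) (T : (ι → ℝ) →ₗ[ℝ] (ι → ℝ) →ₗ[ℝ] W) :
    ∑ i, T (x i) (x i) = ∑ k, T (Pi.single k 1) (Pi.single k 1) := by
  have h1 : (Matrix.of x) * (Matrix.of x)ᵀ = 1 := by
    ext i j
    rw [Matrix.one_apply, ← hx]
    simp [Matrix.mul_apply, dotProduct]
  have h2 := (Matrix.mul_eq_one_comm_of_card_eq κ ι ℝ hc).1 h1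
  have h3 : ∀ k l, ∑ i, x i k * x i l = if k = l then 1 else 0 := by
    intro k l
    rw [← Matrix.one_apply, ← h2]
    simp [Matrix.mul_apply]
  have h4 : ∀ i, T (x i) (x i) =
      ∑ k, ∑ l, (x i k * x i l) • T (Pi.single k 1) (Pi.single l 1) := by
    intro i
    have h5 : x i = ∑ k, x i k • Pi.single k (1 : ℝ) := pi_eq_sum_univ' (x i)
    conv_lhs => rw [h5]
    simp only [map_sum, map_smul, LinearMap.sum_apply, LinearMap.smul_apply, Finset.smul_sum,
      smul_smul]
    rw [Finset.sum_comm]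
    refine Finset.sum_congr rfl fun k _ => Finset.sum_congr rfl fun l _ => ?_
    rw [mul_comm]
  simp only [h4]
  rw [Finset.sum_comm]
  refine Finset.sum_congr rfl fun k _ => ?_
  rw [Finset.sum_comm]
  simp only [← Finset.sum_smul, h3, ite_smul, one_smul, zero_smul]
  simp

theorem sum_sum_frame {x : κ → ι → ℝ} (hc : Fintype.card κ = Fintype.card ι)
    (hx : ∀ i j, x i ⬝ᵥ x j = if i = j then 1 else 0) (C : A →ₗ[ℝ] B →ₗ[ℝ] W)
    (S : (ι → ℝ) →ₗ[ℝ] (ι → ℝ) →ₗ[ℝ] A) (T : (ι → ℝ) →ₗ[ℝ] (ι → ℝ) →ₗ[ℝ] B) :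
    ∑ i, ∑ j, C (S (x i) (x j)) (T (x i) (x j)) =
      ∑ k, ∑ l, C (S (Pi.single k 1) (Pi.single l 1)) (T (Pi.single k 1) (Pi.single l 1)) := by
  have h1 : ∀ i, ∑ j, C (S (x i) (x j)) (T (x i) (x j)) =
      ∑ l, C (S (x i) (Pi.single l 1)) (T (x i) (Pi.single l 1)) := fun i =>
    sum_frame hc hx (C.compl₁₂ (S (x i)) (T (x i)))
  simp only [h1]
  rw [Finset.sum_comm]
  rw [Finset.sum_comm (γ := ι) (α := ι)]
  refine Finset.sum_congr rfl fun l _ => ?_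
  exact sum_frame hc hx (C.compl₁₂ (S.flip (Pi.single l 1)) (T.flip (Pi.single l 1)))

theorem sum_Ioi_of_symm {n : ℕ} {S : Fin n → Fin n → ℝ} (h0 : ∀ i, S i i = 0)
    (hs : ∀ i j, S i j = S j i) :
    ∑ i, ∑ j ∈ Finset.Ioi i, S i j = 1 / 2 * ∑ i, ∑ j, S i j := by
  have h1 : ∀ i, ∑ j ∈ Finset.Ioi i, S i j = ∑ j, if i < j then S i j else 0 := by
    intro i
    rw [← Finset.sum_filter]
    congr 1
    ext j; simp
  have h2 : ∑ i, ∑ j, S i j = (∑ i, ∑ j, if i < j then S i j else 0) +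
      ∑ i, ∑ j, if j < i then S i j else 0 := by
    rw [← Finset.sum_add_distrib]
    refine Finset.sum_congr rfl fun i _ => ?_
    rw [← Finset.sum_add_distrib]
    refine Finset.sum_congr rfl fun j _ => ?_
    rcases lt_trichotomy i j with h | rfl | h
    · simp [h, h.not_gt]
    · simp [h0]
    · simp [h, h.not_gt]
  have h3 : (∑ i, ∑ j, if j < i then S i j else 0) = ∑ i, ∑ j, if i < j then S i j else 0 := by
    rw [Finset.sum_comm]
    refine Finset.sum_congr rfl fun i _ => Finset.sum_congr rfl fun j _ => ?_
    rw [hs j i]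
  simp only [h1]
  rw [h2, h3]
  ring

end Frames

/-! ### The standard `G₂`-structure -/

theorem asd_zero (a b : Fin 4 → ℝ) :
    asd a b 0 = a 0 * b 1 - a 1 * b 0 - (a 2 * b 3 - a 3 * b 2) := rfl

theorem asd_one (a b : Fin 4 → ℝ) :
    asd a b 1 = a 0 * b 2 - a 2 * b 0 - (a 3 * b 1 - a 1 * b 3) := rfl

theorem asd_two (a b : Fin 4 → ℝ) :
    asd a b 2 = a 0 * b 3 - a 3 * b 0 - (a 1 * b 2 - a 2 * b 1) := rfl

theorem stdPhi_swap_left (x y z : Fin 3 ⊕ Fin 4 → ℝ) : stdPhi y x z = -stdPhi x y z := by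
  simp only [stdPhi, cross_zero, cross_one, cross_two, dot_eq, asd_zero, asd_one, asd_two]
  ring

theorem stdPhi_swap_right (x y z : Fin 3 ⊕ Fin 4 → ℝ) : stdPhi x z y = -stdPhi x y z := by
  simp only [stdPhi, cross_zero, cross_one, cross_two, dot_eq, asd_zero, asd_one, asd_two]
  ring

theorem stdPhi_alternating (x : Fin 7 → Fin 3 ⊕ Fin 4 → ℝ) (I : Fin 3 → Fin 7)
    (σ : Equiv.Perm (Fin 3)) :
    stdPhi (x ((I ∘ σ) 0)) (x ((I ∘ σ) 1)) (x ((I ∘ σ) 2)) =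
      ((Equiv.Perm.sign σ : ℤ) : ℝ) * stdPhi (x (I 0)) (x (I 1)) (x (I 2)) := by
  induction σ using Equiv.Perm.swap_induction_on generalizing I with
  | one => simp
  | swap_mul f a b hab ih =>
    have h := ih (I ∘ Equiv.swap a b)
    rw [Function.comp_assoc, ← Equiv.Perm.coe_mul] at h
    rw [h, Equiv.Perm.sign_mul, Equiv.Perm.sign_swap hab]
    have h2 : stdPhi (x ((I ∘ Equiv.swap a b) 0)) (x ((I ∘ Equiv.swap a b) 1))
        (x ((I ∘ Equiv.swap a b) 2)) = -stdPhi (x (I 0)) (x (I 1)) (x (I 2)) := by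
      have e1 := stdPhi_swap_left (x (I 0)) (x (I 1)) (x (I 2))
      have e2 := stdPhi_swap_right (x (I 0)) (x (I 1)) (x (I 2))
      have e3 : stdPhi (x (I 2)) (x (I 1)) (x (I 0)) = -stdPhi (x (I 0)) (x (I 1)) (x (I 2)) := by
        rw [stdPhi_swap_left, stdPhi_swap_right, stdPhi_swap_left]
        ring
      fin_cases a <;> fin_cases b <;> simp [Equiv.swap_apply_def] at hab ⊢ <;> assumption
    rw [h2]
    push_cast
    ring

/-- The contraction of the standard three-form with a vector. -/
def stdPhiBilin (x : Fin 3 ⊕ Fin 4 → ℝ) :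
    (Fin 3 ⊕ Fin 4 → ℝ) →ₗ[ℝ] (Fin 3 ⊕ Fin 4 → ℝ) →ₗ[ℝ] ℝ :=
  LinearMap.mk₂ ℝ (stdPhi x)
    (fun y y' z => by
      simp only [stdPhi, cross_zero, cross_one, cross_two, dot_eq, asd_zero, asd_one, asd_two,
        Function.comp_apply, Pi.add_apply]
      ring)
    (fun c y z => by
      simp only [stdPhi, cross_zero, cross_one, cross_two, dot_eq, asd_zero, asd_one, asd_two,
        Function.comp_apply, Pi.smul_apply, smul_eq_mul]
      ring)
    (fun y z z' => by
      simp only [stdPhi, cross_zero, cross_one, cross_two, dot_eq, asd_zero, asd_one, asd_two,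
        Function.comp_apply, Pi.add_apply]
      ring)
    (fun c y z => by
      simp only [stdPhi, cross_zero, cross_one, cross_two, dot_eq, asd_zero, asd_one, asd_two,
        Function.comp_apply, Pi.smul_apply, smul_eq_mul]
      ring)

/-- The curvature in an orthonormal frame as a bilinear map. -/
def stdCurvBilin (f μ ν : ℝ) (y : Fin 3 → ℝ) :
    (Fin 3 ⊕ Fin 4 → ℝ) →ₗ[ℝ] (Fin 3 ⊕ Fin 4 → ℝ) →ₗ[ℝ] (Fin 3 → ℝ) :=
  LinearMap.mk₂ ℝ (stdCurv f μ ν y)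
    (fun u u' v => by
      apply vec_ext <;>
      simp only [stdCurv, cross_zero, cross_one, cross_two, dot_eq, asd_zero, asd_one, asd_two,
        Function.comp_apply, Pi.add_apply, Pi.sub_apply, Pi.smul_apply, smul_eq_mul] <;>
      ring)
    (fun c u v => by
      apply vec_ext <;>
      simp only [stdCurv, cross_zero, cross_one, cross_two, dot_eq, asd_zero, asd_one, asd_two,
        Function.comp_apply, Pi.add_apply, Pi.sub_apply, Pi.smul_apply, smul_eq_mul] <;>
      ring)
    (fun u v v' => by
      apply vec_ext <;>
      simp only [stdCurv, cross_zero, cross_one, cross_two, dot_eq, asd_zero, asd_one, asd_two,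
        Function.comp_apply, Pi.add_apply, Pi.sub_apply, Pi.smul_apply, smul_eq_mul] <;>
      ring)
    (fun c u v => by
      apply vec_ext <;>
      simp only [stdCurv, cross_zero, cross_one, cross_two, dot_eq, asd_zero, asd_one, asd_two,
        Function.comp_apply, Pi.add_apply, Pi.sub_apply, Pi.smul_apply, smul_eq_mul] <;>
      ring)

theorem single_inl_comp_inl (k : Fin 3) :
    (Pi.single (Sum.inl k) 1 : Fin 3 ⊕ Fin 4 → ℝ) ∘ Sum.inl = Pi.single k 1 := by
  funext i; simp [Pi.single_apply]

theorem single_inl_comp_inr (k : Fin 3) :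
    (Pi.single (Sum.inl k) 1 : Fin 3 ⊕ Fin 4 → ℝ) ∘ Sum.inr = 0 := by
  funext i; simp

theorem single_inr_comp_inr (k : Fin 4) :
    (Pi.single (Sum.inr k) 1 : Fin 3 ⊕ Fin 4 → ℝ) ∘ Sum.inr = Pi.single k 1 := by
  funext i; simp [Pi.single_apply]

theorem single_inr_comp_inl (k : Fin 4) :
    (Pi.single (Sum.inr k) 1 : Fin 3 ⊕ Fin 4 → ℝ) ∘ Sum.inl = 0 := by
  funext i; simp

theorem asd_zero_left (b : Fin 4 → ℝ) : asd 0 b = 0 := by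
  apply vec_ext <;> simp [asd_zero, asd_one, asd_two]

theorem asd_zero_right (b : Fin 4 → ℝ) : asd b 0 = 0 := by
  apply vec_ext <;> simp [asd_zero, asd_one, asd_two]

section Standard

variable (f μ ν : ℝ) (y : Fin 3 → ℝ)

theorem stdCurv_inl_inl (k l : Fin 3) :
    stdCurv f μ ν y (Pi.single (Sum.inl k) 1) (Pi.single (Sum.inl l) 1) =
      (f⁻¹ ^ 2) • (ν • (y k • crossProduct y (Pi.single l 1) - y l • crossProduct y (Pi.single k 1)) +
      (2 * μ) • crossProduct (Pi.single k 1) (Pi.single l 1) +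
      (μ ^ 2) • crossProduct (crossProduct y (Pi.single k 1)) (crossProduct y (Pi.single l 1))) := by
  simp [stdCurv, single_inl_comp_inl, single_inl_comp_inr, asd_zero_left]

theorem stdCurv_inr_inr (k l : Fin 4) :
    stdCurv f μ ν y (Pi.single (Sum.inr k) 1) (Pi.single (Sum.inr l) 1) =
      (f ^ 2 / 2) • (asd (Pi.single k 1) (Pi.single l 1) +
        μ • crossProduct y (crossProduct (asd (Pi.single k 1) (Pi.single l 1)) y)) := by
  simp [stdCurv, single_inr_comp_inl, single_inr_comp_inr]

theorem stdCurv_inl_inr (k : Fin 3) (l : Fin 4) :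
    stdCurv f μ ν y (Pi.single (Sum.inl k) 1) (Pi.single (Sum.inr l) 1) = 0 := by
  simp [stdCurv, single_inr_comp_inl, single_inr_comp_inr, single_inl_comp_inl,
    single_inl_comp_inr, asd_zero_left]

theorem stdCurv_inr_inl (k : Fin 4) (l : Fin 3) :
    stdCurv f μ ν y (Pi.single (Sum.inr k) 1) (Pi.single (Sum.inl l) 1) = 0 := by
  simp [stdCurv, single_inr_comp_inl, single_inr_comp_inr, single_inl_comp_inl,
    single_inl_comp_inr, asd_zero_right]

theorem sum_stdPhi_smul_stdCurv (x : Fin 3 ⊕ Fin 4 → ℝ) :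
    (1 / 2 : ℝ) • ∑ k, ∑ l, stdPhi x (Pi.single k 1) (Pi.single l 1) •
      stdCurv f μ ν y (Pi.single k 1) (Pi.single l 1) =
    (f⁻¹ ^ 2 * ((y ⬝ᵥ y) * ν + 2 * μ) + f ^ 2 * (1 + μ * (y ⬝ᵥ y))) • (x ∘ Sum.inl) +
      ((f⁻¹ ^ 2 * (μ ^ 2 - ν) - f ^ 2 * μ) * (y ⬝ᵥ (x ∘ Sum.inl))) • y := by
  simp only [Fintype.sum_sum_type, stdCurv_inl_inl, stdCurv_inl_inr, stdCurv_inr_inl,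
    stdCurv_inr_inr, smul_zero, Finset.sum_const_zero, add_zero, zero_add]
  have h1 : ∀ k l : Fin 3, stdPhi x (Pi.single (Sum.inl k) 1) (Pi.single (Sum.inl l) 1) =
      (x ∘ Sum.inl) ⬝ᵥ crossProduct (Pi.single k 1) (Pi.single l 1) := by
    intro k l
    simp [stdPhi, single_inl_comp_inl, single_inl_comp_inr, asd_zero_left, asd_zero_right]
  have h2 : ∀ k l : Fin 4, stdPhi x (Pi.single (Sum.inr k) 1) (Pi.single (Sum.inr l) 1) =
      (x ∘ Sum.inl) ⬝ᵥ asd (Pi.single k 1) (Pi.single l 1) := by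
    intro k l
    simp [stdPhi, single_inr_comp_inl, single_inr_comp_inr]
  simp only [h1, h2]
  generalize x ∘ Sum.inl = X
  apply vec_ext <;>
    simp [Fin.sum_univ_three, Fin.sum_univ_four, cross_zero, cross_one, cross_two, dot_eq,
      asd_zero, asd_one, asd_two, Pi.single_apply] <;> ring

theorem sum_stdCurv_dot :
    1 / 2 * ∑ k, ∑ l, stdCurv f μ ν y (Pi.single k 1) (Pi.single l 1) ⬝ᵥ
      stdCurv f μ ν y (Pi.single k 1) (Pi.single l 1) =
    f⁻¹ ^ 4 * ((2 * μ + μ ^ 2 * (y ⬝ᵥ y)) ^ 2 + 2 * ((y ⬝ᵥ y) * ν + 2 * μ) ^ 2) +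
      f ^ 4 * (1 + 2 * (1 + μ * (y ⬝ᵥ y)) ^ 2) / 2 := by
  simp only [Fintype.sum_sum_type, stdCurv_inl_inl, stdCurv_inl_inr, stdCurv_inr_inl,
    stdCurv_inr_inr, zero_dotProduct, Finset.sum_const_zero, add_zero, zero_add]
  simp [Fin.sum_univ_three, Fin.sum_univ_four, cross_zero, cross_one, cross_two, dot_eq,
      asd_zero, asd_one, asd_two, Pi.single_apply]
  ring

theorem stdMonopole {f μ ν χ ρ : ℝ} {y : Fin 3 → ℝ} (hy : y ≠ 0)
    (h1 : f⁻¹ ^ 2 * (2 * μ + μ ^ 2 * (y ⬝ᵥ y)) + f ^ 2 = f⁻¹ * (ρ * (y ⬝ᵥ y) + χ))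
    (h2 : f⁻¹ ^ 2 * ((y ⬝ᵥ y) * ν + 2 * μ) + f ^ 2 * (1 + μ * (y ⬝ᵥ y)) =
      f⁻¹ * χ * (1 + μ * (y ⬝ᵥ y))) (x : Fin 3 ⊕ Fin 4 → ℝ) :
    (1 / 2 : ℝ) • ∑ k, ∑ l, stdPhi x (Pi.single k 1) (Pi.single l 1) •
      stdCurv f μ ν y (Pi.single k 1) (Pi.single l 1) = stdCov f μ χ ρ y x := by
  rw [sum_stdPhi_smul_stdCurv, h2]
  have h3 : f⁻¹ ^ 2 * (μ ^ 2 - ν) - f ^ 2 * μ = f⁻¹ * (ρ - χ * μ) := by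
    have h := (dot_self_pos hy).ne'
    apply mul_left_cancel₀ h
    linear_combination h1 - h2
  rw [h3, stdCov, cross_cross_eq_smul_sub_smul, dotProduct_comm (x ∘ Sum.inl) y]
  apply vec_ext <;> simp only [Pi.add_apply, Pi.smul_apply, Pi.sub_apply, smul_eq_mul] <;> ring

end Standard

variable {𝕜 : Type*} [RCLike 𝕜] {m : Type*} [Fintype m] [DecidableEq m]
  {E : Type*} [NormedAddCommGroup E] [InnerProductSpace ℝ E] {M : OrientedSubmanifold E}

namespace AsdFrames

variable {G : Submonoid (Matrix m m 𝕜)} {κ : ℝ} {L : LieModel G κ}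
  {Q : Type*} [NormedAddCommGroup Q] [NormedSpace ℝ Q] (F : AsdFrames M L Q)

variable {μ χ : ℝ → ℝ} (hμ : ContDiffOn ℝ ∞ μ (Ioi 0)) (hχ : ContDiffOn ℝ ∞ χ (Ioi 0))

theorem curvature_eq_stdCurv {p : Q × (Fin 3 → ℝ)} (hp : p ∈ F.bundle.punctured)
    {ν : ℝ} (hμ' : HasDerivAt μ (ν * len p.2) (len p.2))
    {θ : (Q × (Fin 3 → ℝ)) → (Fin 3 ⊕ Fin 4 → ℝ)}
    (h1 : ∀ v, θ v ∘ Sum.inl = scaleFactor (len p.2) • F.vert p v) {u v : Q × (Fin 3 → ℝ)}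
    (hu : u ∈ tangentVectors F.bundle.punctured p) (hv : v ∈ tangentVectors F.bundle.punctured p)
    (h2 : ∀ i, F.forms p.1 i ![fderiv ℝ F.base p.1 u.1, fderiv ℝ F.base p.1 v.1] =
      scaleFactor (len p.2) ^ 2 * asd (θ u ∘ Sum.inr) (θ v ∘ Sum.inr) i) :
    (F.gaugePair μ χ hμ hχ).curvature p u v =
      L.gen (stdCurv (scaleFactor (len p.2)) (μ (len p.2)) ν p.2 (θ u) (θ v)) := by
  obtain ⟨hq, hy⟩ := F.mem_punctured_iff.1 hp
  have hf : scaleFactor (len p.2) ≠ 0 := (scaleFactor_pos _).ne'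
  have h3 : ∀ v, F.vert p v = (scaleFactor (len p.2))⁻¹ • (θ v ∘ Sum.inl) := fun v => by
    rw [h1, smul_smul, inv_mul_cancel₀ hf, one_smul]
  rw [F.gaugePair_curvature hμ hχ hq hy (F.fst_mem_tangentVectors hu)
    (F.fst_mem_tangentVectors hv) hμ' (r := (scaleFactor (len p.2) ^ 2 / 2) •
      asd (θ u ∘ Sum.inr) (θ v ∘ Sum.inr)) (fun i => by
        rw [h2]; simp only [Pi.smul_apply, smul_eq_mul]; ring), h3, h3]
  congr 1
  apply vec_ext <;>
    simp only [stdCurv, cross_zero, cross_one, cross_two, dot_eq,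
        Function.comp_apply, Pi.add_apply, Pi.sub_apply, Pi.smul_apply, smul_eq_mul] <;>
      ring

theorem covDeriv_eq_stdCov {p : Q × (Fin 3 → ℝ)} (hy : p.2 ≠ 0)
    {ρ : ℝ} (hχ' : HasDerivAt χ (ρ * len p.2) (len p.2))
    {θ : (Q × (Fin 3 → ℝ)) → (Fin 3 ⊕ Fin 4 → ℝ)}
    (h1 : ∀ v, θ v ∘ Sum.inl = scaleFactor (len p.2) • F.vert p v) (v : Q × (Fin 3 → ℝ)) :
    (F.gaugePair μ χ hμ hχ).covDeriv p v =
      L.gen (stdCov (scaleFactor (len p.2)) (μ (len p.2)) (χ (len p.2)) ρ p.2 (θ v)) := by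
  have hf : scaleFactor (len p.2) ≠ 0 := (scaleFactor_pos _).ne'
  have h3 : F.vert p v = (scaleFactor (len p.2))⁻¹ • (θ v ∘ Sum.inl) := by
    rw [h1, smul_smul, inv_mul_cancel₀ hf, one_smul]
  rw [F.gaugePair_covDeriv hμ hχ hy hχ', h3]
  congr 1
  apply vec_ext <;>
    simp only [stdCov, cross_zero, cross_one, cross_two, dot_eq,
        Function.comp_apply, Pi.add_apply, Pi.smul_apply, smul_eq_mul] <;>
      ring

theorem gaugePair_isMonopole {ν ρ : ℝ → ℝ} (hμ' : ∀ s > 0, HasDerivAt μ (ν s * s) s)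
    (hχ' : ∀ s > 0, HasDerivAt χ (ρ s * s) s)
    (h1 : ∀ s > 0, (scaleFactor s)⁻¹ ^ 2 * (2 * μ s + μ s ^ 2 * s ^ 2) + scaleFactor s ^ 2 =
      (scaleFactor s)⁻¹ * (ρ s * s ^ 2 + χ s))
    (h2 : ∀ s > 0, (scaleFactor s)⁻¹ ^ 2 * (s ^ 2 * ν s + 2 * μ s) +
      scaleFactor s ^ 2 * (1 + μ s * s ^ 2) = (scaleFactor s)⁻¹ * χ s * (1 + μ s * s ^ 2)) :
    (F.gaugePair μ χ hμ hχ).IsMonopole := by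
  intro p hp v hv Φ ψ A i
  obtain ⟨hq, hy⟩ := F.mem_punctured_iff.1 hp
  obtain ⟨hvt, -, ho⟩ := hv
  obtain ⟨θ, t1, t2, -⟩ := F.exists_coframe hp
  have hs := len_pos hy
  have hΦ : ∀ I, Φ I = stdPhi (θ (v (I 0))) (θ (v (I 1))) (θ (v (I 2))) := fun I =>
    (t2 _ (hvt _) _ (hvt _)).2.2 _ (hvt _)
  have hA : ∀ I, A I = L.gen (stdCurv (scaleFactor (len p.2)) (μ (len p.2)) (ν (len p.2)) p.2
      (θ (v (I 0))) (θ (v (I 1)))) := fun I =>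
    F.curvature_eq_stdCurv hμ hχ hp (hμ' _ hs) t1 (hvt _) (hvt _) (t2 _ (hvt _) _ (hvt _)).2.1
  have hort : ∀ i j, θ (v i) ⬝ᵥ θ (v j) = if i = j then 1 else 0 := by
    intro i j
    rw [← (t2 _ (hvt i) _ (hvt j)).1]
    exact ho i j
  have hψ : hodge (k := 6) (l := 1) (wedge (k := 2) (l := 4) A ψ) ![i] =
      (1 / 2 : ℝ) • ∑ a, ∑ b, Φ ![i, a, b] • A ![a, b] := by
    refine hodge_wedge_hodge Φ A (fun I σ => ?_) i
    rw [hΦ, hΦ]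
    exact stdPhi_alternating (fun i => θ (v i)) I σ
  rw [hψ, F.covDeriv_eq_stdCov hμ hχ hy (hχ' _ hs) t1,
    ← stdMonopole (ν := ν (len p.2)) hy (by rw [← len_sq]; exact h1 _ hs)
      (by rw [← len_sq]; exact h2 _ hs)]
  have := sum_sum_frame (by simp) hort (LinearMap.lsmul ℝ (Fin 3 → ℝ)) (stdPhiBilin (θ (v i)))
    (stdCurvBilin (scaleFactor (len p.2)) (μ (len p.2)) (ν (len p.2)) p.2)
  simp only [LinearMap.lsmul_apply] at this
  change ∑ a, ∑ b, stdPhi _ _ _ • stdCurv _ _ _ _ _ _ =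
    ∑ k, ∑ l, stdPhi _ _ _ • stdCurv _ _ _ _ _ _ at this
  rw [← this]
  simp only [map_smul, map_sum, hΦ, hA]
  rfl

theorem exists_isFrameLift {p : Q × (Fin 3 → ℝ)} (hp : p ∈ F.bundle.punctured) :
    ∃ v, F.bundle.IsFrameLift p v := by
  obtain ⟨θ, t1, t2, t3⟩ := F.exists_coframe hp
  choose v hv hθ using fun i : Fin 7 => t3 (Pi.single (finSumFinEquiv (m := 3) (n := 4).symm i) 1)
  refine ⟨v, hv, fun i => fderiv_mem_tangentVectors F.proj_smooth
    (fun p hp => F.proj_mem (F.mem_punctured_iff.1 hp).1 p.2) (hv i), fun i j => ?_⟩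
  refine ((t2 _ (hv i) _ (hv j)).1).trans ?_
  rw [hθ, hθ]
  simp [Pi.single_apply, eq_comm]

theorem gaugePair_curvatureNorm {p : Q × (Fin 3 → ℝ)} (hp : p ∈ F.bundle.punctured)
    {ν : ℝ} (hμ' : HasDerivAt μ (ν * len p.2) (len p.2)) :
    (F.gaugePair μ χ hμ hχ).curvatureNorm κ p = Real.sqrt
      ((scaleFactor (len p.2))⁻¹ ^ 4 * ((2 * μ (len p.2) + μ (len p.2) ^ 2 * len p.2 ^ 2) ^ 2 +
        2 * (len p.2 ^ 2 * ν + 2 * μ (len p.2)) ^ 2) +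
      scaleFactor (len p.2) ^ 4 * (1 + 2 * (1 + μ (len p.2) * len p.2 ^ 2) ^ 2) / 2) := by
  obtain ⟨hvt, -, ho⟩ := Classical.epsilon_spec (p := F.bundle.IsFrameLift p)
    (F.exists_isFrameLift hp)
  obtain ⟨θ, t1, t2, -⟩ := F.exists_coframe hp
  set v := Classical.epsilon (F.bundle.IsFrameLift p) with hv
  have hA : ∀ i j, (F.gaugePair μ χ hμ hχ).curvature p (v i) (v j) =
      L.gen (stdCurv (scaleFactor (len p.2)) (μ (len p.2)) ν p.2 (θ (v i)) (θ (v j))) := fun i j =>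
    F.curvature_eq_stdCurv hμ hχ hp hμ' t1 (hvt _) (hvt _) (t2 _ (hvt _) _ (hvt _)).2.1
  have hort : ∀ i j, θ (v i) ⬝ᵥ θ (v j) = if i = j then 1 else 0 := by
    intro i j
    rw [← (t2 _ (hvt i) _ (hvt j)).1]
    exact ho i j
  have hn : ∀ a, lieNorm κ (L.gen a) ^ 2 = a ⬝ᵥ a := fun a => by
    rw [L.lieNorm_gen]; exact len_sq a
  rw [GaugePair.curvatureNorm]
  change Real.sqrt (∑ i : Fin 7, ∑ j ∈ Finset.Ioi i,
    lieNorm κ ((F.gaugePair μ χ hμ hχ).curvature p (v i) (v j)) ^ 2) = _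
  simp only [hA, hn]
  rw [sum_Ioi_of_symm, len_sq, ← sum_stdCurv_dot]
  · have := sum_sum_frame (by simp) hort (dotProductBilin ℝ ℝ)
      (stdCurvBilin (scaleFactor (len p.2)) (μ (len p.2)) ν p.2)
      (stdCurvBilin (scaleFactor (len p.2)) (μ (len p.2)) ν p.2)
    change ∑ a, ∑ b, stdCurv _ _ _ _ _ _ ⬝ᵥ stdCurv _ _ _ _ _ _ =
      ∑ k, ∑ l, stdCurv _ _ _ _ _ _ ⬝ᵥ stdCurv _ _ _ _ _ _ at this
    rw [this]
  · intro i
    simp only [stdCurv, dot_eq, cross_zero, cross_one, cross_two, asd_zero, asd_one, asd_two,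
      Pi.add_apply, Pi.sub_apply, Pi.smul_apply, smul_eq_mul]
    ring
  · intro i j
    simp only [stdCurv, dot_eq, cross_zero, cross_one, cross_two, asd_zero, asd_one, asd_two,
      Pi.add_apply, Pi.sub_apply, Pi.smul_apply, smul_eq_mul]
    ring

end AsdFrames

end

section

open MeasureTheory

/-! ### The distance to the zero section -/

/-- The length of a fibre segment of Euclidean length `s` that starts in the zero section. -/
def radius (s : ℝ) : ℝ := ∫ t in (0 : ℝ)..s, scaleFactor t

theorem hasDerivAt_radius (s : ℝ) : HasDerivAt radius (scaleFactor s) s :=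
  intervalIntegral.integral_hasDerivAt_right (contDiff_scaleFactor.continuous.intervalIntegrable _ _)
    contDiff_scaleFactor.continuous.aestronglyMeasurable.stronglyMeasurableAtFilter
    contDiff_scaleFactor.continuous.continuousAt

theorem radius_zero : radius 0 = 0 := intervalIntegral.integral_same

theorem continuous_radius : Continuous radius :=
  continuous_iff_continuousAt.2 fun s => (hasDerivAt_radius s).continuousAt

theorem strictMono_radius : StrictMono radius :=
  strictMono_of_hasDerivAt_pos hasDerivAt_radius scaleFactor_pos

theorem tendsto_radius_div : Tendsto (fun s => radius s / s) (𝓝[>] 0) (𝓝 1) := by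
  have h := (hasDerivAt_radius 0).tendsto_slope_zero_right
  simp only [zero_add, radius_zero, sub_zero, smul_eq_mul] at h
  have h1 : scaleFactor 0 = 1 := by simp [scaleFactor]
  rw [h1] at h
  exact h.congr fun s => by rw [inv_mul_eq_div]

variable {𝕜 : Type*} [RCLike 𝕜] {m : Type*} [Fintype m] [DecidableEq m]
  {E : Type*} [NormedAddCommGroup E] [InnerProductSpace ℝ E] {M : OrientedSubmanifold E}

theorem len_nonneg (y : Fin 3 → ℝ) : 0 ≤ len y := Real.sqrt_nonneg _

theorem dot_sq_le (a b : Fin 3 → ℝ) : (a ⬝ᵥ b) ^ 2 ≤ (a ⬝ᵥ a) * (b ⬝ᵥ b) := by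
  have := Finset.sum_mul_sq_le_sq_mul_sq Finset.univ a b
  simpa [dotProduct, sq] using this

theorem zero_mem_tangentVectors {V : Type*} [NormedAddCommGroup V] [NormedSpace ℝ V] {S : Set V}
    {p : V} (hp : p ∈ S) : (0 : V) ∈ tangentVectors S p :=
  ⟨fun _ => p, ⟨contDiff_const, fun _ => hp⟩, rfl, by simp⟩

theorem deriv_mem_tangentVectors {V : Type*} [NormedAddCommGroup V] [NormedSpace ℝ V] {S : Set V}
    {γ : ℝ → V} {J : Set ℝ} (hJ : IsOpen J) (hγ : ContDiffOn ℝ ∞ γ J) (hS : ∀ t ∈ J, γ t ∈ S)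
    {t : ℝ} (ht : t ∈ J) : deriv γ t ∈ tangentVectors S (γ t) := by
  obtain ⟨ε, hε, hεJ⟩ := Metric.isOpen_iff.1 hJ t ht
  obtain ⟨β, h1, h2, h3, h4⟩ := exists_small_curve (half_pos hε)
  have hm : ∀ r, t + β r ∈ J := fun r => hεJ (by
    rw [Metric.mem_ball, Real.dist_eq, add_sub_cancel_left]
    exact (h4 r).trans_lt (half_lt_self hε))
  refine ⟨fun r => γ (t + β r), ⟨hγ.comp_contDiff (contDiff_const.add h1) hm, fun r => hS _ (hm r)⟩,
    by simp [h2], ?_⟩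
  have hd : HasDerivAt γ (deriv γ t) (t + β 0) := by
    rw [h2, add_zero]
    exact ((hγ.contDiffAt (hJ.mem_nhds ht)).differentiableAt (by simp)).hasDerivAt
  have := (hd.scomp (0 : ℝ) (h3.const_add t)).deriv
  rw [one_smul] at this
  exact this

namespace AsdFrames

variable {G : Submonoid (Matrix m m 𝕜)} {κ : ℝ} {L : LieModel G κ}
  {Q : Type*} [NormedAddCommGroup Q] [NormedSpace ℝ Q] (F : AsdFrames M L Q)

/-- The squared speed of the projection of a curve in the total space. -/
def speedSq (p v : Q × (Fin 3 → ℝ)) : ℝ :=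
  scaleFactor (len p.2) ^ 2 * (F.vert p v ⬝ᵥ F.vert p v) + (scaleFactor (len p.2) ^ 2)⁻¹ *
    inner ℝ (fderiv ℝ F.base p.1 v.1) (fderiv ℝ F.base p.1 v.1)

theorem continuous_speedSq :
    Continuous fun x : (Q × (Fin 3 → ℝ)) × (Q × (Fin 3 → ℝ)) => F.speedSq x.1 x.2 := by
  have h1 : Continuous fun x : (Q × (Fin 3 → ℝ)) × (Q × (Fin 3 → ℝ)) => F.vert x.1 x.2 :=
    (F.vert_smooth.continuous.comp continuous_fst).clm_apply continuous_snd
  have h2 : Continuous fun x : (Q × (Fin 3 → ℝ)) × (Q × (Fin 3 → ℝ)) =>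
      fderiv ℝ F.base x.1.1 x.2.1 :=
    ((F.base_smooth.continuous_fderiv (by simp)).comp continuous_fst.fst).clm_apply
      continuous_snd.fst
  have h3 : Continuous fun x : (Q × (Fin 3 → ℝ)) × (Q × (Fin 3 → ℝ)) =>
      scaleFactor (len x.1.2) := by
    refine contDiff_scaleFactor.continuous.comp ?_
    exact Real.continuous_sqrt.comp (contDiff_dot_self.continuous.comp continuous_fst.snd)
  unfold speedSq
  refine ((h3.pow 2).mul ?_).add (((h3.pow 2).inv₀ fun x => ?_).mul (h2.inner h2))
  · simp only [dotProduct]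
    fun_prop
  · exact pow_ne_zero _ (scaleFactor_pos _).ne'

/-- A curve in the bundle of anti-self-dual forms lifts locally to the frame bundle. -/
theorem exists_local_lift (F : AsdFrames M L Q) {γ : ℝ → E × (E [⋀^Fin 2]→L[ℝ] ℝ)} (hγ : ContDiff ℝ ∞ γ)
    (hm : ∀ t ∈ Icc (0 : ℝ) 1, γ t ∈ asdBundle M) {t₀ : ℝ} (ht₀ : t₀ ∈ Icc (0 : ℝ) 1) :
    ∃ (J : Set ℝ) (p : ℝ → Q × (Fin 3 → ℝ)), IsOpen J ∧ t₀ ∈ J ∧ ContDiffOn ℝ ∞ p J ∧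
      (∀ t ∈ J ∩ Icc 0 1, (p t).1 ∈ F.total ∧ F.proj (p t) = γ t) ∧
      ∀ t ∈ J ∩ Ioo 0 1, (deriv p t).1 ∈ tangentVectors F.total (p t).1 ∧
        deriv γ t = fderiv ℝ F.proj (p t) (deriv p t) := by
  obtain ⟨W, σ, τ, hW, hx, hσ, -, h1, -⟩ := F.exists_section (γ t₀).1 (hm t₀ ht₀).1
  have hJ : IsOpen (γ ⁻¹' W) := hW.preimage hγ.continuous
  have hp : ContDiffOn ℝ ∞ (fun t => σ (γ t)) (γ ⁻¹' W) :=
    hσ.comp hγ.contDiffOn fun t ht => ht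
  have hlift : ∀ t ∈ γ ⁻¹' W ∩ Icc 0 1, (σ (γ t)).1 ∈ F.total ∧ F.proj (σ (γ t)) = γ t := by
    rintro t ⟨ht, ht'⟩
    obtain ⟨h2, h3, -⟩ := h1 (γ t) ⟨hm t ht', ht⟩
    exact ⟨h2, h3⟩
  refine ⟨γ ⁻¹' W, fun t => σ (γ t), hJ, hx _, hp, hlift, fun t ht => ?_⟩
  have hJ' : IsOpen (γ ⁻¹' W ∩ Ioo 0 1) := hJ.inter isOpen_Ioo
  have hd : HasDerivAt (fun t => σ (γ t)) (deriv (fun t => σ (γ t)) t) t :=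
    ((hp.contDiffAt (hJ.mem_nhds ht.1)).differentiableAt (by simp)).hasDerivAt
  constructor
  · have := deriv_mem_tangentVectors (S := F.total) (γ := fun t => (σ (γ t)).1) hJ'
      (contDiff_fst.comp_contDiffOn (hp.mono inter_subset_left))
      (fun t ht => (hlift t ⟨ht.1, Ioo_subset_Icc_self ht.2⟩).1) ht
    rwa [HasDerivAt.deriv (f := fun t => (σ (γ t)).1)
      ((ContinuousLinearMap.fst ℝ Q (Fin 3 → ℝ)).hasFDerivAt.comp_hasDerivAt t hd)] at this
  · have h3 : HasDerivAt (fun t => F.proj (σ (γ t)))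
        (fderiv ℝ F.proj (σ (γ t)) (deriv (fun t => σ (γ t)) t)) t :=
      (F.proj_smooth.differentiable (by simp) _).hasFDerivAt.comp_hasDerivAt t hd
    rw [← h3.deriv]
    refine Filter.EventuallyEq.deriv_eq ?_
    filter_upwards [hJ'.mem_nhds ht] with r hr
    exact (hlift r ⟨hr.1, Ioo_subset_Icc_self hr.2⟩).2.symm

theorem metric_eq_speedSq {γ : ℝ → E × (E [⋀^Fin 2]→L[ℝ] ℝ)} {p : Q × (Fin 3 → ℝ)}
    {v : Q × (Fin 3 → ℝ)} {t : ℝ} (hp : p.1 ∈ F.total) (hv : v.1 ∈ tangentVectors F.total p.1)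
    (h1 : F.proj p = γ t) (h2 : deriv γ t = fderiv ℝ F.proj p v) :
    metric M (γ t) (deriv γ t) (deriv γ t) = F.speedSq p v := by
  rw [h2, ← h1, F.metric_proj hp hv hv, speedSq]

theorem integrableOn_speed (F : AsdFrames M L Q) {γ : ℝ → E × (E [⋀^Fin 2]→L[ℝ] ℝ)} (hγ : ContDiff ℝ ∞ γ)
    (hm : ∀ t ∈ Icc (0 : ℝ) 1, γ t ∈ asdBundle M) :
    IntegrableOn (fun t => Real.sqrt (metric M (γ t) (deriv γ t) (deriv γ t))) (Icc 0 1) := by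
  refine LocallyIntegrableOn.integrableOn_isCompact (fun t₀ ht₀ => ?_) isCompact_Icc
  obtain ⟨J, p, hJ, htJ, hp, h1, h2⟩ := F.exists_local_lift hγ hm ht₀
  obtain ⟨ε, hε, hεJ⟩ := Metric.nhds_basis_closedBall.mem_iff.1 (hJ.mem_nhds htJ)
  refine ⟨Metric.closedBall t₀ ε ∩ Icc 0 1,
    inter_mem (mem_nhdsWithin_of_mem_nhds (Metric.closedBall_mem_nhds _ hε)) self_mem_nhdsWithin, ?_⟩
  have hc : ContinuousOn (fun t => Real.sqrt (F.speedSq (p t) (deriv p t)))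
      (Metric.closedBall t₀ ε) := by
    have hd : ContinuousOn (deriv p) (Metric.closedBall t₀ ε) :=
      (hp.continuousOn_deriv_of_isOpen hJ (by simp)).mono hεJ
    have hpd : ContinuousOn (fun t => (p t, deriv p t)) (Metric.closedBall t₀ ε) :=
      (hp.continuousOn.mono hεJ).prodMk hd
    have hs : ContinuousOn (fun t => F.speedSq (p t) (deriv p t)) (Metric.closedBall t₀ ε) :=
      Continuous.comp_continuousOn (g := fun x : (Q × (Fin 3 → ℝ)) × (Q × (Fin 3 → ℝ)) =>
        F.speedSq x.1 x.2) (f := fun t => (p t, deriv p t)) F.continuous_speedSq hpd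
    exact hs.sqrt
  have hi := (hc.integrableOn_compact (μ := volume) (isCompact_closedBall t₀ ε)).mono_set
    (inter_subset_left (t := Icc 0 1))
  refine hi.congr_fun_ae ?_
  rw [Filter.EventuallyEq, ae_restrict_iff' (Metric.isClosed_closedBall.measurableSet.inter
    measurableSet_Icc)]
  filter_upwards [Measure.ae_ne volume (0 : ℝ), Measure.ae_ne volume (1 : ℝ)] with t ht0 ht1 ht
  have ht' : t ∈ Ioo (0 : ℝ) 1 :=
    ⟨lt_of_le_of_ne ht.2.1 (Ne.symm ht0), lt_of_le_of_ne ht.2.2 ht1⟩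
  obtain ⟨h3, h4⟩ := h1 t ⟨hεJ ht.1, ht.2⟩
  obtain ⟨h5, h6⟩ := h2 t ⟨hεJ ht.1, ht'⟩
  rw [F.metric_eq_speedSq h3 h5 h4 h6]

theorem radius_le_length (F : AsdFrames M L Q) {γ : ℝ → E × (E [⋀^Fin 2]→L[ℝ] ℝ)} (hγ : ContDiff ℝ ∞ γ)
    (hm : ∀ t ∈ Icc (0 : ℝ) 1, γ t ∈ asdBundle M) (h0 : fibreNormSq M (γ 0) = 0) :
    radius (Real.sqrt (fibreNormSq M (γ 1))) ≤
      ∫ t in (0 : ℝ)..1, Real.sqrt (metric M (γ t) (deriv γ t) (deriv γ t)) := by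
  set N : ℝ → ℝ := fun t => fibreNormSq M (γ t) with hN
  have hN0 : ∀ t, 0 ≤ N t := fun t => Finset.sum_nonneg fun i _ => sq_nonneg _
  have hNc : ContinuousOn N (Icc 0 1) := by
    intro t₀ ht₀
    obtain ⟨J, p, hJ, htJ, hp, h1, -⟩ := F.exists_local_lift hγ hm ht₀
    have h2 : ContinuousAt (fun t => (p t).2 ⬝ᵥ (p t).2) t₀ :=
      contDiff_dot_self.continuous.continuousAt.comp
        (continuous_snd.continuousAt.comp (hp.continuousOn.continuousAt (hJ.mem_nhds htJ)))
    refine (h2.continuousWithinAt (s := Icc 0 1)).congr_of_eventuallyEq ?_ ?_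
    · filter_upwards [mem_nhdsWithin_of_mem_nhds (hJ.mem_nhds htJ), self_mem_nhdsWithin] with t h3 h4
      obtain ⟨h5, h6⟩ := h1 t ⟨h3, h4⟩
      rw [hN]; simp only; rw [← h6, F.fibreNormSq_proj h5]
    · obtain ⟨h5, h6⟩ := h1 t₀ ⟨htJ, ht₀⟩
      rw [hN]; simp only; rw [← h6, F.fibreNormSq_proj h5]
  have key : ∀ ε > 0, radius (Real.sqrt (N 1 + ε ^ 2)) - radius (Real.sqrt (N 0 + ε ^ 2)) ≤
      ∫ t in (0 : ℝ)..1, Real.sqrt (metric M (γ t) (deriv γ t) (deriv γ t)) := by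
    intro ε hε
    refine intervalIntegral.sub_le_integral_of_hasDeriv_right_of_le
      (g := fun t => radius (Real.sqrt (N t + ε ^ 2)))
      (g' := fun t => scaleFactor (Real.sqrt (N t + ε ^ 2)) *
        (deriv N t / (2 * Real.sqrt (N t + ε ^ 2)))) zero_le_one ?_ ?_
      (F.integrableOn_speed hγ hm) ?_
    · exact continuous_radius.comp_continuousOn (Real.continuous_sqrt.comp_continuousOn
        (hNc.add continuousOn_const))
    all_goals
      intro t ht
      obtain ⟨J, p, hJ, htJ, hp, h1, h2⟩ := F.exists_local_lift hγ hm (Ioo_subset_Icc_self ht)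
      obtain ⟨h5, h6⟩ := h1 t ⟨htJ, Ioo_subset_Icc_self ht⟩
      obtain ⟨h7, h8⟩ := h2 t ⟨htJ, ht⟩
      have hd : HasDerivAt p (deriv p t) t :=
        ((hp.contDiffAt (hJ.mem_nhds htJ)).differentiableAt (by simp)).hasDerivAt
      have hd2 : HasDerivAt (fun t => (p t).2) (deriv p t).2 t :=
        (ContinuousLinearMap.snd ℝ Q (Fin 3 → ℝ)).hasFDerivAt.comp_hasDerivAt t hd
      have hNt : N t = (p t).2 ⬝ᵥ (p t).2 := by
        rw [hN]; simp only; rw [← h6, F.fibreNormSq_proj h5]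
      have hNd : HasDerivAt N (2 * ((p t).2 ⬝ᵥ F.vert (p t) (deriv p t))) t := by
        have h9 := hasDerivAt_dot hd2 hd2
        have h10 : N =ᶠ[𝓝 t] fun t => (p t).2 ⬝ᵥ (p t).2 := by
          filter_upwards [hJ.mem_nhds htJ, isOpen_Ioo.mem_nhds ht] with r h3 h4
          obtain ⟨h5, h6⟩ := h1 r ⟨h3, Ioo_subset_Icc_self h4⟩
          rw [hN]; simp only; rw [← h6, F.fibreNormSq_proj h5]
        refine (h9.congr_of_eventuallyEq h10).congr_deriv ?_
        rw [vert_apply, dotProduct_add, dot_cross_self, dotProduct_comm (deriv p t).2]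
        ring
      have hpos : 0 < N t + ε ^ 2 := add_pos_of_nonneg_of_pos (hN0 t) (by positivity)
    · rw [hNd.deriv]
      have h9 := (hasDerivAt_radius (Real.sqrt (N t + ε ^ 2))).comp t
        ((hNd.add_const (ε ^ 2)).sqrt hpos.ne')
      exact h9.hasDerivWithinAt
    · rw [F.metric_eq_speedSq h5 h7 h6 h8, hNd.deriv]
      set d := F.vert (p t) (deriv p t) with hdd
      set y := (p t).2 with hy
      have hlen : len y ≤ Real.sqrt (N t + ε ^ 2) := by
        refine Real.sqrt_le_sqrt ?_
        rw [hNt]; nlinarith [sq_nonneg ε]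
      have hf : scaleFactor (Real.sqrt (N t + ε ^ 2)) ≤ scaleFactor (len y) :=
        scaleFactor_anti (Real.sqrt_nonneg _) hlen
      have hr : 0 < Real.sqrt (N t + ε ^ 2) := Real.sqrt_pos.2 hpos
      have h9 : y ⬝ᵥ d / Real.sqrt (N t + ε ^ 2) ≤ len d := by
        rw [div_le_iff₀ hr]
        have h10 : y ⬝ᵥ d ≤ len y * len d := by
          rw [len, len, ← Real.sqrt_mul (by rw [← len_sq]; positivity)]
          exact Real.le_sqrt_of_sq_le (dot_sq_le y d)
        have h11 : 0 ≤ len d := Real.sqrt_nonneg _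
        nlinarith
      have h12 : scaleFactor (len y) * len d ≤ Real.sqrt (F.speedSq (p t) (deriv p t)) := by
        refine Real.le_sqrt_of_sq_le ?_
        rw [mul_pow, len_sq, speedSq, ← hdd, ← hy]
        refine le_add_of_nonneg_right (mul_nonneg (by positivity) real_inner_self_nonneg)
      refine le_trans ?_ h12
      rw [mul_div_mul_left _ _ two_ne_zero]
      calc _ ≤ scaleFactor (Real.sqrt (N t + ε ^ 2)) * len d :=
            mul_le_mul_of_nonneg_left h9 (scaleFactor_pos _).le
        _ ≤ _ := mul_le_mul_of_nonneg_right hf (Real.sqrt_nonneg _)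
  have hlim : Tendsto (fun ε : ℝ => radius (Real.sqrt (N 1 + ε ^ 2)) -
      radius (Real.sqrt (N 0 + ε ^ 2))) (𝓝[>] 0) (𝓝 (radius (Real.sqrt (N 1)))) := by
    have hc : Continuous fun ε : ℝ => radius (Real.sqrt (N 1 + ε ^ 2)) -
        radius (Real.sqrt (N 0 + ε ^ 2)) := by
      have := continuous_radius
      fun_prop
    have h := (hc.tendsto 0).mono_left (nhdsWithin_le_nhds (s := Ioi 0))
    have h00 : N 0 = 0 := h0
    simpa [h00, radius_zero] using h
  exact le_of_tendsto hlim (by filter_upwards [self_mem_nhdsWithin] with ε hε using key ε hε)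

theorem zeroSectionDist_proj {p : Q × (Fin 3 → ℝ)} (hp : p.1 ∈ F.total) :
    zeroSectionDist M (F.proj p) = radius (len p.2) := by
  have hlow : ∀ ℓ ∈ {L | ∃ γ : ℝ → E × (E [⋀^Fin 2]→L[ℝ] ℝ), ContDiff ℝ ∞ γ ∧
    (∀ t ∈ Icc (0 : ℝ) 1, γ t ∈ asdBundle M) ∧ (γ 0).2 = 0 ∧ γ 1 = F.proj p ∧
    L = ∫ t in (0 : ℝ)..1, Real.sqrt (metric M (γ t) (deriv γ t) (deriv γ t))},
      radius (len p.2) ≤ ℓ := by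
    rintro ℓ ⟨γ, h1, h2, h3, h4, rfl⟩
    have h5 := F.radius_le_length h1 h2 (by simp [fibreNormSq, fibreCoord, h3])
    rwa [h4, F.fibreNormSq_proj hp] at h5
  refine IsLeast.csInf_eq ⟨?_, hlow⟩
  have hc : ContDiff ℝ ∞ fun t : ℝ => (p.1, t • p.2) :=
    contDiff_const.prodMk (contDiff_id.smul contDiff_const)
  refine ⟨fun t => F.proj (p.1, t • p.2), F.proj_smooth.comp hc, fun t _ => F.proj_mem hp _, ?_, ?_,
    ?_⟩
  · simp [proj, form]
  · simp
  · have h1 : ∀ t ∈ uIcc (0 : ℝ) 1, Real.sqrt (metric M (F.proj (p.1, t • p.2))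
        (deriv (fun t : ℝ => F.proj (p.1, t • p.2)) t)
        (deriv (fun t : ℝ => F.proj (p.1, t • p.2)) t)) =
        len p.2 * scaleFactor (t * len p.2) := by
      intro t ht
      rw [uIcc_of_le zero_le_one] at ht
      have hd : HasDerivAt (fun t : ℝ => (p.1, t • p.2)) ((0 : Q), p.2) t := by
        simpa using (hasDerivAt_const t p.1).prodMk ((hasDerivAt_id t).smul_const p.2)
      have h2 := ((F.proj_smooth.differentiable (by simp) (p.1, t • p.2)).hasFDerivAt.comp_hasDerivAt
        t hd).deriv
      have hz : ((0 : Q), p.2).1 ∈ tangentVectors F.total (p.1, t • p.2).1 :=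
        zero_mem_tangentVectors hp
      have h3 := F.metric_eq_speedSq (γ := fun t : ℝ => F.proj (p.1, t • p.2)) (t := t)
        (p := (p.1, t • p.2)) hp hz rfl h2
      rw [h3, speedSq]
      have h4 : len (t • p.2) = t * len p.2 := by
        rw [len, smul_dotProduct, dotProduct_smul, smul_eq_mul, smul_eq_mul, ← mul_assoc,
          Real.sqrt_mul (mul_self_nonneg t), Real.sqrt_mul_self ht.1, len]
      simp only [vert_apply, map_zero, LinearMap.zero_apply, add_zero, inner_zero_left, mul_zero, h4]
      rw [← len_sq, ← mul_pow, Real.sqrt_sq (mul_nonneg (scaleFactor_pos _).le (len_nonneg _)),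
        mul_comm]
    rw [intervalIntegral.integral_congr h1, intervalIntegral.integral_const_mul]
    have := intervalIntegral.smul_integral_comp_mul_right (a := 0) (b := 1) scaleFactor (len p.2)
    rw [smul_eq_mul, zero_mul, one_mul] at this
    rw [this]
    rfl

/-! ### The charge -/

theorem tendsto_len : Tendsto (fun p : Q × (Fin 3 → ℝ) => len p.2)
    (comap (fun p => zeroSectionDist M (F.proj p)) (𝓝 0) ⊓ 𝓟 F.bundle.punctured) (𝓝[>] 0) := by
  refine tendsto_nhdsWithin_iff.2 ⟨?_, ?_⟩
  · rw [Metric.tendsto_nhds]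
    intro ε hε
    rw [eventually_inf_principal]
    have h1 : 0 < radius ε := by
      rw [← radius_zero]; exact strictMono_radius hε
    have h2 : ∀ᶠ r in 𝓝 (0 : ℝ), r < radius ε := eventually_lt_nhds h1
    filter_upwards [h2.comap fun p => zeroSectionDist M (F.proj p)] with p hp hpp
    rw [F.zeroSectionDist_proj (F.mem_punctured_iff.1 hpp).1] at hp
    rw [Real.dist_eq, sub_zero, abs_of_nonneg (len_nonneg _)]
    exact strictMono_radius.lt_iff_lt.1 hp
  · rw [eventually_inf_principal]
    filter_upwards with p hp
    exact len_pos (F.mem_punctured_iff.1 hp).2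

variable {μ χ : ℝ → ℝ} (hμ : ContDiffOn ℝ ∞ μ (Ioi 0)) (hχ : ContDiffOn ℝ ∞ χ (Ioi 0))

theorem lieNorm_higgs (p : Q × (Fin 3 → ℝ)) :
    lieNorm κ ((F.gaugePair μ χ hμ hχ).higgs p) = |χ (len p.2)| * len p.2 := by
  have h6 : (F.gaugePair μ χ hμ hχ).higgs p = L.gen (χ (len p.2) • p.2) := (map_smul _ _ _).symm
  rw [h6, L.lieNorm_gen, smul_dotProduct, dotProduct_smul, smul_eq_mul, smul_eq_mul, ← mul_assoc,
    Real.sqrt_mul (mul_self_nonneg _), Real.sqrt_mul_self_eq_abs, len]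

theorem gaugePair_hasUnitCharge {ν : ℝ → ℝ} (hμ' : ∀ s > 0, HasDerivAt μ (ν s * s) s)
    (h1 : Tendsto (fun s => s ^ 2 * μ s) (𝓝[>] 0) (𝓝 (-1)))
    (h2 : Tendsto (fun s => s ^ 2 * (s ^ 2 * ν s + 2 * μ s)) (𝓝[>] 0) (𝓝 0))
    (h3 : Tendsto (fun s => s ^ 2 * χ s) (𝓝[>] 0) (𝓝 1)) :
    (F.gaugePair μ χ hμ hχ).HasUnitCharge κ := by
  have hf : Tendsto scaleFactor (𝓝[>] 0) (𝓝 1) := by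
    have h := (contDiff_scaleFactor.continuous.tendsto 0).mono_left
      (nhdsWithin_le_nhds (s := Ioi 0))
    have h1 : scaleFactor 0 = 1 := by simp [scaleFactor]
    rwa [h1] at h
  have hs : Tendsto (fun s : ℝ => s) (𝓝[>] 0) (𝓝 0) := nhdsWithin_le_nhds
  constructor
  · have h4 : Tendsto (fun s => radius s / s * |s ^ 2 * χ s|) (𝓝[>] 0) (𝓝 1) := by
      simpa using tendsto_radius_div.mul h3.abs
    refine (h4.comp F.tendsto_len).congr' ?_
    filter_upwards [mem_inf_of_right (mem_principal_self _)] with p hp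
    obtain ⟨hq, hy⟩ := F.mem_punctured_iff.1 hp
    have h5 := len_pos hy
    change _ = zeroSectionDist M (F.proj p) * _
    rw [F.zeroSectionDist_proj hq, F.lieNorm_higgs hμ hχ, Function.comp_apply, abs_mul,
      abs_of_pos (by positivity : 0 < len p.2 ^ 2)]
    field_simp
  · have h4 : Tendsto (fun s => (radius s / s) ^ 2 * Real.sqrt ((scaleFactor s)⁻¹ ^ 4 *
        ((2 * (s ^ 2 * μ s) + (s ^ 2 * μ s) ^ 2) ^ 2 +
          2 * (s ^ 2 * (s ^ 2 * ν s + 2 * μ s)) ^ 2) + s ^ 4 *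
        (scaleFactor s ^ 4 * (1 + 2 * (1 + s ^ 2 * μ s) ^ 2) / 2))) (𝓝[>] 0) (𝓝 1) := by
      have h5 := (tendsto_radius_div.pow 2).mul (((((hf.inv₀ one_ne_zero).pow 4).mul
        ((((h1.const_mul 2).add (h1.pow 2)).pow 2).add ((h2.pow 2).const_mul 2))).add
        ((hs.pow 4).mul (((hf.pow 4).mul ((((h1.const_add 1).pow 2).const_mul 2).const_add
          1)).div_const 2))).sqrt)
      norm_num at h5
      simpa using h5
    refine (h4.comp F.tendsto_len).congr' ?_
    filter_upwards [mem_inf_of_right (mem_principal_self _)] with p hp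
    obtain ⟨hq, hy⟩ := F.mem_punctured_iff.1 hp
    have h5 := len_pos hy
    change _ = zeroSectionDist M (F.proj p) ^ 2 * _
    rw [F.zeroSectionDist_proj hq, F.gaugePair_curvatureNorm hμ hχ hp (hμ' _ h5),
      Function.comp_apply]
    generalize len p.2 = s at h5
    have h6 : ∀ X : ℝ, s ^ 2 * Real.sqrt X = Real.sqrt (s ^ 4 * X) := fun X => by
      rw [Real.sqrt_mul (by positivity), show s ^ 4 = (s ^ 2) ^ 2 by ring,
        Real.sqrt_sq (by positivity)]
    have h7 : radius s ^ 2 = (radius s / s) ^ 2 * s ^ 2 := by field_simp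
    rw [h7, mul_assoc, h6]
    congr 2
    ring

end AsdFrames

end

section

variable {𝕜 : Type*} [RCLike 𝕜] {m : Type*} [Fintype m] [DecidableEq m]
  {E : Type*} [NormedAddCommGroup E] [InnerProductSpace ℝ E] {M : OrientedSubmanifold E}

/-! ### Generators of the structure group -/

theorem exists_unit_orthogonal (u : Fin 3 → ℝ) : ∃ m : Fin 3 → ℝ, m ⬝ᵥ m = 1 ∧ m ⬝ᵥ u = 0 := by
  suffices h : ∃ m : Fin 3 → ℝ, m ≠ 0 ∧ m ⬝ᵥ u = 0 by
    obtain ⟨m, h1, h2⟩ := h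
    have h3 := len_pos h1
    refine ⟨(len m)⁻¹ • m, ?_, by rw [smul_dotProduct, h2, smul_zero]⟩
    rw [smul_dotProduct, dotProduct_smul, ← len_sq, smul_eq_mul, smul_eq_mul]
    field_simp
  by_cases h : u 0 = 0
  · refine ⟨![1, 0, 0], fun h1 => ?_, by rw [dot_eq]; simp [h]⟩
    simpa using congrFun h1 0
  · refine ⟨![-u 1, u 0, 0], fun h1 => h ?_, by rw [dot_eq]; simp; ring⟩
    simpa using congrFun h1 1

theorem orthonormal_expansion {u m : Fin 3 → ℝ} (hu : u ⬝ᵥ u = 1) (hm : m ⬝ᵥ m = 1)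
    (hum : u ⬝ᵥ m = 0) (a : Fin 3 → ℝ) :
    a = (u ⬝ᵥ a) • u + (m ⬝ᵥ a) • m + (crossProduct u m ⬝ᵥ a) • crossProduct u m := by
  have hc : crossProduct u m ⬝ᵥ crossProduct u m = 1 := by
    rw [cross_dot_cross, hu, hm, hum]; ring
  have h1 : u ⬝ᵥ crossProduct u m = 0 := dot_self_cross u m
  have h2 : m ⬝ᵥ crossProduct u m = 0 := dot_cross_self u m
  set R : Matrix (Fin 3) (Fin 3) ℝ := Matrix.of ![u, m, crossProduct u m] with hR
  have h3 : R * Rᵀ = 1 := by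
    ext i j
    rw [Matrix.one_apply]
    change R i ⬝ᵥ R j = _
    fin_cases i <;> fin_cases j
    exacts [hu, hum, h1, (dotProduct_comm _ _).trans hum, hm, h2, (dotProduct_comm _ _).trans h1,
      (dotProduct_comm _ _).trans h2, hc]
  have h4 : Rᵀ *ᵥ (R *ᵥ a) = a := by
    rw [Matrix.mulVec_mulVec, mul_eq_one_comm.1 h3, Matrix.one_mulVec]
  conv_lhs => rw [← h4]
  funext i
  simp [Matrix.mulVec, dotProduct, Fin.sum_univ_three, hR]
  ring

theorem exists_rotation_plane {u v : Fin 3 → ℝ} (hu : u ⬝ᵥ u = 1) (hv : v ⬝ᵥ v = 1) :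
    ∃ t n, n ⬝ᵥ n = 1 ∧ n ⬝ᵥ u = 0 ∧ v = Real.cos t • u - Real.sin t • crossProduct n u := by
  obtain ⟨m, hm, hmu, r, hr⟩ : ∃ m : Fin 3 → ℝ, m ⬝ᵥ m = 1 ∧ m ⬝ᵥ u = 0 ∧
      ∃ r : ℝ, v = (u ⬝ᵥ v) • u + r • m := by
    set z := v - (u ⬝ᵥ v) • u with hz
    have hzu : z ⬝ᵥ u = 0 := by
      rw [hz, sub_dotProduct, smul_dotProduct, hu, dotProduct_comm v u]; simp
    by_cases h : z = 0
    · obtain ⟨m, h1, h2⟩ := exists_unit_orthogonal u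
      exact ⟨m, h1, h2, 0, by rw [zero_smul, add_zero]; exact sub_eq_zero.1 h⟩
    · have h3 := len_pos h
      refine ⟨(len z)⁻¹ • z, ?_, by rw [smul_dotProduct, hzu, smul_zero], len z, ?_⟩
      · rw [smul_dotProduct, dotProduct_smul, ← len_sq, smul_eq_mul, smul_eq_mul]
        field_simp
      · rw [smul_smul, mul_inv_cancel₀ h3.ne', one_smul, hz]; abel
  have hsq : (u ⬝ᵥ v) ^ 2 + r ^ 2 = 1 := by
    have h1 := hv
    rw [hr] at h1
    simp only [add_dotProduct, dotProduct_add, smul_dotProduct, dotProduct_smul, hu, hm, hmu,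
      dotProduct_comm u m, smul_eq_mul] at h1
    linarith
  obtain ⟨t, ht1, ht2⟩ : ∃ t, Real.cos t = u ⬝ᵥ v ∧ Real.sin t = r := by
    have h1 : ‖(⟨u ⬝ᵥ v, r⟩ : ℂ)‖ = 1 := by
      rw [Complex.norm_def, Complex.normSq_mk, Real.sqrt_eq_one]; linarith
    refine ⟨Complex.arg ⟨u ⬝ᵥ v, r⟩, ?_, ?_⟩
    · rw [Complex.cos_arg (fun h => by rw [h] at h1; simp at h1), h1, div_one]
    · rw [Complex.sin_arg, h1, div_one]
  refine ⟨t, crossProduct m u, ?_, ?_, ?_⟩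
  · rw [cross_dot_cross, hm, hu, hmu]; ring
  · rw [dotProduct_comm, dot_cross_self]
  · have h2 : crossProduct (crossProduct m u) u = -m := by
      rw [cross_cross_eq_smul_sub_smul, hmu, hu]; simp
    rw [ht1, ht2, h2, smul_neg, sub_neg_eq_add]
    exact hr

namespace LieModel

variable {G : Submonoid (Matrix m m 𝕜)} {κ : ℝ} (L : LieModel G κ)

theorem ad_rot_pi {n : Fin 3 → ℝ} (hn : n ⬝ᵥ n = 1) (x : Fin 3 → ℝ) :
    L.ad (L.rot Real.pi n) x = (2 * (n ⬝ᵥ x)) • n - x := by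
  have h1 : n ⬝ᵥ (x - (n ⬝ᵥ x) • n) = 0 := by
    rw [dotProduct_sub, dotProduct_smul, hn]; simp
  have h2 := L.ad_rot Real.pi n _ hn h1
  rw [map_sub, map_smul, L.ad_rot_self _ _ hn, Real.cos_pi, Real.sin_pi] at h2
  rw [sub_eq_iff_eq_add.1 h2]
  module

theorem exists_ad_eq {g : Matrix m m 𝕜} (hg : g ∈ G) {u : Fin 3 → ℝ} (hu : u ⬝ᵥ u = 1)
    (hfix : L.ad g u = u) : ∃ n₁ n₂ : Fin 3 → ℝ, n₁ ⬝ᵥ n₁ = 1 ∧ n₁ ⬝ᵥ u = 0 ∧ n₂ ⬝ᵥ n₂ = 1 ∧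
      n₂ ⬝ᵥ u = 0 ∧ ∀ a, L.ad (L.rot Real.pi n₁ * L.rot Real.pi n₂) a = L.ad g a := by
  obtain ⟨v, hv, hvu⟩ := exists_unit_orthogonal u
  have huv : u ⬝ᵥ v = 0 := by rw [dotProduct_comm, hvu]
  set v' := L.ad g v with hv'
  have h1 : v' ⬝ᵥ v' = 1 := by rw [hv', L.ad_dot g hg, hv]
  have h2 : v' ⬝ᵥ u = 0 := by rw [← hfix, hv', L.ad_dot g hg, hvu]
  obtain ⟨n, hn, hnu, hnv⟩ : ∃ n : Fin 3 → ℝ, n ⬝ᵥ n = 1 ∧ n ⬝ᵥ u = 0 ∧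
      (2 * (n ⬝ᵥ v)) • n - v = v' := by
    by_cases h : v + v' = 0
    · refine ⟨crossProduct u v, ?_, ?_, ?_⟩
      · rw [cross_dot_cross, hu, hv, huv]; ring
      · rw [dotProduct_comm, dot_self_cross]
      · rw [dotProduct_comm, dot_cross_self, mul_zero, zero_smul, zero_sub]
        exact neg_eq_of_add_eq_zero_right h
    · have h3 := len_pos h
      have h4 : len (v + v') ^ 2 = 2 * ((v + v') ⬝ᵥ v) := by
        rw [len_sq, add_dotProduct, dotProduct_add, dotProduct_add, add_dotProduct, hv, h1,
          dotProduct_comm v' v]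
        ring
      refine ⟨(len (v + v'))⁻¹ • (v + v'), ?_, ?_, ?_⟩
      · rw [smul_dotProduct, dotProduct_smul, ← len_sq, smul_eq_mul, smul_eq_mul]
        field_simp
      · rw [smul_dotProduct, add_dotProduct, hvu, h2]; simp
      · rw [smul_dotProduct, smul_smul, smul_eq_mul]
        have h5 : 2 * ((len (v + v'))⁻¹ * ((v + v') ⬝ᵥ v)) * (len (v + v'))⁻¹ = 1 := by
          field_simp
          rw [h4]
        rw [h5, one_smul]
        abel
  have hk : L.rot Real.pi v * L.rot Real.pi n ∈ G :=
    G.mul_mem (L.rot_mem _ _ hv) (L.rot_mem _ _ hn)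
  have hku : L.ad (L.rot Real.pi v * L.rot Real.pi n) u = u := by
    rw [L.ad_mul (L.rot_mem _ _ hv) (L.rot_mem _ _ hn), L.ad_rot_pi hv, hvu, L.ad_rot_pi hn]
    simp [hnu]
  have hkv : L.ad (L.rot Real.pi v * L.rot Real.pi n) v = v' := by
    rw [L.ad_mul (L.rot_mem _ _ hv) (L.rot_mem _ _ hn), L.ad_rot_pi hv, hv, L.ad_rot_pi hn,
      ← hnv, show (2 * (1 : ℝ)) • v - v = v by module]
  refine ⟨v, n, hv, hvu, hn, hnu, fun a => ?_⟩
  rw [orthonormal_expansion hu hv huv a]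
  simp only [map_add, map_smul, L.ad_cross hg, L.ad_cross hk, hku, hkv, hfix, hv']

theorem generate (y : Fin 3 → ℝ) (hy : y ≠ 0) (g : Matrix m m 𝕜) (hg : g ∈ G) :
    ∃ l : List (ℝ × (Fin 3 → ℝ)), (∀ p ∈ l, p.2 ⬝ᵥ p.2 = 1 ∧ p.2 ⬝ᵥ y = 0) ∧
      g = (l.map fun p => L.rot p.1 p.2).prod := by
  set u := (len y)⁻¹ • y with hu
  have hlen := len_pos hy
  have huu : u ⬝ᵥ u = 1 := by
    rw [hu, smul_dotProduct, dotProduct_smul, ← len_sq, smul_eq_mul, smul_eq_mul]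
    field_simp
  have huy : ∀ n : Fin 3 → ℝ, n ⬝ᵥ u = 0 → n ⬝ᵥ y = 0 := by
    intro n hn
    rw [hu, dotProduct_smul, smul_eq_mul] at hn
    exact (mul_eq_zero.1 hn).resolve_left (inv_pos.2 hlen).ne'
  obtain ⟨t, n, hn, hnu, ht⟩ := exists_rotation_plane huu
    (show L.ad g u ⬝ᵥ L.ad g u = 1 by rw [L.ad_dot g hg, huu])
  set k := L.rot t n with hk
  have hkG : k ∈ G := L.rot_mem _ _ hn
  have hku : L.ad k u = L.ad g u := by rw [hk, L.ad_rot t n u hn hnu, ← ht]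
  have hki := L.inv_mem k hkG
  have hgk : g * k⁻¹ ∈ G := G.mul_mem hg hki
  have hfix : L.ad (g * k⁻¹) u = u := by
    rw [L.ad_mul hg hki, ← hku, ← L.ad_mul hkG hki, L.mul_inv hkG, L.ad_one]
  obtain ⟨n₁, n₂, h1, h2, h3, h4, h5⟩ := L.exists_ad_eq hgk huu hfix
  set k₂ := L.rot Real.pi n₁ * L.rot Real.pi n₂ with hk₂
  have hk2G : k₂ ∈ G := G.mul_mem (L.rot_mem _ _ h1) (L.rot_mem _ _ h3)
  have hk2i := L.inv_mem k₂ hk2G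
  have hz : g * k⁻¹ * k₂⁻¹ ∈ G := G.mul_mem hgk hk2i
  have hz1 : ∀ a, L.ad (g * k⁻¹ * k₂⁻¹) a = a := by
    intro a
    rw [L.ad_mul hgk hk2i, ← h5, ← L.ad_mul hk2G hk2i, L.mul_inv hk2G, L.ad_one]
  have hg' : g = g * k⁻¹ * k₂⁻¹ * (k₂ * k) := by
    rw [← mul_assoc, mul_assoc (g * k⁻¹), L.inv_mul k₂ hk2G, mul_one, mul_assoc, L.inv_mul k hkG,
      mul_one]
  rcases L.ker_ad _ hz hz1 with h6 | h6
  · refine ⟨[(Real.pi, n₁), (Real.pi, n₂), (t, n)], ?_, ?_⟩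
    · simp [h1, h3, hn, huy _ h2, huy _ h4, huy _ hnu]
    · rw [hg', h6]
      simp [hk₂, hk, mul_assoc]
  · refine ⟨[(2 * Real.pi, n), (Real.pi, n₁), (Real.pi, n₂), (t, n)], ?_, ?_⟩
    · simp [h1, h3, hn, huy _ h2, huy _ h4, huy _ hnu]
    · rw [hg', h6 n hn]
      simp [hk₂, hk, mul_assoc]

end LieModel

/-! ### Holonomy -/

theorem cross_unit_cross {n y : Fin 3 → ℝ} (hn : n ⬝ᵥ n = 1) (hy : n ⬝ᵥ y = 0) :
    crossProduct n (crossProduct n y) = -y := by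
  rw [cross_cross_eq_smul_sub_smul', hn, hy]
  simp

theorem cross_cross_self {n y : Fin 3 → ℝ} (hy : n ⬝ᵥ y = 0) :
    crossProduct y (crossProduct n y) = (y ⬝ᵥ y) • n := by
  rw [cross_cross_eq_smul_sub_smul', hy]
  simp

namespace AsdFrames

variable {G : Submonoid (Matrix m m 𝕜)} {κ : ℝ} {L : LieModel G κ}
  {Q : Type*} [NormedAddCommGroup Q] [NormedSpace ℝ Q] (F : AsdFrames M L Q)
variable {μ χ : ℝ → ℝ} (hμ : ContDiffOn ℝ ∞ μ (Ioi 0)) (hχ : ContDiffOn ℝ ∞ χ (Ioi 0))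

theorem horizontalStep_radial {q : Q} (hq : q ∈ F.total) {y : Fin 3 → ℝ} (hy : y ≠ 0) {c : ℝ}
    (hc : 0 < c) : (F.gaugePair μ χ hμ hχ).HorizontalStep (q, y) (q, c • y) := by
  refine ⟨fun t => (q, (1 + t * (c - 1)) • y), ?_, by simp, by simp, fun t ht => ⟨?_, ?_⟩⟩
  · exact contDiff_const.prodMk ((by fun_prop : ContDiff ℝ ∞ fun t : ℝ => 1 + t * (c - 1)).smul
      contDiff_const)
  · refine F.mem_punctured_iff.2 ⟨hq, smul_ne_zero ?_ hy⟩
    nlinarith [ht.1, ht.2, mul_nonneg ht.1 hc.le]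
  · have hd : HasDerivAt (fun t : ℝ => (q, (1 + t * (c - 1)) • y)) ((0 : Q), (c - 1) • y) t := by
      have h1 : HasDerivAt (fun t : ℝ => 1 + t * (c - 1)) (c - 1) t := by
        simpa using ((hasDerivAt_id t).mul_const (c - 1)).const_add 1
      exact (hasDerivAt_const t q).prodMk (h1.smul_const y)
    rw [hd.deriv]
    change L.gen (F.potential μ _ _) = 0
    simp [cross_self]

theorem horizontalStep_loop {q : Q} (hq : q ∈ F.total) {y : Fin 3 → ℝ} (hy : y ≠ 0)
    {n : Fin 3 → ℝ} (hn : n ⬝ᵥ n = 1) (hny : n ⬝ᵥ y = 0) :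
    (F.gaugePair μ χ hμ hχ).HorizontalStep (q, y)
      (F.bundle.act (q, y) (L.rot (2 * Real.pi * (1 - (1 + len y ^ 2 * μ (len y)))) n)) := by
  set w := 1 + len y ^ 2 * μ (len y) with hw
  set a : ℝ := 2 * Real.pi * (1 - w) with ha
  set b : ℝ := 2 * Real.pi * w with hb
  have hab : a = 2 * Real.pi - b := by rw [ha, hb]; ring
  set z : ℝ → Fin 3 → ℝ := fun t => Real.cos (b * t) • y + Real.sin (b * t) • crossProduct n y
    with hz
  set r : ℝ → Q := fun t => F.act q (L.rot (a * t) n) with hr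
  have hnn : crossProduct n (crossProduct n y) = -y := cross_unit_cross hn hny
  have hcc : crossProduct n y ⬝ᵥ crossProduct n y = y ⬝ᵥ y := by
    rw [cross_dot_cross, hn, hny, dotProduct_comm y n, hny]; ring
  have hyc : y ⬝ᵥ crossProduct n y = 0 := dot_cross_self n y
  have hzz : ∀ t, z t ⬝ᵥ z t = y ⬝ᵥ y := by
    intro t
    simp only [hz, add_dotProduct, dotProduct_add, smul_dotProduct, dotProduct_smul, hcc, hyc,
      dotProduct_comm (crossProduct n y) y, smul_eq_mul, mul_zero, add_zero, zero_add]
    linear_combination (y ⬝ᵥ y) * Real.sin_sq_add_cos_sq (b * t)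
  have hnz : ∀ t, n ⬝ᵥ z t = 0 := by
    intro t
    simp [hz, dotProduct_add, dotProduct_smul, hny, dot_self_cross]
  have hzd : ∀ t, HasDerivAt z (b • crossProduct n (z t)) t := by
    intro t
    have h0 : HasDerivAt (fun t : ℝ => b * t) b t := by simpa using (hasDerivAt_id t).const_mul b
    have := ((h0.cos).smul_const y).add ((h0.sin).smul_const (crossProduct n y))
    refine this.congr_deriv ?_
    simp only [hz, map_add, map_smul, hnn]
    module
  have hrm : ∀ t, r t ∈ F.total := fun t => F.act_mem q hq _ (L.rot_mem _ _ hn)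
  have hrs : ContDiff ℝ ∞ r := F.act_smooth.comp (contDiff_const.prodMk
    ((L.rot_smooth n).comp (contDiff_const.mul contDiff_id)))
  have hrd : ∀ t, HasDerivAt r (deriv r t) t := fun t =>
    (hrs.differentiable (by simp)).differentiableAt.hasDerivAt
  have hconn : ∀ t, F.conn (r t) (deriv r t) = a • n := by
    intro t
    apply L.gen_injective
    have h1 : SmoothCurveIn (G : Set (Matrix m m 𝕜)) fun τ => L.rot (a * τ) n :=
      ⟨(L.rot_smooth n).comp (contDiff_const.mul contDiff_id), fun τ => L.rot_mem _ _ hn⟩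
    have h2 := F.conn_vertical (r t) (hrm t) _ h1 (by simp [L.rot_zero])
    have h3 : (fun τ => F.act (r t) (L.rot (a * τ) n)) = fun τ => r (t + τ) := by
      funext τ
      simp only [hr]
      rw [mul_add, L.rot_add _ _ _ hn, F.act_mul q hq _ (L.rot_mem _ _ hn) _ (L.rot_mem _ _ hn)]
    rw [h3, deriv_comp_const_add, add_zero] at h2
    rw [h2]
    have h4 : HasDerivAt (fun τ => L.rot (a * τ) n) (a • (L.rot (a * 0) n * L.gen n)) 0 :=
      (L.rot_deriv (a * 0) n hn).scomp (0 : ℝ) (by simpa using (hasDerivAt_id (0:ℝ)).const_mul a)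
    rw [h4.deriv, mul_zero, L.rot_zero, one_mul, map_smul]
  refine ⟨fun t => (r t, z t), ?_, ?_, ?_, fun t _ => ⟨?_, ?_⟩⟩
  · refine hrs.prodMk ?_
    simp only [hz]
    exact ((by fun_prop : ContDiff ℝ ∞ fun t : ℝ => Real.cos (b * t)).smul contDiff_const).add
      ((by fun_prop : ContDiff ℝ ∞ fun t : ℝ => Real.sin (b * t)).smul contDiff_const)
  · simp [hr, hz, L.rot_zero, F.act_one q hq]
  · refine Prod.ext (by simp [hr, bundle]) ?_
    change z 1 = L.ad (L.rot a n) y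
    rw [L.ad_rot _ _ _ hn hny, hab, Real.cos_two_pi_sub, Real.sin_two_pi_sub]
    simp [hz]
  · refine F.mem_punctured_iff.2 ⟨hrm t, fun h => hy ?_⟩
    have h1 := hzz t
    change z t = 0 at h
    rw [h, dotProduct_zero] at h1
    exact dotProduct_self_eq_zero.1 h1.symm
  · rw [((hrd t).prodMk (hzd t)).deriv]
    change L.gen (F.potential μ _ _) = 0
    have hlen : len (z t) = len y := by rw [len, len, hzz]
    have h5 : a • n + μ (len y) • ((b + a) • ((y ⬝ᵥ y) • n)) = 0 := by
      rw [← len_sq, smul_smul, smul_smul, ← add_smul]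
      have : a + μ (len y) * (b + a) * len y ^ 2 = 0 := by
        rw [hab, hb, hw]; ring
      rw [this, zero_smul]
    simp only [potential_apply, vert_apply, hconn, hlen, map_smul, LinearMap.smul_apply, ← add_smul,
      cross_cross_self (hnz t), hzz]
    rw [h5, map_zero]

theorem reach_small_rotation
    (hw : Tendsto (fun s => 1 + s ^ 2 * μ s) (𝓝[>] 0) (𝓝 0))
    {q : Q} (hq : q ∈ F.total) {y : Fin 3 → ℝ} (hy : y ≠ 0)
    {n : Fin 3 → ℝ} (hn : n ⬝ᵥ n = 1) (hny : n ⬝ᵥ y = 0) {v : ℝ} (hv0 : 0 < v)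
    (hv : v < 1 + len y ^ 2 * μ (len y)) :
    Relation.ReflTransGen (F.gaugePair μ χ hμ hχ).HorizontalStep (q, y)
      (F.bundle.act (q, y) (L.rot (-(4 * Real.pi * v)) n)) := by
  have hs := len_pos hy
  obtain ⟨s₁, hs1, hs1y, hs1v⟩ : ∃ s₁ > 0, s₁ < len y ∧ 1 + s₁ ^ 2 * μ s₁ < v := by
    have h1 := hw.eventually (gt_mem_nhds hv0)
    have h2 : ∀ᶠ s in 𝓝[>] (0 : ℝ), s < len y :=
      nhdsWithin_le_nhds (eventually_lt_nhds hs)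
    obtain ⟨s, h3, h4, h5⟩ := (h1.and (h2.and self_mem_nhdsWithin)).exists
    exact ⟨s, h5, h4, h3⟩
  have hcont : ContinuousOn (fun s => 1 + s ^ 2 * μ s) (Icc s₁ (len y)) := by
    refine continuousOn_const.add ((continuousOn_pow 2).mul (hμ.continuousOn.mono ?_))
    exact fun s hs => hs1.trans_le hs.1
  obtain ⟨s, hsI, hsv⟩ := intermediate_value_Icc hs1y.le hcont ⟨hs1v.le, hv.le⟩
  have hs0 : 0 < s := hs1.trans_le hsI.1
  set c := s / len y with hc
  have hc0 : 0 < c := div_pos hs0 hs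
  have hcy : c • y ≠ 0 := smul_ne_zero hc0.ne' hy
  have hlen : len (c • y) = s := by
    rw [len, smul_dotProduct, dotProduct_smul, smul_eq_mul, smul_eq_mul, ← mul_assoc,
      Real.sqrt_mul (mul_self_nonneg _), Real.sqrt_mul_self hc0.le, ← len, hc]
    field_simp
  set g := L.rot (2 * Real.pi * (1 - v)) n with hg
  have hgG : g ∈ G := L.rot_mem _ _ hn
  have hny' : n ⬝ᵥ (c • y) = 0 := by rw [dotProduct_smul, hny, smul_zero]
  have st1 := F.horizontalStep_radial hμ hχ hq hy hc0
  have st2 := F.horizontalStep_loop hμ hχ hq hcy hn hny'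
  simp only [hlen, hsv] at st2
  have hq1 := F.act_mem q hq g hgG
  have hlen1 : len (L.ad g (c • y)) = s := by rw [← hlen, len, L.ad_dot g hgG, len]
  have hy1 : L.ad g (c • y) ≠ 0 := fun h => by
    rw [h] at hlen1; simp [len] at hlen1; exact hs0.ne hlen1
  have hn1 : n ⬝ᵥ L.ad g (c • y) = 0 := by
    rw [← L.ad_rot_self (2 * Real.pi * (1 - v)) n hn, ← hg, L.ad_dot g hgG, hny']
  have st3 := F.horizontalStep_loop hμ hχ hq1 hy1 hn hn1
  simp only [hlen1, hsv] at st3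
  have hgg : g * g = L.rot (-(4 * Real.pi * v)) n := by
    rw [hg, ← L.rot_add _ _ _ hn, show 2 * Real.pi * (1 - v) + 2 * Real.pi * (1 - v) =
      4 * Real.pi + -(4 * Real.pi * v) by ring, L.rot_add _ _ _ hn, L.rot_period, one_mul]
  have hggG : g * g ∈ G := G.mul_mem hgG hgG
  have st4 := F.horizontalStep_radial hμ hχ (F.act_mem q hq _ hggG) (y := L.ad (g * g) (c • y))
    (by rw [L.ad_mul hgG hgG]
        intro h
        have h2 := L.ad_dot g hgG (L.ad g (c • y)) (L.ad g (c • y))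
        rw [h, dotProduct_zero] at h2
        exact hy1 (dotProduct_self_eq_zero.1 h2.symm)) (inv_pos.2 hc0)
  have e : F.bundle.act (F.act q g, L.ad g (c • y)) g = (F.act q (g * g), L.ad (g * g) (c • y)) := by
    rw [F.act_mul q hq g hgG g hgG, L.ad_mul hgG hgG]
    rfl
  rw [← hg, e] at st3
  rw [← hgg]
  rw [map_smul, smul_smul, inv_mul_cancel₀ hc0.ne', one_smul] at st4
  refine Relation.ReflTransGen.head st1 (Relation.ReflTransGen.head st2 ?_)
  exact Relation.ReflTransGen.head st3 (Relation.ReflTransGen.single (by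
    rw [map_smul] at *
    exact st4))

theorem reach_rotation (hw0 : ∀ s > 0, 0 < 1 + s ^ 2 * μ s)
    (hw : Tendsto (fun s => 1 + s ^ 2 * μ s) (𝓝[>] 0) (𝓝 0))
    {q : Q} (hq : q ∈ F.total) {y : Fin 3 → ℝ} (hy : y ≠ 0)
    {n : Fin 3 → ℝ} (hn : n ⬝ᵥ n = 1) (hny : n ⬝ᵥ y = 0) (t : ℝ) :
    Relation.ReflTransGen (F.gaugePair μ χ hμ hχ).HorizontalStep (q, y)
      (F.bundle.act (q, y) (L.rot t n)) := by
  wlog ht : t ≤ 0 generalizing t n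
  · have := this (n := -n) (by simpa using hn) (by simpa using hny) (-t) (by linarith)
    rwa [L.rot_neg, neg_neg] at this
  have hpos := hw0 _ (len_pos hy)
  obtain ⟨N, hN⟩ := exists_nat_gt (-t / (4 * Real.pi * (1 + len y ^ 2 * μ (len y))))
  rcases ht.eq_or_lt with rfl | ht
  · rw [L.rot_zero, F.bundle.act_one (q, y) hq]
  have hN0 : (0 : ℝ) < N := lt_of_le_of_lt (by have := Real.pi_pos; exact div_nonneg (by linarith) (by positivity)) hN
  set v := -t / (4 * Real.pi * N) with hv
  have hv0 : 0 < v := div_pos (by linarith) (by have := Real.pi_pos; positivity)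
  have hv1 : v < 1 + len y ^ 2 * μ (len y) := by
    have := Real.pi_pos
    rw [div_lt_iff₀ (by positivity)] at hN
    rw [hv, div_lt_iff₀ (by positivity)]
    linarith
  have hstep : ∀ k : ℕ, Relation.ReflTransGen (F.gaugePair μ χ hμ hχ).HorizontalStep (q, y)
      (F.bundle.act (q, y) (L.rot (k * -(4 * Real.pi * v)) n)) := by
    intro k
    induction k with
    | zero =>
      simp only [Nat.cast_zero, zero_mul, L.rot_zero]
      rw [F.bundle.act_one (q, y) hq]
    | succ k ih =>
      refine ih.trans ?_
      set g := L.rot (k * -(4 * Real.pi * v)) n with hg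
      have hgG : g ∈ G := L.rot_mem _ _ hn
      have h1 : n ⬝ᵥ L.ad g y = 0 := by
        rw [← L.ad_rot_self (k * -(4 * Real.pi * v)) n hn, ← hg, L.ad_dot g hgG, hny]
      have h2 : len (L.ad g y) = len y := by rw [len, L.ad_dot g hgG, len]
      have h3 : L.ad g y ≠ 0 := fun h => by
        have h4 := len_pos hy
        rw [← h2, h] at h4
        simp [len] at h4
      have h5 := F.reach_small_rotation hμ hχ hw (F.act_mem q hq g hgG) h3 hn h1 hv0
        (by rw [h2]; exact hv1)
      have h6 : F.bundle.act (F.act q g, L.ad g y) (L.rot (-(4 * Real.pi * v)) n) =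
          F.bundle.act (q, y) (L.rot ((k + 1 : ℕ) * -(4 * Real.pi * v)) n) := by
        rw [Nat.cast_add, Nat.cast_one, add_mul, one_mul, L.rot_add _ _ _ hn, ← hg]
        exact (F.bundle.act_mul (q, y) hq g hgG _ (L.rot_mem _ _ hn)).symm
      rw [h6] at h5
      exact h5
  have := hstep N
  have h7 : (N : ℝ) * -(4 * Real.pi * v) = t := by
    have := Real.pi_pos
    rw [hv]; field_simp
  rwa [h7] at this

theorem gaugePair_isIrreducible (hw0 : ∀ s > 0, 0 < 1 + s ^ 2 * μ s)
    (hw : Tendsto (fun s => 1 + s ^ 2 * μ s) (𝓝[>] 0) (𝓝 0)) :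
    (F.gaugePair μ χ hμ hχ).IsIrreducible := by
  rintro ⟨q, y⟩ hp g hg
  obtain ⟨hq, hy⟩ := F.mem_punctured_iff.1 hp
  obtain ⟨l, hl, rfl⟩ := L.generate y hy g hg
  clear hg
  suffices h : (l.map fun p => L.rot p.1 p.2).prod ∈ G ∧
      Relation.ReflTransGen (F.gaugePair μ χ hμ hχ).HorizontalStep (q, y)
        (F.bundle.act (q, y) (l.map fun p => L.rot p.1 p.2).prod) from h.2
  induction l with
  | nil =>
    refine ⟨G.one_mem, ?_⟩
    rw [List.map_nil, List.prod_nil, F.bundle.act_one (q, y) hq]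
  | cons p l ih =>
    obtain ⟨h1, h2⟩ := ih fun p hp => hl p (List.mem_cons_of_mem _ hp)
    obtain ⟨hn, hny⟩ := hl p List.mem_cons_self
    rw [List.map_cons, List.prod_cons]
    set h := (l.map fun p => L.rot p.1 p.2).prod
    refine ⟨G.mul_mem (L.rot_mem _ _ hn) h1, h2.trans ?_⟩
    have h3 : L.rot p.1 p.2 * h = h * L.rot p.1 (L.ad h p.2) := by
      rw [← L.conj_rot h h1, ← mul_assoc, ← mul_assoc, L.mul_inv h1, one_mul]
    have hn' : L.ad h p.2 ⬝ᵥ L.ad h p.2 = 1 := by rw [L.ad_dot h h1, hn]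
    have h4 : L.ad h y ≠ 0 := fun h5 => by
      have h6 := L.ad_dot h h1 y y
      rw [h5, dotProduct_zero] at h6
      exact hy (dotProduct_self_eq_zero.1 h6.symm)
    have h5 := F.reach_rotation hμ hχ hw0 hw (F.act_mem q hq h h1) h4 hn'
      (by rw [L.ad_dot h h1, hny]) p.1
    rw [h3, F.bundle.act_mul (q, y) hq h h1 _ (L.rot_mem _ _ hn')]
    exact h5

end AsdFrames

end

section

/-! ### The two-parameter family -/

section Profile

variable {W h : ℝ → ℝ}

/-- The coefficient of the connection form of the solution with profile `W`. -/
def connCoeff (W : ℝ → ℝ) (s : ℝ) : ℝ := (W s * scaleFactor s ^ 2 - 1) / s ^ 2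

theorem hasDerivAt_connCoeff {s : ℝ} (hs : 0 < s)
    (hW : HasDerivAt W (scaleFactor s * h s * W s) s) :
    HasDerivAt (connCoeff W)
      ((W s * scaleFactor s ^ 2 * (scaleFactor s * h s - s * scaleFactor s ^ 4) / s ^ 3 -
        2 * (W s * scaleFactor s ^ 2 - 1) / s ^ 4) * s) s := by
  have h1 := ((hW.mul ((hasDerivAt_scaleFactor s).pow 2)).sub_const 1).div (hasDerivAt_pow 2 s)
    (by positivity)
  refine h1.congr_deriv ?_
  simp only [Pi.mul_apply, Pi.pow_apply]
  field_simp
  ring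

theorem hasDerivAt_higgsCoeff {s : ℝ} (hs : 0 < s)
    (hh : HasDerivAt h ((W s ^ 2 - 1) * scaleFactor s ^ 3 / s ^ 2) s) :
    HasDerivAt (fun s => h s / s)
      (((W s ^ 2 - 1) * scaleFactor s ^ 3 / s ^ 4 - h s / s ^ 3) * s) s := by
  have h1 := hh.div (hasDerivAt_id s) hs.ne'
  refine h1.congr_deriv ?_
  simp only [id]
  field_simp

theorem contDiffOn_connCoeff {X : Type*} [NormedAddCommGroup X] [NormedSpace ℝ X] {D : Set X}
    {W : X → ℝ → ℝ} (hW : ContDiffOn ℝ ∞ (fun q : X × ℝ => W q.1 q.2) (D ×ˢ Ioi 0)) :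
    ContDiffOn ℝ ∞ (fun q : X × ℝ => connCoeff (W q.1) q.2) (D ×ˢ Ioi 0) := by
  refine ContDiffOn.div ((hW.mul ((contDiff_scaleFactor.comp contDiff_snd).pow 2).contDiffOn).sub
    contDiffOn_const) (contDiff_snd.pow 2).contDiffOn fun q hq => ?_
  exact pow_ne_zero _ (ne_of_gt hq.2)

theorem contDiffOn_higgsCoeff {X : Type*} [NormedAddCommGroup X] [NormedSpace ℝ X] {D : Set X}
    {h : X → ℝ → ℝ} (hh : ContDiffOn ℝ ∞ (fun q : X × ℝ => h q.1 q.2) (D ×ˢ Ioi 0)) :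
    ContDiffOn ℝ ∞ (fun q : X × ℝ => h q.1 q.2 / q.2) (D ×ˢ Ioi 0) :=
  hh.div contDiff_snd.contDiffOn fun _ hq => ne_of_gt hq.2

theorem contDiffOn_slice {X : Type*} [NormedAddCommGroup X] [NormedSpace ℝ X] {D : Set X}
    {h : X → ℝ → ℝ} (hh : ContDiffOn ℝ ∞ (fun q : X × ℝ => h q.1 q.2) (D ×ˢ Ioi 0)) {c : X}
    (hc : c ∈ D) : ContDiffOn ℝ ∞ (h c) (Ioi 0) :=
  hh.comp (contDiff_const.prodMk contDiff_id).contDiffOn fun _ hs => ⟨hc, hs⟩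

end Profile

variable {𝕜 : Type*} [RCLike 𝕜] {m : Type*} [Fintype m] [DecidableEq m]
  {E : Type*} [NormedAddCommGroup E] [InnerProductSpace ℝ E] {M : OrientedSubmanifold E}

namespace AsdFrames

variable {G : Submonoid (Matrix m m 𝕜)} {κ : ℝ} {L : LieModel G κ}
  {Q : Type*} [NormedAddCommGroup Q] [NormedSpace ℝ Q] (F : AsdFrames M L Q)

theorem isMonopole_of_profile {W h : ℝ → ℝ} (hμ : ContDiffOn ℝ ∞ (connCoeff W) (Ioi 0))
    (hχ : ContDiffOn ℝ ∞ (fun s => h s / s) (Ioi 0))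
    (hW : ∀ s > 0, HasDerivAt W (scaleFactor s * h s * W s) s)
    (hh : ∀ s > 0, HasDerivAt h ((W s ^ 2 - 1) * scaleFactor s ^ 3 / s ^ 2) s) :
    (F.gaugePair (connCoeff W) (fun s => h s / s) hμ hχ).IsMonopole := by
  refine F.gaugePair_isMonopole hμ hχ (fun s hs => hasDerivAt_connCoeff hs (hW s hs))
    (fun s hs => hasDerivAt_higgsCoeff hs (hh s hs)) (fun s hs => ?_) fun s hs => ?_
  · have hf := scaleFactor_pos s
    have h4 := scaleFactor_pow_four s
    rw [connCoeff]
    field_simp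
    linear_combination h4
  · have hf := scaleFactor_pos s
    rw [connCoeff]
    field_simp
    ring

theorem one_add_connCoeff (W : ℝ → ℝ) {s : ℝ} (hs : s ≠ 0) :
    1 + s ^ 2 * connCoeff W s = W s * scaleFactor s ^ 2 := by
  rw [connCoeff]
  field_simp
  ring

theorem tendsto_scaleFactor : Tendsto scaleFactor (𝓝[>] 0) (𝓝 1) := by
  have h := (contDiff_scaleFactor.continuous.tendsto 0).mono_left
    (nhdsWithin_le_nhds (s := Ioi 0))
  have h1 : scaleFactor 0 = 1 := by simp [scaleFactor]
  rwa [h1] at h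

theorem tendsto_one_add_connCoeff {W : ℝ → ℝ} (hW : Tendsto W (𝓝[>] 0) (𝓝 0)) :
    Tendsto (fun s => 1 + s ^ 2 * connCoeff W s) (𝓝[>] 0) (𝓝 0) := by
  have h : Tendsto (fun s => W s * scaleFactor s ^ 2) (𝓝[>] 0) (𝓝 0) := by
    simpa using hW.mul (tendsto_scaleFactor.pow 2)
  refine h.congr' ?_
  filter_upwards [self_mem_nhdsWithin] with s hs
  rw [one_add_connCoeff W (ne_of_gt hs)]

theorem hasUnitCharge_of_profile {W h : ℝ → ℝ} (hμ : ContDiffOn ℝ ∞ (connCoeff W) (Ioi 0))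
    (hχ : ContDiffOn ℝ ∞ (fun s => h s / s) (Ioi 0))
    (hW : ∀ s > 0, HasDerivAt W (scaleFactor s * h s * W s) s)
    (hW0 : Tendsto W (𝓝[>] 0) (𝓝 0)) (hh0 : Tendsto (fun s => s * h s) (𝓝[>] 0) (𝓝 1)) :
    (F.gaugePair (connCoeff W) (fun s => h s / s) hμ hχ).HasUnitCharge κ := by
  have hs0 : Tendsto (fun s : ℝ => s) (𝓝[>] 0) (𝓝 0) := nhdsWithin_le_nhds
  refine F.gaugePair_hasUnitCharge hμ hχ (fun s hs => hasDerivAt_connCoeff hs (hW s hs)) ?_ ?_ ?_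
  · simpa using (tendsto_one_add_connCoeff hW0).const_add (-1)
  · have h1 : Tendsto (fun s => W s * scaleFactor s ^ 2 * (scaleFactor s * (s * h s) -
        s ^ 2 * scaleFactor s ^ 4)) (𝓝[>] 0) (𝓝 0) := by
      have := (hW0.mul (tendsto_scaleFactor.pow 2)).mul ((tendsto_scaleFactor.mul hh0).sub
        ((hs0.pow 2).mul (tendsto_scaleFactor.pow 4)))
      simpa using this
    refine h1.congr' ?_
    filter_upwards [self_mem_nhdsWithin] with s hs
    have hs' : s ≠ 0 := ne_of_gt hs
    rw [connCoeff]
    field_simp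
    ring
  · refine hh0.congr' ?_
    filter_upwards [self_mem_nhdsWithin] with s hs
    have hs' : s ≠ 0 := ne_of_gt hs
    field_simp

theorem isIrreducible_of_profile {W h : ℝ → ℝ} (hμ : ContDiffOn ℝ ∞ (connCoeff W) (Ioi 0))
    (hχ : ContDiffOn ℝ ∞ (fun s => h s / s) (Ioi 0)) (hW : ∀ s > 0, 0 < W s)
    (hW0 : Tendsto W (𝓝[>] 0) (𝓝 0)) :
    (F.gaugePair (connCoeff W) (fun s => h s / s) hμ hχ).IsIrreducible := by
  refine F.gaugePair_isIrreducible hμ hχ (fun s hs => ?_) (tendsto_one_add_connCoeff hW0)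
  rw [one_add_connCoeff W (ne_of_gt hs)]
  exact mul_pos (hW s hs) (pow_pos (scaleFactor_pos s) 2)

theorem abs_higgsCoeff_eq (hne : F.total.Nonempty) {μ χ μ' χ' : ℝ → ℝ}
    {hμ : ContDiffOn ℝ ∞ μ (Ioi 0)} {hχ : ContDiffOn ℝ ∞ χ (Ioi 0)}
    {hμ' : ContDiffOn ℝ ∞ μ' (Ioi 0)} {hχ' : ContDiffOn ℝ ∞ χ' (Ioi 0)}
    (h : (F.gaugePair μ χ hμ hχ).GaugeEquivalent (F.gaugePair μ' χ' hμ' hχ')) {s : ℝ}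
    (hs : 0 < s) : |χ s| = |χ' s| := by
  obtain ⟨a, -, h1, h2, -⟩ := h
  obtain ⟨q, hq⟩ := hne
  set y : Fin 3 → ℝ := Pi.single 0 s with hy
  have hlen : len y = s := by
    rw [len, hy, single_dotProduct, Pi.single_eq_same, Real.sqrt_mul_self hs.le]
  have hy0 : y ≠ 0 := fun h => by
    rw [h] at hlen; simp [len] at hlen; exact hs.ne hlen
  have hp : (q, y) ∈ F.bundle.punctured := F.mem_punctured_iff.2 ⟨hq, hy0⟩
  obtain ⟨h3, h4, -⟩ := h1 _ hp
  have h5 : len (a (q, y)).2 = s := by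
    have h6 : F.proj (a (q, y)) = F.proj (q, y) := h4
    have h7 := F.fibreNormSq_proj (F.mem_punctured_iff.1 h3).1
    rw [h6, F.fibreNormSq_proj hq] at h7
    rw [len, ← h7, ← len, hlen]
  have h8 := congrArg (lieNorm κ) (h2 _ hp)
  rw [F.lieNorm_higgs hμ' hχ', F.lieNorm_higgs hμ hχ, h5] at h8
  simp only [hlen] at h8
  exact (mul_right_cancel₀ hs.ne' h8).symm

end AsdFrames

theorem profile_eq_of_abs_eq {c c' : ℝ × ℝ} (hc : c ∈ profileDomain) (hc' : c' ∈ profileDomain)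
    {W h W' h' : ℝ → ℝ}
    (h1 : W c.1 = c.2) (h2 : h c.1 = 0) (h1' : W' c'.1 = c'.2) (h2' : h' c'.1 = 0)
    (h3 : ∀ s, 0 < s → 0 < W s ∧ W s < 1 ∧ HasDerivAt W (scaleFactor s * h s * W s) s ∧
      HasDerivAt h ((W s ^ 2 - 1) * scaleFactor s ^ 3 / s ^ 2) s)
    (h3' : ∀ s, 0 < s → 0 < W' s ∧ W' s < 1 ∧ HasDerivAt W' (scaleFactor s * h' s * W' s) s ∧
      HasDerivAt h' ((W' s ^ 2 - 1) * scaleFactor s ^ 3 / s ^ 2) s)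
    (habs : ∀ s > 0, |h s| = |h' s|) : c = c' := by
  have anti : ∀ {W h : ℝ → ℝ}, (∀ s, 0 < s → 0 < W s ∧ W s < 1 ∧
      HasDerivAt W (scaleFactor s * h s * W s) s ∧
      HasDerivAt h ((W s ^ 2 - 1) * scaleFactor s ^ 3 / s ^ 2) s) → StrictAntiOn h (Ioi 0) := by
    intro W h h3
    refine strictAntiOn_of_deriv_neg (convex_Ioi 0)
      (fun s hs => (h3 s hs).2.2.2.continuousAt.continuousWithinAt) fun s hs => ?_
    rw [interior_Ioi] at hs
    obtain ⟨h4, h5, -, h6⟩ := h3 s hs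
    have hs' : (0 : ℝ) < s := hs
    rw [h6.deriv]
    refine div_neg_of_neg_of_pos (mul_neg_of_neg_of_pos ?_ (pow_pos (scaleFactor_pos s) 3))
      (by positivity)
    nlinarith
  have a := anti h3
  have a' := anti h3'
  have hc1 : 0 < c.1 := hc.1
  have hc1' : 0 < c'.1 := hc'.1
  have e1 : c.1 = c'.1 := by
    refine a'.injOn hc1 hc1' ?_
    rw [h2', ← abs_eq_zero, ← habs _ hc1, h2, abs_zero]
  have e2 : ∀ s ∈ Ioo 0 c.1, h s = h' s := by
    intro s hs
    have h4 := a hs.1 hc1 hs.2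
    have h5 := a' hs.1 hc1' (e1 ▸ hs.2)
    rw [h2] at h4
    rw [h2'] at h5
    rw [← abs_of_pos h4, ← abs_of_pos h5]
    exact habs s hs.1
  have e3 : ∀ s ∈ Ioo 0 c.1, W s = W' s := by
    intro s hs
    obtain ⟨h4, h5, -, h6⟩ := h3 s hs.1
    obtain ⟨h4', h5', -, h6'⟩ := h3' s hs.1
    have h7 : h =ᶠ[𝓝 s] h' := by
      filter_upwards [isOpen_Ioo.mem_nhds hs] with r hr using e2 r hr
    have h8 := h6.unique (h6'.congr_of_eventuallyEq h7)
    have hs0 : (0 : ℝ) < s := hs.1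
    have h9 := scaleFactor_pos s
    rw [div_left_inj' (by positivity), mul_left_inj' (by positivity)] at h8
    have h10 : W s ^ 2 = W' s ^ 2 := by linarith
    exact (pow_left_inj₀ h4.le h4'.le two_ne_zero).1 h10
  refine Prod.ext e1 ?_
  rw [← h1, ← h1', ← e1]
  have t1 : Tendsto W (𝓝[<] c.1) (𝓝 (W c.1)) :=
    (h3 _ hc1).2.2.1.continuousAt.tendsto.mono_left nhdsWithin_le_nhds
  have t2 : Tendsto W' (𝓝[<] c.1) (𝓝 (W' c.1)) :=
    (h3' _ hc1).2.2.1.continuousAt.tendsto.mono_left nhdsWithin_le_nhds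
  refine tendsto_nhds_unique (t1.congr' ?_) t2
  filter_upwards [Ioo_mem_nhdsLT hc1] with s hs using e3 s hs

theorem AsdFrames.exists_family {G : Submonoid (Matrix m m 𝕜)} {κ : ℝ} {L : LieModel G κ}
    {Q : Type*} [NormedAddCommGroup Q] [NormedSpace ℝ Q] (F : AsdFrames M L Q)
    (hne : F.total.Nonempty) :
    ∃ C : ℝ × ℝ → GaugePair F.bundle,
      GaugePair.IsSmoothFamily C (Set.Ioi 0 ×ˢ Set.Ioo 0 1) ∧
      (∀ c ∈ (Set.Ioi 0 ×ˢ Set.Ioo 0 1 : Set (ℝ × ℝ)),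
        (C c).IsMonopole ∧ (C c).IsIrreducible ∧ (C c).HasUnitCharge κ) ∧
      (∀ c ∈ (Set.Ioi 0 ×ˢ Set.Ioo 0 1 : Set (ℝ × ℝ)),
        ∀ c' ∈ (Set.Ioi 0 ×ˢ Set.Ioo 0 1 : Set (ℝ × ℝ)),
          (C c).GaugeEquivalent (C c') → c = c') := by
  classical
  obtain ⟨W, h, hW, hh, hprof⟩ := exists_profile
  have hμ := contDiffOn_connCoeff hW
  have hχ := contDiffOn_higgsCoeff hh
  have hμc := fun c (hc : c ∈ profileDomain) =>
    contDiffOn_slice (h := fun c => connCoeff (W c)) hμ hc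
  have hχc := fun c (hc : c ∈ profileDomain) =>
    contDiffOn_slice (h := fun c s => h c s / s) hχ hc
  let C : ℝ × ℝ → GaugePair F.bundle := fun c =>
    if hc : c ∈ profileDomain then
      F.gaugePair (connCoeff (W c)) (fun s => h c s / s) (hμc c hc) (hχc c hc)
    else F.gaugePair (fun _ => 0) (fun _ => 0) contDiffOn_const contDiffOn_const
  have hC : ∀ c (hc : c ∈ profileDomain), C c =
      F.gaugePair (connCoeff (W c)) (fun s => h c s / s) (hμc c hc) (hχc c hc) := fun c hc =>
    dif_pos hc
  refine ⟨C, ?_, fun c hc => ?_, fun c hc c' hc' hg => ?_⟩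
  · refine F.isSmoothFamily (μ := fun c => connCoeff (W c)) (χ := fun c s => h c s / s) hμ hχ
      (fun c hc => ?_) fun c hc => ?_
    · rw [hC c hc]; rfl
    · rw [hC c hc]; rfl
  · obtain ⟨-, -, h3, h4, h5⟩ := hprof c hc
    rw [hC c hc]
    exact ⟨F.isMonopole_of_profile _ _ (fun s hs => (h3 s hs).2.2.1) fun s hs => (h3 s hs).2.2.2,
      F.isIrreducible_of_profile _ _ (fun s hs => (h3 s hs).1) h4,
      F.hasUnitCharge_of_profile _ _ (fun s hs => (h3 s hs).2.2.1) h4 h5⟩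
  · rw [hC c hc, hC c' hc'] at hg
    obtain ⟨h1, h2, h3, -, -⟩ := hprof c hc
    obtain ⟨h1', h2', h3', -, -⟩ := hprof c' hc'
    refine profile_eq_of_abs_eq hc hc' h1 h2 h1' h2' h3 h3' fun s hs => ?_
    have := F.abs_higgsCoeff_eq hne hg hs
    rw [abs_div, abs_div] at this
    exact (div_left_inj' (abs_pos.2 hs.ne').ne').1 this

end

/-! ### The rotation group -/

namespace Rotation

/-- The matrix of `v ↦ a × v`. -/
def hat : (Fin 3 → ℝ) →ₗ[ℝ] Matrix (Fin 3) (Fin 3) ℝ where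
  toFun a := !![0, -a 2, a 1; a 2, 0, -a 0; -a 1, a 0, 0]
  map_add' a b := by
    ext i j; fin_cases i <;> fin_cases j <;> simp <;> ring
  map_smul' c a := by
    ext i j; fin_cases i <;> fin_cases j <;> simp

theorem hat_apply (a : Fin 3 → ℝ) : hat a = !![0, -a 2, a 1; a 2, 0, -a 0; -a 1, a 0, 0] := rfl

/-- The rotation about the axis `n` by the angle `t`. -/
def rot (t : ℝ) (n : Fin 3 → ℝ) : Matrix (Fin 3) (Fin 3) ℝ :=
  1 + Real.sin t • hat n + (1 - Real.cos t) • (hat n * hat n)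

theorem hat_bracket (a b : Fin 3 → ℝ) :
    hat a * hat b - hat b * hat a = hat (crossProduct a b) := by
  ext i j
  fin_cases i <;> fin_cases j <;>
    simp [hat_apply, cross_zero, cross_one, cross_two] <;> ring

theorem hat_mulVec (a v : Fin 3 → ℝ) : hat a *ᵥ v = crossProduct a v := by
  apply vec_ext <;>
    simp [hat_apply, Matrix.mulVec, dotProduct, Fin.sum_univ_three, cross_zero, cross_one,
      cross_two] <;> ring

theorem hat_cube {n : Fin 3 → ℝ} (hn : n ⬝ᵥ n = 1) : hat n * hat n * hat n = -hat n := by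
  rw [dot_eq] at hn
  ext i j
  fin_cases i <;> fin_cases j <;>
    simp [hat_apply, Matrix.mul_apply, Fin.sum_univ_three] <;>
    first
    | ring1
    | linear_combination (n 0) * hn
    | linear_combination (n 1) * hn
    | linear_combination (n 2) * hn
    | linear_combination (-n 0) * hn
    | linear_combination (-n 1) * hn
    | linear_combination (-n 2) * hn

theorem hat_transpose (n : Fin 3 → ℝ) : (hat n)ᵀ = -hat n := by
  ext i j
  fin_cases i <;> fin_cases j <;> simp [hat_apply]

theorem rot_add {n : Fin 3 → ℝ} (hn : n ⬝ᵥ n = 1) (s t : ℝ) :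
    rot (s + t) n = rot s n * rot t n := by
  have h3 := hat_cube hn
  have h4 : hat n * hat n * (hat n * hat n) = -(hat n * hat n) := by
    rw [← mul_assoc, h3, neg_mul]
  have h3' : hat n * (hat n * hat n) = -hat n := by rw [← mul_assoc, h3]
  simp only [rot, mul_add, add_mul, one_mul, mul_one, smul_mul_smul_comm, h3, h3', h4,
    Real.sin_add, Real.cos_add]
  module

theorem rot_zero (n : Fin 3 → ℝ) : rot 0 n = 1 := by simp [rot]

theorem rot_transpose (t : ℝ) (n : Fin 3 → ℝ) : (rot t n)ᵀ = rot (-t) n := by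
  simp [rot, Matrix.transpose_mul, hat_transpose]

theorem rot_mul_transpose {n : Fin 3 → ℝ} (hn : n ⬝ᵥ n = 1) (t : ℝ) :
    rot t n * (rot t n)ᵀ = 1 := by
  rw [rot_transpose, ← rot_add hn, add_neg_cancel, rot_zero]

theorem det_rot {n : Fin 3 → ℝ} (hn : n ⬝ᵥ n = 1) (t : ℝ) : (rot t n).det = 1 := by
  have h := congrArg Matrix.det (rot_mul_transpose hn (t / 2))
  rw [Matrix.det_mul, Matrix.det_transpose, Matrix.det_one] at h
  rw [show t = t / 2 + t / 2 by ring, rot_add hn, Matrix.det_mul, h]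

theorem mem_iff {g : Matrix (Fin 3) (Fin 3) ℝ} :
    g ∈ Matrix.specialOrthogonalGroup (Fin 3) ℝ ↔ g * gᵀ = 1 ∧ g.det = 1 := by
  rw [Matrix.mem_specialOrthogonalGroup_iff, Matrix.mem_orthogonalGroup_iff]

theorem rot_mem {n : Fin 3 → ℝ} (hn : n ⬝ᵥ n = 1) (t : ℝ) :
    rot t n ∈ Matrix.specialOrthogonalGroup (Fin 3) ℝ :=
  mem_iff.2 ⟨rot_mul_transpose hn t, det_rot hn t⟩

theorem adjugate_eq {g : Matrix (Fin 3) (Fin 3) ℝ}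
    (hg : g ∈ Matrix.specialOrthogonalGroup (Fin 3) ℝ) : g.adjugate = gᵀ := by
  obtain ⟨h1, h2⟩ := mem_iff.1 hg
  have h3 : g * g.adjugate = 1 := by rw [Matrix.mul_adjugate, h2, one_smul]
  calc g.adjugate = (gᵀ * g) * g.adjugate := by rw [mul_eq_one_comm.1 h1, one_mul]
    _ = gᵀ := by rw [mul_assoc, h3, mul_one]

theorem inv_eq {g : Matrix (Fin 3) (Fin 3) ℝ}
    (hg : g ∈ Matrix.specialOrthogonalGroup (Fin 3) ℝ) : g⁻¹ = gᵀ :=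
  Matrix.inv_eq_right_inv (mem_iff.1 hg).1

theorem transpose_mul_hat_mul (A : Matrix (Fin 3) (Fin 3) ℝ) (a : Fin 3 → ℝ) :
    Aᵀ * hat a * A = hat (A.adjugate *ᵥ a) := by
  rw [Matrix.adjugate_fin_three]
  ext i j
  fin_cases i <;> fin_cases j <;>
    simp [hat_apply, Matrix.mul_apply, dotProduct, Fin.sum_univ_three] <;> ring

theorem hasDerivAt_rot {n : Fin 3 → ℝ} (hn : n ⬝ᵥ n = 1) (t : ℝ) :
    HasDerivAt (fun t => rot t n) (rot t n * hat n) t := by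
  have h := (((Real.hasDerivAt_sin t).smul_const (hat n)).const_add 1).add
    (((Real.hasDerivAt_cos t).const_sub 1).smul_const (hat n * hat n))
  refine h.congr_deriv ?_
  simp only [rot, add_mul, one_mul, smul_mul_assoc, hat_cube hn]
  module

theorem contDiff_rot (n : Fin 3 → ℝ) : ContDiff ℝ ∞ fun t => rot t n := by
  have h1 : ContDiff ℝ ∞ fun t : ℝ => Real.sin t • hat n := Real.contDiff_sin.smul contDiff_const
  have h2 : ContDiff ℝ ∞ fun t : ℝ => (1 - Real.cos t) • (hat n * hat n) :=
    (contDiff_const.sub Real.contDiff_cos).smul contDiff_const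
  exact (contDiff_const.add h1).add h2

end Rotation

section Tangent

variable {𝕜 : Type*} [RCLike 𝕜] {m : Type*} [Fintype m] [DecidableEq m]

theorem range_subset_tangentVectors {G : Set (Matrix m m 𝕜)}
    {gen : (Fin 3 → ℝ) →ₗ[ℝ] Matrix m m 𝕜} {rot : ℝ → (Fin 3 → ℝ) → Matrix m m 𝕜}
    (h1 : ∀ t n, n ⬝ᵥ n = 1 → rot t n ∈ G) (h2 : ∀ n, ContDiff ℝ ∞ fun t => rot t n)
    (h3 : ∀ n, rot 0 n = 1)
    (h4 : ∀ t n, n ⬝ᵥ n = 1 → HasDerivAt (fun t => rot t n) (rot t n * gen n) t) :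
    Set.range gen ⊆ tangentVectors G 1 := by
  rintro _ ⟨a, rfl⟩
  by_cases ha : a = 0
  · rw [ha, map_zero]
    have he : (Pi.single 0 1 : Fin 3 → ℝ) ⬝ᵥ Pi.single 0 1 = 1 := by simp
    have := h1 0 _ he
    rw [h3] at this
    exact zero_mem_tangentVectors this
  · have hl := len_pos ha
    set n := (len a)⁻¹ • a with hn
    have hnn : n ⬝ᵥ n = 1 := by
      rw [hn, smul_dotProduct, dotProduct_smul, ← len_sq, smul_eq_mul, smul_eq_mul]
      field_simp
    refine ⟨fun t => rot (len a * t) n, ⟨(h2 n).comp (contDiff_const.mul contDiff_id),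
      fun t => h1 _ _ hnn⟩, by simp [h3], ?_⟩
    have h5 : HasDerivAt (fun t => rot (len a * t) n) (len a • (rot (len a * 0) n * gen n)) 0 :=
      (h4 (len a * 0) n hnn).scomp (0 : ℝ) (by simpa using (hasDerivAt_id (0 : ℝ)).const_mul (len a))
    rw [h5.deriv, mul_zero, h3, one_mul, hn, map_smul, smul_smul, mul_inv_cancel₀ hl.ne', one_smul]

end Tangent

namespace Rotation

theorem tangentVectors_eq :
    tangentVectors (Matrix.specialOrthogonalGroup (Fin 3) ℝ : Set (Matrix (Fin 3) (Fin 3) ℝ)) 1 =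
      Set.range hat := by
  refine Set.Subset.antisymm ?_ (range_subset_tangentVectors (fun t n hn => rot_mem hn t)
    contDiff_rot rot_zero fun t n hn => hasDerivAt_rot hn t)
  rintro _ ⟨γ, hγ, h0, rfl⟩
  have hd := hasDerivAt_of_smoothCurveIn hγ 0
  have hij : ∀ i j, HasDerivAt (fun t => γ t i j) (deriv γ 0 i j) 0 := fun i j =>
    hasDerivAt_pi.1 (hasDerivAt_pi.1 hd i) j
  have hdT : HasDerivAt (fun t => (γ t)ᵀ) (deriv γ 0)ᵀ 0 :=
    hasDerivAt_pi.2 fun i => hasDerivAt_pi.2 fun j => hij j i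
  have h1 := hasDerivAt_matrix_mul hd hdT
  have h2 : (fun t => γ t * (γ t)ᵀ) = fun _ => 1 := funext fun t => (mem_iff.1 (hγ.2 t)).1
  rw [h2] at h1
  have h3 := h1.unique (hasDerivAt_const _ _)
  rw [h0, Matrix.transpose_one, one_mul, mul_one] at h3
  have h4 : ∀ i j, deriv γ 0 j i = -deriv γ 0 i j := fun i j => by
    have := congrFun (congrFun h3 i) j
    simp only [Matrix.add_apply, Matrix.transpose_apply, Matrix.zero_apply] at this
    linarith
  refine ⟨![deriv γ 0 2 1, deriv γ 0 0 2, deriv γ 0 1 0], ?_⟩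
  ext i j
  have h5 := h4 0 0
  have h6 := h4 1 1
  have h7 := h4 2 2
  have h8 := h4 0 1
  have h9 := h4 0 2
  have h10 := h4 1 2
  fin_cases i <;> fin_cases j <;> simp [hat_apply] <;> linarith

theorem adjugate_dot {g : Matrix (Fin 3) (Fin 3) ℝ}
    (hg : g ∈ Matrix.specialOrthogonalGroup (Fin 3) ℝ) (a b : Fin 3 → ℝ) :
    (g.adjugate *ᵥ a) ⬝ᵥ (g.adjugate *ᵥ b) = a ⬝ᵥ b := by
  rw [adjugate_eq hg]
  refine mulVec_dot_mulVec ?_ a b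
  rw [Matrix.transpose_transpose]
  exact mul_eq_one_comm.1 (mem_iff.1 hg).1

theorem adjugate_rot {t : ℝ} {n : Fin 3 → ℝ} (hn : n ⬝ᵥ n = 1) (y : Fin 3 → ℝ) :
    (rot t n).adjugate *ᵥ y = y - Real.sin t • crossProduct n y +
      (1 - Real.cos t) • crossProduct n (crossProduct n y) := by
  rw [adjugate_eq (rot_mem hn t), rot_transpose]
  simp only [rot, Matrix.add_mulVec, Matrix.smul_mulVec, Matrix.one_mulVec, hat_mulVec,
    ← Matrix.mulVec_mulVec, Real.sin_neg, Real.cos_neg]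
  module

/-- The rotation group. -/
def lieModel : LieModel (Matrix.specialOrthogonalGroup (Fin 3) ℝ) (1 / 2) where
  gen := hat
  ad g := Matrix.toLin' g.adjugate
  rot := rot
  tangent_eq := tangentVectors_eq
  bracket := hat_bracket
  lieNorm_gen a := by
    rw [lieNorm]
    congr 1
    rw [dot_eq]
    simp [Fin.sum_univ_three, hat_apply]
    ring
  ad_smooth := by
    rw [contDiff_pi]
    intro i
    have h1 : ∀ j k, ContDiff ℝ ∞ fun q : Matrix (Fin 3) (Fin 3) ℝ × (Fin 3 → ℝ) => q.1 j k :=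
      fun j k => (contDiff_apply_apply ℝ ℝ j k).comp contDiff_fst
    have h2 : ∀ j, ContDiff ℝ ∞ fun q : Matrix (Fin 3) (Fin 3) ℝ × (Fin 3 → ℝ) => q.2 j :=
      fun j => (contDiff_apply ℝ ℝ j).comp contDiff_snd
    simp only [Matrix.toLin'_apply, Matrix.mulVec, dotProduct, Fin.sum_univ_three,
      Matrix.adjugate_fin_three]
    fin_cases i <;> simp <;> fun_prop
  conj_gen g hg a := by
    rw [inv_eq hg, transpose_mul_hat_mul, Matrix.toLin'_apply]
  inv_mem g hg := by
    obtain ⟨h1, h2⟩ := mem_iff.1 hg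
    rw [inv_eq hg, mem_iff, Matrix.transpose_transpose, Matrix.det_transpose]
    exact ⟨mul_eq_one_comm.1 h1, h2⟩
  inv_mul g hg := by
    rw [inv_eq hg]
    exact mul_eq_one_comm.1 (mem_iff.1 hg).1
  ad_dot g hg a b := by
    rw [Matrix.toLin'_apply, Matrix.toLin'_apply, adjugate_dot hg]
  rot_mem t n hn := rot_mem hn t
  rot_smooth := contDiff_rot
  rot_zero := rot_zero
  rot_deriv t n hn := hasDerivAt_rot hn t
  rot_add s t n hn := rot_add hn s t
  rot_neg t n := by simp [rot]
  rot_period n := by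
    have h1 : Real.sin (4 * Real.pi) = 0 := by
      rw [show 4 * Real.pi = ((4 : ℕ) : ℝ) * Real.pi by norm_num, Real.sin_nat_mul_pi]
    have h2 : Real.cos (4 * Real.pi) = 1 := by
      rw [show 4 * Real.pi = ((2 : ℕ) : ℝ) * (2 * Real.pi) by norm_num; ring,
        Real.cos_nat_mul_two_pi]
    simp [rot, h1, h2]
  ad_rot t n y hn hy := by
    rw [Matrix.toLin'_apply, adjugate_rot hn, cross_unit_cross hn hy]
    module
  ad_rot_self t n hn := by
    rw [Matrix.toLin'_apply, adjugate_rot hn]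
    simp [cross_self]
  conj_rot g hg t n := by
    have h1 : g * gᵀ = 1 := (mem_iff.1 hg).1
    have h2 : gᵀ * g = 1 := mul_eq_one_comm.1 h1
    have h3 : gᵀ * (hat n * hat n) * g = (gᵀ * hat n * g) * (gᵀ * hat n * g) := by
      calc _ = gᵀ * hat n * 1 * hat n * g := by rw [mul_one]; simp only [mul_assoc]
        _ = _ := by rw [← h1]; simp only [mul_assoc]
    rw [inv_eq hg, rot, rot, Matrix.toLin'_apply, ← transpose_mul_hat_mul, ← h3]
    simp only [mul_add, add_mul, mul_one, h2, mul_smul_comm, smul_mul_assoc]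
  ker_ad g hg h := by
    left
    have h1 : gᵀ = 1 := by
      rw [← adjugate_eq hg]
      exact Matrix.toLin'.injective (LinearMap.ext fun a => by rw [h a]; simp)
    rw [← Matrix.transpose_transpose g, h1, Matrix.transpose_one]

end Rotation

/-! ### The group of unit quaternions -/

namespace UnitQuaternion

open scoped Quaternion

/-- The imaginary quaternion with given coordinates. -/
def vec (a : Fin 3 → ℝ) : ℍ[ℝ] := ⟨0, a 0, a 1, a 2⟩

@[simp] theorem vec_re (a : Fin 3 → ℝ) : (vec a).re = 0 := rfl

@[simp] theorem vec_imI (a : Fin 3 → ℝ) : (vec a).imI = a 0 := rfl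

@[simp] theorem vec_imJ (a : Fin 3 → ℝ) : (vec a).imJ = a 1 := rfl

@[simp] theorem vec_imK (a : Fin 3 → ℝ) : (vec a).imK = a 2 := rfl

/-- The imaginary part of a quaternion. -/
def im (q : ℍ[ℝ]) : Fin 3 → ℝ := ![q.imI, q.imJ, q.imK]

@[simp] theorem im_zero (q : ℍ[ℝ]) : im q 0 = q.imI := rfl

@[simp] theorem im_one (q : ℍ[ℝ]) : im q 1 = q.imJ := rfl

@[simp] theorem im_two (q : ℍ[ℝ]) : im q 2 = q.imK := rfl

/-- The matrix of a quaternion. -/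
def toMatrix (q : ℍ[ℝ]) : Matrix (Fin 2) (Fin 2) ℂ :=
  !![⟨q.re, q.imI⟩, ⟨q.imJ, q.imK⟩; ⟨-q.imJ, q.imK⟩, ⟨q.re, -q.imI⟩]

/-- The quaternion of a matrix. -/
def ofMatrix (g : Matrix (Fin 2) (Fin 2) ℂ) : ℍ[ℝ] :=
  ⟨(g 0 0).re, (g 0 0).im, (g 0 1).re, (g 0 1).im⟩

theorem ofMatrix_toMatrix (q : ℍ[ℝ]) : ofMatrix (toMatrix q) = q := rfl

theorem toMatrix_mul (p q : ℍ[ℝ]) : toMatrix (p * q) = toMatrix p * toMatrix q := by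
  ext i j
  fin_cases i <;> fin_cases j <;> apply Complex.ext <;> simp [toMatrix] <;> ring

theorem toMatrix_one : toMatrix 1 = 1 := by
  ext i j
  fin_cases i <;> fin_cases j <;> apply Complex.ext <;> simp [toMatrix]

theorem toMatrix_add (p q : ℍ[ℝ]) : toMatrix (p + q) = toMatrix p + toMatrix q := by
  ext i j
  fin_cases i <;> fin_cases j <;> apply Complex.ext <;> simp [toMatrix] <;> ring

theorem toMatrix_smul (c : ℝ) (q : ℍ[ℝ]) : toMatrix (c • q) = c • toMatrix q := by
  ext i j
  fin_cases i <;> fin_cases j <;> apply Complex.ext <;> simp [toMatrix]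

theorem normSq_eq (q : ℍ[ℝ]) :
    Quaternion.normSq q = q.re * q.re + q.imI * q.imI + q.imJ * q.imJ + q.imK * q.imK := by
  rw [Quaternion.normSq_def']
  ring

theorem vec_im_star_mul_mul (q : ℍ[ℝ]) (a : Fin 3 → ℝ) :
    vec (im (star q * vec a * q)) = star q * vec a * q := by
  ext <;> simp
  ring

theorem im_star_mul_mul (q : ℍ[ℝ]) (a : Fin 3 → ℝ) :
    im (star q * vec a * q) = (q.re ^ 2 - im q ⬝ᵥ im q) • a + (2 * (im q ⬝ᵥ a)) • im q -
      (2 * q.re) • crossProduct (im q) a := by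
  apply vec_ext <;>
    simp only [im_zero, im_one, im_two, Pi.add_apply, Pi.sub_apply, Pi.smul_apply, smul_eq_mul,
      dot_eq, cross_zero, cross_one, cross_two] <;> simp <;> ring

theorem star_mul_self {q : ℍ[ℝ]} (hq : Quaternion.normSq q = 1) : star q * q = 1 := by
  rw [Quaternion.star_mul_self, hq, Quaternion.coe_one]

theorem toMatrix_inv {q : ℍ[ℝ]} (hq : Quaternion.normSq q = 1) :
    (toMatrix q)⁻¹ = toMatrix (star q) :=
  Matrix.inv_eq_left_inv (by rw [← toMatrix_mul, star_mul_self hq, toMatrix_one])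

theorem toMatrix_conjTranspose (q : ℍ[ℝ]) : (toMatrix q)ᴴ = toMatrix (star q) := by
  ext i j
  fin_cases i <;> fin_cases j <;> apply Complex.ext <;> simp [toMatrix]

theorem toMatrix_mem {q : ℍ[ℝ]} (hq : Quaternion.normSq q = 1) :
    toMatrix q ∈ Matrix.specialUnitaryGroup (Fin 2) ℂ := by
  rw [Matrix.mem_specialUnitaryGroup_iff, Matrix.mem_unitaryGroup_iff']
  refine ⟨by
    rw [Matrix.star_eq_conjTranspose, toMatrix_conjTranspose, ← toMatrix_mul, star_mul_self hq,
      toMatrix_one], ?_⟩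
  rw [normSq_eq] at hq
  rw [Matrix.det_fin_two]
  apply Complex.ext <;> simp [toMatrix]
  · linarith
  · ring

theorem exists_toMatrix {g : Matrix (Fin 2) (Fin 2) ℂ}
    (hg : g ∈ Matrix.specialUnitaryGroup (Fin 2) ℂ) :
    ∃ q, Quaternion.normSq q = 1 ∧ g = toMatrix q := by
  rw [Matrix.mem_specialUnitaryGroup_iff, Matrix.mem_unitaryGroup_iff',
    Matrix.star_eq_conjTranspose] at hg
  obtain ⟨h1, h2⟩ := hg
  have h3 : g.adjugate = gᴴ := by
    calc g.adjugate = gᴴ * g * g.adjugate := by rw [h1, one_mul]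
      _ = gᴴ := by rw [mul_assoc, Matrix.mul_adjugate, h2, one_smul, mul_one]
  rw [Matrix.adjugate_fin_two] at h3
  have h4 := congrFun (congrFun h3 0) 0
  have h5 := congrFun (congrFun h3 0) 1
  simp at h4 h5
  have h6 : g = toMatrix (ofMatrix g) := by
    have h7 : g 1 0 = -(starRingEnd ℂ) (g 0 1) := by
      rw [← map_neg, h5, Complex.conj_conj]
    ext i j
    fin_cases i <;> fin_cases j <;> simp [toMatrix, ofMatrix, h4, h7] <;> apply Complex.ext <;> simp
  refine ⟨ofMatrix g, ?_, h6⟩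
  rw [h6, Matrix.det_fin_two] at h2
  have := congrArg Complex.re h2
  simp [toMatrix] at this
  rw [normSq_eq]
  linarith

/-- The isomorphism of `ℝ³` with the Lie algebra. -/
def gen : (Fin 3 → ℝ) →ₗ[ℝ] Matrix (Fin 2) (Fin 2) ℂ where
  toFun a := (1 / 2 : ℝ) • toMatrix (vec a)
  map_add' a b := by
    rw [← smul_add, ← toMatrix_add, show vec (a + b) = vec a + vec b by ext <;> simp]
  map_smul' c a := by
    rw [RingHom.id_apply, show vec (c • a) = c • vec a by ext <;> simp,
      toMatrix_smul, smul_comm]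

theorem gen_apply (a : Fin 3 → ℝ) : gen a = (1 / 2 : ℝ) • toMatrix (vec a) := rfl

/-- The rotation of the imaginary quaternions by the inverse of a unit quaternion. -/
def ad (g : Matrix (Fin 2) (Fin 2) ℂ) : (Fin 3 → ℝ) →ₗ[ℝ] (Fin 3 → ℝ) where
  toFun a := im (star (ofMatrix g) * vec a * ofMatrix g)
  map_add' a b := by
    simp only [im_star_mul_mul, dotProduct_add, map_add]
    module
  map_smul' c a := by
    simp only [im_star_mul_mul, dotProduct_smul, map_smul, smul_eq_mul, RingHom.id_apply]
    module

theorem ad_toMatrix (q : ℍ[ℝ]) (a : Fin 3 → ℝ) : ad (toMatrix q) a = im (star q * vec a * q) := rfl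

/-- The one-parameter groups of unit quaternions, as quaternions. -/
def rotQuaternion (t : ℝ) (n : Fin 3 → ℝ) : ℍ[ℝ] :=
  ⟨Real.cos (t / 2), Real.sin (t / 2) * n 0, Real.sin (t / 2) * n 1, Real.sin (t / 2) * n 2⟩

/-- The one-parameter groups of unit quaternions. -/
def rot (t : ℝ) (n : Fin 3 → ℝ) : Matrix (Fin 2) (Fin 2) ℂ := toMatrix (rotQuaternion t n)

theorem rot_eq (t : ℝ) (n : Fin 3 → ℝ) :
    rot t n = Real.cos (t / 2) • 1 + (2 * Real.sin (t / 2)) • gen n := by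
  rw [gen_apply, ← toMatrix_one, smul_smul, ← toMatrix_smul, ← toMatrix_smul, ← toMatrix_add, rot]
  congr 1
  ext <;> simp [rotQuaternion] <;> left <;> ring

theorem normSq_rotQuaternion {n : Fin 3 → ℝ} (hn : n ⬝ᵥ n = 1) (t : ℝ) :
    Quaternion.normSq (rotQuaternion t n) = 1 := by
  rw [dot_eq] at hn
  rw [normSq_eq]
  simp only [rotQuaternion]
  linear_combination Real.sin (t / 2) ^ 2 * hn + Real.sin_sq_add_cos_sq (t / 2)

theorem ad_rot {n : Fin 3 → ℝ} (hn : n ⬝ᵥ n = 1) (t : ℝ) (y : Fin 3 → ℝ) :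
    ad (rot t n) y = Real.cos t • y + ((1 - Real.cos t) * (n ⬝ᵥ y)) • n -
      Real.sin t • crossProduct n y := by
  have h1 : im (rotQuaternion t n) = Real.sin (t / 2) • n := by
    apply vec_ext <;> simp [im, rotQuaternion]
  have h2 : Real.cos t = 2 * Real.cos (t / 2) ^ 2 - 1 := by
    rw [← Real.cos_two_mul]; ring_nf
  have h3 : Real.sin t = 2 * Real.sin (t / 2) * Real.cos (t / 2) := by
    rw [← Real.sin_two_mul]; ring_nf
  have h4 := Real.sin_sq_add_cos_sq (t / 2)
  have h5 : Real.sin (t / 2) ^ 2 = 1 - Real.cos (t / 2) ^ 2 := by linarith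
  have h6 : (rotQuaternion t n).re = Real.cos (t / 2) := rfl
  rw [rot, ad_toMatrix, im_star_mul_mul, h1, h2, h3, h6]
  simp only [smul_dotProduct, dotProduct_smul, hn, map_smul, LinearMap.smul_apply, smul_eq_mul,
    smul_smul]
  congr 1
  · congr 1
    · congr 1
      linear_combination -h5
    · congr 1
      linear_combination 2 * (n ⬝ᵥ y) * h5
  · congr 1
    ring

theorem contDiff_rot (n : Fin 3 → ℝ) : ContDiff ℝ ∞ fun t => rot t n := by
  have h0 : ContDiff ℝ ∞ fun t : ℝ => t / 2 := contDiff_id.div_const 2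
  simp only [rot_eq]
  exact ((Real.contDiff_cos.comp h0).smul contDiff_const).add
    ((contDiff_const.mul (Real.contDiff_sin.comp h0)).smul contDiff_const)

theorem gen_mul_gen_self {n : Fin 3 → ℝ} (hn : n ⬝ᵥ n = 1) :
    gen n * gen n = (-(1 / 4) : ℝ) • (1 : Matrix (Fin 2) (Fin 2) ℂ) := by
  rw [dot_eq] at hn
  rw [gen_apply, smul_mul_smul_comm, ← toMatrix_mul, ← toMatrix_one, ← toMatrix_smul,
    ← toMatrix_smul]
  congr 1
  ext <;> simp
  · linear_combination (-1 / 4) * hn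
  all_goals ring

theorem hasDerivAt_rot {n : Fin 3 → ℝ} (hn : n ⬝ᵥ n = 1) (t : ℝ) :
    HasDerivAt (fun t => rot t n) (rot t n * gen n) t := by
  have h0 : HasDerivAt (fun t : ℝ => t / 2) (1 / 2) t := (hasDerivAt_id t).div_const 2
  have h := (h0.cos.smul_const (1 : Matrix (Fin 2) (Fin 2) ℂ)).add
    ((h0.sin.const_mul 2).smul_const (gen n))
  simp only [rot_eq]
  refine h.congr_deriv ?_
  simp only [add_mul, smul_mul_assoc, one_mul, gen_mul_gen_self hn]
  module

theorem rot_add {n : Fin 3 → ℝ} (hn : n ⬝ᵥ n = 1) (s t : ℝ) :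
    rot (s + t) n = rot s n * rot t n := by
  simp only [rot_eq, add_mul, mul_add, smul_mul_smul_comm, one_mul, mul_one, gen_mul_gen_self hn,
    add_div, Real.cos_add, Real.sin_add]
  module

theorem rot_zero (n : Fin 3 → ℝ) : rot 0 n = 1 := by simp [rot_eq]

theorem tangentVectors_eq :
    tangentVectors (Matrix.specialUnitaryGroup (Fin 2) ℂ : Set (Matrix (Fin 2) (Fin 2) ℂ)) 1 =
      Set.range gen := by
  refine Set.Subset.antisymm ?_ (range_subset_tangentVectors
    (fun t n hn => toMatrix_mem (normSq_rotQuaternion hn t)) contDiff_rot rot_zero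
    fun t n hn => hasDerivAt_rot hn t)
  rintro _ ⟨γ, hγ, h0, rfl⟩
  have hd := hasDerivAt_of_smoothCurveIn hγ 0
  have hij : ∀ i j, HasDerivAt (fun t => γ t i j) (deriv γ 0 i j) 0 := fun i j =>
    hasDerivAt_pi.1 (hasDerivAt_pi.1 hd i) j
  have hre : ∀ i j, HasDerivAt (fun t => (γ t i j).re) (deriv γ 0 i j).re 0 := fun i j =>
    (Complex.reCLM.hasFDerivAt.comp_hasDerivAt 0 (hij i j))
  have him : ∀ i j, HasDerivAt (fun t => (γ t i j).im) (deriv γ 0 i j).im 0 := fun i j =>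
    (Complex.imCLM.hasFDerivAt.comp_hasDerivAt 0 (hij i j))
  choose q hq hγq using fun t => exists_toMatrix (hγ.2 t)
  have h1 : deriv γ 0 1 1 = ⟨(deriv γ 0 0 0).re, -(deriv γ 0 0 0).im⟩ := by
    apply Complex.ext
    · refine (hre 1 1).unique ((hre 0 0).congr_of_eventuallyEq (Eventually.of_forall fun t => ?_))
      simp only [hγq t]; rfl
    · refine (him 1 1).unique
        ((him 0 0).neg.congr_of_eventuallyEq (Eventually.of_forall fun t => ?_))
      simp only [Pi.neg_apply, hγq t]; rfl
  have h2 : deriv γ 0 1 0 = ⟨-(deriv γ 0 0 1).re, (deriv γ 0 0 1).im⟩ := by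
    apply Complex.ext
    · refine (hre 1 0).unique
        ((hre 0 1).neg.congr_of_eventuallyEq (Eventually.of_forall fun t => ?_))
      simp only [Pi.neg_apply, hγq t]; rfl
    · refine (him 1 0).unique ((him 0 1).congr_of_eventuallyEq (Eventually.of_forall fun t => ?_))
      simp only [hγq t]; rfl
  have h3 : (deriv γ 0 0 0).re = 0 := by
    have e : (fun t => (γ t 0 0).re * (γ t 0 0).re + (γ t 0 0).im * (γ t 0 0).im +
        (γ t 0 1).re * (γ t 0 1).re + (γ t 0 1).im * (γ t 0 1).im) = fun _ => 1 := by
      funext t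
      rw [← hq t, normSq_eq, hγq t]; rfl
    have h4 := ((((hre 0 0).mul (hre 0 0)).add ((him 0 0).mul (him 0 0))).add
      ((hre 0 1).mul (hre 0 1))).add ((him 0 1).mul (him 0 1))
    have h5 := (h4.congr_of_eventuallyEq (Eventually.of_forall fun t => (congrFun e t).symm)).unique
      (hasDerivAt_const _ _)
    rw [h0] at h5
    simp at h5
    linarith
  refine ⟨![2 * (deriv γ 0 0 0).im, 2 * (deriv γ 0 0 1).re, 2 * (deriv γ 0 0 1).im], ?_⟩
  ext i j
  fin_cases i <;> fin_cases j <;> apply Complex.ext <;> simp [gen_apply, toMatrix, h1, h2, h3]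

/-- The group of unit quaternions. -/
def lieModel : LieModel (Matrix.specialUnitaryGroup (Fin 2) ℂ) 2 where
  gen := gen
  ad := ad
  rot := rot
  tangent_eq := tangentVectors_eq
  bracket a b := by
    rw [gen_apply, gen_apply, gen_apply, smul_mul_smul_comm, smul_mul_smul_comm, ← toMatrix_mul,
      ← toMatrix_mul]
    ext i j
    fin_cases i <;> fin_cases j <;> apply Complex.ext <;>
      simp [toMatrix, cross_zero, cross_one, cross_two] <;> ring
  lieNorm_gen a := by
    have h : ∀ x y : ℝ, ‖(⟨x, y⟩ : ℂ)‖ ^ 2 = x ^ 2 + y ^ 2 := fun x y => by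
      rw [← Complex.normSq_eq_norm_sq, Complex.normSq_apply]; ring
    rw [lieNorm]
    congr 1
    rw [dot_eq]
    simp [Fin.sum_univ_two, gen_apply, toMatrix, mul_pow, h]
    ring
  ad_smooth := by
    have h1 : ∀ j k, ContDiff ℝ ∞ fun q : Matrix (Fin 2) (Fin 2) ℂ × (Fin 3 → ℝ) => q.1 j k :=
      fun j k => (contDiff_apply_apply ℝ ℂ j k).comp contDiff_fst
    have h2 : ∀ j, ContDiff ℝ ∞ fun q : Matrix (Fin 2) (Fin 2) ℂ × (Fin 3 → ℝ) => q.2 j :=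
      fun j => (contDiff_apply ℝ ℝ j).comp contDiff_snd
    have h3 : ∀ j k, ContDiff ℝ ∞ fun q : Matrix (Fin 2) (Fin 2) ℂ × (Fin 3 → ℝ) => (q.1 j k).re :=
      fun j k => Complex.reCLM.contDiff.comp (h1 j k)
    have h4 : ∀ j k, ContDiff ℝ ∞ fun q : Matrix (Fin 2) (Fin 2) ℂ × (Fin 3 → ℝ) => (q.1 j k).im :=
      fun j k => Complex.imCLM.contDiff.comp (h1 j k)
    rw [contDiff_pi]
    intro i
    fin_cases i <;> simp [ad, im] <;> simp [ofMatrix] <;> fun_prop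
  conj_gen g hg a := by
    obtain ⟨q, hq, rfl⟩ := exists_toMatrix hg
    rw [toMatrix_inv hq, gen_apply, gen_apply, mul_smul_comm, smul_mul_assoc, ← toMatrix_mul,
      ← toMatrix_mul, ad_toMatrix, vec_im_star_mul_mul]
  inv_mem g hg := by
    obtain ⟨q, hq, rfl⟩ := exists_toMatrix hg
    rw [toMatrix_inv hq]
    exact toMatrix_mem (by rw [Quaternion.normSq_star, hq])
  inv_mul g hg := by
    obtain ⟨q, hq, rfl⟩ := exists_toMatrix hg
    rw [toMatrix_inv hq, ← toMatrix_mul, star_mul_self hq, toMatrix_one]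
  ad_dot g hg a b := by
    obtain ⟨q, hq, rfl⟩ := exists_toMatrix hg
    rw [normSq_eq] at hq
    simp only [ad_toMatrix, dot_eq]
    simp
    linear_combination (q.re * q.re + q.imI * q.imI + q.imJ * q.imJ + q.imK * q.imK + 1) *
      (a 0 * b 0 + a 1 * b 1 + a 2 * b 2) * hq
  rot_mem t n hn := toMatrix_mem (normSq_rotQuaternion hn t)
  rot_smooth := contDiff_rot
  rot_zero := rot_zero
  rot_deriv t n hn := hasDerivAt_rot hn t
  rot_add s t n hn := rot_add hn s t
  rot_neg t n := by simp [rot_eq, neg_div]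
  rot_period n := by
    rw [rot_eq, show 4 * Real.pi / 2 = 2 * Real.pi by ring]
    simp
  ad_rot t n y hn hy := by
    rw [ad_rot hn, hy, mul_zero, zero_smul, add_zero]
  ad_rot_self t n hn := by
    rw [ad_rot hn, hn, cross_self]
    module
  conj_rot g hg t n := by
    obtain ⟨q, hq, rfl⟩ := exists_toMatrix hg
    have h : (toMatrix q)⁻¹ * gen n * toMatrix q = gen (ad (toMatrix q) n) := by
      rw [toMatrix_inv hq, gen_apply, gen_apply, mul_smul_comm, smul_mul_assoc, ← toMatrix_mul,
        ← toMatrix_mul, ad_toMatrix, vec_im_star_mul_mul]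
    have h' : (toMatrix q)⁻¹ * toMatrix q = 1 := by
      rw [toMatrix_inv hq, ← toMatrix_mul, star_mul_self hq, toMatrix_one]
    rw [rot_eq, rot_eq, ← h]
    simp only [mul_add, add_mul, mul_smul_comm, smul_mul_assoc, mul_one, h']
  ker_ad g hg h := by
    obtain ⟨q, hq, rfl⟩ := exists_toMatrix hg
    rw [normSq_eq] at hq
    have h0 := congrFun (h (Pi.single 0 1)) 0
    have h1 := congrFun (h (Pi.single 1 1)) 1
    have h2 := congrFun (h (Pi.single 2 1)) 2
    simp [ad_toMatrix, im] at h0 h1 h2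
    have e1 : q.imI = 0 := by nlinarith
    have e2 : q.imJ = 0 := by nlinarith
    have e3 : q.imK = 0 := by nlinarith
    rw [e1, e2, e3] at hq
    have hre : (q.re - 1) * (q.re + 1) = 0 := by linarith
    rcases mul_eq_zero.1 hre with hr | hr
    · left
      rw [← toMatrix_one]
      congr 1
      ext <;> simp [e1, e2, e3]
      linarith
    · right
      intro n hn
      rw [rot]
      congr 1
      have hpi : 2 * Real.pi / 2 = Real.pi := by ring
      ext <;> simp [rotQuaternion, e1, e2, e3, hpi]
      linarith

end UnitQuaternion

/-! ### Bilinear maps, two-forms and spheres -/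

section Bilinear

variable {V W E : Type*} [NormedAddCommGroup V] [NormedSpace ℝ V] [NormedAddCommGroup W]
  [NormedSpace ℝ W] [NormedAddCommGroup E] [NormedSpace ℝ E]

/-- The alternating form `(u, v) ↦ f u v - f v u` of a bilinear form `f`. -/
def altForm [FiniteDimensional ℝ E] (f : E →ₗ[ℝ] E →ₗ[ℝ] ℝ) : E [⋀^Fin 2]→L[ℝ] ℝ where
  toFun w := f (w 0) (w 1) - f (w 1) (w 0)
  map_update_add' w i x y := by
    fin_cases i
    · simp
      ring
    · simp
      ring
  map_update_smul' w i c x := by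
    fin_cases i
    · simp
      ring
    · simp
      ring
  cont := by
    have h : ∀ i j : Fin 2, Continuous fun w : Fin 2 → E => f.toContinuousBilinearMap (w i) (w j) :=
      fun i j => (f.toContinuousBilinearMap.continuous.comp (continuous_apply i)).clm_apply
        (continuous_apply j)
    exact (h 0 1).sub (h 1 0)
  map_eq_zero_of_eq' w i j h hij := by
    fin_cases i <;> fin_cases j <;> simp_all

/-- `altForm` as a linear map. -/
def altFormₗ [FiniteDimensional ℝ E] : (E →ₗ[ℝ] E →ₗ[ℝ] ℝ) →ₗ[ℝ] (E [⋀^Fin 2]→L[ℝ] ℝ) where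
  toFun := altForm
  map_add' f g := by
    ext w
    change (f + g) (w 0) (w 1) - (f + g) (w 1) (w 0) =
      (f (w 0) (w 1) - f (w 1) (w 0)) + (g (w 0) (w 1) - g (w 1) (w 0))
    simp only [LinearMap.add_apply]
    ring
  map_smul' c f := by
    ext w
    change (c • f) (w 0) (w 1) - (c • f) (w 1) (w 0) = c • (f (w 0) (w 1) - f (w 1) (w 0))
    simp only [LinearMap.smul_apply, smul_eq_mul]
    ring

theorem contDiff_bilinear (f : V →L[ℝ] V →L[ℝ] W) : ContDiff ℝ ∞ fun q => f q q :=
  f.isBoundedBilinearMap.contDiff.comp (contDiff_id.prodMk contDiff_id)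

theorem fderiv_bilinear (f : V →L[ℝ] V →L[ℝ] W) (q u : V) :
    fderiv ℝ (fun q => f q q) q u = f q u + f u q := by
  have h : HasFDerivAt (fun q => f q q) _ q := (f.hasFDerivAt (x := q)).clm_apply (hasFDerivAt_id q)
  rw [h.fderiv]
  simp

theorem mem_tangentVectors_of_normalized {S : Set V} {p v : V} {c : ℝ} (hc : 0 ≤ c)
    (h : ∀ t : ℝ, (Real.sqrt (1 + c * t ^ 2))⁻¹ • (p + t • v) ∈ S) : v ∈ tangentVectors S p := by
  have hpos : ∀ t : ℝ, 0 < 1 + c * t ^ 2 := fun t => by positivity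
  refine ⟨fun t => (Real.sqrt (1 + c * t ^ 2))⁻¹ • (p + t • v), ⟨?_, h⟩, by simp, ?_⟩
  · refine ContDiff.smul (ContDiff.inv (ContDiff.sqrt (by fun_prop) fun t => (hpos t).ne')
      fun t => (Real.sqrt_pos.2 (hpos t)).ne') (by fun_prop)
  · have h1 : HasDerivAt (fun t : ℝ => 1 + c * t ^ 2) 0 0 := by
      simpa using (((hasDerivAt_id (0 : ℝ)).pow 2).const_mul c).const_add 1
    have h2 := (h1.sqrt (hpos 0).ne').inv (Real.sqrt_pos.2 (hpos 0)).ne'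
    have h3 : HasDerivAt (fun t : ℝ => p + t • v) v 0 := by
      simpa using ((hasDerivAt_id (0 : ℝ)).smul_const v).const_add p
    have h4 := h2.smul h3
    simp at h4
    exact h4.deriv

/-- The derivative of a relation between a bilinear and a linear map. -/
theorem bilinear_relation_of_curve (f : V →L[ℝ] V →L[ℝ] W) (l : V →L[ℝ] W) {S : Set V} {c : W}
    (hS : ∀ q ∈ S, f q q = l q + c) {q u : V} (hu : u ∈ tangentVectors S q) :
    f q u + f u q = l u := by
  have h := fderiv_mem_tangentVectors (T := {c}) ((contDiff_bilinear f).sub l.contDiff)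
    (fun q hq => by
      change f q q - l q = c
      rw [hS q hq, add_sub_cancel_left]) hu
  rw [fderiv_fun_sub ((contDiff_bilinear f).differentiable (by simp) q) l.differentiableAt,
    _root_.sub_apply, fderiv_bilinear, l.fderiv] at h
  obtain ⟨γ, hγ, -, h2⟩ := h
  rw [← sub_eq_zero, ← h2, show γ = fun _ => c from funext hγ.2, deriv_const]

theorem bilinear_eq_zero_of_curve (f : V →L[ℝ] V →L[ℝ] W) {S : Set V} {c : W}
    (hS : ∀ q ∈ S, f q q = c) {q u : V} (hu : u ∈ tangentVectors S q) : f q u + f u q = 0 :=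
  bilinear_relation_of_curve f 0 (c := c) (fun q hq => by simp [hS q hq]) hu

theorem linear_eq_zero_of_curve (l : V →L[ℝ] W) {S : Set V} {c : W}
    (hS : ∀ q ∈ S, l q = c) {q u : V} (hu : u ∈ tangentVectors S q) : l u = 0 := by
  have := bilinear_relation_of_curve 0 l (c := -c) (fun q hq => by simp [hS q hq]) hu
  simpa using this.symm

theorem tangentVectors_sphere {E : Type*} [NormedAddCommGroup E] [InnerProductSpace ℝ E] {r : ℝ}
    (hr : 0 < r) {x : E} (hx : x ∈ Metric.sphere (0 : E) r) :
    tangentVectors (Metric.sphere (0 : E) r) x = {v | inner ℝ x v = 0} := by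
  rw [mem_sphere_zero_iff_norm] at hx
  ext v
  refine ⟨fun hv => ?_, fun hv => ?_⟩
  · have h := bilinear_eq_zero_of_curve (innerSL ℝ) (c := r ^ 2) (fun q hq => by
      rw [mem_sphere_zero_iff_norm] at hq
      rw [innerSL_apply_apply, real_inner_self_eq_norm_sq, hq]) hv
    rw [innerSL_apply_apply, innerSL_apply_apply, real_inner_comm] at h
    rw [Set.mem_ofPred_eq, real_inner_comm]
    linarith
  · rw [Set.mem_ofPred_eq] at hv
    refine mem_tangentVectors_of_normalized (c := ‖v‖ ^ 2 / r ^ 2) (by positivity) fun t => ?_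
    rw [mem_sphere_zero_iff_norm, norm_smul, norm_inv, Real.norm_eq_abs,
      abs_of_nonneg (Real.sqrt_nonneg _)]
    have h1 : ‖x + t • v‖ ^ 2 = r ^ 2 * (1 + ‖v‖ ^ 2 / r ^ 2 * t ^ 2) := by
      rw [norm_add_sq_real, inner_smul_right, hv, norm_smul, hx, mul_pow, Real.norm_eq_abs, sq_abs]
      field_simp
      ring
    have h2 : ‖x + t • v‖ = r * Real.sqrt (1 + ‖v‖ ^ 2 / r ^ 2 * t ^ 2) := by
      rw [← Real.sqrt_sq (norm_nonneg (x + t • v)), h1, Real.sqrt_mul (sq_nonneg r),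
        Real.sqrt_sq hr.le]
    have h3 : 0 < Real.sqrt (1 + ‖v‖ ^ 2 / r ^ 2 * t ^ 2) := Real.sqrt_pos.2 (by positivity)
    rw [h2]
    field_simp

end Bilinear

/-! ### The quaternionic Hopf fibration -/

namespace FourSphere

open scoped Quaternion

open UnitQuaternion

/-- The last four coordinates as a quaternion. -/
def quat (ξ : EuclideanSpace ℝ (Fin 5)) : ℍ[ℝ] := ⟨ξ 1, ξ 2, ξ 3, ξ 4⟩

/-- The point with given first coordinate and given last coordinates. -/
def point (r : ℝ) (v : ℍ[ℝ]) : EuclideanSpace ℝ (Fin 5) := !₂[r, v.re, v.imI, v.imJ, v.imK]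

@[simp] theorem quat_re (ξ : EuclideanSpace ℝ (Fin 5)) : (quat ξ).re = ξ 1 := rfl

@[simp] theorem quat_imI (ξ : EuclideanSpace ℝ (Fin 5)) : (quat ξ).imI = ξ 2 := rfl

@[simp] theorem quat_imJ (ξ : EuclideanSpace ℝ (Fin 5)) : (quat ξ).imJ = ξ 3 := rfl

@[simp] theorem quat_imK (ξ : EuclideanSpace ℝ (Fin 5)) : (quat ξ).imK = ξ 4 := rfl

@[simp] theorem point_zero (r : ℝ) (v : ℍ[ℝ]) : point r v 0 = r := rfl

@[simp] theorem point_one (r : ℝ) (v : ℍ[ℝ]) : point r v 1 = v.re := rfl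

@[simp] theorem point_two (r : ℝ) (v : ℍ[ℝ]) : point r v 2 = v.imI := rfl

@[simp] theorem point_three (r : ℝ) (v : ℍ[ℝ]) : point r v 3 = v.imJ := rfl

@[simp] theorem point_four (r : ℝ) (v : ℍ[ℝ]) : point r v 4 = v.imK := rfl

@[simp] theorem quat_point (r : ℝ) (v : ℍ[ℝ]) : quat (point r v) = v := rfl

theorem point_ext {ξ η : EuclideanSpace ℝ (Fin 5)} (h0 : ξ 0 = η 0) (h : quat ξ = quat η) :
    ξ = η := by
  rw [Quaternion.ext_iff] at h
  obtain ⟨h1, h2, h3, h4⟩ := h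
  ext i
  fin_cases i
  exacts [h0, h1, h2, h3, h4]

@[simp] theorem quat_add (ξ η : EuclideanSpace ℝ (Fin 5)) : quat (ξ + η) = quat ξ + quat η := by
  ext <;> simp

@[simp] theorem quat_smul (c : ℝ) (ξ : EuclideanSpace ℝ (Fin 5)) : quat (c • ξ) = c • quat ξ := by
  ext <;> simp

theorem inner_eq (ξ η : EuclideanSpace ℝ (Fin 5)) :
    inner ℝ ξ η = ξ 0 * η 0 + ξ 1 * η 1 + ξ 2 * η 2 + ξ 3 * η 3 + ξ 4 * η 4 := by
  simp [PiLp.inner_apply, Fin.sum_univ_succ]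
  ring

theorem pair_ext {p q : ℍ[ℝ] × ℍ[ℝ]} (h1 : p.1 = q.1) (h2 : p.2 = q.2) : p = q := Prod.ext h1 h2

/-- Clifford multiplication. -/
def cliff : EuclideanSpace ℝ (Fin 5) →ₗ[ℝ] ℍ[ℝ] × ℍ[ℝ] →ₗ[ℝ] ℍ[ℝ] × ℍ[ℝ] :=
  LinearMap.mk₂ ℝ (fun ξ q => (ξ 0 • q.1 + star (quat ξ) * q.2, -(ξ 0 • q.2) + quat ξ * q.1))
    (fun ξ η q => by
      apply pair_ext <;> simp only [quat_add, star_add, add_mul, PiLp.add_apply, add_smul,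
        Prod.fst_add, Prod.snd_add] <;> abel)
    (fun c ξ q => by
      apply pair_ext <;> simp [mul_smul])
    (fun ξ p q => by
      apply pair_ext <;> simp only [smul_add, mul_add, Prod.fst_add, Prod.snd_add] <;> abel)
    (fun c ξ q => by
      apply pair_ext <;> simp [smul_comm c])

theorem cliff_apply (ξ : EuclideanSpace ℝ (Fin 5)) (q : ℍ[ℝ] × ℍ[ℝ]) :
    cliff ξ q = (ξ 0 • q.1 + star (quat ξ) * q.2, -(ξ 0 • q.2) + quat ξ * q.1) := rfl

/-- The quaternionic Hermitian form. -/
def herm : ℍ[ℝ] × ℍ[ℝ] →ₗ[ℝ] ℍ[ℝ] × ℍ[ℝ] →ₗ[ℝ] ℍ[ℝ] :=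
  LinearMap.mk₂ ℝ (fun p q => star p.1 * q.1 + star p.2 * q.2)
    (fun p q r => by simp only [Prod.fst_add, Prod.snd_add, star_add, add_mul]; abel)
    (fun c p q => by simp)
    (fun p q r => by simp only [Prod.fst_add, Prod.snd_add, mul_add]; abel)
    (fun c p q => by simp)

theorem herm_apply (p q : ℍ[ℝ] × ℍ[ℝ]) : herm p q = star p.1 * q.1 + star p.2 * q.2 := rfl

theorem star_herm (p q : ℍ[ℝ] × ℍ[ℝ]) : star (herm p q) = herm q p := by
  simp [herm_apply]

/-- Right multiplication by a quaternion. -/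
def rmul (q : ℍ[ℝ] × ℍ[ℝ]) (g : ℍ[ℝ]) : ℍ[ℝ] × ℍ[ℝ] := (q.1 * g, q.2 * g)

theorem herm_rmul_right (p q : ℍ[ℝ] × ℍ[ℝ]) (g : ℍ[ℝ]) : herm p (rmul q g) = herm p q * g := by
  simp only [herm_apply, rmul, add_mul, mul_assoc]

theorem herm_rmul_left (p q : ℍ[ℝ] × ℍ[ℝ]) (g : ℍ[ℝ]) :
    herm (rmul p g) q = star g * herm p q := by
  simp only [herm_apply, rmul, mul_add, mul_assoc, star_mul]

theorem cliff_rmul (ξ : EuclideanSpace ℝ (Fin 5)) (q : ℍ[ℝ] × ℍ[ℝ]) (g : ℍ[ℝ]) :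
    cliff ξ (rmul q g) = rmul (cliff ξ q) g := by
  apply pair_ext <;> simp only [cliff_apply, rmul, add_mul, mul_assoc, smul_mul_assoc, neg_mul]

theorem rmul_mul (q : ℍ[ℝ] × ℍ[ℝ]) (g h : ℍ[ℝ]) : rmul q (g * h) = rmul (rmul q g) h := by
  apply pair_ext <;> simp only [rmul, mul_assoc]

theorem herm_cliff (ξ : EuclideanSpace ℝ (Fin 5)) (p q : ℍ[ℝ] × ℍ[ℝ]) :
    herm (cliff ξ p) q = herm p (cliff ξ q) := by
  simp only [herm_apply, cliff_apply, star_add, add_mul, mul_add, star_mul, Quaternion.star_smul, star_star,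
    star_neg, smul_mul_assoc, mul_smul_comm, mul_neg, neg_mul, mul_assoc]
  abel

theorem cliff_cliff (ξ η : EuclideanSpace ℝ (Fin 5)) (q : ℍ[ℝ] × ℍ[ℝ]) :
    cliff ξ (cliff η q) + cliff η (cliff ξ q) = (2 * inner ℝ ξ η : ℝ) • q := by
  rw [inner_eq]
  apply pair_ext <;> ext <;> simp [cliff_apply] <;> ring

/-- The bilinear map behind the Hopf fibration. -/
def hopfBilin : (ℍ[ℝ] × ℍ[ℝ]) →L[ℝ] (ℍ[ℝ] × ℍ[ℝ]) →L[ℝ] EuclideanSpace ℝ (Fin 5) :=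
  IsBilinearMap.toContinuousBilinearMap (𝕜 := ℝ)
    (f := fun p q : ℍ[ℝ] × ℍ[ℝ] => Real.sqrt 2 •
      point ((star p.1 * q.1).re - (star p.2 * q.2).re) ((2 : ℝ) • (p.2 * star q.1)))
    ⟨fun p q r => by
        apply point_ext
        · simp [add_mul]; ring
        · simp [add_mul],
      fun c p q => by
        apply point_ext
        · simp; ring
        · simp [smul_comm c],
      fun p q r => by
        apply point_ext
        · simp [mul_add]; ring
        · simp [mul_add],
      fun c p q => by
        apply point_ext
        · simp; ring
        · simp [smul_comm c]⟩

/-- The quaternionic Hopf fibration. -/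
def hopf (q : ℍ[ℝ] × ℍ[ℝ]) : EuclideanSpace ℝ (Fin 5) := hopfBilin q q

theorem hopfBilin_apply (p q : ℍ[ℝ] × ℍ[ℝ]) : hopfBilin p q = Real.sqrt 2 •
    point ((star p.1 * q.1).re - (star p.2 * q.2).re) ((2 : ℝ) • (p.2 * star q.1)) := rfl

theorem fderiv_hopf (q u : ℍ[ℝ] × ℍ[ℝ]) : fderiv ℝ hopf q u = hopfBilin q u + hopfBilin u q :=
  fderiv_bilinear hopfBilin q u

theorem cliff_hopf (q p : ℍ[ℝ] × ℍ[ℝ]) :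
    cliff (hopf q) p = Real.sqrt 2 • ((2 : ℝ) • rmul q (herm q p) - (herm q q).re • p) := by
  rw [hopf, hopfBilin_apply, map_smul, LinearMap.smul_apply]
  congr 1
  apply pair_ext <;> ext <;> simp [cliff_apply, herm_apply, rmul] <;> ring

theorem cliff_fderiv_hopf (q u : ℍ[ℝ] × ℍ[ℝ]) :
    cliff (fderiv ℝ hopf q u) q = (2 * Real.sqrt 2) •
      ((herm q q).re • u - rmul q (herm q u) + (herm q u).re • q) := by
  rw [fderiv_hopf, hopfBilin_apply, hopfBilin_apply, ← smul_add, map_smul, LinearMap.smul_apply,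
    mul_comm, mul_smul]
  congr 1
  apply pair_ext <;> ext <;> simp [cliff_apply, herm_apply, rmul] <;> ring

theorem fderiv_hopf_cliff (q : ℍ[ℝ] × ℍ[ℝ]) (v : EuclideanSpace ℝ (Fin 5)) :
    fderiv ℝ hopf q (cliff v q) = (2 * Real.sqrt 2 * (herm q q).re) • v := by
  rw [fderiv_hopf, hopfBilin_apply, hopfBilin_apply, ← smul_add, mul_comm 2, mul_assoc, mul_smul]
  congr 1
  apply point_ext
  · simp [cliff_apply, herm_apply]; ring
  · ext <;> simp [cliff_apply, herm_apply] <;> ring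

theorem norm_hopf_sq (q : ℍ[ℝ] × ℍ[ℝ]) : inner ℝ (hopf q) (hopf q) = 2 * (herm q q).re ^ 2 := by
  rw [hopf, hopfBilin_apply, inner_smul_left, inner_smul_right, ← mul_assoc, inner_eq]
  simp [herm_apply]
  ring

theorem herm_self (q : ℍ[ℝ] × ℍ[ℝ]) : herm q q = (((herm q q).re : ℝ) : ℍ[ℝ]) := by
  ext <;> simp [herm_apply] <;> ring

/-! ### The tautological two-forms over the sphere -/

theorem im_add (p q : ℍ[ℝ]) : im (p + q) = im p + im q := by apply vec_ext <;> simp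

theorem im_smul (c : ℝ) (q : ℍ[ℝ]) : im (c • q) = c • im q := by apply vec_ext <;> simp

/-- The coordinates of the imaginary part, as a linear map. -/
def imₗ : ℍ[ℝ] →ₗ[ℝ] (Fin 3 → ℝ) where
  toFun := im
  map_add' := im_add
  map_smul' := im_smul

@[simp] theorem imₗ_apply (q : ℍ[ℝ]) : imₗ q = im q := rfl

theorem im_star (q : ℍ[ℝ]) : im (star q) = -im q := by apply vec_ext <;> simp

theorem im_mul_sub_mul (p q : ℍ[ℝ]) : im (p * q - q * p) = (2 : ℝ) • crossProduct (im p) (im q) := by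
  apply vec_ext <;>
    simp only [im_zero, im_one, im_two, Pi.smul_apply, smul_eq_mul, cross_zero, cross_one,
      cross_two] <;> simp <;> ring

theorem im_mul {p q : ℍ[ℝ]} (hp : p.re = 0) (hq : q.re = 0) :
    im (p * q) = crossProduct (im p) (im q) := by
  apply vec_ext <;>
    simp only [im_zero, im_one, im_two, cross_zero, cross_one, cross_two] <;> simp [hp, hq]
  ring

/-- The bilinear map behind the tautological two-forms. -/
def formsBilin (i : Fin 3) : (ℍ[ℝ] × ℍ[ℝ]) →L[ℝ] (ℍ[ℝ] × ℍ[ℝ]) →L[ℝ]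
    (EuclideanSpace ℝ (Fin 5) [⋀^Fin 2]→L[ℝ] ℝ) :=
  IsBilinearMap.toContinuousBilinearMap (𝕜 := ℝ)
    (f := fun p q : ℍ[ℝ] × ℍ[ℝ] => altFormₗ ((herm.compl₁₂ (cliff.flip p) (cliff.flip q)).compr₂
      ((1 / 2 : ℝ) • LinearMap.proj i ∘ₗ imₗ)))
    ⟨fun p q r => by
        rw [← map_add]; congr 1; ext ξ η; simp [im_add, mul_add],
      fun c p q => by
        rw [← map_smul]; congr 1; ext ξ η; simp,
      fun p q r => by
        rw [← map_add]; congr 1; ext ξ η; simp [im_add, mul_add],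
      fun c p q => by
        rw [← map_smul]; congr 1; ext ξ η; simp⟩

theorem formsBilin_apply (i : Fin 3) (p q : ℍ[ℝ] × ℍ[ℝ]) (ξ η : EuclideanSpace ℝ (Fin 5)) :
    formsBilin i p q ![ξ, η] = 1 / 2 * im (herm (cliff ξ p) (cliff η q)) i -
      1 / 2 * im (herm (cliff η p) (cliff ξ q)) i := rfl

/-- The tautological two-forms. -/
def forms (q : ℍ[ℝ] × ℍ[ℝ]) (i : Fin 3) : EuclideanSpace ℝ (Fin 5) [⋀^Fin 2]→L[ℝ] ℝ :=
  formsBilin i q q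

theorem forms_apply (q : ℍ[ℝ] × ℍ[ℝ]) (i : Fin 3) (ξ η : EuclideanSpace ℝ (Fin 5)) :
    forms q i ![ξ, η] = im (herm (cliff ξ q) (cliff η q)) i := by
  rw [forms, formsBilin_apply, ← star_herm (cliff ξ q), im_star, Pi.neg_apply]
  ring

theorem fderiv_forms (q u : ℍ[ℝ] × ℍ[ℝ]) (i : Fin 3) (ξ η : EuclideanSpace ℝ (Fin 5)) :
    fderiv ℝ (fun q => forms q i) q u ![ξ, η] =
      im (herm (cliff ξ q) (cliff η u) + herm (cliff ξ u) (cliff η q)) i := by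
  have h : fderiv ℝ (fun q => forms q i) q u = formsBilin i q u + formsBilin i u q :=
    fderiv_bilinear (formsBilin i) q u
  rw [h, ContinuousAlternatingMap.add_apply, formsBilin_apply, formsBilin_apply,
    ← star_herm (cliff ξ u) (cliff η q), ← star_herm (cliff ξ q) (cliff η u), im_star, im_star,
    im_add, Pi.neg_apply, Pi.neg_apply, Pi.add_apply]
  ring

/-- The unit sphere in the quaternionic plane. -/
def total : Set (ℍ[ℝ] × ℍ[ℝ]) := {q | (herm q q).re = 1}

theorem herm_self_of_mem {q : ℍ[ℝ] × ℍ[ℝ]} (hq : q ∈ total) : herm q q = 1 := by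
  rw [herm_self, show (herm q q).re = 1 from hq, Quaternion.coe_one]

theorem hopf_mem {q : ℍ[ℝ] × ℍ[ℝ]} (hq : q ∈ total) : hopf q ∈ sphere4.carrier := by
  have h := norm_hopf_sq q
  rw [show (herm q q).re = 1 from hq, real_inner_self_eq_norm_sq, one_pow, mul_one] at h
  rw [sphere4, mem_sphere_zero_iff_norm, ← h, Real.sqrt_sq (norm_nonneg _)]

theorem re_herm_comm (p q : ℍ[ℝ] × ℍ[ℝ]) : (herm p q).re = (herm q p).re := by
  rw [← star_herm q p, Quaternion.re_star]

theorem mem_tangentVectors_total {q u : ℍ[ℝ] × ℍ[ℝ]} (hq : q ∈ total) :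
    u ∈ tangentVectors total q ↔ (herm q u).re = 0 := by
  refine ⟨fun hu => ?_, fun hu => ?_⟩
  · let f : (ℍ[ℝ] × ℍ[ℝ]) →L[ℝ] (ℍ[ℝ] × ℍ[ℝ]) →L[ℝ] ℝ :=
      IsBilinearMap.toContinuousBilinearMap (𝕜 := ℝ)
        (f := fun p q : ℍ[ℝ] × ℍ[ℝ] => (herm p q).re)
        ⟨fun p q r => by simp, fun c p q => by simp, fun p q r => by simp, fun c p q => by simp⟩
    have h := bilinear_eq_zero_of_curve f (c := 1) (fun q hq => hq) hu
    change (herm q u).re + (herm u q).re = 0 at h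
    rw [re_herm_comm u q] at h
    linarith
  · have hpos : 0 ≤ (herm u u).re := by
      simp [herm_apply]
      nlinarith [sq_nonneg u.1.re]
    refine mem_tangentVectors_of_normalized hpos fun t => ?_
    have h2 : 0 < 1 + (herm u u).re * t ^ 2 := by positivity
    have h3 := Real.mul_self_sqrt h2.le
    have h4 := (Real.sqrt_pos.2 h2).ne'
    change (herm _ _).re = 1
    simp only [map_smul, map_add, LinearMap.smul_apply, LinearMap.add_apply, smul_add,
      Quaternion.re_add, Quaternion.re_smul, smul_eq_mul, re_herm_comm u q, hu,
      show (herm q q).re = 1 from hq]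
    generalize Real.sqrt (1 + (herm u u).re * t ^ 2) = s at h3 h4
    field_simp
    linarith

theorem mem_tangentVectors_carrier {x v : EuclideanSpace ℝ (Fin 5)} (hx : x ∈ sphere4.carrier) :
    v ∈ tangentVectors sphere4.carrier x ↔ inner ℝ x v = 0 := by
  rw [sphere4, tangentVectors_sphere (Real.sqrt_pos.2 two_pos) hx, Set.mem_ofPred_eq]

theorem cliff_hopf_self {q : ℍ[ℝ] × ℍ[ℝ]} (hq : q ∈ total) :
    cliff (hopf q) q = Real.sqrt 2 • q := by
  rw [cliff_hopf, herm_self_of_mem hq, Quaternion.re_one, one_smul, rmul, mul_one, mul_one, two_smul]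
  simp

theorem herm_cliff_cliff_eq_zero {q h : ℍ[ℝ] × ℍ[ℝ]} (hq : q ∈ total) (hh : herm q h = 0)
    {v w : EuclideanSpace ℝ (Fin 5)} (hv : inner ℝ (hopf q) v = 0) (hw : inner ℝ (hopf q) w = 0) :
    herm (cliff v h) (cliff w q) = 0 := by
  have h1 : cliff (hopf q) h = -(Real.sqrt 2 • h) := by
    rw [cliff_hopf, hh, herm_self_of_mem hq, rmul, mul_zero, mul_zero, Prod.mk_zero_zero, smul_zero,
      Quaternion.re_one, one_smul, zero_sub, smul_neg]
  have h2 : cliff w (cliff (hopf q) q) = -cliff (hopf q) (cliff w q) := by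
    have := cliff_cliff (hopf q) w q
    rw [hw, mul_zero, zero_smul] at this
    exact eq_neg_of_add_eq_zero_right this
  have h3 : cliff (hopf q) (cliff v h) = -cliff v (cliff (hopf q) h) := by
    have := cliff_cliff (hopf q) v h
    rw [hv, mul_zero, zero_smul] at this
    exact eq_neg_of_add_eq_zero_left this
  have h4 : Real.sqrt 2 • herm (cliff v h) (cliff w q) =
      -(Real.sqrt 2 • herm (cliff v h) (cliff w q)) := by
    calc Real.sqrt 2 • herm (cliff v h) (cliff w q)
        = herm (cliff v h) (cliff w (cliff (hopf q) q)) := by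
          rw [cliff_hopf_self hq, map_smul, map_smul]
      _ = -herm (cliff (hopf q) (cliff v h)) (cliff w q) := by rw [h2, map_neg, herm_cliff (hopf q)]
      _ = -(Real.sqrt 2 • herm (cliff v h) (cliff w q)) := by
          rw [h3, h1, map_neg (cliff v), neg_neg, map_smul (cliff v), map_smul herm,
            LinearMap.smul_apply]
  have h5 : (2 * Real.sqrt 2) • herm (cliff v h) (cliff w q) = 0 := by
    rw [two_mul, add_smul]
    nth_rewrite 1 [h4]
    exact neg_add_cancel _
  exact (smul_eq_zero.1 h5).resolve_left (by positivity)

theorem star_of_re {ξ : ℍ[ℝ]} (h : ξ.re = 0) : star ξ = -ξ := by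
  ext <;> simp [h]

/-- The covariant derivative of the tautological two-forms. -/
theorem fderiv_forms_of_tangent {q u : ℍ[ℝ] × ℍ[ℝ]} (hq : q ∈ total) (hu : (herm q u).re = 0)
    {v w : EuclideanSpace ℝ (Fin 5)} (hv : inner ℝ (hopf q) v = 0) (hw : inner ℝ (hopf q) w = 0)
    (i : Fin 3) :
    fderiv ℝ (fun q => forms q i) q u ![v, w] =
      ((2 : ℝ) • crossProduct (im (herm (cliff v q) (cliff w q))) (im (herm q u))) i := by
  have h1 : u = (u - rmul q (herm q u)) + rmul q (herm q u) := by abel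
  have h2 : herm q (u - rmul q (herm q u)) = 0 := by
    rw [map_sub, herm_rmul_right, herm_self_of_mem hq, one_mul, sub_self]
  have h3 := herm_cliff_cliff_eq_zero hq h2 hv hw
  have h4 : herm (cliff v q) (cliff w (u - rmul q (herm q u))) = 0 := by
    rw [← star_herm, herm_cliff_cliff_eq_zero hq h2 hw hv, star_zero]
  rw [fderiv_forms]
  conv_lhs => rw [h1]
  rw [map_add (cliff w), map_add (cliff v), map_add (herm (cliff v q)), map_add herm,
    LinearMap.add_apply, h3, h4, zero_add, zero_add, cliff_rmul, cliff_rmul, herm_rmul_right,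
    herm_rmul_left, star_of_re hu, neg_mul, ← sub_eq_add_neg, im_mul_sub_mul]

/-- The curvature of the connection is one half of the tautological two-forms. -/
theorem curvature_eq {q u v : ℍ[ℝ] × ℍ[ℝ]} (hq : q ∈ total) (hu : (herm q u).re = 0)
    (hv : (herm q v).re = 0) :
    (2 : ℝ) • im (herm u v) - (2 : ℝ) • im (herm v u) +
      crossProduct ((2 : ℝ) • im (herm q u)) ((2 : ℝ) • im (herm q v)) =
    (1 / 2 : ℝ) • im (herm (cliff (fderiv ℝ hopf q u) q) (cliff (fderiv ℝ hopf q v) q)) := by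
  have hs : (2 * Real.sqrt 2) * (2 * Real.sqrt 2) = 8 := by
    nlinarith [Real.mul_self_sqrt (show (0 : ℝ) ≤ 2 by norm_num)]
  have h1 : ∀ u, (herm q u).re = 0 → cliff (fderiv ℝ hopf q u) q =
      (2 * Real.sqrt 2) • (u - rmul q (herm q u)) := fun u hu => by
    rw [cliff_fderiv_hopf, hu, show (herm q q).re = 1 from hq, one_smul, zero_smul, add_zero]
  have h2 : herm (u - rmul q (herm q u)) (v - rmul q (herm q v)) =
      herm u v + herm q u * herm q v := by
    rw [map_sub, map_sub, LinearMap.sub_apply, LinearMap.sub_apply, herm_rmul_right, herm_rmul_right,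
      herm_rmul_left, herm_rmul_left, herm_self_of_mem hq, ← star_herm q u, star_of_re hu]
    noncomm_ring
  rw [h1 u hu, h1 v hv, map_smul herm, LinearMap.smul_apply, map_smul (herm _), smul_smul, hs, h2, ← star_herm u v,
    im_star, im_smul, im_add, im_mul hu hv, map_smul, map_smul, LinearMap.smul_apply]
  module

/-! ### Adapted frames of the sphere -/

/-- The quaternion with given coordinates. -/
def quad : (Fin 4 → ℝ) →ₗ[ℝ] ℍ[ℝ] where
  toFun a := ⟨a 0, a 1, a 2, a 3⟩
  map_add' a b := by ext <;> rfl
  map_smul' c a := by ext <;> rfl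

@[simp] theorem quad_re (a : Fin 4 → ℝ) : (quad a).re = a 0 := rfl

@[simp] theorem quad_imI (a : Fin 4 → ℝ) : (quad a).imI = a 1 := rfl

@[simp] theorem quad_imJ (a : Fin 4 → ℝ) : (quad a).imJ = a 2 := rfl

@[simp] theorem quad_imK (a : Fin 4 → ℝ) : (quad a).imK = a 3 := rfl

/-- The reflection in the hyperplane orthogonal to `(-t, c̄)`, on vectors with vanishing first
coordinate. -/
def reflect (c : ℍ[ℝ]) (t : ℝ) : ℍ[ℝ] →ₗ[ℝ] EuclideanSpace ℝ (Fin 5) where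
  toFun ν := point (2 * t * (c * ν).re) (ν - (2 * (c * ν).re) • star c)
  map_add' μ ν := by
    apply point_ext
    · simp; ring
    · rw [quat_add, quat_point, quat_point, quat_point, mul_add, Quaternion.re_add]
      module
  map_smul' r ν := by
    apply point_ext
    · simp; ring
    · rw [quat_smul, quat_point, quat_point, mul_smul_comm, Quaternion.re_smul, RingHom.id_apply,
        smul_eq_mul]
      module

theorem reflect_apply (c : ℍ[ℝ]) (t : ℝ) (ν : ℍ[ℝ]) :
    reflect c t ν = point (2 * t * (c * ν).re) (ν - (2 * (c * ν).re) • star c) := rfl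

theorem inner_reflect {c : ℍ[ℝ]} {t : ℝ} (h : Quaternion.normSq c + t ^ 2 = 1) (μ ν : ℍ[ℝ]) :
    inner ℝ (reflect c t μ) (reflect c t ν) = (star μ * ν).re := by
  rw [normSq_eq] at h
  rw [inner_eq, reflect_apply, reflect_apply]
  simp
  linear_combination 4 * (c.re * μ.re - c.imI * μ.imI - c.imJ * μ.imJ - c.imK * μ.imK) *
    (c.re * ν.re - c.imI * ν.imI - c.imJ * ν.imJ - c.imK * ν.imK) * h

/-- The frame at the point `(c g, t g)`. -/
def frame (c : ℍ[ℝ]) (t : ℝ) (g : ℍ[ℝ]) : (Fin 4 → ℝ) →ₗ[ℝ] EuclideanSpace ℝ (Fin 5) where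
  toFun a := reflect c t (g * star (quad a))
  map_add' a b := by rw [map_add, star_add, mul_add, map_add]
  map_smul' r a := by
    rw [map_smul, Quaternion.star_smul, mul_smul_comm, map_smul, RingHom.id_apply]

theorem frame_apply (c : ℍ[ℝ]) (t : ℝ) (g : ℍ[ℝ]) (a : Fin 4 → ℝ) :
    frame c t g a = reflect c t (g * star (quad a)) := rfl

variable {c g : ℍ[ℝ]} {t : ℝ}

theorem inner_frame (h : Quaternion.normSq c + t ^ 2 = 1) (hg : Quaternion.normSq g = 1)
    (a b : Fin 4 → ℝ) : inner ℝ (frame c t g a) (frame c t g b) = a ⬝ᵥ b := by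
  rw [frame_apply, frame_apply, inner_reflect h, star_mul, mul_assoc, ← mul_assoc (star g),
    UnitQuaternion.star_mul_self hg, one_mul]
  simp [dotProduct, Fin.sum_univ_succ]
  ring

theorem hopf_eq (hg : Quaternion.normSq g = 1) :
    hopf (c * g, t • g) = Real.sqrt 2 • point (Quaternion.normSq c - t ^ 2) ((2 * t) • star c) := by
  have h1 : g * star g = 1 := by rw [Quaternion.self_mul_star, hg, Quaternion.coe_one]
  rw [hopf, hopfBilin_apply]
  congr 1
  apply point_ext
  · rw [point_zero, point_zero, star_mul, mul_assoc, ← mul_assoc (star c), Quaternion.star_smul,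
      smul_mul_smul_comm, Quaternion.star_mul_self, UnitQuaternion.star_mul_self hg,
      Quaternion.coe_mul_eq_smul, mul_smul_comm, UnitQuaternion.star_mul_self hg]
    simp
    ring
  · rw [quat_point, quat_point, star_mul, smul_mul_assoc, ← mul_assoc, h1, one_mul, smul_smul]

theorem inner_hopf_frame (h : Quaternion.normSq c + t ^ 2 = 1) (hg : Quaternion.normSq g = 1)
    (a : Fin 4 → ℝ) : inner ℝ (hopf (c * g, t • g)) (frame c t g a) = 0 := by
  rw [hopf_eq hg, frame_apply, reflect_apply, inner_smul_left, inner_eq]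
  rw [normSq_eq] at h
  simp only [point_zero, point_one, point_two, point_three, point_four, normSq_eq]
  generalize g * star (quad a) = ν
  simp
  linear_combination (-2 * t * (c.re * ν.re - c.imI * ν.imI - c.imJ * ν.imJ - c.imK * ν.imK)) * h

theorem mem_total_of_eq (h : Quaternion.normSq c + t ^ 2 = 1) (hg : Quaternion.normSq g = 1) :
    ((c * g, t • g) : ℍ[ℝ] × ℍ[ℝ]) ∈ total := by
  change (herm _ _).re = 1
  rw [herm_apply, star_mul, mul_assoc, ← mul_assoc (star c), Quaternion.star_smul,
      smul_mul_smul_comm, Quaternion.star_mul_self, UnitQuaternion.star_mul_self hg,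
      Quaternion.coe_mul_eq_smul, mul_smul_comm, UnitQuaternion.star_mul_self hg]
  simp
  linarith

theorem range_frame (h : Quaternion.normSq c + t ^ 2 = 1) (hg : Quaternion.normSq g = 1) :
    tangentVectors sphere4.carrier (hopf (c * g, t • g)) = Set.range (frame c t g) := by
  have hx := hopf_mem (mem_total_of_eq h hg)
  have hx0 : hopf (c * g, t • g) ≠ 0 := by
    intro h0
    rw [h0, sphere4, mem_sphere_zero_iff_norm, norm_zero] at hx
    exact (Real.sqrt_pos.2 (two_pos (α := ℝ))).ne hx
  have hinj : Function.Injective (frame c t g) := by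
    rw [← LinearMap.ker_eq_bot, LinearMap.ker_eq_bot']
    intro a ha
    have := inner_frame h hg a a
    rw [ha, inner_zero_left] at this
    exact dotProduct_self_eq_zero.1 this.symm
  have : Fact (Module.finrank ℝ (EuclideanSpace ℝ (Fin 5)) = 4 + 1) := ⟨by simp⟩
  have hle : LinearMap.range (frame c t g) ≤ (ℝ ∙ hopf (c * g, t • g))ᗮ := by
    rintro _ ⟨a, rfl⟩
    rw [Submodule.mem_orthogonal_singleton_iff_inner_right]
    exact inner_hopf_frame h hg a
  have heq := Submodule.eq_of_le_of_finrank_eq hle (by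
    rw [LinearMap.finrank_range_of_inj hinj, Submodule.finrank_orthogonal_span_singleton (n := 4) hx0]
    simp)
  ext v
  rw [mem_tangentVectors_carrier hx, ← Submodule.mem_orthogonal_singleton_iff_inner_right, ← heq]
  rfl

theorem cliff_frame (h : Quaternion.normSq c + t ^ 2 = 1) (hg : Quaternion.normSq g = 1)
    (a : Fin 4 → ℝ) :
    cliff (frame c t g a) (c * g, t • g) = (t • quad a, -(star c * quad a)) := by
  have h1 : g * star (quad a) * (c * g) =
      (2 * (c * (g * star (quad a))).re) • g - (Quaternion.normSq g) • (star c * quad a) := by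
    rw [normSq_eq]
    ext <;> simp <;> ring
  apply pair_ext
  · rw [cliff_apply, frame_apply, reflect_apply, point_zero, quat_point, star_sub, star_mul,
      star_star, Quaternion.star_smul, star_star]
    simp only [sub_mul, mul_smul_comm, mul_assoc, smul_mul_assoc, UnitQuaternion.star_mul_self hg,
      mul_one]
    module
  · rw [cliff_apply, frame_apply, reflect_apply, point_zero, quat_point]
    simp only [sub_mul, smul_mul_assoc]
    rw [h1, hg, ← mul_assoc (star c), Quaternion.star_mul_self, Quaternion.coe_mul_eq_smul,
      show Quaternion.normSq c = 1 - t ^ 2 by linarith]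
    module

theorem forms_frame (h : Quaternion.normSq c + t ^ 2 = 1) (hg : Quaternion.normSq g = 1)
    (i : Fin 3) (a b : Fin 4 → ℝ) :
    forms (c * g, t • g) i ![frame c t g a, frame c t g b] = asd a b i := by
  have h1 : herm (t • quad a, -(star c * quad a)) (t • quad b, -(star c * quad b)) =
      star (quad a) * quad b := by
    rw [herm_apply, star_neg, neg_mul_neg, star_mul, star_star, mul_assoc, ← mul_assoc c,
      Quaternion.self_mul_star, Quaternion.coe_mul_eq_smul, Quaternion.star_smul,
      smul_mul_smul_comm, mul_smul_comm, ← add_smul, show t * t + Quaternion.normSq c = 1 by linarith,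
      one_smul]
  rw [forms_apply, cliff_frame h hg, cliff_frame h hg, h1]
  fin_cases i <;> simp [asd] <;> ring

theorem forms_hopf {q : ℍ[ℝ] × ℍ[ℝ]} (hq : q ∈ total) (i : Fin 3) (ξ : EuclideanSpace ℝ (Fin 5)) :
    forms q i ![hopf q, ξ] = 0 := by
  have h1 : star (herm q (cliff ξ q)) = herm q (cliff ξ q) := by rw [star_herm, herm_cliff]
  have h2 : im (herm q (cliff ξ q)) = 0 := by
    have := im_star (herm q (cliff ξ q))
    rw [h1] at this
    exact self_eq_neg.1 this
  rw [forms_apply, cliff_hopf_self hq, map_smul, LinearMap.smul_apply, im_smul, h2, smul_zero,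
    Pi.zero_apply]

theorem det_frame (h : Quaternion.normSq c + t ^ 2 = 1) (hg : Quaternion.normSq g = 1)
    (ε : Fin 4 → Fin 4 → ℝ) :
    Matrix.det (Matrix.of fun i j : Fin 5 => (Fin.cons (hopf (c * g, t • g))
      (fun i => frame c t g (ε i)) : Fin 5 → EuclideanSpace ℝ (Fin 5)) i j) =
      Real.sqrt 2 * (Matrix.of ε).det := by
  set k : Fin 5 → ℝ := ![-t, c.re, -c.imI, -c.imJ, -c.imK] with hk
  set N : Matrix (Fin 4) (Fin 4) ℝ := Matrix.of fun i =>
    ![(g * star (quad (ε i))).re, (g * star (quad (ε i))).imI, (g * star (quad (ε i))).imJ,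
      (g * star (quad (ε i))).imK] with hN
  set D : Matrix (Fin 5) (Fin 5) ℝ := Matrix.of
    (Fin.cons ![Real.sqrt 2, 0, 0, 0, 0] fun i => Fin.cons 0 (N i)) with hD
  set H : Matrix (Fin 5) (Fin 5) ℝ :=
    1 + Matrix.replicateCol (Fin 1) ((-2 : ℝ) • k) * Matrix.replicateRow (Fin 1) k with hH
  rw [normSq_eq] at h
  have hdetH : H.det = -1 := by
    rw [hH, Matrix.det_one_add_mul_comm, Matrix.det_fin_one, Matrix.add_apply, Matrix.mul_apply]
    simp [hk, Fin.sum_univ_succ]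
    linarith
  have hdetN : N.det = -(Matrix.of ε).det := by
    have e : N = Matrix.of ε * !![g.re, g.imI, g.imJ, g.imK; g.imI, -g.re, -g.imK, g.imJ;
        g.imJ, g.imK, -g.re, -g.imI; g.imK, -g.imJ, g.imI, -g.re] := by
      ext i j
      fin_cases j <;> simp [hN, Matrix.mul_apply, Fin.sum_univ_succ] <;> ring
    have e2 : (!![g.re, g.imI, g.imJ, g.imK; g.imI, -g.re, -g.imK, g.imJ;
        g.imJ, g.imK, -g.re, -g.imI; g.imK, -g.imJ, g.imI, -g.re] : Matrix _ _ ℝ).det =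
        -(Quaternion.normSq g) ^ 2 := by
      rw [normSq_eq, det_of_fin_four]
      simp only [Matrix.det_fin_three]
      simp
      ring
    rw [e, Matrix.det_mul, e2, hg]
    ring
  have hdetD : D.det = Real.sqrt 2 * N.det := by
    rw [Matrix.det_succ_row_zero, Fin.sum_univ_succ]
    have e0 : D 0 0 = Real.sqrt 2 := rfl
    have e1 : ∀ j : Fin 4, D 0 j.succ = 0 := fun j => by fin_cases j <;> rfl
    have e2 : D.submatrix Fin.succ Fin.succ = N := by
      ext i j
      simp [hD]
    simp [e0, e1, e2]
  have hA : (Matrix.of fun i j : Fin 5 => (Fin.cons (hopf (c * g, t • g))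
      (fun i => frame c t g (ε i)) : Fin 5 → EuclideanSpace ℝ (Fin 5)) i j) = D * H := by
    ext i j
    rw [hH, Matrix.mul_add, Matrix.mul_one, ← Matrix.mul_assoc, Matrix.add_apply, Matrix.mul_apply,
      Fin.sum_univ_one, Matrix.mul_apply]
    refine Fin.cases ?_ (fun i => ?_) i
    · simp only [Matrix.of_apply, Fin.cons_zero, hopf_eq hg, normSq_eq]
      fin_cases j <;> simp [hD, hk, Fin.sum_univ_succ]
      · linear_combination Real.sqrt 2 * h
      all_goals ring
    · simp only [Matrix.of_apply, Fin.cons_succ, frame_apply, reflect_apply]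
      have hNi : N i = ![(g * star (quad (ε i))).re, (g * star (quad (ε i))).imI,
        (g * star (quad (ε i))).imJ, (g * star (quad (ε i))).imK] := rfl
      generalize g * star (quad (ε i)) = ν at hNi
      fin_cases j <;> simp [hD, hk, hNi, Fin.sum_univ_succ] <;> ring
  rw [hA, Matrix.det_mul, hdetH, hdetD, hdetN]
  ring

theorem isAdaptedFrame (h : Quaternion.normSq c + t ^ 2 = 1) (hg : Quaternion.normSq g = 1) :
    IsAdaptedFrame sphere4 (hopf (c * g, t • g)) (forms (c * g, t • g)) (frame c t g) where
  inner_eq := inner_frame h hg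
  range_eq := range_frame h hg
  positive_iff ε _ := by
    change 0 < Matrix.det _ ↔ _
    rw [det_frame h hg, mul_pos_iff_of_pos_left (Real.sqrt_pos.2 two_pos)]
  forms_apply := forms_frame h hg
  forms_normal i n hn u := by
    set x := hopf (c * g, t • g) with hx
    have hq := mem_total_of_eq h hg
    have hxx : inner ℝ x x = 2 := by
      rw [hx, norm_hopf_sq, show (herm (c * g, t • g) (c * g, t • g)).re = 1 from hq]
      norm_num
    have h1 : inner ℝ x (n - (inner ℝ x n / 2) • x) = 0 := by
      rw [inner_sub_right, inner_smul_right, hxx]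
      ring
    have h2 : n - (inner ℝ x n / 2) • x ∈ Set.range (frame c t g) := by
      rw [← range_frame h hg, mem_tangentVectors_carrier (hopf_mem hq)]
      exact h1
    obtain ⟨a, ha⟩ := h2
    have h3 : n = (inner ℝ x n / 2) • x := by
      rw [← sub_eq_zero, ← inner_self_eq_zero (𝕜 := ℝ)]
      nth_rewrite 1 [inner_sub_left]
      rw [inner_smul_left, h1, mul_zero, sub_zero, ← ha, hn]
    rw [h3, alternating_smul_left, forms_hopf hq, mul_zero]

theorem exists_frame {q : ℍ[ℝ] × ℍ[ℝ]} (hq : q ∈ total) :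
    ∃ e, IsAdaptedFrame sphere4 (hopf q) (forms q) e := by
  have h1 : Quaternion.normSq q.1 + Quaternion.normSq q.2 = 1 := by
    have : (herm q q).re = 1 := hq
    rw [herm_apply, Quaternion.star_mul_self, Quaternion.star_mul_self] at this
    simpa using this
  by_cases h2 : q.2 = 0
  · have e : q = (q.1 * 1, (0 : ℝ) • (1 : ℍ[ℝ])) := by
      apply pair_ext <;> simp [h2]
    rw [e]
    refine ⟨_, isAdaptedFrame ?_ (map_one _)⟩
    rw [h2, map_zero] at h1
    linarith
  · have h3 : 0 < ‖q.2‖ := norm_pos_iff.2 h2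
    have h4 : Quaternion.normSq (‖q.2‖⁻¹ • q.2) = 1 := by
      rw [Quaternion.normSq_smul, Quaternion.normSq_eq_norm_mul_self]
      field_simp
    have e : q = (q.1 * star (‖q.2‖⁻¹ • q.2) * (‖q.2‖⁻¹ • q.2), ‖q.2‖ • ‖q.2‖⁻¹ • q.2) := by
      apply pair_ext
      · rw [mul_assoc, UnitQuaternion.star_mul_self h4, mul_one]
      · rw [smul_smul, mul_inv_cancel₀ h3.ne', one_smul]
    rw [e]
    refine ⟨_, isAdaptedFrame ?_ h4⟩
    rw [map_mul, Quaternion.normSq_star, h4, mul_one, sq, ← Quaternion.normSq_eq_norm_mul_self, h1]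

/-! ### The bundle of frames over the sphere -/

/-- The quaternion of a matrix, as a continuous linear map. -/
def ofMatrixL : Matrix (Fin 2) (Fin 2) ℂ →L[ℝ] ℍ[ℝ] :=
  LinearMap.toContinuousLinearMap
    { toFun := ofMatrix
      map_add' := fun _ _ => Quaternion.ext _ _ rfl rfl rfl rfl
      map_smul' := fun c g => by
        refine Quaternion.ext _ _ ?_ ?_ ?_ ?_ <;> simp <;> simp [ofMatrix] }

@[simp] theorem ofMatrixL_apply (g : Matrix (Fin 2) (Fin 2) ℂ) : ofMatrixL g = ofMatrix g := rfl

/-- The matrix of a quaternion, as a continuous linear map. -/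
def toMatrixL : ℍ[ℝ] →L[ℝ] Matrix (Fin 2) (Fin 2) ℂ :=
  LinearMap.toContinuousLinearMap
    { toFun := toMatrix
      map_add' := toMatrix_add
      map_smul' := toMatrix_smul }

@[simp] theorem toMatrixL_apply (q : ℍ[ℝ]) : toMatrixL q = toMatrix q := rfl

/-- Right multiplication as a continuous bilinear map. -/
def rmulL : (ℍ[ℝ] × ℍ[ℝ]) →L[ℝ] ℍ[ℝ] →L[ℝ] (ℍ[ℝ] × ℍ[ℝ]) :=
  IsBilinearMap.toContinuousBilinearMap (𝕜 := ℝ) (f := rmul)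
    ⟨fun p q g => by apply pair_ext <;> simp [rmul, add_mul],
      fun c p g => by apply pair_ext <;> simp [rmul],
      fun p g h => by apply pair_ext <;> simp [rmul, mul_add],
      fun c p g => by apply pair_ext <;> simp [rmul]⟩

@[simp] theorem rmulL_apply (q : ℍ[ℝ] × ℍ[ℝ]) (g : ℍ[ℝ]) : rmulL q g = rmul q g := rfl

/-- The connection form. -/
def conn : (ℍ[ℝ] × ℍ[ℝ]) →L[ℝ] (ℍ[ℝ] × ℍ[ℝ]) →L[ℝ] (Fin 3 → ℝ) :=
  (herm.compr₂ ((2 : ℝ) • imₗ)).toContinuousBilinearMap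

theorem conn_apply (p q : ℍ[ℝ] × ℍ[ℝ]) : conn p q = (2 : ℝ) • im (herm p q) := rfl

theorem mem_total_iff {q : ℍ[ℝ] × ℍ[ℝ]} :
    q ∈ total ↔ Quaternion.normSq q.1 + Quaternion.normSq q.2 = 1 := by
  change (herm q q).re = 1 ↔ _
  rw [herm_apply, Quaternion.star_mul_self, Quaternion.star_mul_self]
  simp

theorem ofMatrix_mul {g h : Matrix (Fin 2) (Fin 2) ℂ}
    (hg : g ∈ Matrix.specialUnitaryGroup (Fin 2) ℂ)
    (hh : h ∈ Matrix.specialUnitaryGroup (Fin 2) ℂ) :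
    ofMatrix (g * h) = ofMatrix g * ofMatrix h := by
  obtain ⟨a, -, rfl⟩ := exists_toMatrix hg
  obtain ⟨b, -, rfl⟩ := exists_toMatrix hh
  rw [← toMatrix_mul, ofMatrix_toMatrix, ofMatrix_toMatrix, ofMatrix_toMatrix]

theorem normSq_ofMatrix {g : Matrix (Fin 2) (Fin 2) ℂ}
    (hg : g ∈ Matrix.specialUnitaryGroup (Fin 2) ℂ) : Quaternion.normSq (ofMatrix g) = 1 := by
  obtain ⟨a, ha, rfl⟩ := exists_toMatrix hg
  rw [ofMatrix_toMatrix, ha]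

theorem toMatrix_ofMatrix {g : Matrix (Fin 2) (Fin 2) ℂ}
    (hg : g ∈ Matrix.specialUnitaryGroup (Fin 2) ℂ) : toMatrix (ofMatrix g) = g := by
  obtain ⟨a, -, rfl⟩ := exists_toMatrix hg
  rw [ofMatrix_toMatrix]

theorem rmul_one (q : ℍ[ℝ] × ℍ[ℝ]) : rmul q 1 = q := by
  apply pair_ext <;> simp [rmul]

theorem rmul_mem {q : ℍ[ℝ] × ℍ[ℝ]} (hq : q ∈ total) {g : ℍ[ℝ]} (hg : Quaternion.normSq g = 1) :
    rmul q g ∈ total := by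
  rw [mem_total_iff] at hq ⊢
  simp only [rmul, map_mul, hg, mul_one, hq]

theorem hopf_rmul (q : ℍ[ℝ] × ℍ[ℝ]) {g : ℍ[ℝ]} (hg : Quaternion.normSq g = 1) :
    hopf (rmul q g) = hopf q := by
  have h1 : g * star g = 1 := by rw [Quaternion.self_mul_star, hg, Quaternion.coe_one]
  rw [hopf, hopf, hopfBilin_apply, hopfBilin_apply]
  simp only [rmul, Quaternion.star_mul_self, map_mul, hg, mul_one]
  rw [star_mul, mul_assoc, ← mul_assoc g, h1, one_mul]

theorem ad_im {g : ℍ[ℝ]} (hg : Quaternion.normSq g = 1) (p : ℍ[ℝ]) :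
    ad (toMatrix g) (im p) = im (star g * p * g) := by
  rw [ad_toMatrix]
  have h : p = (p.re : ℍ[ℝ]) + vec (im p) := by ext <;> simp
  conv_rhs => rw [h]
  rw [mul_add, add_mul, im_add, Quaternion.mul_coe_eq_smul, smul_mul_assoc,
    UnitQuaternion.star_mul_self hg, im_smul]
  have h0 : im 1 = 0 := by apply vec_ext <;> simp
  rw [h0, smul_zero, zero_add]

theorem hopf_eq_point {q : ℍ[ℝ] × ℍ[ℝ]} : hopf q = Real.sqrt 2 •
    point (Quaternion.normSq q.1 - Quaternion.normSq q.2) ((2 : ℝ) • (q.2 * star q.1)) := by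
  rw [hopf, hopfBilin_apply, Quaternion.star_mul_self, Quaternion.star_mul_self]
  simp

theorem mem_carrier_iff {x : EuclideanSpace ℝ (Fin 5)} :
    x ∈ sphere4.carrier ↔ Quaternion.normSq (quat x) = 2 - x 0 ^ 2 := by
  rw [sphere4, mem_sphere_zero_iff_norm, ← sq_eq_sq₀ (norm_nonneg x) (Real.sqrt_nonneg 2),
    ← real_inner_self_eq_norm_sq, Real.sq_sqrt zero_le_two, inner_eq, normSq_eq]
  simp only [quat_re, quat_imI, quat_imJ, quat_imK]
  constructor <;> intro h <;> linarith

theorem contDiff_quat : ContDiff ℝ ∞ quat :=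
  (LinearMap.toContinuousLinearMap
    ({ toFun := quat, map_add' := quat_add, map_smul' := quat_smul } :
      EuclideanSpace ℝ (Fin 5) →ₗ[ℝ] ℍ[ℝ])).contDiff

/-- The direction of a quaternion. -/
def direction (q : ℍ[ℝ]) : ℍ[ℝ] := (Real.sqrt (Quaternion.normSq q))⁻¹ • q

theorem normSq_direction {q : ℍ[ℝ]} (hq : 0 < Quaternion.normSq q) :
    Quaternion.normSq (direction q) = 1 := by
  rw [direction, Quaternion.normSq_smul, inv_pow, Real.sq_sqrt hq.le, inv_mul_cancel₀ hq.ne']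

theorem sqrt_smul_direction {q : ℍ[ℝ]} (hq : 0 < Quaternion.normSq q) :
    Real.sqrt (Quaternion.normSq q) • direction q = q := by
  rw [direction, smul_smul, mul_inv_cancel₀ (Real.sqrt_pos.2 hq).ne', one_smul]

theorem direction_smul {r : ℝ} (hr : 0 < r) {g : ℍ[ℝ]} (hg : Quaternion.normSq g = 1) :
    direction (r • g) = g := by
  rw [direction, Quaternion.normSq_smul, hg, mul_one, Real.sqrt_sq hr.le, smul_smul,
    inv_mul_cancel₀ hr.ne', one_smul]

theorem contDiffOn_direction : ContDiffOn ℝ ∞ direction {q | 0 < Quaternion.normSq q} := by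
  have h : ContDiff ℝ ∞ fun q : ℍ[ℝ] => Quaternion.normSq q := by
    simp only [Quaternion.normSq_eq_norm_mul_self, ← real_inner_self_eq_norm_mul_norm]
    exact contDiff_id.inner ℝ contDiff_id
  refine ContDiffOn.smul (ContDiffOn.inv (ContDiffOn.sqrt h.contDiffOn fun q hq => ?_)
    fun q hq => ?_) contDiffOn_id
  · exact ne_of_gt hq
  · exact (Real.sqrt_pos.2 hq).ne'

theorem northern_chart {x : EuclideanSpace ℝ (Fin 5)} {a : ℝ} (hx : x ∈ sphere4.carrier)
    (ha : 0 < a) (h : a ^ 2 = (1 + x 0 / Real.sqrt 2) / 2) :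
    ((a : ℍ[ℝ]), (2 * Real.sqrt 2 * a)⁻¹ • quat x) ∈ total ∧
      hopf ((a : ℍ[ℝ]), (2 * Real.sqrt 2 * a)⁻¹ • quat x) = x := by
  have h2 : 0 < Real.sqrt 2 := Real.sqrt_pos.2 two_pos
  have h3 : Real.sqrt 2 ^ 2 = 2 := Real.sq_sqrt zero_le_two
  have h4 : x 0 = Real.sqrt 2 * (2 * a ^ 2 - 1) := by rw [h]; field_simp; ring
  have h5 : Quaternion.normSq ((2 * Real.sqrt 2 * a)⁻¹ • quat x) = 1 - a ^ 2 := by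
    rw [Quaternion.normSq_smul, mem_carrier_iff.1 hx, h4, mul_pow, h3, inv_pow, mul_pow, mul_pow, h3]
    field_simp
    ring
  refine ⟨?_, ?_⟩
  · rw [mem_total_iff, h5, Quaternion.normSq_coe]
    ring
  · rw [hopf_eq_point, h5, Quaternion.normSq_coe, Quaternion.star_coe, Quaternion.mul_coe_eq_smul]
    apply point_ext
    · rw [PiLp.smul_apply, point_zero, smul_eq_mul, h4]
      ring
    · rw [quat_smul, quat_point, smul_smul, smul_smul, smul_smul]
      rw [show Real.sqrt 2 * 2 * a * (2 * Real.sqrt 2 * a)⁻¹ = 1 by field_simp, one_smul]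

/-- The half space of the points whose first coordinate exceeds the one of the south pole. -/
def northern : Set (EuclideanSpace ℝ (Fin 5)) := {x | 0 < 1 + x 0 / Real.sqrt 2}

theorem isOpen_northern : IsOpen northern := by
  refine isOpen_lt continuous_const ?_
  have h0 : Continuous fun x : EuclideanSpace ℝ (Fin 5) => x 0 := by fun_prop
  fun_prop

theorem contDiffOn_sqrt_coord : ContDiffOn ℝ ∞
    (fun x : EuclideanSpace ℝ (Fin 5) => Real.sqrt ((1 + x 0 / Real.sqrt 2) / 2)) northern := by
  have h0 : ContDiff ℝ ∞ fun x : EuclideanSpace ℝ (Fin 5) => x 0 := contDiff_piLp_apply 2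
  refine ContDiffOn.sqrt (ContDiff.contDiffOn (by fun_prop)) fun x hx => ?_
  have : 0 < 1 + x 0 / Real.sqrt 2 := hx
  positivity

theorem northern_trivialization : ∃ (σ : EuclideanSpace ℝ (Fin 5) → ℍ[ℝ] × ℍ[ℝ])
    (τ : ℍ[ℝ] × ℍ[ℝ] → Matrix (Fin 2) (Fin 2) ℂ),
    ContDiffOn ℝ ∞ σ northern ∧ ContDiffOn ℝ ∞ τ (total ∩ hopf ⁻¹' northern) ∧
    (∀ y ∈ sphere4.carrier ∩ northern, σ y ∈ total ∧ hopf (σ y) = y ∧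
      ∀ g ∈ Matrix.specialUnitaryGroup (Fin 2) ℂ, τ (rmul (σ y) (ofMatrix g)) = g) ∧
    ∀ q ∈ total ∩ hopf ⁻¹' northern, τ q ∈ Matrix.specialUnitaryGroup (Fin 2) ℂ ∧
      rmul (σ (hopf q)) (ofMatrix (τ q)) = q := by
  have hsqrt : 0 < Real.sqrt 2 := Real.sqrt_pos.2 two_pos
  let r : EuclideanSpace ℝ (Fin 5) → ℝ := fun x => Real.sqrt ((1 + x 0 / Real.sqrt 2) / 2)
  have hr : ∀ x : EuclideanSpace ℝ (Fin 5), 0 < 1 + x 0 / Real.sqrt 2 →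
      0 < r x ∧ r x ^ 2 = (1 + x 0 / Real.sqrt 2) / 2 := fun x hx =>
    ⟨Real.sqrt_pos.2 (half_pos hx), Real.sq_sqrt (half_pos hx).le⟩
  have hq : ∀ q ∈ total, (1 + hopf q 0 / Real.sqrt 2) / 2 = Quaternion.normSq q.1 := by
    intro q hq
    rw [mem_total_iff] at hq
    rw [hopf_eq_point, PiLp.smul_apply, point_zero, smul_eq_mul, mul_div_cancel_left₀ _ hsqrt.ne']
    linarith
  refine ⟨fun x => ((r x : ℍ[ℝ]), (2 * Real.sqrt 2 * r x)⁻¹ • quat x),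
    fun q => toMatrix (direction q.1), ?_, ?_, fun y hy => ?_, fun q hqW => ?_⟩
  · have h1 : ContDiffOn ℝ ∞ r northern := contDiffOn_sqrt_coord
    refine ContDiffOn.prodMk ?_ (ContDiffOn.smul (ContDiffOn.inv (contDiffOn_const.mul h1)
      fun x hx => ?_) contDiff_quat.contDiffOn)
    · have h2 : ContDiffOn ℝ ∞ (fun x => r x • (1 : ℍ[ℝ])) northern :=
        h1.smul contDiffOn_const
      refine h2.congr fun x _ => ?_
      rw [← Quaternion.coe_mul_eq_smul, mul_one]
    · have := (hr x hx).1
      positivity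
  · refine toMatrixL.contDiff.comp_contDiffOn
      (contDiffOn_direction.comp contDiff_fst.contDiffOn fun q hqW => ?_)
    have h2 := half_pos (show (0 : ℝ) < _ from hqW.2)
    rw [hq q hqW.1] at h2
    exact h2
  · obtain ⟨h1, h2⟩ := hr y hy.2
    obtain ⟨h3, h4⟩ := northern_chart hy.1 h1 h2
    refine ⟨h3, h4, fun g hg => ?_⟩
    simp only [rmul]
    rw [Quaternion.coe_mul_eq_smul, direction_smul h1 (normSq_ofMatrix hg), toMatrix_ofMatrix hg]
  · have h1 : 0 < Quaternion.normSq q.1 := by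
      have h2 := half_pos (show (0 : ℝ) < _ from hqW.2)
      rwa [hq q hqW.1] at h2
    refine ⟨toMatrix_mem (normSq_direction h1), ?_⟩
    rw [ofMatrix_toMatrix]
    have h3 : r (hopf q) = Real.sqrt (Quaternion.normSq q.1) := by rw [← hq q hqW.1]
    have h4 := Real.sqrt_pos.2 h1
    apply pair_ext
    · simp only [rmul]
      rw [Quaternion.coe_mul_eq_smul, h3, sqrt_smul_direction h1]
    · simp only [rmul]
      rw [h3, direction, hopf_eq_point, quat_smul, quat_point, smul_mul_assoc, smul_mul_assoc,
        smul_mul_assoc, mul_smul_comm, mul_assoc (G := ℍ[ℝ]), Quaternion.star_mul_self, Quaternion.mul_coe_eq_smul,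
        smul_smul, smul_smul, smul_smul, smul_smul]
      convert one_smul ℝ q.2 using 2
      have h5 := Real.mul_self_sqrt h1.le
      field_simp
      linarith

/-- The reflection of the four-sphere that corresponds to the exchange of the coordinates. -/
def mirror : EuclideanSpace ℝ (Fin 5) →L[ℝ] EuclideanSpace ℝ (Fin 5) :=
  LinearMap.toContinuousLinearMap
    { toFun := fun x => point (-x 0) (star (quat x))
      map_add' := fun x y => by
        apply point_ext
        · simp; ring
        · simp
      map_smul' := fun c x => by apply point_ext <;> simp }

theorem mirror_apply (x : EuclideanSpace ℝ (Fin 5)) : mirror x = point (-x 0) (star (quat x)) := rfl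

theorem mirror_mirror (x : EuclideanSpace ℝ (Fin 5)) : mirror (mirror x) = x := by
  apply point_ext <;> simp [mirror_apply]

theorem mirror_mem {x : EuclideanSpace ℝ (Fin 5)} (hx : x ∈ sphere4.carrier) :
    mirror x ∈ sphere4.carrier := by
  rw [mem_carrier_iff] at hx ⊢
  rw [mirror_apply, quat_point, Quaternion.normSq_star, hx, point_zero, neg_sq]

theorem hopf_swap (q : ℍ[ℝ] × ℍ[ℝ]) : hopf q.swap = mirror (hopf q) := by
  rw [hopf_eq_point, hopf_eq_point]
  apply point_ext <;> simp [mirror_apply]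

theorem swap_mem {q : ℍ[ℝ] × ℍ[ℝ]} (hq : q ∈ total) : q.swap ∈ total := by
  rw [mem_total_iff] at hq ⊢
  rw [← hq, add_comm]
  rfl

theorem locally_trivial (x : EuclideanSpace ℝ (Fin 5)) :
    ∃ (W : Set (EuclideanSpace ℝ (Fin 5))) (σ : EuclideanSpace ℝ (Fin 5) → ℍ[ℝ] × ℍ[ℝ])
    (τ : ℍ[ℝ] × ℍ[ℝ] → Matrix (Fin 2) (Fin 2) ℂ),
    IsOpen W ∧ x ∈ W ∧ ContDiffOn ℝ ∞ σ W ∧ ContDiffOn ℝ ∞ τ (total ∩ hopf ⁻¹' W) ∧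
    (∀ y ∈ sphere4.carrier ∩ W, σ y ∈ total ∧ hopf (σ y) = y ∧
      ∀ g ∈ Matrix.specialUnitaryGroup (Fin 2) ℂ, τ (rmul (σ y) (ofMatrix g)) = g) ∧
    ∀ q ∈ total ∩ hopf ⁻¹' W, τ q ∈ Matrix.specialUnitaryGroup (Fin 2) ℂ ∧
      rmul (σ (hopf q)) (ofMatrix (τ q)) = q := by
  have hsqrt : 0 < Real.sqrt 2 := Real.sqrt_pos.2 two_pos
  obtain ⟨σ, τ, h1, h2, h3, h4⟩ := northern_trivialization
  rcases le_or_gt 0 (x 0) with h | h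
  · refine ⟨_, σ, τ, isOpen_northern, ?_, h1, h2, h3, h4⟩
    change 0 < 1 + x 0 / Real.sqrt 2
    positivity
  · have hswap : ∀ q ∈ total ∩ hopf ⁻¹' (mirror ⁻¹' northern),
        q.swap ∈ total ∩ hopf ⁻¹' northern := fun q hq => by
      refine ⟨swap_mem hq.1, ?_⟩
      rw [Set.mem_preimage, hopf_swap]
      exact hq.2
    refine ⟨mirror ⁻¹' northern, fun x => (σ (mirror x)).swap, fun q => τ q.swap,
      isOpen_northern.preimage mirror.continuous, ?_, ?_, ?_, fun y hy => ?_, fun q hq => ?_⟩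
    · change 0 < 1 + -x 0 / Real.sqrt 2
      have := neg_pos.2 h
      positivity
    · exact (contDiff_snd.prodMk contDiff_fst).comp_contDiffOn
        (h1.comp mirror.contDiff.contDiffOn fun x hx => hx)
    · exact h2.comp (contDiff_snd.prodMk contDiff_fst).contDiffOn hswap
    · obtain ⟨h5, h6, h7⟩ := h3 (mirror y) ⟨mirror_mem hy.1, hy.2⟩
      exact ⟨swap_mem h5, by rw [hopf_swap, h6, mirror_mirror], h7⟩
    · obtain ⟨h5, h6⟩ := h4 q.swap (hswap q hq)
      rw [hopf_swap] at h6
      exact ⟨h5, congrArg Prod.swap h6⟩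

/-- The Hopf fibration as a bundle of frames of the anti-self-dual two-forms. -/
def asdFrames : AsdFrames sphere4 UnitQuaternion.lieModel (ℍ[ℝ] × ℍ[ℝ]) where
  total := total
  base := hopf
  forms := forms
  conn := conn
  act q g := rmul q (ofMatrix g)
  base_smooth := contDiff_bilinear hopfBilin
  forms_smooth i := contDiff_bilinear (formsBilin i)
  act_smooth := (rmulL.isBoundedBilinearMap.contDiff).comp
    (contDiff_fst.prodMk (ofMatrixL.contDiff.comp contDiff_snd))
  base_mem q hq := hopf_mem hq
  act_mem q hq g hg := rmul_mem hq (normSq_ofMatrix hg)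
  act_one q hq := by
    rw [← toMatrix_one, ofMatrix_toMatrix, rmul_one]
  act_mul q hq g hg h hh := by rw [ofMatrix_mul hg hh, rmul_mul]
  base_act q hq g hg := hopf_rmul q (normSq_ofMatrix hg)
  forms_act q hq g hg y := by
    obtain ⟨a, ha, rfl⟩ := exists_toMatrix hg
    ext w
    have hw : w = ![w 0, w 1] := by funext i; fin_cases i <;> rfl
    have h := UnitQuaternion.lieModel.ad_dot _ hg y (im (herm (cliff (w 0) q) (cliff (w 1) q)))
    have h2 : UnitQuaternion.lieModel.ad (toMatrix a) (im (herm (cliff (w 0) q) (cliff (w 1) q))) =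
        im (herm (cliff (w 0) (rmul q a)) (cliff (w 1) (rmul q a))) := by
      rw [cliff_rmul, cliff_rmul, herm_rmul_right, herm_rmul_left]
      exact ad_im ha _
    rw [h2, dot_eq, dot_eq] at h
    rw [hw]
    simpa [Fin.sum_univ_three, forms_apply, ofMatrix_toMatrix] using h
  exists_frame q hq := exists_frame hq
  parallel q hq u hu y v hv w hw := by
    rw [mem_tangentVectors_total hq] at hu
    rw [mem_tangentVectors_carrier (hopf_mem hq)] at hv hw
    simp only [fderiv_forms_of_tangent hq hu hv hw, forms_apply, conn_apply]
    simp only [Fin.sum_univ_three, Pi.smul_apply, smul_eq_mul, map_smul, LinearMap.smul_apply,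
      cross_zero, cross_one, cross_two]
    ring
  curvature q hq u hu v hv i := by
    rw [mem_tangentVectors_total hq] at hu hv
    rw [forms_apply, conn_apply, conn_apply, conn_apply, conn_apply, curvature_eq hq hu hv]
    rfl
  horizontal q hq v hv := by
    rw [mem_tangentVectors_carrier (hopf_mem hq)] at hv
    have hr : (herm q (cliff v q)).re = 0 := by
      have h := cliff_cliff (hopf q) v q
      rw [hv, mul_zero, zero_smul, cliff_hopf_self hq] at h
      have h2 := congrArg (fun p => (herm q p).re) h
      simp only [map_add, map_smul, map_zero, Quaternion.re_add, Quaternion.re_smul,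
        smul_eq_mul, Quaternion.re_zero] at h2
      rw [← herm_cliff (hopf q), cliff_hopf_self hq, map_smul, LinearMap.smul_apply,
        Quaternion.re_smul, smul_eq_mul, ← two_mul, ← mul_assoc] at h2
      exact (mul_eq_zero.1 h2).resolve_left (by positivity)
    have hs : star (herm q (cliff v q)) = herm q (cliff v q) := by rw [star_herm, herm_cliff]
    have h0 : im (herm q (cliff v q)) = 0 := by
      have := im_star (herm q (cliff v q))
      rw [hs] at this
      exact self_eq_neg.1 this
    refine ⟨(2 * Real.sqrt 2)⁻¹ • cliff v q, ?_, ?_, ?_⟩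
    · rw [mem_tangentVectors_total hq, map_smul, Quaternion.re_smul, hr, smul_zero]
    · rw [conn_apply, map_smul, im_smul, h0, smul_zero, smul_zero]
    · rw [map_smul, fderiv_hopf_cliff, show (herm q q).re = 1 from hq, mul_one, smul_smul,
        inv_mul_cancel₀ (by positivity), one_smul]
  conn_vertical q hq g hg h0 := by
    have hd := (rmulL q).hasFDerivAt.comp_hasDerivAt (0 : ℝ)
      (ofMatrixL.hasFDerivAt.comp_hasDerivAt (0 : ℝ) (hasDerivAt_of_smoothCurveIn hg 0))
    have hd' : deriv (fun t => rmul q (ofMatrix (g t))) 0 = rmul q (ofMatrix (deriv g 0)) :=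
      hd.deriv
    have ht : deriv g 0 ∈ Set.range gen := by
      rw [← UnitQuaternion.tangentVectors_eq]
      exact ⟨g, hg, h0, rfl⟩
    obtain ⟨a, ha⟩ := ht
    rw [hd', ← ha, conn_apply, herm_rmul_right, herm_self_of_mem hq, one_mul]
    change gen _ = _
    congr 1
    apply vec_ext <;> simp [gen_apply, ← toMatrix_smul, ofMatrix_toMatrix]
  conn_equivariant γ hγ g hg := by
    obtain ⟨a, ha, rfl⟩ := exists_toMatrix hg
    have hd := (rmulL.flip a).hasFDerivAt.comp_hasDerivAt (0 : ℝ) (hasDerivAt_of_smoothCurveIn hγ 0)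
    have hd' : deriv (fun t => rmul (γ t) (ofMatrix (toMatrix a))) 0 = rmul (deriv γ 0) a := hd.deriv
    rw [hd', ofMatrix_toMatrix, conn_apply, conn_apply, herm_rmul_right, herm_rmul_left, map_smul]
    congr 1
    exact (ad_im ha _).symm
  locally_trivial x _ := locally_trivial x

theorem total_nonempty : total.Nonempty := ⟨(1, 0), by rw [mem_total_iff]; simp⟩

end FourSphere

namespace ProjectivePlane

/-! ### Complex matrices -/

/-- A point of the space of matrices as a matrix. -/
def toMat : MatrixSpace →ₗ[ℝ] Matrix (Fin 3) (Fin 3) ℂ where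
  toFun ξ := Matrix.of fun i j => ξ (i, j)
  map_add' _ _ := rfl
  map_smul' _ _ := rfl

/-- A matrix as a point of the space of matrices. -/
def ofMat : Matrix (Fin 3) (Fin 3) ℂ →ₗ[ℝ] MatrixSpace where
  toFun X := WithLp.toLp 2 fun ij => X ij.1 ij.2
  map_add' _ _ := rfl
  map_smul' _ _ := rfl

theorem toMat_apply (ξ : MatrixSpace) (i j : Fin 3) : toMat ξ i j = ξ (i, j) := rfl

@[simp] theorem toMat_ofMat (X : Matrix (Fin 3) (Fin 3) ℂ) : toMat (ofMat X) = X := rfl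

@[simp] theorem ofMat_toMat (ξ : MatrixSpace) : ofMat (toMat ξ) = ξ := rfl

/-- The real inner product of matrices. -/
def ip : Matrix (Fin 3) (Fin 3) ℂ →ₗ[ℝ] Matrix (Fin 3) (Fin 3) ℂ →ₗ[ℝ] ℝ :=
  LinearMap.mk₂ ℝ (fun X Y => (trace (Xᴴ * Y)).re)
    (fun X Y Z => by simp [add_mul]) (fun c X Y => by simp)
    (fun X Y Z => by simp [mul_add]) (fun c X Y => by simp)

theorem ip_apply (X Y : Matrix (Fin 3) (Fin 3) ℂ) : ip X Y = (trace (Xᴴ * Y)).re := rfl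

theorem ip_eq (X Y : Matrix (Fin 3) (Fin 3) ℂ) :
    ip X Y = ∑ i, ∑ j, ((X j i).re * (Y j i).re + (X j i).im * (Y j i).im) := by
  simp [ip_apply, Matrix.trace, Matrix.mul_apply]

theorem ip_comm (X Y : Matrix (Fin 3) (Fin 3) ℂ) : ip X Y = ip Y X := by
  simp only [ip_eq, mul_comm]

theorem inner_eq (ξ η : MatrixSpace) : inner ℝ ξ η = ip (toMat ξ) (toMat η) := by
  rw [ip_eq, Finset.sum_comm, PiLp.inner_apply, Fintype.sum_prod_type]
  refine Finset.sum_congr rfl fun i _ => Finset.sum_congr rfl fun j _ => ?_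
  rw [Complex.inner]
  simp [toMat_apply]
  ring

/-- The projection onto the first coordinate axis. -/
def proj0 : Matrix (Fin 3) (Fin 3) ℂ := !![1, 0, 0; 0, 0, 0; 0, 0, 0]

/-- The tangent vectors of the space of projections at the projection onto the first axis. -/
def off : (Fin 4 → ℝ) →ₗ[ℝ] Matrix (Fin 3) (Fin 3) ℂ where
  toFun a := !![0, ⟨a 0, a 1⟩, ⟨a 2, a 3⟩; ⟨a 0, -a 1⟩, 0, 0; ⟨a 2, -a 3⟩, 0, 0]
  map_add' a b := by
    ext i j; fin_cases i <;> fin_cases j <;> apply Complex.ext <;> simp <;> ring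
  map_smul' c a := by
    ext i j; fin_cases i <;> fin_cases j <;> apply Complex.ext <;> simp

theorem off_apply (a : Fin 4 → ℝ) :
    off a = !![0, ⟨a 0, a 1⟩, ⟨a 2, a 3⟩; ⟨a 0, -a 1⟩, 0, 0; ⟨a 2, -a 3⟩, 0, 0] := rfl

/-- The skew-Hermitian matrices that generate the motions of the space of projections. -/
def zeta : (Fin 4 → ℝ) →ₗ[ℝ] Matrix (Fin 3) (Fin 3) ℂ where
  toFun a := !![0, ⟨-a 0, -a 1⟩, ⟨-a 2, -a 3⟩; ⟨a 0, -a 1⟩, 0, 0; ⟨a 2, -a 3⟩, 0, 0]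
  map_add' a b := by
    ext i j; fin_cases i <;> fin_cases j <;> apply Complex.ext <;> simp <;> ring
  map_smul' c a := by
    ext i j; fin_cases i <;> fin_cases j <;> apply Complex.ext <;> simp

theorem zeta_apply (a : Fin 4 → ℝ) :
    zeta a = !![0, ⟨-a 0, -a 1⟩, ⟨-a 2, -a 3⟩; ⟨a 0, -a 1⟩, 0, 0; ⟨a 2, -a 3⟩, 0, 0] := rfl

/-- The Lie algebra of the special unitary group of the last two coordinates. -/
def su : (Fin 3 → ℝ) →ₗ[ℝ] Matrix (Fin 3) (Fin 3) ℂ where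
  toFun y := !![0, 0, 0; 0, ⟨0, y 0 / 2⟩, ⟨y 1 / 2, y 2 / 2⟩; 0, ⟨-y 1 / 2, y 2 / 2⟩, ⟨0, -y 0 / 2⟩]
  map_add' a b := by
    ext i j; fin_cases i <;> fin_cases j <;> apply Complex.ext <;> simp <;> ring
  map_smul' c a := by
    ext i j; fin_cases i <;> fin_cases j <;> apply Complex.ext <;> simp <;> ring

theorem su_apply (y : Fin 3 → ℝ) : su y =
    !![0, 0, 0; 0, ⟨0, y 0 / 2⟩, ⟨y 1 / 2, y 2 / 2⟩; 0, ⟨-y 1 / 2, y 2 / 2⟩, ⟨0, -y 0 / 2⟩] := rfl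

theorem ip_su_su (x y : Fin 3 → ℝ) : ip (su x) (su y) = x ⬝ᵥ y / 2 := by
  rw [ip_eq, dot_eq]
  simp [su_apply, Fin.sum_univ_three]
  ring

theorem ip_off_off (a b : Fin 4 → ℝ) : ip (off a) (off b) = 2 * (a ⬝ᵥ b) := by
  rw [ip_eq]
  simp [off_apply, Fin.sum_univ_succ, dotProduct]
  ring

theorem off_conjTranspose (a : Fin 4 → ℝ) : (off a)ᴴ = off a := by
  ext i j; fin_cases i <;> fin_cases j <;> apply Complex.ext <;> simp [off_apply]

theorem zeta_conjTranspose (a : Fin 4 → ℝ) : (zeta a)ᴴ = -zeta a := by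
  ext i j; fin_cases i <;> fin_cases j <;> apply Complex.ext <;> simp [zeta_apply]

theorem su_conjTranspose (y : Fin 3 → ℝ) : (su y)ᴴ = -su y := by
  ext i j; fin_cases i <;> fin_cases j <;> apply Complex.ext <;> simp [su_apply] <;> ring

theorem proj0_conjTranspose : proj0ᴴ = proj0 := by
  ext i j; fin_cases i <;> fin_cases j <;> simp [proj0]

theorem proj0_mul_self : proj0 * proj0 = proj0 := by
  ext i j; fin_cases i <;> fin_cases j <;> simp [proj0, Matrix.mul_apply, Fin.sum_univ_succ]

theorem su_mul_proj0 (y : Fin 3 → ℝ) : su y * proj0 = 0 := by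
  ext i j
  fin_cases i <;> fin_cases j <;> simp [proj0, su_apply]

theorem trace_su (y : Fin 3 → ℝ) : trace (su y) = 0 := by
  rw [Matrix.trace_fin_three]
  apply Complex.ext <;> simp [su_apply]
  ring

theorem zeta_commutator (a : Fin 4 → ℝ) : zeta a * proj0 - proj0 * zeta a = off a := by
  ext i j
  fin_cases i <;> fin_cases j <;> apply Complex.ext <;> simp [proj0, zeta_apply, off_apply]

theorem zeta_cube (a : Fin 4 → ℝ) : zeta a * zeta a * zeta a = (-(a ⬝ᵥ a)) • zeta a := by
  ext i j
  fin_cases i <;> fin_cases j <;> apply Complex.ext <;>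
    simp [zeta_apply, Fin.sum_univ_succ, dotProduct] <;> ring

theorem ip_su_off_mul (y : Fin 3 → ℝ) (a b : Fin 4 → ℝ) :
    ip (su y) (off a * proj0 * off b) - ip (su y) (off b * proj0 * off a) = y ⬝ᵥ asd a b := by
  rw [ip_eq, ip_eq, dot_eq]
  simp [su_apply, off_apply, proj0, asd, Fin.sum_univ_succ]
  ring

theorem trace_su_mul (x y z : Fin 3 → ℝ) :
    (trace (su x * su y * su z)).re = -(x ⬝ᵥ crossProduct y z) / 4 := by
  rw [Matrix.trace_fin_three, dot_eq, cross_zero, cross_one, cross_two]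
  simp [su_apply]
  ring

theorem eq_su {X : Matrix (Fin 3) (Fin 3) ℂ} (h1 : Xᴴ = -X) (h2 : X * proj0 = 0)
    (h3 : trace X = 0) : X = su fun k => 2 * ip (su (Pi.single k 1)) X := by
  have h4 : ∀ i j, (X j i).re = -(X i j).re := fun i j => by
    simpa using congrArg Complex.re (congrFun (congrFun h1 i) j)
  have h5 : ∀ i j, (X j i).im = (X i j).im := fun i j => by
    simpa using congrArg Complex.im (congrFun (congrFun h1 i) j)
  have h6 : ∀ i, X i 0 = 0 := fun i => by
    simpa [proj0, Matrix.mul_apply, Fin.sum_univ_succ] using congrFun (congrFun h2 i) 0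
  have h7 : ∀ i, X 0 i = 0 := fun i => by
    apply Complex.ext
    · rw [h4 i 0, h6, Complex.zero_re, neg_zero]
    · rw [h5 i 0, h6]
  have h8 : (X 1 1).im = -(X 2 2).im := by
    rw [Matrix.trace_fin_three, h6] at h3
    have := congrArg Complex.im h3
    simp at this
    linarith
  have h9 : ∀ i, (X i i).re = 0 := fun i => by linarith [h4 i i]
  have h10 := h4 1 2
  have h11 := h5 1 2
  ext i j
  simp only [su_apply, ip_eq]
  fin_cases i <;> fin_cases j <;> apply Complex.ext <;>
    simp [Fin.sum_univ_three, h6, h7, h9] <;> linarith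

/-! ### Frames of traceless skew-Hermitian matrices -/

/-- The space of pairs of a matrix and a triple of matrices. -/
abbrev FrameSpace : Type :=
  Matrix (Fin 3) (Fin 3) ℂ × (Fin 3 → Matrix (Fin 3) (Fin 3) ℂ)

/-- Conjugation of matrices. -/
def conjMat (V : Matrix (Fin 3) (Fin 3) ℂ) :
    Matrix (Fin 3) (Fin 3) ℂ →ₗ[ℝ] Matrix (Fin 3) (Fin 3) ℂ where
  toFun X := V * X * Vᴴ
  map_add' X Y := by rw [mul_add, add_mul]
  map_smul' c X := by simp

theorem conjMat_apply (V X : Matrix (Fin 3) (Fin 3) ℂ) : conjMat V X = V * X * Vᴴ := rfl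

section Conj

variable {V : Matrix (Fin 3) (Fin 3) ℂ}

theorem conjMat_mul (hV : Vᴴ * V = 1) (X Y : Matrix (Fin 3) (Fin 3) ℂ) :
    conjMat V (X * Y) = conjMat V X * conjMat V Y := by
  simp only [conjMat_apply]
  calc V * (X * Y) * Vᴴ = V * X * 1 * Y * Vᴴ := by rw [mul_one]; simp only [mul_assoc]
    _ = _ := by rw [← hV]; simp only [mul_assoc]

theorem conjMat_conjTranspose (X : Matrix (Fin 3) (Fin 3) ℂ) :
    (conjMat V X)ᴴ = conjMat V Xᴴ := by
  simp [conjMat_apply, mul_assoc]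

theorem trace_conjMat (hV : Vᴴ * V = 1) (X : Matrix (Fin 3) (Fin 3) ℂ) :
    trace (conjMat V X) = trace X := by
  rw [conjMat_apply, Matrix.trace_mul_comm, ← mul_assoc, hV, one_mul]

theorem ip_conjMat (hV : Vᴴ * V = 1) (X Y : Matrix (Fin 3) (Fin 3) ℂ) :
    ip (conjMat V X) (conjMat V Y) = ip X Y := by
  rw [ip_apply, ip_apply, conjMat_conjTranspose, ← conjMat_mul hV, trace_conjMat hV]

theorem conjMat_conjMat (V W X : Matrix (Fin 3) (Fin 3) ℂ) :
    conjMat V (conjMat W X) = conjMat (V * W) X := by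
  simp [conjMat_apply, mul_assoc]

theorem conjMat_one (X : Matrix (Fin 3) (Fin 3) ℂ) : conjMat 1 X = X := by
  simp [conjMat_apply]

theorem conjMat_inverse (hV : Vᴴ * V = 1) (X : Matrix (Fin 3) (Fin 3) ℂ) :
    conjMat V (conjMat Vᴴ X) = X := by
  rw [conjMat_conjMat, mul_eq_one_comm.1 hV, conjMat_one]

end Conj

/-- The standard frame. -/
def frame0 : FrameSpace := (proj0, fun i => su (Pi.single i 1))

/-- Conjugation of frames. -/
def conjFrame (V : Matrix (Fin 3) (Fin 3) ℂ) : FrameSpace →L[ℝ] FrameSpace :=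
  LinearMap.toContinuousLinearMap
    { toFun := fun q => (conjMat V q.1, fun i => conjMat V (q.2 i))
      map_add' := fun p q => by ext1 <;> [simp; (simp; rfl)]
      map_smul' := fun c q => by ext1 <;> [simp; (simp; rfl)] }

theorem conjFrame_apply (V : Matrix (Fin 3) (Fin 3) ℂ) (q : FrameSpace) :
    conjFrame V q = (conjMat V q.1, fun i => conjMat V (q.2 i)) := rfl

theorem conjFrame_conjFrame (V W : Matrix (Fin 3) (Fin 3) ℂ) (q : FrameSpace) :
    conjFrame V (conjFrame W q) = conjFrame (V * W) q := by
  simp only [conjFrame_apply, conjMat_conjMat]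

theorem conjFrame_one (q : FrameSpace) : conjFrame 1 q = q := by
  simp only [conjFrame_apply, conjMat_one]

/-- The frames. -/
def total : Set FrameSpace := {q | ∃ V, Vᴴ * V = 1 ∧ q = conjFrame V frame0}

/-- The projection to the projective plane. -/
def base : FrameSpace →L[ℝ] MatrixSpace :=
  LinearMap.toContinuousLinearMap (Real.sqrt 2 • ofMat ∘ₗ LinearMap.fst ℝ _ _)

theorem base_apply (q : FrameSpace) : base q = Real.sqrt 2 • ofMat q.1 := rfl

/-- The connection form. -/
def conn : FrameSpace →L[ℝ] FrameSpace →L[ℝ] (Fin 3 → ℝ) :=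
  IsBilinearMap.toContinuousBilinearMap (𝕜 := ℝ)
    (f := fun p q : FrameSpace =>
      ![ip (p.2 2) (q.2 1) - ip (p.2 1) (q.2 2), ip (p.2 0) (q.2 2) - ip (p.2 2) (q.2 0),
        ip (p.2 1) (q.2 0) - ip (p.2 0) (q.2 1)])
    ⟨fun p q r => by apply vec_ext <;> simp <;> ring, fun c p q => by apply vec_ext <;> simp <;> ring,
      fun p q r => by apply vec_ext <;> simp <;> ring, fun c p q => by apply vec_ext <;> simp <;> ring⟩

theorem conn_apply (p q : FrameSpace) : conn p q =
    ![ip (p.2 2) (q.2 1) - ip (p.2 1) (q.2 2), ip (p.2 0) (q.2 2) - ip (p.2 2) (q.2 0),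
      ip (p.2 1) (q.2 0) - ip (p.2 0) (q.2 1)] := rfl

theorem conn_conjFrame {V : Matrix (Fin 3) (Fin 3) ℂ} (hV : Vᴴ * V = 1) (p q : FrameSpace) :
    conn (conjFrame V p) (conjFrame V q) = conn p q := by
  simp only [conn_apply, conjFrame_apply, ip_conjMat hV]

/-- The Hermitian part. -/
def hermPart : MatrixSpace →ₗ[ℝ] Matrix (Fin 3) (Fin 3) ℂ where
  toFun ξ := (1 / 2 : ℝ) • (toMat ξ + (toMat ξ)ᴴ)
  map_add' ξ η := by
    rw [map_add, Matrix.conjTranspose_add]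
    module
  map_smul' c ξ := by
    rw [map_smul, Matrix.conjTranspose_smul, star_trivial, RingHom.id_apply]
    module

theorem hermPart_apply (ξ : MatrixSpace) :
    hermPart ξ = (1 / 2 : ℝ) • (toMat ξ + (toMat ξ)ᴴ) := rfl

theorem hermPart_off (a : Fin 4 → ℝ) : hermPart (ofMat (off a)) = off a := by
  rw [hermPart_apply, toMat_ofMat, off_conjTranspose]
  module

/-- The bilinear map behind the tautological two-forms. -/
def formsBilin (i : Fin 3) : FrameSpace →L[ℝ] FrameSpace →L[ℝ] (MatrixSpace [⋀^Fin 2]→L[ℝ] ℝ) :=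
  IsBilinearMap.toContinuousBilinearMap (𝕜 := ℝ)
    (f := fun p q : FrameSpace => altFormₗ (LinearMap.mk₂ ℝ
      (fun ξ η => 2 * ip (p.2 i) (hermPart ξ * q.1 * hermPart η))
      (fun ξ η ζ => by simp [add_mul, mul_add]) (fun c ξ η => by simp; ring)
      (fun ξ η ζ => by simp [mul_add]) (fun c ξ η => by simp; ring)))
    ⟨fun p q r => by rw [← map_add]; congr 1; ext ξ η; simp [mul_add],
      fun c p q => by rw [← map_smul]; congr 1; ext ξ η; simp; ring,
      fun p q r => by rw [← map_add]; congr 1; ext ξ η; simp [mul_add, add_mul],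
      fun c p q => by rw [← map_smul]; congr 1; ext ξ η; simp; ring⟩

theorem formsBilin_apply (i : Fin 3) (p q : FrameSpace) (ξ η : MatrixSpace) :
    formsBilin i p q ![ξ, η] = 2 * ip (p.2 i) (hermPart ξ * q.1 * hermPart η) -
      2 * ip (p.2 i) (hermPart η * q.1 * hermPart ξ) := rfl

/-- The action of unitary matrices on the ambient space of the projective plane. -/
def conjPoint (V : Matrix (Fin 3) (Fin 3) ℂ) : MatrixSpace →L[ℝ] MatrixSpace :=
  LinearMap.toContinuousLinearMap (ofMat ∘ₗ conjMat V ∘ₗ toMat)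

theorem conjPoint_apply (V : Matrix (Fin 3) (Fin 3) ℂ) (ξ : MatrixSpace) :
    conjPoint V ξ = ofMat (conjMat V (toMat ξ)) := rfl

theorem conjPoint_inverse {V : Matrix (Fin 3) (Fin 3) ℂ} (hV : Vᴴ * V = 1) (ξ : MatrixSpace) :
    conjPoint V (conjPoint Vᴴ ξ) = ξ := by
  rw [conjPoint_apply, conjPoint_apply, toMat_ofMat, conjMat_inverse hV, ofMat_toMat]

theorem inner_conjPoint {V : Matrix (Fin 3) (Fin 3) ℂ} (hV : Vᴴ * V = 1) (ξ η : MatrixSpace) :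
    inner ℝ (conjPoint V ξ) (conjPoint V η) = inner ℝ ξ η := by
  simp only [inner_eq, conjPoint_apply, toMat_ofMat, ip_conjMat hV]

theorem hermPart_conjPoint (V : Matrix (Fin 3) (Fin 3) ℂ) (ξ : MatrixSpace) :
    hermPart (conjPoint V ξ) = conjMat V (hermPart ξ) := by
  rw [hermPart_apply, hermPart_apply, conjPoint_apply, toMat_ofMat, conjMat_conjTranspose, ← map_add,
    ← map_smul]

theorem formsBilin_conj {V : Matrix (Fin 3) (Fin 3) ℂ} (hV : Vᴴ * V = 1) (i : Fin 3)
    (p q : FrameSpace) (ξ η : MatrixSpace) :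
    formsBilin i (conjFrame V p) (conjFrame V q) ![conjPoint V ξ, conjPoint V η] =
      formsBilin i p q ![ξ, η] := by
  simp only [formsBilin_apply, hermPart_conjPoint, conjFrame_apply, ← conjMat_mul hV, ip_conjMat hV]

theorem base_conjFrame (V : Matrix (Fin 3) (Fin 3) ℂ) (q : FrameSpace) :
    base (conjFrame V q) = conjPoint V (base q) := by
  simp only [base_apply, conjFrame_apply, conjPoint_apply, map_smul, toMat_ofMat]

theorem conjFrame_mem {V : Matrix (Fin 3) (Fin 3) ℂ} (hV : Vᴴ * V = 1) {q : FrameSpace}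
    (hq : q ∈ total) : conjFrame V q ∈ total := by
  obtain ⟨W, hW, rfl⟩ := hq
  refine ⟨V * W, ?_, conjFrame_conjFrame V W _⟩
  rw [Matrix.conjTranspose_mul, mul_assoc, ← mul_assoc Vᴴ, hV, one_mul, hW]

/-! ### The tangent space at the standard frame -/

theorem exists_eq_off {X : Matrix (Fin 3) (Fin 3) ℂ} (h1 : Xᴴ = X)
    (h2 : proj0 * X + X * proj0 = X) : ∃ a, X = off a := by
  have h3 : ∀ i j, star (X j i) = X i j := fun i j => congrFun (congrFun h1 i) j
  have h4 : ∀ i j, (proj0 * X + X * proj0) i j = X i j := fun i j => congrFun (congrFun h2 i) j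
  have e0 : X 0 0 = 0 := by simpa [proj0, Matrix.vecMul, dotProduct, Matrix.mul_apply, Fin.sum_univ_succ] using h4 0 0
  have e1 : 0 = X 1 1 := by simpa [proj0, Matrix.vecMul, dotProduct, Matrix.mul_apply, Fin.sum_univ_succ] using h4 1 1
  have e2 : 0 = X 1 2 := by simpa [proj0, Matrix.vecMul, dotProduct, Matrix.mul_apply, Fin.sum_univ_succ] using h4 1 2
  have e3 : 0 = X 2 1 := by simpa [proj0, Matrix.vecMul, dotProduct, Matrix.mul_apply, Fin.sum_univ_succ] using h4 2 1
  have e4 : 0 = X 2 2 := by simpa [proj0, Matrix.vecMul, dotProduct, Matrix.mul_apply, Fin.sum_univ_succ] using h4 2 2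
  refine ⟨![(X 1 0).re, -(X 1 0).im, (X 2 0).re, -(X 2 0).im], ?_⟩
  ext i j
  fin_cases i <;> fin_cases j <;> apply Complex.ext <;>
    simp [off_apply, e0, ← e1, ← e2, ← e3, ← e4, ← h3 0 1, ← h3 0 2]

theorem ip_su_bracket (x y : Fin 3 → ℝ) (a : Fin 4 → ℝ) :
    ip (su x) (zeta a * su y - su y * zeta a) = 0 := by
  rw [ip_eq]
  simp [su_apply, zeta_apply, Fin.sum_univ_three]

theorem ip_bracket_bracket (x y : Fin 3 → ℝ) (a b : Fin 4 → ℝ) :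
    ip (zeta a * su x - su x * zeta a) (zeta b * su y - su y * zeta b) -
      ip (zeta a * su y - su y * zeta a) (zeta b * su x - su x * zeta b) =
      -(crossProduct x y ⬝ᵥ asd a b) := by
  rw [ip_eq, ip_eq, dot_eq, cross_zero, cross_one, cross_two]
  simp [su_apply, zeta_apply, Fin.sum_univ_three, asd]
  ring

theorem ip_bracket_off (y : Fin 3 → ℝ) (a b c : Fin 4 → ℝ) :
    ip (zeta a * su y - su y * zeta a) (off b * proj0 * off c) = 0 := by
  rw [ip_eq]
  simp [su_apply, zeta_apply, off_apply, proj0, Fin.sum_univ_three]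

theorem ip_su_off_off (y : Fin 3 → ℝ) (a b c : Fin 4 → ℝ) :
    ip (su y) (off b * off a * off c) = 0 := by
  rw [ip_eq]
  simp [su_apply, off_apply, Fin.sum_univ_three]

/-- The tangent vectors of the space of frames at the standard frame. -/
def velocity (a : Fin 4 → ℝ) (b : Fin 3 → ℝ) : FrameSpace :=
  (off a, fun i => (zeta a * su (Pi.single i 1) - su (Pi.single i 1) * zeta a) +
    su (crossProduct b (Pi.single i 1)))

theorem conjFrame_relations {q : FrameSpace} (hq : q ∈ total) :
    q.1ᴴ = q.1 ∧ q.1 * q.1 = q.1 ∧ (∀ i, (q.2 i)ᴴ = -q.2 i) ∧ (∀ i, q.2 i * q.1 = 0) ∧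
      (∀ i, trace (q.2 i) = 0) ∧ ∀ i j, ip (q.2 i) (q.2 j) = if i = j then 1 / 2 else 0 := by
  obtain ⟨V, hV, rfl⟩ := hq
  simp only [conjFrame_apply, frame0, conjMat_conjTranspose, ← conjMat_mul hV, proj0_conjTranspose,
    proj0_mul_self, su_conjTranspose, su_mul_proj0, map_neg, map_zero, trace_conjMat hV, trace_su,
    ip_conjMat hV, ip_su_su, implies_true, true_and]
  intro i j
  rw [single_one_dotProduct, Pi.single_apply]
  split_ifs <;> simp

/-- The inner products of the components of two frames. -/
def framePairing (i j : Fin 3) : FrameSpace →L[ℝ] FrameSpace →L[ℝ] ℝ :=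
  LinearMap.toContinuousBilinearMap (ip.compl₁₂ (LinearMap.proj i ∘ₗ LinearMap.snd ℝ _ _)
    (LinearMap.proj j ∘ₗ LinearMap.snd ℝ _ _))

theorem framePairing_apply (i j : Fin 3) (p q : FrameSpace) :
    framePairing i j p q = ip (p.2 i) (q.2 j) := rfl

theorem exists_velocity {u : FrameSpace} (hu : u ∈ tangentVectors total frame0) :
    ∃ a b, u = velocity a b := by
  have r1 : u.1ᴴ - u.1 = 0 := linear_eq_zero_of_curve (c := 0)
    (LinearMap.toContinuousLinearMap
      { toFun := fun q : FrameSpace => q.1ᴴ - q.1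
        map_add' := fun p q => by simp; abel
        map_smul' := fun c q => by simp [smul_sub] })
    (fun q hq => sub_eq_zero.2 (conjFrame_relations hq).1) hu
  have r2 : proj0 * u.1 + u.1 * proj0 = u.1 := bilinear_relation_of_curve (c := 0)
    (IsBilinearMap.toContinuousBilinearMap (𝕜 := ℝ) (f := fun p q : FrameSpace => p.1 * q.1)
      ⟨fun p q r => by simp [add_mul], fun c p q => by simp, fun p q r => by simp [mul_add],
        fun c p q => by simp⟩)
    (ContinuousLinearMap.fst ℝ _ _)
    (fun q hq => by rw [add_zero]; exact (conjFrame_relations hq).2.1) hu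
  have r3 : ∀ i, (u.2 i)ᴴ + u.2 i = 0 := fun i => linear_eq_zero_of_curve (c := 0)
    (LinearMap.toContinuousLinearMap
      { toFun := fun q : FrameSpace => (q.2 i)ᴴ + q.2 i
        map_add' := fun p q => by simp; abel
        map_smul' := fun c q => by simp })
    (fun q hq => by
      change (q.2 i)ᴴ + q.2 i = 0
      rw [(conjFrame_relations hq).2.2.1, neg_add_cancel]) hu
  have r4 : ∀ i, su (Pi.single i 1) * u.1 + u.2 i * proj0 = 0 := fun i =>
    bilinear_eq_zero_of_curve (c := 0)
      (IsBilinearMap.toContinuousBilinearMap (𝕜 := ℝ) (f := fun p q : FrameSpace => p.2 i * q.1)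
        ⟨fun p q r => by simp [add_mul], fun c p q => by simp, fun p q r => by simp [mul_add],
          fun c p q => by simp⟩)
      (fun q hq => (conjFrame_relations hq).2.2.2.1 i) hu
  have r5 : ∀ i, trace (u.2 i) = 0 := fun i => linear_eq_zero_of_curve (c := 0)
    (LinearMap.toContinuousLinearMap
      { toFun := fun q : FrameSpace => trace (q.2 i)
        map_add' := fun p q => by simp
        map_smul' := fun c q => by simp })
    (fun q hq => (conjFrame_relations hq).2.2.2.2.1 i) hu
  have r6 : ∀ i j, ip (su (Pi.single i 1)) (u.2 j) + ip (u.2 i) (su (Pi.single j 1)) = 0 := by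
    intro i j
    have h := bilinear_eq_zero_of_curve (c := if i = j then 1 / 2 else 0) (framePairing i j)
      (fun q hq => by rw [framePairing_apply]; exact (conjFrame_relations hq).2.2.2.2.2 i j) hu
    rwa [framePairing_apply, framePairing_apply] at h
  obtain ⟨a, ha⟩ := exists_eq_off (sub_eq_zero.1 r1) r2
  set N : Fin 3 → Fin 3 → ℝ := fun k i => 2 * ip (su (Pi.single k 1)) (u.2 i) with hN
  have hNs : ∀ i j, N i j = -N j i := fun i j => by
    have := r6 i j
    rw [ip_comm (u.2 i)] at this
    simp only [hN]
    linarith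
  refine ⟨a, ![N 2 1, N 0 2, N 1 0], Prod.ext ha (funext fun i => ?_)⟩
  set Y := u.2 i - (zeta a * su (Pi.single i 1) - su (Pi.single i 1) * zeta a) with hY
  have e1 : Yᴴ = -Y := by
    rw [hY, Matrix.conjTranspose_sub, Matrix.conjTranspose_sub, Matrix.conjTranspose_mul,
      Matrix.conjTranspose_mul, su_conjTranspose, zeta_conjTranspose, eq_neg_of_add_eq_zero_left (r3 i)]
    noncomm_ring
  have e2 : Y * proj0 = 0 := by
    have h1 : zeta a * proj0 = off a + proj0 * zeta a := by rw [← zeta_commutator]; abel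
    rw [hY, sub_mul, sub_mul, mul_assoc, su_mul_proj0, mul_assoc, h1, mul_add, ← mul_assoc _ proj0,
      su_mul_proj0, ← ha, mul_zero, zero_mul, add_zero, zero_sub, sub_neg_eq_add, add_comm]
    exact r4 i
  have e3 : trace Y = 0 := by
    rw [hY, Matrix.trace_sub, Matrix.trace_sub, Matrix.trace_mul_comm, sub_self, r5, sub_self]
  have e4 := eq_su e1 e2 e3
  have e5 : (fun k => 2 * ip (su (Pi.single k 1)) Y) =
      crossProduct ![N 2 1, N 0 2, N 1 0] (Pi.single i 1) := by
    have e6 : ∀ k, 2 * ip (su (Pi.single k 1)) Y = N k i := fun k => by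
      rw [hY, map_sub, ip_su_bracket, sub_zero]
    simp only [e6]
    have h0 := hNs 0 0
    have h1 := hNs 1 1
    have h2 := hNs 2 2
    have h01 := hNs 0 1
    have h12 := hNs 1 2
    have h20 := hNs 2 0
    fin_cases i <;> apply vec_ext <;> simp [cross_zero, cross_one, cross_two] <;> linarith
  rw [e5] at e4
  change u.2 i = (zeta a * su (Pi.single i 1) - su (Pi.single i 1) * zeta a) + su _
  rw [← e4, hY]
  abel

/-! ### The geometry of the bundle of frames -/

/-- The tautological two-forms. -/
def forms (q : FrameSpace) (i : Fin 3) : MatrixSpace [⋀^Fin 2]→L[ℝ] ℝ := formsBilin i q q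

/-- The frames of the tangent spaces of the projective plane. -/
def coframe (V : Matrix (Fin 3) (Fin 3) ℂ) : (Fin 4 → ℝ) →ₗ[ℝ] MatrixSpace :=
  (conjPoint V).toLinearMap ∘ₗ ((Real.sqrt 2)⁻¹ • (ofMat ∘ₗ off))

theorem coframe_apply (V : Matrix (Fin 3) (Fin 3) ℂ) (a : Fin 4 → ℝ) :
    coframe V a = conjPoint V (ofMat (off ((Real.sqrt 2)⁻¹ • a))) := by
  rw [map_smul, map_smul]
  rfl

section Frames

variable {V : Matrix (Fin 3) (Fin 3) ℂ}

theorem conjFrame_inverse (hV : Vᴴ * V = 1) (u : FrameSpace) :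
    conjFrame V (conjFrame Vᴴ u) = u := by
  rw [conjFrame_conjFrame, mul_eq_one_comm.1 hV, conjFrame_one]

theorem conjFrame_frame0_mem (hV : Vᴴ * V = 1) : conjFrame V frame0 ∈ total := ⟨V, hV, rfl⟩

theorem conjTranspose_mul_self (hV : Vᴴ * V = 1) : Vᴴᴴ * Vᴴ = 1 := by
  rw [Matrix.conjTranspose_conjTranspose, mul_eq_one_comm.1 hV]

theorem exists_conjFrame_velocity (hV : Vᴴ * V = 1) {u : FrameSpace}
    (hu : u ∈ tangentVectors total (conjFrame V frame0)) :
    ∃ a b, u = conjFrame V (velocity a b) := by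
  have h := fderiv_mem_tangentVectors (T := total) (conjFrame Vᴴ).contDiff
    (fun q hq => conjFrame_mem (conjTranspose_mul_self hV) hq) hu
  rw [ContinuousLinearMap.fderiv, conjFrame_conjFrame, hV, conjFrame_one] at h
  obtain ⟨a, b, h⟩ := exists_velocity h
  exact ⟨a, b, by rw [← h, conjFrame_inverse hV]⟩

theorem conn_velocity (a : Fin 4 → ℝ) (b : Fin 3 → ℝ) : conn frame0 (velocity a b) = b := by
  simp only [conn_apply, frame0, velocity, map_add, ip_su_bracket, ip_su_su, zero_add,
    single_one_dotProduct, cross_zero, cross_one, cross_two]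
  apply vec_ext <;> simp <;> ring

theorem ip_velocity (a a' : Fin 4 → ℝ) (b b' : Fin 3 → ℝ) (i j : Fin 3) :
    ip ((velocity a b).2 i) ((velocity a' b').2 j) - ip ((velocity a b).2 j) ((velocity a' b').2 i) =
      -(crossProduct (Pi.single i 1) (Pi.single j 1) ⬝ᵥ asd a a') +
        crossProduct b (Pi.single i 1) ⬝ᵥ crossProduct b' (Pi.single j 1) / 2 -
        crossProduct b (Pi.single j 1) ⬝ᵥ crossProduct b' (Pi.single i 1) / 2 := by
  rw [← ip_bracket_bracket]
  simp only [velocity, map_add, LinearMap.add_apply, ip_su_bracket, ip_su_su,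
    ip_comm (zeta a * _ - _) (su _)]
  ring

theorem conn_velocity_velocity (a a' : Fin 4 → ℝ) (b b' : Fin 3 → ℝ) :
    conn (velocity a b) (velocity a' b') - conn (velocity a' b') (velocity a b) + crossProduct b b' =
      (2 : ℝ) • asd a a' := by
  have h01 := ip_velocity a a' b b' 0 1
  have h12 := ip_velocity a a' b b' 1 2
  have h20 := ip_velocity a a' b b' 2 0
  simp only [dot_eq, cross_zero, cross_one, cross_two] at h01 h12 h20
  simp at h01 h12 h20
  simp only [conn_apply, ip_comm ((velocity a' b').2 _)]
  apply vec_ext <;> simp [cross_zero, cross_one, cross_two] <;> linarith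

theorem forms_coframe (hV : Vᴴ * V = 1) (i : Fin 3) (a b : Fin 4 → ℝ) :
    forms (conjFrame V frame0) i ![coframe V a, coframe V b] = asd a b i := by
  rw [forms, coframe_apply, coframe_apply, formsBilin_conj hV, formsBilin_apply, hermPart_off,
    hermPart_off, ← mul_sub]
  simp only [frame0]
  rw [ip_su_off_mul, single_one_dotProduct]
  fin_cases i <;> simp [asd] <;> field_simp <;> simp

theorem base_conjFrame_velocity (a : Fin 4 → ℝ) (b : Fin 3 → ℝ) :
    base (conjFrame V (velocity a b)) = coframe V ((2 : ℝ) • a) := by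
  rw [base_conjFrame, base_apply, coframe_apply, smul_smul, map_smul off, map_smul ofMat]
  congr 2
  field_simp
  simp

theorem curvature_forms (hV : Vᴴ * V = 1) {u v : FrameSpace}
    (hu : u ∈ tangentVectors total (conjFrame V frame0))
    (hv : v ∈ tangentVectors total (conjFrame V frame0)) (i : Fin 3) :
    (conn u v - conn v u +
      crossProduct (conn (conjFrame V frame0) u) (conn (conjFrame V frame0) v)) i =
      1 / 2 * forms (conjFrame V frame0) i ![base u, base v] := by
  obtain ⟨a, b, rfl⟩ := exists_conjFrame_velocity hV hu
  obtain ⟨a', b', rfl⟩ := exists_conjFrame_velocity hV hv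
  simp only [conn_conjFrame hV, conn_velocity, conn_velocity_velocity, base_conjFrame_velocity,
    forms_coframe hV]
  fin_cases i <;> simp [asd] <;> ring

theorem fderiv_forms (hV : Vᴴ * V = 1) {u : FrameSpace}
    (hu : u ∈ tangentVectors total (conjFrame V frame0)) (i : Fin 3) (c d : Fin 4 → ℝ) :
    (fderiv ℝ (fun q => forms q i) (conjFrame V frame0) u) ![coframe V c, coframe V d] =
      crossProduct (conn (conjFrame V frame0) u) (Pi.single i 1) ⬝ᵥ asd c d := by
  obtain ⟨a, b, rfl⟩ := exists_conjFrame_velocity hV hu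
  have h := fderiv_bilinear (formsBilin i) (conjFrame V frame0) (conjFrame V (velocity a b))
  change fderiv ℝ (fun q => forms q i) _ _ = _ at h
  rw [h, ContinuousAlternatingMap.add_apply, coframe_apply, coframe_apply, formsBilin_conj hV,
    formsBilin_conj hV, conn_conjFrame hV, conn_velocity]
  simp only [formsBilin_apply, hermPart_off, frame0, velocity, map_add, LinearMap.add_apply,
    ip_bracket_off, ip_su_off_off, zero_add, mul_zero, sub_zero, ← mul_sub, ip_su_off_mul]
  simp only [dot_eq]
  simp [asd]
  field_simp
  simp

theorem coframe_inner (hV : Vᴴ * V = 1) (a b : Fin 4 → ℝ) :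
    inner ℝ (coframe V a) (coframe V b) = a ⬝ᵥ b := by
  rw [coframe_apply, coframe_apply, inner_conjPoint hV, inner_eq, toMat_ofMat, toMat_ofMat, ip_off_off]
  have h : Real.sqrt 2 ^ 2 = 2 := Real.sq_sqrt zero_le_two
  simp only [smul_dotProduct, dotProduct_smul, smul_eq_mul]
  field_simp
  rw [h]

/-! ### The tangent spaces of the projective plane -/

theorem base_frame0_apply (V : Matrix (Fin 3) (Fin 3) ℂ) (i j : Fin 3) :
    base (conjFrame V frame0) (i, j) = (Real.sqrt 2 : ℂ) * V i 0 * starRingEnd ℂ (V j 0) := by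
  rw [base_apply]
  change Real.sqrt 2 • (V * proj0 * Vᴴ) i j = _
  rw [Complex.real_smul]
  simp [Matrix.mul_apply, proj0, Fin.sum_univ_three, mul_assoc]

theorem base_mem (hV : Vᴴ * V = 1) : base (conjFrame V frame0) ∈ projectivePlane.carrier := by
  refine ⟨fun i => V i 0, ?_, fun i j => ?_⟩
  · have h := congrArg Complex.re (congrFun (congrFun hV 0) 0)
    simp only [Matrix.mul_apply, Matrix.conjTranspose_apply, Matrix.one_apply_eq, Complex.re_sum,
      Complex.one_re] at h
    rw [← h]
    refine Finset.sum_congr rfl fun i _ => ?_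
    rw [← Complex.normSq_eq_norm_sq, Complex.normSq_apply]
    simp
  · exact base_frame0_apply V i j

theorem carrier_relations {x : MatrixSpace} (hx : x ∈ projectivePlane.carrier) :
    (toMat x)ᴴ = toMat x ∧ toMat x * toMat x = Real.sqrt 2 • toMat x := by
  obtain ⟨z, hz, hx⟩ := hx
  have h2 : ∑ k, starRingEnd ℂ (z k) * z k = 1 := by
    have := congrArg (fun r : ℝ => (r : ℂ)) hz
    simp only [Complex.ofReal_sum, Complex.ofReal_pow, Complex.ofReal_one] at this
    simpa only [← Complex.conj_mul'] using this
  constructor <;> ext i j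
  · simp [toMat_apply, hx, mul_assoc, mul_comm]
  · simp only [Matrix.mul_apply, Matrix.smul_apply, toMat_apply, hx, Complex.real_smul]
    calc ∑ k, (Real.sqrt 2 : ℂ) * z i * starRingEnd ℂ (z k) *
          ((Real.sqrt 2 : ℂ) * z k * starRingEnd ℂ (z j))
        = (Real.sqrt 2 : ℂ) * ((Real.sqrt 2 : ℂ) * z i * starRingEnd ℂ (z j)) *
          ∑ k, starRingEnd ℂ (z k) * z k := by
          rw [Finset.mul_sum]
          exact Finset.sum_congr rfl fun k _ => by ring
      _ = _ := by rw [h2, mul_one]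

theorem exists_coframe (hV : Vᴴ * V = 1) {v : MatrixSpace}
    (hv : v ∈ tangentVectors projectivePlane.carrier (base (conjFrame V frame0))) :
    ∃ a, v = coframe V a := by
  have r1 : (toMat v)ᴴ - toMat v = 0 := linear_eq_zero_of_curve (c := 0)
    (LinearMap.toContinuousLinearMap
      { toFun := fun x : MatrixSpace => (toMat x)ᴴ - toMat x
        map_add' := fun p q => by simp; abel
        map_smul' := fun c q => by simp [smul_sub] })
    (fun x hx => sub_eq_zero.2 (carrier_relations hx).1) hv
  have r2 := bilinear_relation_of_curve (c := 0)
    (LinearMap.toContinuousBilinearMap ((LinearMap.mul ℝ _).compl₁₂ toMat toMat))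
    (LinearMap.toContinuousLinearMap (Real.sqrt 2 • toMat))
    (fun x hx => by rw [add_zero]; exact (carrier_relations hx).2) hv
  change toMat (base _) * toMat v + toMat v * toMat (base _) = Real.sqrt 2 • toMat v at r2
  have h0 : Real.sqrt 2 ≠ 0 := (Real.sqrt_pos.2 two_pos).ne'
  have hb : toMat (base (conjFrame V frame0)) = Real.sqrt 2 • conjMat V proj0 := rfl
  have hv' : toMat v = conjMat V (conjMat Vᴴ (toMat v)) := (conjMat_inverse hV _).symm
  set X := conjMat Vᴴ (toMat v) with hX
  have e1 : Xᴴ = X := by rw [hX, conjMat_conjTranspose, sub_eq_zero.1 r1]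
  have e2 : proj0 * X + X * proj0 = X := by
    rw [hb, hv', smul_mul_assoc, mul_smul_comm, ← smul_add, ← conjMat_mul hV, ← conjMat_mul hV,
      ← map_add] at r2
    have h := congrArg (conjMat Vᴴ) (smul_right_injective _ h0 r2)
    rwa [conjMat_conjMat, conjMat_conjMat, hV, conjMat_one, conjMat_one] at h
  obtain ⟨a, ha⟩ := exists_eq_off e1 e2
  refine ⟨Real.sqrt 2 • a, ?_⟩
  rw [coframe_apply, smul_smul, inv_mul_cancel₀ h0, one_smul, conjPoint_apply, toMat_ofMat, ← ha,
    ← hv', ofMat_toMat]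

/-- The bilinear map behind the orbit of the standard frame. -/
def orbit : Matrix (Fin 3) (Fin 3) ℂ →L[ℝ] Matrix (Fin 3) (Fin 3) ℂ →L[ℝ] FrameSpace :=
  IsBilinearMap.toContinuousBilinearMap (𝕜 := ℝ)
    (f := fun V W => (V * proj0 * Wᴴ, fun i => V * su (Pi.single i 1) * Wᴴ))
    ⟨fun p q r => by ext1 <;> simp [add_mul]; rfl, fun c p q => by ext1 <;> simp; rfl,
      fun p q r => by ext1 <;> simp [mul_add]; rfl, fun c p q => by ext1 <;> simp; rfl⟩

theorem orbit_self (V : Matrix (Fin 3) (Fin 3) ℂ) : orbit V V = conjFrame V frame0 := rfl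

theorem orbit_apply (V W : Matrix (Fin 3) (Fin 3) ℂ) :
    orbit V W = (V * proj0 * Wᴴ, fun i => V * su (Pi.single i 1) * Wᴴ) := rfl

/-- A curve of unitary matrices with the velocity `zeta w`. -/
def unitaryCurve (w : Fin 4 → ℝ) (t : ℝ) : Matrix (Fin 3) (Fin 3) ℂ :=
  1 + (t / (1 + t ^ 2 * (w ⬝ᵥ w) / 4)) • zeta w +
    (t ^ 2 / (1 + t ^ 2 * (w ⬝ᵥ w) / 4) / 2) • (zeta w * zeta w)

theorem unitaryCurve_denom_pos (w : Fin 4 → ℝ) (t : ℝ) : 0 < 1 + t ^ 2 * (w ⬝ᵥ w) / 4 := by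
  have : 0 ≤ w ⬝ᵥ w := Finset.sum_nonneg fun i _ => mul_self_nonneg _
  positivity

theorem unitaryCurve_unitary (w : Fin 4 → ℝ) (t : ℝ) :
    (unitaryCurve w t)ᴴ * unitaryCurve w t = 1 := by
  have h := unitaryCurve_denom_pos w t
  have h4 : zeta w * zeta w * (zeta w * zeta w) = (-(w ⬝ᵥ w)) • (zeta w * zeta w) := by
    rw [← mul_assoc, zeta_cube, smul_mul_assoc]
  have h3 : zeta w * (zeta w * zeta w) = zeta w * zeta w * zeta w := (mul_assoc _ _ _).symm
  have hs := inv_mul_cancel₀ h.ne'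
  simp only [unitaryCurve, Matrix.conjTranspose_add, Matrix.conjTranspose_one,
    Matrix.conjTranspose_smul, Matrix.conjTranspose_mul, zeta_conjTranspose, star_trivial,
    add_mul, mul_add, one_mul, mul_one, smul_mul_assoc, mul_smul_comm, h3, h4, neg_mul, mul_neg,
    div_eq_mul_inv t, div_eq_mul_inv (t ^ 2)]
  set s := (1 + t ^ 2 * (w ⬝ᵥ w) / 4)⁻¹
  match_scalars <;> first | ring1 | linear_combination (-(t ^ 2 * s)) * hs

theorem contDiff_unitaryCurve (w : Fin 4 → ℝ) : ContDiff ℝ ∞ (unitaryCurve w) := by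
  have h : ContDiff ℝ ∞ fun t : ℝ => 1 + t ^ 2 * (w ⬝ᵥ w) / 4 := by fun_prop
  have h1 : ∀ t : ℝ, 1 + t ^ 2 * (w ⬝ᵥ w) / 4 ≠ 0 := fun t => (unitaryCurve_denom_pos w t).ne'
  exact (contDiff_const.add ((contDiff_id.div h h1).smul contDiff_const)).add
    ((((contDiff_id.pow 2).div h h1).div_const 2).smul contDiff_const)

theorem unitaryCurve_zero (w : Fin 4 → ℝ) : unitaryCurve w 0 = 1 := by simp [unitaryCurve]

theorem hasDerivAt_unitaryCurve (w : Fin 4 → ℝ) : HasDerivAt (unitaryCurve w) (zeta w) 0 := by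
  have h : HasDerivAt (fun t : ℝ => 1 + t ^ 2 * (w ⬝ᵥ w) / 4) 0 0 := by
    have := ((((hasDerivAt_id (0 : ℝ)).pow 2).mul_const (w ⬝ᵥ w)).div_const 4).const_add 1
    simpa using this
  have h1 : HasDerivAt (fun t : ℝ => t / (1 + t ^ 2 * (w ⬝ᵥ w) / 4)) 1 0 :=
    ((hasDerivAt_id' (0 : ℝ)).fun_div h (by simp)).congr_deriv (by simp)
  have h2 : HasDerivAt (fun t : ℝ => t ^ 2 / (1 + t ^ 2 * (w ⬝ᵥ w) / 4) / 2) 0 0 :=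
    (((hasDerivAt_pow 2 (0 : ℝ)).fun_div h (by simp)).div_const 2).congr_deriv (by simp)
  have h3 := ((hasDerivAt_const (0 : ℝ) (1 : Matrix (Fin 3) (Fin 3) ℂ)).add
    (h1.smul_const (zeta w))).add (h2.smul_const (zeta w * zeta w))
  simp only [zero_add, one_smul, zero_smul, add_zero] at h3
  exact h3

theorem velocity_mem (w : Fin 4 → ℝ) : velocity w 0 ∈ tangentVectors total frame0 := by
  refine ⟨fun t => orbit (unitaryCurve w t) (unitaryCurve w t),
    ⟨(contDiff_bilinear orbit).comp (contDiff_unitaryCurve w), fun t => ?_⟩, ?_, ?_⟩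
  · change orbit _ _ ∈ total
    rw [orbit_self]
    exact conjFrame_frame0_mem (unitaryCurve_unitary w t)
  · change orbit _ _ = frame0
    rw [unitaryCurve_zero, orbit_self, conjFrame_one]
  · have h := (orbit.hasFDerivAt.comp_hasDerivAt (0 : ℝ) (hasDerivAt_unitaryCurve w)).clm_apply
      (hasDerivAt_unitaryCurve w)
    rw [Function.comp_apply, unitaryCurve_zero, orbit_apply, orbit_apply, zeta_conjTranspose] at h
    refine h.deriv.trans (Prod.ext ?_ (funext fun i => ?_))
    · rw [velocity, ← zeta_commutator]
      simp
      abel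
    · simp [velocity]
      abel

theorem exists_horizontal (hV : Vᴴ * V = 1) (a : Fin 4 → ℝ) :
    ∃ u ∈ tangentVectors total (conjFrame V frame0),
      conn (conjFrame V frame0) u = 0 ∧ base u = coframe V a := by
  refine ⟨conjFrame V (velocity ((1 / 2 : ℝ) • a) 0), ?_, ?_, ?_⟩
  · have h := fderiv_mem_tangentVectors (T := total) (conjFrame V).contDiff
      (fun q hq => conjFrame_mem hV hq) (velocity_mem ((1 / 2 : ℝ) • a))
    rwa [ContinuousLinearMap.fderiv] at h
  · rw [conn_conjFrame hV, conn_velocity]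
  · rw [base_conjFrame_velocity, smul_smul]
    norm_num

theorem tangentVectors_carrier (hV : Vᴴ * V = 1) :
    tangentVectors projectivePlane.carrier (base (conjFrame V frame0)) = Set.range (coframe V) := by
  refine Set.Subset.antisymm (fun v hv => ?_) ?_
  · obtain ⟨a, rfl⟩ := exists_coframe hV hv
    exact ⟨a, rfl⟩
  · rintro _ ⟨a, rfl⟩
    obtain ⟨u, hu, -, h⟩ := exists_horizontal hV a
    have h2 := fderiv_mem_tangentVectors (T := projectivePlane.carrier) base.contDiff
      (fun q hq => by obtain ⟨W, hW, rfl⟩ := hq; exact base_mem hW) hu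
    rwa [ContinuousLinearMap.fderiv, h] at h2

theorem kaehlerForm_coframe (hV : Vᴴ * V = 1) (a b : Fin 4 → ℝ) :
    kaehlerForm (base (conjFrame V frame0)) (coframe V a) (coframe V b) =
      a 1 * b 0 - a 0 * b 1 + (a 3 * b 2 - a 2 * b 3) := by
  have h0 : (Real.sqrt 2 : ℂ) ≠ 0 := by simp
  have h1 : complexStructure (base (conjFrame V frame0)) (coframe V a) =
      conjPoint V (ofMat (Complex.I • (off ((Real.sqrt 2)⁻¹ • a) * proj0 -
        proj0 * off ((Real.sqrt 2)⁻¹ • a)))) := by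
    have h2 : ∀ X, conjMat V (Complex.I • X) = Complex.I • conjMat V X := fun X => by
      simp [conjMat_apply]
    rw [coframe_apply, conjPoint_apply, conjPoint_apply, toMat_ofMat, toMat_ofMat, h2, map_sub,
      conjMat_mul hV, conjMat_mul hV]
    ext ⟨i, j⟩
    change Complex.I * (((Real.sqrt 2)⁻¹ : ℝ) : ℂ) * ∑ k, (conjMat V _ i k *
      (Real.sqrt 2 • conjMat V proj0 k j) - (Real.sqrt 2 • conjMat V proj0 i k) * conjMat V _ k j) =
      Complex.I * ((conjMat V _ * conjMat V proj0) i j - (conjMat V proj0 * conjMat V _) i j)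
    simp only [Matrix.mul_apply, Complex.real_smul, ← Finset.sum_sub_distrib, mul_assoc,
      Finset.mul_sum]
    refine Finset.sum_congr rfl fun k _ => ?_
    push_cast
    field_simp
  rw [kaehlerForm, h1, coframe_apply, inner_conjPoint hV, inner_eq, toMat_ofMat, toMat_ofMat, ip_eq]
  have h : Real.sqrt 2 ^ 2 = 2 := Real.sq_sqrt zero_le_two
  simp [Fin.sum_univ_three, off_apply, proj0]
  field_simp
  rw [h]
  ring

theorem forms_normal (hV : Vᴴ * V = 1) (i : Fin 3) {n : MatrixSpace}
    (hn : ∀ a, inner ℝ n (coframe V a) = 0) (u : MatrixSpace) :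
    forms (conjFrame V frame0) i ![n, u] = 0 := by
  have h0 : Real.sqrt 2 ≠ 0 := (Real.sqrt_pos.2 two_pos).ne'
  obtain ⟨m, rfl⟩ : ∃ m, n = conjPoint V m := ⟨_, (conjPoint_inverse hV n).symm⟩
  obtain ⟨v, rfl⟩ : ∃ v, u = conjPoint V v := ⟨_, (conjPoint_inverse hV u).symm⟩
  have h1 : ∀ a, ip (hermPart m) (off a) = 0 := fun a => by
    have h := hn (Real.sqrt 2 • a)
    rw [coframe_apply, inner_conjPoint hV, inner_eq, toMat_ofMat, smul_smul, inv_mul_cancel₀ h0,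
      one_smul] at h
    have h2 : ip (toMat m)ᴴ (off a) = ip (toMat m) (off a) := by
      rw [ip_apply, Matrix.conjTranspose_conjTranspose, ip_comm, ip_apply, off_conjTranspose,
        Matrix.trace_mul_comm]
    rw [hermPart_apply, map_smul, map_add, LinearMap.smul_apply, LinearMap.add_apply, h2, h]
    simp
  have h2 : (hermPart m)ᴴ = hermPart m := by
    simp [hermPart_apply, add_comm]
  rw [forms, formsBilin_conj hV, formsBilin_apply, ip_eq, ip_eq]
  generalize hermPart m = S at h1 h2 ⊢
  have h3 : ∀ i j, star (S j i) = S i j := fun i j => congrFun (congrFun h2 i) j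
  simp only [ip_eq, off_apply, Fin.sum_univ_three, ← h3 0 1, ← h3 0 2] at h1
  have g0 := h1 ![1, 0, 0, 0]
  have g1 := h1 ![0, 1, 0, 0]
  have g2 := h1 ![0, 0, 1, 0]
  have g3 := h1 ![0, 0, 0, 1]
  simp at g0 g1 g2 g3
  have k1 : S 1 0 = 0 := by apply Complex.ext <;> simp <;> linarith
  have k2 : S 2 0 = 0 := by apply Complex.ext <;> simp <;> linarith
  have k3 : S 0 1 = 0 := by rw [← h3, k1, star_zero]
  have k4 : S 0 2 = 0 := by rw [← h3, k2, star_zero]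
  simp [frame0, su_apply, proj0, Fin.sum_univ_three, Matrix.mul_apply, k1, k2, k3, k4]

theorem isAdaptedFrame (hV : Vᴴ * V = 1) :
    IsAdaptedFrame projectivePlane (base (conjFrame V frame0)) (forms (conjFrame V frame0))
      (coframe V) where
  inner_eq := coframe_inner hV
  range_eq := tangentVectors_carrier hV
  positive_iff ε _ := by
    have h : Matrix.of ε = Matrix.of ![ε 0, ε 1, ε 2, ε 3] := by
      ext i j; fin_cases i <;> rfl
    change 0 < _ ↔ _
    refine iff_of_eq (congrArg _ ?_)
    simp only [kaehlerForm_coframe hV]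
    rw [h, det_of_fin_four]
    simp only [Matrix.det_fin_three]
    simp
    ring
  forms_apply i a b := forms_coframe hV i a b
  forms_normal i _ hn u := forms_normal hV i hn u

end Frames

/-! ### The action of the rotation group on frames -/

/-- The bilinear map behind the action of the rotation group. -/
def actL : FrameSpace →L[ℝ] Matrix (Fin 3) (Fin 3) ℝ →L[ℝ] (Fin 3 → Matrix (Fin 3) (Fin 3) ℂ) :=
  IsBilinearMap.toContinuousBilinearMap (𝕜 := ℝ)
    (f := fun (q : FrameSpace) (g : Matrix (Fin 3) (Fin 3) ℝ) => fun j => ∑ i, g i j • q.2 i)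
    ⟨fun p q g => by funext j; simp [Finset.sum_add_distrib],
      fun c q g => by
        funext j
        simp only [Pi.smul_apply, Prod.smul_snd, Finset.smul_sum]
        exact Finset.sum_congr rfl fun i _ => smul_comm _ _ _,
      fun q g h => by funext j; simp [add_smul, Finset.sum_add_distrib],
      fun c q g => by funext j; simp [mul_smul, Finset.smul_sum]⟩

theorem actL_apply (q : FrameSpace) (g : Matrix (Fin 3) (Fin 3) ℝ) (j : Fin 3) :
    actL q g j = ∑ i, g i j • q.2 i := rfl

/-- The action of rotations on frames. -/
def act (q : FrameSpace) (g : Matrix (Fin 3) (Fin 3) ℝ) : FrameSpace := (q.1, actL q g)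

theorem act_one (q : FrameSpace) : act q 1 = q := by
  refine Prod.ext rfl (funext fun j => ?_)
  simp [act, actL_apply, Matrix.one_apply]

theorem act_mul (q : FrameSpace) (g h : Matrix (Fin 3) (Fin 3) ℝ) :
    act q (g * h) = act (act q g) h := by
  refine Prod.ext rfl (funext fun j => ?_)
  simp only [act, actL_apply, Matrix.mul_apply, Finset.sum_smul, Finset.smul_sum, smul_smul]
  rw [Finset.sum_comm]
  simp only [mul_comm]

theorem conjFrame_act (V : Matrix (Fin 3) (Fin 3) ℂ) (q : FrameSpace)
    (g : Matrix (Fin 3) (Fin 3) ℝ) : conjFrame V (act q g) = act (conjFrame V q) g := by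
  refine Prod.ext rfl (funext fun j => ?_)
  simp only [act, conjFrame_apply, actL_apply, map_sum, map_smul]

theorem act_frame0 (g : Matrix (Fin 3) (Fin 3) ℝ) :
    act frame0 g = (proj0, fun j => su (g *ᵥ Pi.single j 1)) := by
  refine Prod.ext rfl (funext fun j => ?_)
  simp only [act, actL_apply, frame0, ← map_smul, ← map_sum]
  congr 1
  funext k
  simp [Pi.single_apply]

open scoped Quaternion in
/-- A quaternion as a matrix that fixes the first axis. -/
def block (q : ℍ[ℝ]) : Matrix (Fin 3) (Fin 3) ℂ :=
  !![1, 0, 0; 0, ⟨q.re, q.imI⟩, ⟨q.imJ, q.imK⟩; 0, ⟨-q.imJ, q.imK⟩, ⟨q.re, -q.imI⟩]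

open scoped Quaternion in
theorem block_unitary {q : ℍ[ℝ]} (hq : Quaternion.normSq q = 1) : (block q)ᴴ * block q = 1 := by
  rw [UnitQuaternion.normSq_eq] at hq
  ext i j
  fin_cases i <;> fin_cases j <;> apply Complex.ext <;>
    simp [block, Matrix.mul_apply, Fin.sum_univ_three] <;> first | ring1 | linear_combination hq

open scoped Quaternion in
theorem conjMat_block_su (q : ℍ[ℝ]) (y : Fin 3 → ℝ) : conjMat (block q) (su y) =
    su (UnitQuaternion.im (q * UnitQuaternion.vec y * star q)) := by
  rw [conjMat_apply]
  ext i j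
  fin_cases i <;> fin_cases j <;> apply Complex.ext <;>
    simp [block, su_apply, Matrix.mul_apply, Fin.sum_univ_three] <;> ring

open scoped Quaternion in
theorem conjMat_block_proj0 (q : ℍ[ℝ]) : conjMat (block q) proj0 = proj0 := by
  rw [conjMat_apply]
  ext i j
  fin_cases i <;> fin_cases j <;> simp [block, proj0, Matrix.mul_apply, Fin.sum_univ_three]

theorem im_rotQuaternion {n : Fin 3 → ℝ} (hn : n ⬝ᵥ n = 1) (t : ℝ) (y : Fin 3 → ℝ) :
    UnitQuaternion.im (UnitQuaternion.rotQuaternion t n * UnitQuaternion.vec y *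
      star (UnitQuaternion.rotQuaternion t n)) = Rotation.rot t n *ᵥ y := by
  have h1 : UnitQuaternion.rotQuaternion t n = star (UnitQuaternion.rotQuaternion (-t) n) := by
    apply Quaternion.ext <;> simp only [Quaternion.re_star, Quaternion.imI_star, Quaternion.imJ_star,
      Quaternion.imK_star] <;> simp [UnitQuaternion.rotQuaternion, neg_div]
  have h2 := UnitQuaternion.ad_rot hn (-t) y
  rw [UnitQuaternion.rot, UnitQuaternion.ad_toMatrix] at h2
  rw [h1, star_star, h2]
  simp only [Rotation.rot, Matrix.add_mulVec, Matrix.smul_mulVec, Matrix.one_mulVec,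
    Rotation.hat_mulVec, ← Matrix.mulVec_mulVec, Real.sin_neg, Real.cos_neg]
  rw [dot_eq] at hn ⊢
  apply vec_ext <;> simp [cross_zero, cross_one, cross_two]
  · linear_combination (1 - Real.cos t) * y 0 * hn
  · linear_combination (1 - Real.cos t) * y 1 * hn
  · linear_combination (1 - Real.cos t) * y 2 * hn

theorem exists_conjFrame_act (g : Matrix (Fin 3) (Fin 3) ℝ)
    (hg : g ∈ Matrix.specialOrthogonalGroup (Fin 3) ℝ) :
    ∃ W, Wᴴ * W = 1 ∧ conjMat W proj0 = proj0 ∧ ∀ y, conjMat W (su y) = su (g *ᵥ y) := by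
  obtain ⟨l, hl, rfl⟩ := Rotation.lieModel.generate (Pi.single 0 1) (by simp) g hg
  clear hg
  induction l with
  | nil => exact ⟨1, by simp, conjMat_one _, fun y => by simp [conjMat_one]⟩
  | cons p l ih =>
    obtain ⟨W, h1, h2, h3⟩ := ih fun r hr => hl r (List.mem_cons_of_mem _ hr)
    have hp := (hl p List.mem_cons_self).1
    refine ⟨block (UnitQuaternion.rotQuaternion p.1 p.2) * W, ?_, ?_, fun y => ?_⟩
    · rw [Matrix.conjTranspose_mul, mul_assoc, ← mul_assoc (block _)ᴴ,
        block_unitary (UnitQuaternion.normSq_rotQuaternion hp _), one_mul, h1]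
    · rw [← conjMat_conjMat, h2, conjMat_block_proj0]
    · rw [← conjMat_conjMat, h3, conjMat_block_su, im_rotQuaternion hp, List.map_cons,
        List.prod_cons, Matrix.mulVec_mulVec]
      rfl

theorem act_mem {q : FrameSpace} (hq : q ∈ total) {g : Matrix (Fin 3) (Fin 3) ℝ}
    (hg : g ∈ Matrix.specialOrthogonalGroup (Fin 3) ℝ) : act q g ∈ total := by
  obtain ⟨V, hV, rfl⟩ := hq
  obtain ⟨W, h1, h2, h3⟩ := exists_conjFrame_act g hg
  rw [← conjFrame_act]
  refine conjFrame_mem hV ⟨W, h1, ?_⟩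
  rw [act_frame0, conjFrame_apply]
  simp only [frame0, h2, h3]

theorem forms_act (q : FrameSpace) (g : Matrix (Fin 3) (Fin 3) ℝ) (j : Fin 3) (ξ η : MatrixSpace) :
    forms (act q g) j ![ξ, η] = ∑ i, g i j * forms q i ![ξ, η] := by
  simp only [forms, formsBilin_apply, act, actL_apply, map_sum, map_smul, LinearMap.sum_apply,
    LinearMap.smul_apply, Finset.mul_sum, ← Finset.sum_sub_distrib, smul_eq_mul]
  exact Finset.sum_congr rfl fun i _ => by ring

theorem conn_act (p u : FrameSpace) (g : Matrix (Fin 3) (Fin 3) ℝ) :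
    conn (act p g) (act u g) = g.adjugate *ᵥ conn p u := by
  have h : ∀ i j, ip ((act p g).2 i) ((act u g).2 j) =
      ∑ k, ∑ l, g k i * g l j * ip (p.2 k) (u.2 l) := fun i j => by
    simp only [act, actL_apply, map_sum, map_smul, LinearMap.sum_apply, LinearMap.smul_apply,
      smul_eq_mul, Finset.mul_sum, mul_assoc]
    rw [Finset.sum_comm]
    exact Finset.sum_congr rfl fun k _ => Finset.sum_congr rfl fun l _ => mul_left_comm _ _ _
  rw [Matrix.adjugate_fin_three, conn_apply, conn_apply]
  simp only [h, Fin.sum_univ_three]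
  apply vec_ext <;> simp [Matrix.mulVec, dotProduct, Fin.sum_univ_three] <;> ring

theorem conn_actL {q : FrameSpace} (hq : q ∈ total) (a : Fin 3 → ℝ) :
    conn q (0, actL q (Rotation.hat a)) = a := by
  have h := (conjFrame_relations hq).2.2.2.2.2
  simp only [conn_apply, actL_apply, Fin.sum_univ_three, Rotation.hat_apply]
  apply vec_ext <;> simp [h] <;> ring

/-! ### Local triviality -/

theorem conjFrame_fst (V : Matrix (Fin 3) (Fin 3) ℂ) (q : FrameSpace) :
    (conjFrame V q).1 = conjMat V q.1 := rfl

theorem conjFrame_snd (V : Matrix (Fin 3) (Fin 3) ℂ) (q : FrameSpace) (i : Fin 3) :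
    (conjFrame V q).2 i = conjMat V (q.2 i) := rfl

theorem frame0_fst : frame0.1 = proj0 := rfl

theorem frame0_snd (i : Fin 3) : frame0.2 i = su (Pi.single i 1) := rfl

/-- The matrix of inner products of two frames. -/
def transitionMatrix (q r : FrameSpace) : Matrix (Fin 3) (Fin 3) ℝ :=
  Matrix.of fun i j => 2 * framePairing i j q r

theorem transitionMatrix_mulVec (q r : FrameSpace) (j : Fin 3) :
    transitionMatrix q r *ᵥ Pi.single j 1 = fun i => 2 * ip (q.2 i) (r.2 j) := by
  rw [Matrix.mulVec_single_one]
  rfl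

theorem transitionMatrix_conjFrame {V : Matrix (Fin 3) (Fin 3) ℂ} (hV : Vᴴ * V = 1)
    (q r : FrameSpace) : transitionMatrix (conjFrame V q) (conjFrame V r) = transitionMatrix q r := by
  simp only [transitionMatrix, framePairing_apply, conjFrame_snd, ip_conjMat hV]

theorem su_mulVec_orthogonal {r : FrameSpace} (hr : r ∈ total) {g : Matrix (Fin 3) (Fin 3) ℝ}
    (h : ∀ j, su (g *ᵥ Pi.single j 1) = r.2 j) : gᵀ * g = 1 := by
  ext i j
  have h7 := (conjFrame_relations hr).2.2.2.2.2 i j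
  rw [← h, ← h, ip_su_su, Matrix.mulVec_single_one, Matrix.mulVec_single_one] at h7
  have h8 : (gᵀ * g) i j = g.col i ⬝ᵥ g.col j := rfl
  rw [h8, Matrix.one_apply]
  split_ifs at h7 ⊢ <;> linarith

theorem su_mulVec_det {r : FrameSpace} (hr : r ∈ total) {g : Matrix (Fin 3) (Fin 3) ℝ}
    (h : ∀ j, su (g *ᵥ Pi.single j 1) = r.2 j) : g.det = 1 := by
  have h7 := trace_su_mul (g *ᵥ Pi.single 0 1) (g *ᵥ Pi.single 1 1) (g *ᵥ Pi.single 2 1)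
  obtain ⟨W, hW, rfl⟩ := hr
  rw [h, h, h, conjFrame_snd, conjFrame_snd, conjFrame_snd, ← conjMat_mul hW, ← conjMat_mul hW,
    trace_conjMat hW, frame0_snd, frame0_snd, frame0_snd, trace_su_mul] at h7
  simp only [dot_eq, cross_zero, cross_one, cross_two, Matrix.mulVec_single_one,
    Matrix.col_apply] at h7
  simp at h7
  rw [Matrix.det_fin_three]
  linarith

theorem transition_frame0 {r : FrameSpace} (hr : r ∈ total) (h : r.1 = proj0) :
    transitionMatrix frame0 r ∈ Matrix.specialOrthogonalGroup (Fin 3) ℝ ∧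
      act frame0 (transitionMatrix frame0 r) = r := by
  obtain ⟨-, -, h1, h2, h3, -⟩ := conjFrame_relations hr
  have h5 : ∀ j, su (transitionMatrix frame0 r *ᵥ Pi.single j 1) = r.2 j := fun j => by
    have h6 : r.2 j * proj0 = 0 := by rw [← h, h2]
    rw [transitionMatrix_mulVec, eq_su (h1 j) h6 (h3 j)]
    simp only [frame0_snd, ← eq_su (h1 j) h6 (h3 j)]
  refine ⟨Rotation.mem_iff.2 ⟨mul_eq_one_comm.1 (su_mulVec_orthogonal hr h5),
    su_mulVec_det hr h5⟩, ?_⟩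
  rw [act_frame0]
  exact Prod.ext h.symm (funext h5)

theorem transition {q r : FrameSpace} (hq : q ∈ total) (hr : r ∈ total) (h : q.1 = r.1) :
    transitionMatrix q r ∈ Matrix.specialOrthogonalGroup (Fin 3) ℝ ∧
      act q (transitionMatrix q r) = r := by
  obtain ⟨V, hV, rfl⟩ := hq
  have h1 := conjFrame_inverse hV r
  have h2 := conjFrame_mem (conjTranspose_mul_self hV) hr
  have h3 : (conjFrame Vᴴ r).1 = proj0 := by
    rw [conjFrame_fst, ← h, conjFrame_fst, conjMat_conjMat, hV, conjMat_one, frame0_fst]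
  obtain ⟨h4, h5⟩ := transition_frame0 h2 h3
  have h6 := transitionMatrix_conjFrame hV frame0 (conjFrame Vᴴ r)
  rw [h1] at h6
  rw [h6, ← conjFrame_act, h5]
  exact ⟨h4, h1⟩

/-- The reflection that maps the coordinate vector `k` to `-z`, where `w` is the sum of `z` and
this vector. -/
def reflection (c : ℝ) (w : Fin 3 → ℂ) : Matrix (Fin 3) (Fin 3) ℂ :=
  1 - c⁻¹ • Matrix.vecMulVec w (star w)

theorem reflection_unitary {c : ℝ} {w : Fin 3 → ℂ} (hc : c ≠ 0)
    (hw : star w ⬝ᵥ w = (2 * c : ℝ)) :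
    (reflection c w)ᴴ * reflection c w = 1 := by
  have h1 : (Matrix.vecMulVec w (star w))ᴴ = Matrix.vecMulVec w (star w) := by
    rw [Matrix.conjTranspose_vecMulVec, star_star]
  have h2 : Matrix.vecMulVec w (star w) * Matrix.vecMulVec w (star w) =
      (2 * c) • Matrix.vecMulVec w (star w) := by
    rw [Matrix.vecMulVec_mul_vecMulVec, hw]
    ext i j
    simp [Matrix.vecMulVec_apply]
    ring
  simp only [reflection, Matrix.conjTranspose_sub, Matrix.conjTranspose_one,
    Matrix.conjTranspose_smul, h1, star_trivial, sub_mul, mul_sub, smul_mul_assoc, mul_smul_comm, h2,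
    one_mul, mul_one]
  match_scalars <;> field_simp
  norm_num

/-- The unitary matrix that moves the first axis to the line of a point of the projective plane,
near the coordinate axis `k`. -/
def lift (k : Fin 3) (x : MatrixSpace) : Matrix (Fin 3) (Fin 3) ℂ :=
  (reflection (1 + (Real.sqrt (Real.sqrt 2 * (x (k, k)).re))⁻¹ * (x (k, k)).re)
    fun i => (if i = k then 1 else 0) +
      (Real.sqrt (Real.sqrt 2 * (x (k, k)).re))⁻¹ • x (i, k)).submatrix id (Equiv.swap 0 k)

theorem lift_spec {k : Fin 3} {x : MatrixSpace} (hx : x ∈ projectivePlane.carrier)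
    (hk : 0 < (x (k, k)).re) :
    (lift k x)ᴴ * lift k x = 1 ∧ base (conjFrame (lift k x) frame0) = x := by
  obtain ⟨h1, h2⟩ := carrier_relations hx
  have h0 : 0 < Real.sqrt 2 := Real.sqrt_pos.2 two_pos
  have hs : 0 < Real.sqrt (Real.sqrt 2 * (x (k, k)).re) := Real.sqrt_pos.2 (by positivity)
  have hs2 : Real.sqrt (Real.sqrt 2 * (x (k, k)).re) ^ 2 = Real.sqrt 2 * (x (k, k)).re :=
    Real.sq_sqrt (by positivity)
  have h3 : ∀ i j, star (x (j, i)) = x (i, j) := fun i j => congrFun (congrFun h1 i) j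
  have h4 : ∑ l, x (k, l) * x (l, k) = Real.sqrt 2 * x (k, k) := by
    have := congrFun (congrFun h2 k) k
    rwa [Matrix.smul_apply, Complex.real_smul] at this
  have h5 : ∀ i j, x (i, k) * x (k, j) = x (i, j) * x (k, k) := fun i j => by
    obtain ⟨z, -, hz⟩ := hx
    simp only [hz]
    ring
  have h6 : x (k, k) = ((x (k, k)).re : ℂ) := (Complex.conj_eq_iff_re.1 (h3 k k)).symm
  obtain ⟨r, hr⟩ : ∃ r, r = (x (k, k)).re := ⟨_, rfl⟩
  rw [lift]
  rw [← hr] at hk hs hs2 h6 ⊢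
  generalize Real.sqrt (Real.sqrt 2 * r) = s at hs hs2 ⊢
  have hc : 0 < 1 + s⁻¹ * r := by positivity
  have hwk : (if k = k then 1 else 0) + s⁻¹ • x (k, k) = ((1 + s⁻¹ * r : ℝ) : ℂ) := by
    rw [if_pos rfl, h6, Complex.real_smul]
    push_cast
    ring
  have hs3 : (s : ℂ) ^ 2 = Real.sqrt 2 * r := by exact_mod_cast congrArg (fun t : ℝ => (t : ℂ)) hs2
  have hs0 : (s : ℂ) ≠ 0 := Complex.ofReal_ne_zero.2 hs.ne'
  have hw : star (fun i => (if i = k then 1 else 0) + s⁻¹ • x (i, k)) ⬝ᵥ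
      (fun i => (if i = k then 1 else 0) + s⁻¹ • x (i, k)) = (2 * (1 + s⁻¹ * r) : ℝ) := by
    have h7 : ∀ i, star ((if i = k then 1 else 0) + s⁻¹ • x (i, k)) *
        ((if i = k then 1 else 0) + s⁻¹ • x (i, k)) =
        (if i = k then 1 + 2 * ((s : ℂ)⁻¹ * r) else 0) + (s : ℂ)⁻¹ ^ 2 * (x (k, i) * x (i, k)) := by
      intro i
      rw [Complex.real_smul, star_add, star_mul', h3,
        show star ((s⁻¹ : ℝ) : ℂ) = ((s⁻¹ : ℝ) : ℂ) from Complex.conj_ofReal _]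
      split_ifs with h
      · rw [h, h6, star_one]
        push_cast
        ring
      · rw [star_zero]
        push_cast
        ring
    simp only [dotProduct, Pi.star_apply, h7]
    rw [Finset.sum_add_distrib, Finset.sum_ite_eq' Finset.univ k, if_pos (Finset.mem_univ k),
      ← Finset.mul_sum, h4, h6, ← hs3]
    push_cast
    field_simp
    ring
  refine ⟨?_, ?_⟩
  · rw [Matrix.conjTranspose_submatrix, ← Matrix.submatrix_mul _ _ _ id _ Function.bijective_id,
      reflection_unitary hc.ne' hw, Matrix.submatrix_one_equiv]
  · have h8 : ∀ i, ((reflection (1 + s⁻¹ * r) fun i => (if i = k then 1 else 0) +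
        s⁻¹ • x (i, k)).submatrix id (Equiv.swap 0 k)) i 0 = -((s : ℂ)⁻¹ * x (i, k)) := fun i => by
      have hc' : ((1 + s⁻¹ * r : ℝ) : ℂ) ≠ 0 := Complex.ofReal_ne_zero.2 hc.ne'
      rw [Matrix.submatrix_apply, Equiv.swap_apply_left, id, reflection, Matrix.sub_apply,
        Matrix.smul_apply, Matrix.vecMulVec_apply, Pi.star_apply, hwk, Matrix.one_apply,
        Complex.real_smul, ← Complex.ofReal_inv, Complex.real_smul]
      rw [show star ((1 + s⁻¹ * r : ℝ) : ℂ) = ((1 + s⁻¹ * r : ℝ) : ℂ) from Complex.conj_ofReal _]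
      rw [Complex.ofReal_inv (1 + s⁻¹ * r)]
      generalize ((1 + s⁻¹ * r : ℝ) : ℂ) = C at hc'
      rw [mul_comm _ C, inv_mul_cancel_left₀ hc']
      ring
    ext ⟨i, j⟩
    have h9 : starRingEnd ℂ (x (j, k)) = x (k, j) := h3 k j
    rw [base_frame0_apply, h8, h8, map_neg, map_mul, h9, map_inv₀, Complex.conj_ofReal]
    calc (Real.sqrt 2 : ℂ) * -((s : ℂ)⁻¹ * x (i, k)) * -((s : ℂ)⁻¹ * x (k, j))
        = Real.sqrt 2 * (s : ℂ)⁻¹ ^ 2 * (x (i, k) * x (k, j)) := by ring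
      _ = ((s : ℂ)⁻¹ ^ 2 * (Real.sqrt 2 * r)) * x (i, j) := by rw [h5, h6]; ring
      _ = x (i, j) := by rw [← hs3]; field_simp

theorem contDiffOn_lift (k : Fin 3) : ContDiffOn ℝ ∞ (lift k) {x | 0 < (x (k, k)).re} := by
  have h0 : 0 < Real.sqrt 2 := Real.sqrt_pos.2 two_pos
  have hx : ∀ i j, ContDiff ℝ ∞ fun x : MatrixSpace => x (i, j) := fun i j =>
    (contDiff_piLp_apply 2 (𝕜 := ℂ) (n := ∞)).restrict_scalars ℝ
  have hr : ContDiff ℝ ∞ fun x : MatrixSpace => (x (k, k)).re :=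
    Complex.reCLM.contDiff.comp (hx k k)
  have hs : ContDiffOn ℝ ∞ (fun x : MatrixSpace =>
      (Real.sqrt (Real.sqrt 2 * (x (k, k)).re))⁻¹) {x | 0 < (x (k, k)).re} := by
    refine ((contDiff_const.mul hr).contDiffOn.sqrt fun x hx => ?_).inv fun x hx => ?_
    · have : 0 < (x (k, k)).re := hx
      positivity
    · have : 0 < (x (k, k)).re := hx
      positivity
  have hc : ContDiffOn ℝ ∞ (fun x : MatrixSpace =>
      (1 + (Real.sqrt (Real.sqrt 2 * (x (k, k)).re))⁻¹ * (x (k, k)).re)⁻¹)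
      {x | 0 < (x (k, k)).re} := by
    refine (contDiffOn_const.add (hs.mul hr.contDiffOn)).inv fun x hx => ?_
    have : 0 < (x (k, k)).re := hx
    positivity
  have hw : ∀ i, ContDiffOn ℝ ∞ (fun x : MatrixSpace => (if i = k then (1 : ℂ) else 0) +
      (Real.sqrt (Real.sqrt 2 * (x (k, k)).re))⁻¹ • x (i, k)) {x | 0 < (x (k, k)).re} := fun i =>
    contDiffOn_const.add (hs.smul (hx i k).contDiffOn)
  refine contDiffOn_pi.2 fun i => contDiffOn_pi.2 fun j => ?_
  exact contDiffOn_const.sub (hc.smul ((hw i).mul (Complex.conjCLE.contDiff.comp_contDiffOn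
    (hw (Equiv.swap 0 k j)))))

theorem conjFrame_lift_mem {k : Fin 3} {x : MatrixSpace} (hx : x ∈ projectivePlane.carrier)
    (hk : 0 < (x (k, k)).re) : conjFrame (lift k x) frame0 ∈ total :=
  conjFrame_frame0_mem (lift_spec hx hk).1

theorem fst_eq_of_base_eq {q r : FrameSpace} (h : base q = base r) : q.1 = r.1 := by
  rw [base_apply, base_apply] at h
  have h2 := congrArg toMat (smul_right_injective _ (Real.sqrt_pos.2 two_pos).ne' h)
  rwa [toMat_ofMat, toMat_ofMat] at h2

theorem transitionMatrix_act {q : FrameSpace} (hq : q ∈ total) (g : Matrix (Fin 3) (Fin 3) ℝ) :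
    transitionMatrix q (act q g) = g := by
  ext i j
  have h := (conjFrame_relations hq).2.2.2.2.2
  simp only [transitionMatrix, Matrix.of_apply, framePairing_apply, act, actL_apply, map_sum, map_smul,
    h, smul_eq_mul]
  simp
  ring

theorem locally_trivial {x : MatrixSpace} (hx : x ∈ projectivePlane.carrier) :
    ∃ (W : Set MatrixSpace) (σ : MatrixSpace → FrameSpace)
    (τ : FrameSpace → Matrix (Fin 3) (Fin 3) ℝ),
    IsOpen W ∧ x ∈ W ∧ ContDiffOn ℝ ∞ σ W ∧ ContDiffOn ℝ ∞ τ (total ∩ base ⁻¹' W) ∧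
    (∀ y ∈ projectivePlane.carrier ∩ W, σ y ∈ total ∧ base (σ y) = y ∧
      ∀ g ∈ Matrix.specialOrthogonalGroup (Fin 3) ℝ, τ (act (σ y) g) = g) ∧
    ∀ q ∈ total ∩ base ⁻¹' W, τ q ∈ Matrix.specialOrthogonalGroup (Fin 3) ℝ ∧
      act (σ (base q)) (τ q) = q := by
  obtain ⟨k, hk⟩ : ∃ k, 0 < (x (k, k)).re := by
    obtain ⟨z, hz, h⟩ := hx
    obtain ⟨k, hk⟩ : ∃ k, z k ≠ 0 := by
      by_contra! h0
      simp [h0] at hz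
    refine ⟨k, ?_⟩
    have h1 : x (k, k) = ((Real.sqrt 2 * ‖z k‖ ^ 2 : ℝ) : ℂ) := by
      rw [h, mul_assoc, Complex.mul_conj']
      push_cast
      rfl
    rw [h1, Complex.ofReal_re]
    have := norm_pos_iff.2 hk
    positivity
  have hσ : ContDiffOn ℝ ∞ (fun x => conjFrame (lift k x) frame0) {x | 0 < (x (k, k)).re} :=
    (contDiff_bilinear orbit).comp_contDiffOn (contDiffOn_lift k)
  have hmem : ∀ q ∈ total, base q ∈ projectivePlane.carrier := fun q hq => by
    obtain ⟨W, hW, rfl⟩ := hq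
    exact base_mem hW
  refine ⟨{x | 0 < (x (k, k)).re}, fun x => conjFrame (lift k x) frame0,
    fun q => transitionMatrix (conjFrame (lift k (base q)) frame0) q, ?_, hk, hσ, ?_, ?_, ?_⟩
  · exact isOpen_lt continuous_const (Complex.continuous_re.comp
      (PiLp.continuous_apply 2 (fun _ : Fin 3 × Fin 3 => ℂ) (k, k)))
  · refine contDiffOn_pi.2 fun i => contDiffOn_pi.2 fun j => ?_
    have h1 : ContDiffOn ℝ ∞ (fun q => conjFrame (lift k (base q)) frame0)
        (total ∩ base ⁻¹' {x | 0 < (x (k, k)).re}) :=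
      hσ.comp base.contDiff.contDiffOn fun q hq => hq.2
    exact contDiffOn_const.mul (((framePairing i j).contDiff.comp_contDiffOn h1).clm_apply
      contDiffOn_id)
  · rintro y ⟨hy, hyk⟩
    obtain ⟨h1, h2⟩ := lift_spec hy hyk
    have h3 := conjFrame_lift_mem hy hyk
    refine ⟨h3, h2, fun g hg => ?_⟩
    have h4 : base (act (conjFrame (lift k y) frame0) g) = y := h2
    simp only [h4]
    exact transitionMatrix_act h3 g
  · rintro q ⟨hq, hqk⟩
    have h2 := (lift_spec (hmem q hq) hqk).2
    exact transition (conjFrame_lift_mem (hmem q hq) hqk) hq (fst_eq_of_base_eq h2)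

theorem sum_smul_forms_act (q : FrameSpace) {g : Matrix (Fin 3) (Fin 3) ℝ}
    (hg : g ∈ Matrix.specialOrthogonalGroup (Fin 3) ℝ) (y : Fin 3 → ℝ) :
    ∑ i, Rotation.lieModel.ad g y i • forms (act q g) i = ∑ i, y i • forms q i := by
  ext w
  have hw : w = ![w 0, w 1] := by funext i; fin_cases i <;> rfl
  have h := Rotation.lieModel.ad_dot g hg y fun i => forms q i ![w 0, w 1]
  have h2 : Rotation.lieModel.ad g (fun i => forms q i ![w 0, w 1]) =
      fun j => forms (act q g) j ![w 0, w 1] := by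
    rw [show Rotation.lieModel.ad g = Matrix.toLin' g.adjugate from rfl, Matrix.toLin'_apply]
    rw [Rotation.adjugate_eq hg]
    funext j
    rw [forms_act]
    rfl
  rw [h2, dot_eq, dot_eq] at h
  rw [hw]
  simpa [Fin.sum_univ_three] using h

theorem exists_frame {q : FrameSpace} (hq : q ∈ total) :
    ∃ e, IsAdaptedFrame projectivePlane (base q) (forms q) e := by
  obtain ⟨V, hV, rfl⟩ := hq
  exact ⟨_, isAdaptedFrame hV⟩

theorem parallel {q : FrameSpace} (hq : q ∈ total) {u : FrameSpace} (hu : u ∈ tangentVectors total q)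
    (y : Fin 3 → ℝ) {v w : MatrixSpace} (hv : v ∈ tangentVectors projectivePlane.carrier (base q))
    (hw : w ∈ tangentVectors projectivePlane.carrier (base q)) :
    ∑ i, y i * (fderiv ℝ (fun q => forms q i) q u) ![v, w] =
      ∑ i, crossProduct (conn q u) y i * forms q i ![v, w] := by
  obtain ⟨V, hV, rfl⟩ := hq
  obtain ⟨c, rfl⟩ := exists_coframe hV hv
  obtain ⟨d, rfl⟩ := exists_coframe hV hw
  simp only [fderiv_forms hV hu, forms_coframe hV, Fin.sum_univ_three, dot_eq, cross_zero, cross_one,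
    cross_two]
  simp
  ring

theorem conn_vertical {q : FrameSpace} (hq : q ∈ total) {g : ℝ → Matrix (Fin 3) (Fin 3) ℝ}
    (hg : SmoothCurveIn (Matrix.specialOrthogonalGroup (Fin 3) ℝ : Set (Matrix (Fin 3) (Fin 3) ℝ)) g)
    (h0 : g 0 = 1) :
    Rotation.hat (conn q (deriv (fun t => act q (g t)) 0)) = deriv g 0 := by
  have hd : HasDerivAt (fun t => act q (g t)) (0, actL q (deriv g 0)) 0 :=
    (hasDerivAt_const (0 : ℝ) q.1).prodMk
      ((actL q).hasFDerivAt.comp_hasDerivAt (0 : ℝ) (hasDerivAt_of_smoothCurveIn hg 0))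
  have ht : deriv g 0 ∈ Set.range Rotation.hat := by
    rw [← Rotation.tangentVectors_eq]
    exact ⟨g, hg, h0, rfl⟩
  obtain ⟨a, ha⟩ := ht
  rw [hd.deriv, ← ha, conn_actL hq]

theorem conn_equivariant {γ : ℝ → FrameSpace} (hγ : SmoothCurveIn total γ)
    (g : Matrix (Fin 3) (Fin 3) ℝ) :
    conn (act (γ 0) g) (deriv (fun t => act (γ t) g) 0) = g.adjugate *ᵥ conn (γ 0) (deriv γ 0) := by
  have h := hasDerivAt_of_smoothCurveIn hγ 0
  have hd : HasDerivAt (fun t => act (γ t) g) (act (deriv γ 0) g) 0 :=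
    ((ContinuousLinearMap.fst ℝ _ _).hasFDerivAt.comp_hasDerivAt (0 : ℝ) h).prodMk
      ((actL.flip g).hasFDerivAt.comp_hasDerivAt (0 : ℝ) h)
  rw [hd.deriv, conn_act]

/-- The frames of the anti-self-dual two-forms of the projective plane. -/
def asdFrames : AsdFrames projectivePlane Rotation.lieModel FrameSpace where
  total := total
  base := base
  forms := forms
  conn := conn
  act := act
  base_smooth := base.contDiff
  forms_smooth i := contDiff_bilinear (formsBilin i)
  act_smooth := (contDiff_fst.comp contDiff_fst).prodMk actL.isBoundedBilinearMap.contDiff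
  base_mem q hq := by
    obtain ⟨V, hV, rfl⟩ := hq
    exact base_mem hV
  act_mem q hq g hg := act_mem hq hg
  act_one q _ := act_one q
  act_mul q _ g _ h _ := act_mul q g h
  base_act _ _ _ _ := rfl
  forms_act q _ g hg y := sum_smul_forms_act q hg y
  exists_frame q hq := exists_frame hq
  parallel q hq u hu y v hv w hw := parallel hq hu y hv hw
  curvature q hq u hu v hv i := by
    obtain ⟨V, hV, rfl⟩ := hq
    rw [curvature_forms hV hu hv, ContinuousLinearMap.fderiv]
  horizontal q hq v hv := by
    obtain ⟨V, hV, rfl⟩ := hq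
    obtain ⟨a, rfl⟩ := exists_coframe hV hv
    rw [ContinuousLinearMap.fderiv]
    exact exists_horizontal hV a
  conn_vertical q hq g hg h0 := conn_vertical hq hg h0
  conn_equivariant γ hγ g _ := conn_equivariant hγ g
  locally_trivial x hx := locally_trivial hx

theorem total_nonempty : total.Nonempty := ⟨conjFrame 1 frame0, conjFrame_frame0_mem (by simp)⟩

end ProjectivePlane

/-- The existence of a two-parameter family of irreducible monopoles of unit charge on a principal
bundle with the structure group `G`. -/
def HasMonopoleFamily {𝕜 : Type*} [RCLike 𝕜] {m : Type*} [Fintype m] [DecidableEq m] {E : Type*}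
    [NormedAddCommGroup E] [InnerProductSpace ℝ E] (M : OrientedSubmanifold E)
    (G : Submonoid (Matrix m m 𝕜)) (κ : ℝ) : Prop :=
  ∃ (V : Type) (_ : NormedAddCommGroup V) (_ : NormedSpace ℝ V) (_ : FiniteDimensional ℝ V)
    (P : PrincipalBundle G (asdBundle M) V) (C : ℝ × ℝ → GaugePair P),
    GaugePair.IsSmoothFamily C (Set.Ioi 0 ×ˢ Set.Ioo 0 1) ∧
    (∀ c ∈ (Set.Ioi 0 ×ˢ Set.Ioo 0 1 : Set (ℝ × ℝ)),
      (C c).IsMonopole ∧ (C c).IsIrreducible ∧ (C c).HasUnitCharge κ) ∧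
    (∀ c ∈ (Set.Ioi 0 ×ˢ Set.Ioo 0 1 : Set (ℝ × ℝ)),
      ∀ c' ∈ (Set.Ioi 0 ×ˢ Set.Ioo 0 1 : Set (ℝ × ℝ)),
        (C c).GaugeEquivalent (C c') → c = c')

theorem FourSphere.hasMonopoleFamily :
    HasMonopoleFamily sphere4 (Matrix.specialUnitaryGroup (Fin 2) ℂ) 2 :=
  ⟨_, inferInstance, inferInstance, inferInstance, asdFrames.bundle,
    asdFrames.exists_family total_nonempty⟩

theorem ProjectivePlane.hasMonopoleFamily :
    HasMonopoleFamily projectivePlane (Matrix.specialOrthogonalGroup (Fin 3) ℝ) (1 / 2) :=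
  ⟨_, inferInstance, inferInstance, inferInstance, asdFrames.bundle,
    asdFrames.exists_family total_nonempty⟩

end

end G2Monopole

theorem theorem1 :
    (∃ (V : Type) (_ : NormedAddCommGroup V) (_ : NormedSpace ℝ V) (_ : FiniteDimensional ℝ V)
      (P : G2Monopole.PrincipalBundle (Matrix.specialUnitaryGroup (Fin 2) ℂ)
        (G2Monopole.asdBundle G2Monopole.sphere4) V)
      (C : ℝ × ℝ → G2Monopole.GaugePair P),
      G2Monopole.GaugePair.IsSmoothFamily C (Set.Ioi 0 ×ˢ Set.Ioo 0 1) ∧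
      (∀ c ∈ (Set.Ioi 0 ×ˢ Set.Ioo 0 1 : Set (ℝ × ℝ)),
        (C c).IsMonopole ∧ (C c).IsIrreducible ∧ (C c).HasUnitCharge 2) ∧
      (∀ c ∈ (Set.Ioi 0 ×ˢ Set.Ioo 0 1 : Set (ℝ × ℝ)),
        ∀ c' ∈ (Set.Ioi 0 ×ˢ Set.Ioo 0 1 : Set (ℝ × ℝ)),
          (C c).GaugeEquivalent (C c') → c = c')) ∧
    (∃ (V : Type) (_ : NormedAddCommGroup V) (_ : NormedSpace ℝ V) (_ : FiniteDimensional ℝ V)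
      (P : G2Monopole.PrincipalBundle (Matrix.specialOrthogonalGroup (Fin 3) ℝ)
        (G2Monopole.asdBundle G2Monopole.projectivePlane) V)
      (C : ℝ × ℝ → G2Monopole.GaugePair P),
      G2Monopole.GaugePair.IsSmoothFamily C (Set.Ioi 0 ×ˢ Set.Ioo 0 1) ∧
      (∀ c ∈ (Set.Ioi 0 ×ˢ Set.Ioo 0 1 : Set (ℝ × ℝ)),
        (C c).IsMonopole ∧ (C c).IsIrreducible ∧ (C c).HasUnitCharge (1 / 2)) ∧
      (∀ c ∈ (Set.Ioi 0 ×ˢ Set.Ioo 0 1 : Set (ℝ × ℝ)),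
        ∀ c' ∈ (Set.Ioi 0 ×ˢ Set.Ioo 0 1 : Set (ℝ × ℝ)),
          (C c).GaugeEquivalent (C c') → c = c')) := by
  exact ⟨G2Monopole.FourSphere.hasMonopoleFamily, G2Monopole.ProjectivePlane.hasMonopoleFamily⟩
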